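/- Let $k$ be any field of characteristic $2$ (for instance $\mathbb F_2$ or any extension field of it). Let $S\subset\mathbb P_k(1,1,1,2)$ be the surface $$x_3^2=x_0x_1x_2(x_0+x_1+x_2),$$ and let $g:S\to\mathbb P^2_k$, $(x_0:x_1:x_2:x_3)\mapsto(x_0:x_1:x_2)$. This is Kollár's surface, obtained from $\mathbb P^2$ with coordinates $(u:v:t)$ by blowing up the seven $\mathbb F_2$-points and contracting the strict transforms of the seven $\mathbb F_2$-lines: the formulas $$x_0=vt(v+t),\quad x_1=tu(t+u),\quad x_2=uv(u+v),\quad x_3=uvt(u+v)(v+t)(t+u)$$ define an open immersion of the complement of the seven $\mathbb F_2$-lines into $S$. 1. $S$ is an integral proper surface over $k$; the morphism $g$ is finite and flat of degree $2$; exactly seven points of $S$ are not smooth over $k$, and all of them are $A_1$-points (étale locally the vertex of the cone $ab=c^2$); the smooth locus $S^{sm}$ is smooth of relative dimension $2$, and $\omega_{S^{sm}}\cong (g^*\mathcal O_{\mathbb P^2}(-1))|_{S^{sm}}$. Thus $S$ is a Gorenstein log del Pezzo surface of degree $2$ with seven $A_1$-points and $-K_S=g^*\mathcal O_{\mathbb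 P^2}(1)$. 2. Let $I\subset\mathcal O_{\mathbb P^2}$ be the ideal sheaf of the reduced set of the images under $g$ of the seven singular points. There is an exact sequence of $\mathcal O_S$-modules $$0\to g^*(I(1))\to\Omega^1_{S/k}\to g^*\mathcal O_{\mathbb P^2}(-2)\to0.$$ 3. $S^{sm}$ contains no free rational curve: there is no nonconstant $k$-morphism $f:\mathbb P^1_k\to S^{sm}$ for which $f^*T_{S^{sm}}$ is semi-ample (equivalently, generated by global sections). 4. Consequently the theorem of Keel and McKernan on rational curves in the smooth locus of log del Pezzo surfaces fails over every field $k$ of characteristic $2$, including algebraically closed ones: it is not true that the smooth locus of every log del Pezzo surface over $k$ contains a free (a fortiori a very free) rational curve. It is not even true for those Gorenstein log del Pezzo surfaces $X$ whose singularities are all $A_1$-points and for which $-K_X\cong h^*\mathcal O_{\mathbb P^N}(1)$ for a finite morphism $h:X\to\mathbb P^N_k$. -/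

import Mathlib

open CategoryTheory AlgebraicGeometry TopologicalSpace Opposite

universe u

namespace KollarSurface

noncomputable section

attribute [local instance] MvPolynomial.gradedAlgebra

/-! ## Twisting sheaves on `Proj`

For a graded ring `A`, a homogeneous ideal `J` and an integer `n`, `twist 𝒜 J n` is the sheaf of
modules on `Proj A` associated with the graded module `J(n)`. With `J = A` it is `𝒪(n)`, and for
an ideal `J` with ideal sheaf `I` it is `I(n)`, at least if `A` is generated in degree one. -/

section Twist
variable {k A : Type u} [CommRing k] [CommRing A] [Algebra k A]
  (𝒜 : ℕ → Submodule k A) [GradedAlgebra 𝒜] (J : Ideal A) (n : ℤ)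

/-- The localization `A_x` of the graded ring at the homogeneous prime `x` (all degrees). -/
abbrev LocAt (x : ProjectiveSpectrum 𝒜) : Type u :=
  Localization.AtPrime x.asHomogeneousIdeal.toIdeal

theorem exists_homogeneous_notMem (x : ProjectiveSpectrum 𝒜) :
    ∃ (d : ℕ) (c : A), 0 < d ∧ c ∈ 𝒜 d ∧ c ∉ x.asHomogeneousIdeal := by
  by_contra! h
  exact x.not_irrelevant_le ((HomogeneousIdeal.toIdeal_irrelevant_le _).mpr fun i hi c hc => h i c hi hc)

theorem mul_notMem (x : ProjectiveSpectrum 𝒜) {b b' : A} (hb : b ∉ x.asHomogeneousIdeal)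
    (hb' : b' ∉ x.asHomogeneousIdeal) : b * b' ∉ x.asHomogeneousIdeal :=
  x.asHomogeneousIdeal.toIdeal.primeCompl.mul_mem hb hb'

theorem add_aux (x : ProjectiveSpectrum 𝒜) {a a' b b' : A} {s t : LocAt 𝒜 x}
    (hs : algebraMap A _ b * s = algebraMap A _ a)
    (ht : algebraMap A _ b' * t = algebraMap A _ a') :
    algebraMap A _ (b * b') * (s + t) = algebraMap A (LocAt 𝒜 x) (a * b' + a' * b) := by
  simp only [map_add, map_mul, ← hs, ← ht]
  ring

theorem neg_aux (x : ProjectiveSpectrum 𝒜) {a b : A} {s : LocAt 𝒜 x}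
    (hs : algebraMap A _ b * s = algebraMap A _ a) :
    algebraMap A _ b * (-s) = algebraMap A (LocAt 𝒜 x) (-a) := by
  rw [map_neg, ← hs, mul_neg]

theorem one_aux (x : ProjectiveSpectrum 𝒜) (s : LocAt 𝒜 x) :
    (1 : HomogeneousLocalization.AtPrime 𝒜 x.asHomogeneousIdeal.toIdeal).val * s = s := by
  rw [HomogeneousLocalization.val_one, one_mul]

theorem zero_aux (x : ProjectiveSpectrum 𝒜) (s : LocAt 𝒜 x) :
    (0 : HomogeneousLocalization.AtPrime 𝒜 x.asHomogeneousIdeal.toIdeal).val * s = 0 := by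
  rw [HomogeneousLocalization.val_zero, zero_mul]

theorem smul_aux (x : ProjectiveSpectrum 𝒜) {a b : A} {s : LocAt 𝒜 x} {d : ℕ} {c e : 𝒜 d}
    {he : e.1 ∈ x.asHomogeneousIdeal.toIdeal.primeCompl}
    {r : HomogeneousLocalization.AtPrime 𝒜 x.asHomogeneousIdeal.toIdeal}
    (hr : r = .mk ⟨d, c, e, he⟩) (hs : algebraMap A _ b * s = algebraMap A _ a) :
    algebraMap A _ (e.1 * b) * (r.val * s) = algebraMap A (LocAt 𝒜 x) (c.1 * a) := by
  have h : algebraMap A (LocAt 𝒜 x) e.1 * r.val = algebraMap A _ c.1 := by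
    rw [hr, HomogeneousLocalization.val_mk, Localization.mk_eq_mk']
    exact IsLocalization.mk'_spec' _ _ ⟨e.1, he⟩
  rw [map_mul, map_mul, ← h, ← hs]
  ring

/-- `s` is a fraction `a / b` with `a ∈ J` and `b` homogeneous, `deg a = deg b + n`,
and `b` vanishing at no point of `U`. -/
def IsTwistFraction {U : Opens (ProjectiveSpectrum.top 𝒜)} (s : ∀ x : U, LocAt 𝒜 x.1) : Prop :=
  ∃ (i j : ℕ) (a b : A), (i : ℤ) = j + n ∧ a ∈ 𝒜 i ∧ b ∈ 𝒜 j ∧ a ∈ J ∧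
    ∀ x : U, b ∉ x.1.asHomogeneousIdeal ∧ algebraMap A _ b * s x = algebraMap A _ a

/-- Being a fraction of degree `n` with numerator in `J`. -/
def twistPrelocal : TopCat.PrelocalPredicate (fun x : ProjectiveSpectrum.top 𝒜 => LocAt 𝒜 x) where
  pred s := IsTwistFraction 𝒜 J n s
  res := by
    rintro U V i s ⟨p, q, a, b, h, ha, hb, haJ, hs⟩
    exact ⟨p, q, a, b, h, ha, hb, haJ, fun x => hs (i x)⟩

/-- Being locally a fraction of degree `n` with numerator in `J`. -/
def twistLocal : TopCat.LocalPredicate (fun x : ProjectiveSpectrum.top 𝒜 => LocAt 𝒜 x) := (twistPrelocal 𝒜 J n).sheafify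

/-- The sections of `J(n)~` over `U`. -/
def twistSections (U : (Opens (ProjectiveSpectrum.top 𝒜))ᵒᵖ) :
    AddSubgroup (∀ x : U.unop, LocAt 𝒜 x.1) where
  carrier := {s | (twistLocal 𝒜 J n).pred s}
  zero_mem' := by
    intro x
    obtain ⟨d, c, hd, hc, hcx⟩ := exists_homogeneous_notMem 𝒜 x.1
    let N := (-n).toNat
    refine ⟨U.unop ⊓ ProjectiveSpectrum.basicOpen 𝒜 c, ⟨x.2, hcx⟩, Opens.infLELeft _ _,
      (d * N + n).toNat, d * N, 0, c ^ N, ?_, zero_mem _, ?_, zero_mem _, ?_⟩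
    · have : (N : ℤ) ≤ d * N := by exact_mod_cast Nat.le_mul_of_pos_left N hd
      push_cast
      lia
    · rw [mul_comm]; exact SetLike.pow_mem_graded N hc
    · intro y
      refine ⟨fun h => y.2.2 (y.1.isPrime.mem_of_pow_mem N h), ?_⟩
      simp
  add_mem' := by
    rintro s t hs ht x
    obtain ⟨V, hV, iV, p, q, a, b, h, ha, hb, haJ, hs⟩ := hs x
    obtain ⟨W, hW, iW, p', q', a', b', h', ha', hb', haJ', ht⟩ := ht x
    refine ⟨V ⊓ W, ⟨hV, hW⟩, Opens.infLELeft _ _ ≫ iV, p + q', q + q', a * b' + a' * b, b * b',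
      by push_cast; lia, ?_, SetLike.mul_mem_graded hb hb', ?_, ?_⟩
    · refine add_mem (SetLike.mul_mem_graded ha hb') ?_
      have : p + q' = p' + q := by lia
      rw [this]
      exact SetLike.mul_mem_graded ha' hb
    · exact add_mem (J.mul_mem_right _ haJ) (J.mul_mem_right _ haJ')
    · intro y
      have h1 := hs ⟨y.1, y.2.1⟩
      have h2 := ht ⟨y.1, y.2.2⟩
      exact ⟨mul_notMem 𝒜 y.1 h1.1 h2.1, add_aux 𝒜 y.1 h1.2 h2.2⟩
  neg_mem' := by
    rintro s hs x
    obtain ⟨V, hV, iV, p, q, a, b, h, ha, hb, haJ, hs⟩ := hs x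
    refine ⟨V, hV, iV, p, q, -a, b, h, neg_mem ha, hb, neg_mem haJ, fun y => ⟨(hs y).1, ?_⟩⟩
    exact neg_aux 𝒜 y.1 (hs y).2

/-- The abelian sheaf underlying `J(n)~`. -/
def twistPresheaf : TopCat.Presheaf Ab.{u} (ProjectiveSpectrum.top 𝒜) where
  obj U := AddCommGrpCat.of (twistSections 𝒜 J n U)
  map {U V} i := AddCommGrpCat.ofHom
    { toFun := fun s => ⟨fun x => s.1 (i.unop x), (twistLocal 𝒜 J n).res i.unop s.1 s.2⟩
      map_zero' := rfl
      map_add' := fun _ _ => rfl }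

theorem twistPresheaf_isSheaf : (twistPresheaf 𝒜 J n).IsSheaf :=
  (TopCat.Presheaf.isSheaf_iff_isSheaf_comp (forget Ab) _).mpr
    (TopCat.Presheaf.isSheaf_of_iso
      (NatIso.ofComponents (fun _ => Iso.refl _) (by cat_disch) :
        (TopCat.subsheafToTypes (twistLocal 𝒜 J n)).1 ≅ twistPresheaf 𝒜 J n ⋙ forget Ab)
      (TopCat.subsheafToTypes (twistLocal 𝒜 J n)).property)

theorem smul_mem_twistSections (U : (Opens (ProjectiveSpectrum.top 𝒜))ᵒᵖ)
    (r : (ProjectiveSpectrum.Proj.structureSheaf 𝒜).1.obj U) (s : twistSections 𝒜 J n U) :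
    (fun x : U.unop => (r.1 x).val * s.1 x) ∈ twistSections 𝒜 J n U := by
  intro x
  obtain ⟨V, hV, iV, d, c, e, hce, hr⟩ := r.2 x
  obtain ⟨W, hW, iW, p, q, a, b, h, ha, hb, haJ, hs⟩ := s.2 x
  refine ⟨V ⊓ W, ⟨hV, hW⟩, Opens.infLELeft _ _ ≫ iV, d + p, d + q, c * a, e * b,
    by push_cast; lia, SetLike.mul_mem_graded c.2 ha, SetLike.mul_mem_graded e.2 hb,
    J.mul_mem_left _ haJ, ?_⟩
  intro y
  have h1 := hr ⟨y.1, y.2.1⟩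
  have h2 := hs ⟨y.1, y.2.2⟩
  exact ⟨mul_notMem 𝒜 y.1 (hce ⟨y.1, y.2.1⟩) h2.1, smul_aux 𝒜 y.1 h1 h2.2⟩

instance twistModule (U : (Opens (Proj 𝒜))ᵒᵖ) :
    Module ((Proj 𝒜).ringCatSheaf.obj.obj U) ((twistPresheaf 𝒜 J n).obj U) where
  smul r s := ⟨_, smul_mem_twistSections 𝒜 J n U r s⟩
  one_smul s := Subtype.ext <| funext fun x => by
    exact one_aux 𝒜 x.1 (s.1 x)
  mul_smul r r' s := Subtype.ext <| funext fun x => by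
    change (r.1 x * r'.1 x).val * s.1 x = (r.1 x).val * ((r'.1 x).val * s.1 x)
    rw [HomogeneousLocalization.val_mul, mul_assoc]
  smul_zero r := Subtype.ext <| funext fun x => mul_zero _
  smul_add r s t := Subtype.ext <| funext fun x => mul_add _ _ _
  add_smul r r' s := Subtype.ext <| funext fun x => by
    change (r.1 x + r'.1 x).val * s.1 x = (r.1 x).val * s.1 x + (r'.1 x).val * s.1 x
    rw [HomogeneousLocalization.val_add, add_mul]
  zero_smul s := Subtype.ext <| funext fun x => by
    exact zero_aux 𝒜 x.1 (s.1 x)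

/-- The sheaf of modules `J(n)~` on `Proj A`. -/
def twist : (Proj 𝒜).Modules where
  val := PresheafOfModules.ofPresheaf (R := (Proj 𝒜).ringCatSheaf.obj) (twistPresheaf 𝒜 J n) (by
    intro U V f r s
    rfl)
  isSheaf := twistPresheaf_isSheaf 𝒜 J n

end Twist

/-! ## Differentials, vector fields and two-forms on a scheme over a field -/

section ExtSq
variable {R S T M N P : Type u} [CommRing R] [CommRing S] [CommRing T] [AddCommGroup M]
  [AddCommGroup N] [AddCommGroup P] [Module R M] [Module S N] [Module T P]

/-- The map on exterior squares induced by a semilinear map. -/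
def extSqMap (ρ : R →+* S) (f : M →ₛₗ[ρ] N) : ⋀[R]^2 M →ₛₗ[ρ] ⋀[S]^2 N :=
  letI : Module R (⋀[S]^2 N) := Module.compHom _ ρ
  let l : ⋀[R]^2 M →ₗ[R] ⋀[S]^2 N := exteriorPower.alternatingMapLinearEquiv
    { toFun := fun v => exteriorPower.ιMulti S 2 (fun i => f (v i))
      map_update_add' := by
        intro _ v i x y
        have h (z : M) : (fun j => f (Function.update v i z j)) =
            Function.update (fun j => f (v j)) i (f z) := by
          funext j; by_cases hj : j = i
          · subst hj; simp
          · simp [hj]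
        convert (exteriorPower.ιMulti S 2).map_update_add (fun j => f (v j)) i (f x) (f y) using 2
        · rw [← map_add]; exact h (x + y)
        · exact congrArg _ (h x)
        · exact congrArg _ (h y)
      map_update_smul' := by
        intro _ v i c x
        have h (z : M) : (fun j => f (Function.update v i z j)) =
            Function.update (fun j => f (v j)) i (f z) := by
          funext j; by_cases hj : j = i
          · subst hj; simp
          · simp [hj]
        have := (exteriorPower.ιMulti S 2).map_update_smul (fun j => f (v j)) i (ρ c) (f x)
        rw [← map_smulₛₗ] at this
        convert this using 2
        · exact h (c • x)
        · exact congrArg _ (congrArg _ (h x))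
      map_eq_zero_of_eq' := fun v i j hv hij =>
        (exteriorPower.ιMulti S 2).map_eq_zero_of_eq _ (by rw [hv]) hij }
  { toFun := l
    map_add' := l.map_add
    map_smul' := fun r m => l.map_smul r m }

theorem extSqMap_ιMulti (ρ : R →+* S) (f : M →ₛₗ[ρ] N) (v : Fin 2 → M) :
    extSqMap ρ f (exteriorPower.ιMulti R 2 v) = exteriorPower.ιMulti S 2 (fun i => f (v i)) := by
  let : Module R (⋀[S]^2 N) := Module.compHom _ ρ
  exact exteriorPower.alternatingMapLinearEquiv_apply_ιMulti _ _

theorem extSqMap_id (ρ : R →+* R) (f : M →ₛₗ[ρ] M) (hρ : ∀ r, ρ r = r) (hf : ∀ m, f m = m)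
    (x : ⋀[R]^2 M) : extSqMap ρ f x = x := by
  have hx : x ∈ Submodule.span R (Set.range (exteriorPower.ιMulti R 2 (M := M))) := by
    rw [exteriorPower.ιMulti_span]; trivial
  induction hx using Submodule.span_induction with
  | mem x hx => obtain ⟨v, rfl⟩ := hx; simp only [extSqMap_ιMulti, hf]
  | zero => exact map_zero _
  | add x y _ _ hx hy => rw [map_add, hx, hy]
  | smul r x _ hx => rw [map_smulₛₗ, hx, hρ]

theorem extSqMap_comp (ρ : R →+* S) (σ : S →+* T) (τ : R →+* T) (f : M →ₛₗ[ρ] N)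
    (g : N →ₛₗ[σ] P) (h : M →ₛₗ[τ] P) (hρ : ∀ r, τ r = σ (ρ r)) (hf : ∀ m, h m = g (f m))
    (x : ⋀[R]^2 M) : extSqMap τ h x = extSqMap σ g (extSqMap ρ f x) := by
  have hx : x ∈ Submodule.span R (Set.range (exteriorPower.ιMulti R 2 (M := M))) := by
    rw [exteriorPower.ιMulti_span]; trivial
  induction hx using Submodule.span_induction with
  | mem x hx => obtain ⟨v, rfl⟩ := hx; simp only [extSqMap_ιMulti, hf]
  | zero => simp only [map_zero]
  | add x y _ _ hx hy => simp only [map_add, hx, hy]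
  | smul r x _ hx => simp only [map_smulₛₗ, hx, hρ]

end ExtSq

section Sheaves
variable {k : Type u} [Field k] {X : Scheme.{u}} (s : X ⟶ Spec (.of k))

/-- The ring map `k → Γ(X, U)` given by the structure morphism `s : X ⟶ Spec k`. -/
def scalars (U : X.Opensᵒᵖ) : CommRingCat.of k ⟶ X.presheaf.obj U :=
  (Scheme.ΓSpecIso (.of k)).inv ≫ s.appTop ≫ X.presheaf.map (homOfLE le_top : U.unop ⟶ ⊤).op

/-- The maps `k → Γ(X, U)` as a map from the constant presheaf `k` to `𝒪_X`. -/
def scalarsHom : (Functor.const X.Opensᵒᵖ).obj (CommRingCat.of k) ⟶ X.presheaf where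
  app U := scalars s U
  naturality U V i := by
    simp only [scalars, Functor.const_obj_obj, Functor.const_obj_map, Category.id_comp,
      Category.assoc, ← Functor.map_comp]
    rfl

/-- The presheaf `U ↦ Ω¹_{Γ(X, U)/k}`. -/
def differentialsPresheaf : X.PresheafOfModules :=
  PresheafOfModules.DifferentialsConstruction.relativeDifferentials' (scalarsHom s)

/-- The sheaf of modules associated with a presheaf of modules. -/
def sheafify (M : X.PresheafOfModules) : X.Modules :=
  (PresheafOfModules.sheafification (𝟙 X.ringCatSheaf.obj)).obj M

/-- The sheaf of differentials `Ω¹_X = Ω¹_{X/k}`. -/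
def differentials : X.Modules := sheafify (differentialsPresheaf s)

/-- Restriction of differential forms, as a semilinear map. -/
def differentialsRes {U V : X.Opensᵒᵖ} (i : U ⟶ V) :
    CommRingCat.KaehlerDifferential (scalars s U) →ₛₗ[(X.presheaf.map i).hom]
      CommRingCat.KaehlerDifferential (scalars s V) :=
  (differentialsPresheaf s).restrictₛₗ i

theorem differentialsRes_id (U : X.Opensᵒᵖ) (m : CommRingCat.KaehlerDifferential (scalars s U)) :
    differentialsRes s (𝟙 U) m = m :=
  congr($((differentialsPresheaf s).presheaf.map_id U) m)

theorem differentialsRes_comp {U V W : X.Opensᵒᵖ} (i : U ⟶ V) (j : V ⟶ W)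
    (m : CommRingCat.KaehlerDifferential (scalars s U)) :
    differentialsRes s (i ≫ j) m = differentialsRes s j (differentialsRes s i m) :=
  congr($((differentialsPresheaf s).presheaf.map_comp i j) m)

/-- The presheaf `U ↦ ⋀² Ω¹_{Γ(X, U)/k}`. -/
def twoFormsPresheafAb : X.Opensᵒᵖ ⥤ Ab.{u} where
  obj U := AddCommGrpCat.of
    (⋀[X.presheaf.obj U]^2 (CommRingCat.KaehlerDifferential (scalars s U)))
  map i := AddCommGrpCat.ofHom (extSqMap _ (differentialsRes s i)).toAddMonoidHom
  map_id U := AddCommGrpCat.ext fun m =>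
    extSqMap_id _ _ (fun r => congr($(X.presheaf.map_id U) r))
      (differentialsRes_id s U) m
  map_comp i j := AddCommGrpCat.ext fun m =>
    extSqMap_comp _ _ _ _ _ _ (fun r => congr($(X.presheaf.map_comp i j) r))
      (differentialsRes_comp s i j) m

instance twoFormsModule (U : X.Opensᵒᵖ) :
    Module (X.ringCatSheaf.obj.obj U) ((twoFormsPresheafAb s).obj U) :=
  inferInstanceAs (Module (X.presheaf.obj U)
    (⋀[X.presheaf.obj U]^2 (CommRingCat.KaehlerDifferential (scalars s U))))

/-- The sheaf of two-forms `Ω²_X = ⋀² Ω¹_{X/k}`, the canonical sheaf of a smooth surface. -/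
def twoForms : X.Modules :=
  sheafify (PresheafOfModules.ofPresheaf (R := X.ringCatSheaf.obj) (twoFormsPresheafAb s)
    fun _ _ i r m => (extSqMap _ (differentialsRes s i)).map_smulₛₗ r m)

/-- `D` is a `k`-derivation of the sheaf of rings `𝒪_U`. -/
structure IsVectorField {U : X.Opens} (D : ∀ V : {V : X.Opens // V ≤ U}, Γ(X, V) → Γ(X, V)) :
    Prop where
  map_add (V a b) : D V (a + b) = D V a + D V b
  leibniz (V a b) : D V (a * b) = a * D V b + b * D V a
  map_scalar (V c) : D V (scalars s (.op V.1) c) = 0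
  map_res (V W : {V : X.Opens // V ≤ U}) (h : W.1 ≤ V.1) (a) :
    D W (X.presheaf.map (homOfLE h).op a) = X.presheaf.map (homOfLE h).op (D V a)

/-- The `k`-derivations `𝒪_U → 𝒪_U`. -/
def vectorFields (U : X.Opens) :
    AddSubgroup (∀ V : {V : X.Opens // V ≤ U}, Γ(X, V) → Γ(X, V)) where
  carrier := {D | IsVectorField s D}
  zero_mem' := by
    constructor <;> intros <;> simp
  add_mem' {D E} hD hE := by
    constructor
    · intro V a b; simp only [Pi.add_apply, hD.map_add, hE.map_add]; ring
    · intro V a b; simp only [Pi.add_apply, hD.leibniz, hE.leibniz]; ring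
    · intro V c; simp only [Pi.add_apply, hD.map_scalar, hE.map_scalar, add_zero]
    · intro V W h a; simp only [Pi.add_apply, hD.map_res _ _ h, hE.map_res _ _ h, map_add]
  neg_mem' {D} hD := by
    constructor
    · intro V a b; simp only [Pi.neg_apply, hD.map_add]; ring
    · intro V a b; simp only [Pi.neg_apply, hD.leibniz]; ring
    · intro V c; simp only [Pi.neg_apply, hD.map_scalar, neg_zero]
    · intro V W h a; simp only [Pi.neg_apply, hD.map_res _ _ h, map_neg]

theorem smul_mem_vectorFields {U : X.Opens} (r : Γ(X, U)) (D : vectorFields s U) :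
    (fun V a => X.presheaf.map (homOfLE V.2).op r * D.1 V a :
      ∀ V : {V : X.Opens // V ≤ U}, Γ(X, V) → Γ(X, V)) ∈ vectorFields s U where
  map_add V a b := by rw [D.2.map_add, mul_add]
  leibniz V a b := by rw [D.2.leibniz]; ring
  map_scalar V c := by rw [D.2.map_scalar, mul_zero]
  map_res V W h a := by
    rw [D.2.map_res V W h, map_mul, ← CommRingCat.comp_apply, ← Functor.map_comp]
    rfl

/-- The presheaf `U ↦ Der_k(𝒪_U, 𝒪_U)`. -/
def vectorFieldsPresheaf : X.Opensᵒᵖ ⥤ Ab.{u} where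
  obj U := AddCommGrpCat.of (vectorFields s U.unop)
  map {U V} i := AddCommGrpCat.ofHom
    { toFun := fun D => ⟨fun W => D.1 ⟨W.1, W.2.trans i.unop.le⟩,
        ⟨fun A => D.2.map_add ⟨A.1, A.2.trans i.unop.le⟩,
          fun A => D.2.leibniz ⟨A.1, A.2.trans i.unop.le⟩,
          fun A => D.2.map_scalar ⟨A.1, A.2.trans i.unop.le⟩,
          fun A B h => D.2.map_res ⟨A.1, A.2.trans i.unop.le⟩ ⟨B.1, B.2.trans i.unop.le⟩ h⟩⟩
      map_zero' := rfl
      map_add' := fun _ _ => rfl }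

instance vectorFieldsModule (U : X.Opens) : Module Γ(X, U) (vectorFields s U) where
  smul r D := ⟨_, smul_mem_vectorFields s r D⟩
  one_smul D := Subtype.ext <| funext fun V => funext fun a => by
    change X.presheaf.map _ (1 : Γ(X, U)) * D.1 V a = D.1 V a
    rw [map_one, one_mul]
  mul_smul r r' D := Subtype.ext <| funext fun V => funext fun a => by
    change X.presheaf.map _ (r * r') * D.1 V a =
      X.presheaf.map _ r * (X.presheaf.map _ r' * D.1 V a)
    rw [map_mul, mul_assoc]
  smul_zero r := Subtype.ext <| funext fun V => funext fun a => mul_zero _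
  smul_add r D E := Subtype.ext <| funext fun V => funext fun a => mul_add _ _ _
  add_smul r r' D := Subtype.ext <| funext fun V => funext fun a => by
    change X.presheaf.map _ (r + r') * D.1 V a =
      X.presheaf.map _ r * D.1 V a + X.presheaf.map _ r' * D.1 V a
    rw [map_add, add_mul]
  zero_smul D := Subtype.ext <| funext fun V => funext fun a => by
    change X.presheaf.map _ (0 : Γ(X, U)) * D.1 V a = 0
    rw [map_zero, zero_mul]

theorem vectorFieldsPresheaf_map_smul {U V : X.Opensᵒᵖ} (i : U ⟶ V) (r : Γ(X, U.unop))
    (D : vectorFields s U.unop) :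
    (vectorFieldsPresheaf s).map i (r • D : vectorFields s U.unop) =
      ((show Γ(X, V.unop) from X.presheaf.map i r) • (show vectorFields s V.unop from (vectorFieldsPresheaf s).map i D) :
        vectorFields s V.unop) :=
  Subtype.ext <| funext fun W => funext fun a => by
    change X.presheaf.map _ r * _ = X.presheaf.map _ (X.presheaf.map i r) * _
    rw [← CommRingCat.comp_apply (X.presheaf.map i), ← Functor.map_comp]
    rfl

instance vectorFieldsPresheafModule (U : X.Opensᵒᵖ) :
    Module (X.ringCatSheaf.obj.obj U) ((vectorFieldsPresheaf s).obj U) :=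
  inferInstanceAs (Module Γ(X, U.unop) (vectorFields s U.unop))

/-- The tangent sheaf `T_X = Der_k(𝒪_X, 𝒪_X)`, the dual of `Ω¹_X`. -/
def tangentSheaf : X.Modules :=
  sheafify (PresheafOfModules.ofPresheaf (R := X.ringCatSheaf.obj) (vectorFieldsPresheaf s)
    fun _ _ i r D => vectorFieldsPresheaf_map_smul s i r D)

/-- The smooth locus: the largest open subset of `X` that is smooth over `k`. -/
def smoothLocus : X.Opens := sSup {U : X.Opens | Smooth (U.ι ≫ s)}

/-- The structure morphism of the smooth locus. -/
abbrev smoothLocusToSpec : (smoothLocus s).toScheme ⟶ Spec (.of k) := (smoothLocus s).ι ≫ s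

end Sheaves

/-! ## Projective spaces and `Proj` over a field -/

/-- The structure morphism of `Proj A` for a graded `k`-algebra `A`. -/
def projToSpec (k : Type u) [Field k] {A : Type u} [CommRing A] [Algebra k A]
    (𝒜 : ℕ → Submodule k A) [GradedAlgebra 𝒜] : Proj 𝒜 ⟶ Spec (.of k) :=
  Proj.toSpecZero 𝒜 ≫ Spec.map (CommRingCat.ofHom (algebraMap k (𝒜 0)))

/-- The projective space `ℙⁿ` over `k`. -/
abbrev PSpace (k : Type u) [Field k] (n : ℕ) : Scheme.{u} :=
  Proj (MvPolynomial.homogeneousSubmodule (Fin (n + 1)) k)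

/-- The structure morphism of `ℙⁿ`. -/
abbrev pSpaceToSpec (k : Type u) [Field k] (n : ℕ) : PSpace k n ⟶ Spec (.of k) :=
  projToSpec k (MvPolynomial.homogeneousSubmodule (Fin (n + 1)) k)

/-- The line bundle `𝒪(m)` on `ℙⁿ`. -/
abbrev pSpaceO (k : Type u) [Field k] (n : ℕ) (m : ℤ) : (PSpace k n).Modules :=
  twist (MvPolynomial.homogeneousSubmodule (Fin (n + 1)) k) ⊤ m

section Glue

open HomogeneousLocalization Limits

variable {A B : Type u} {σ τ : Type u} [CommRing A] [CommRing B] [SetLike σ A]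
  [AddSubgroupClass σ A] [SetLike τ B] [AddSubgroupClass τ B] {𝒜 : ℕ → σ} {ℬ : ℕ → τ}
  [GradedRing 𝒜] [GradedRing ℬ] (φ : 𝒜 →+*ᵍ ℬ)

/-- The morphism `D₊(φ t) ⟶ D₊(t) ⊆ Proj A` induced by a graded ring homomorphism `φ : A → B`. -/
def projMapOn {d : ℕ} (t : A) (ht : t ∈ 𝒜 d) (hd : 0 < d) :
    (Proj.basicOpen ℬ (φ t)).toScheme ⟶ Proj 𝒜 :=
  Proj.basicOpenToSpec ℬ (φ t) ≫ Spec.map (CommRingCat.ofHom (Away.map φ t)) ≫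
    Proj.awayι 𝒜 t ht hd

theorem homOfLE_projMapOn {d e : ℕ} {t r v : A} (ht : t ∈ 𝒜 d) (hd : 0 < d) (hr : r ∈ 𝒜 e)
    (hv : v = t * r) (hv' : v ∈ 𝒜 (d + e))
    (h : Proj.basicOpen ℬ (φ v) ≤ Proj.basicOpen ℬ (φ t)) :
    (Proj ℬ).homOfLE h ≫ projMapOn φ t ht hd =
      projMapOn φ v hv' (hd.trans_le (d.le_add_right e)) := by
  have hφ : φ v = φ t * φ r := by rw [hv, map_mul]
  have hr' : φ r ∈ ℬ e := φ.2 hr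
  rw [projMapOn, projMapOn, ← Proj.SpecMap_awayMap_awayι 𝒜 ht hd hr hv,
    ← Proj.basicOpenToSpec_SpecMap_awayMap_assoc ℬ hr' hφ, ← Spec.map_comp_assoc,
    ← Spec.map_comp_assoc]
  congr 2
  rw [← CommRingCat.ofHom_comp, ← CommRingCat.ofHom_comp]
  congr 1
  ext z
  obtain ⟨n, a, ha, rfl⟩ := Away.mk_surjective 𝒜 ht z
  simp [Away.map_mk, awayMap_mk]

variable {ι : Type} (t : ι → A) {d : ℕ} (hd : 0 < d) (ht : ∀ i, t i ∈ 𝒜 d)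
  (hcov : ⨆ i, Proj.basicOpen ℬ (φ (t i)) = ⊤)

/-- The morphism `Proj B ⟶ Proj A` induced by a graded ring homomorphism `φ : A → B` when the
open sets `D₊(φ (t i))` cover `Proj B`. -/
def projMapOfCover : Proj ℬ ⟶ Proj 𝒜 :=
  ((Proj ℬ).openCoverOfIsOpenCover (fun i => Proj.basicOpen ℬ (φ (t i))) hcov).glueMorphisms
    (fun i => projMapOn φ (t i) (ht i) hd) (by
      intro x y
      let e : pullback (Proj.basicOpen ℬ (φ (t x))).ι (Proj.basicOpen ℬ (φ (t y))).ι ≅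
          (Proj.basicOpen ℬ (φ (t x * t y))).toScheme :=
        (isPullback_opens_inf _ _).isoPullback.symm ≪≫
          (Proj ℬ).isoOfEq (by rw [map_mul, Proj.basicOpen_mul])
      have hle (i) (hi : t i ∣ t x * t y) :
          Proj.basicOpen ℬ (φ (t x * t y)) ≤ Proj.basicOpen ℬ (φ (t i)) :=
        Proj.basicOpen_mono _ _ _ (map_dvd φ hi)
      change pullback.fst (Proj.basicOpen ℬ (φ (t x))).ι (Proj.basicOpen ℬ (φ (t y))).ι ≫ _ =
        pullback.snd (Proj.basicOpen ℬ (φ (t x))).ι (Proj.basicOpen ℬ (φ (t y))).ι ≫ _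
      have h₁ : e.inv ≫ pullback.fst _ _ = (Proj ℬ).homOfLE (hle x (dvd_mul_right _ _)) := by
        simp [e, Scheme.isoOfEq_inv]
      have h₂ : e.inv ≫ pullback.snd _ _ = (Proj ℬ).homOfLE (hle y (dvd_mul_left _ _)) := by
        simp [e, Scheme.isoOfEq_inv]
      rw [← cancel_epi e.inv, reassoc_of% h₁, reassoc_of% h₂,
        homOfLE_projMapOn φ (ht x) hd (ht y) rfl (SetLike.mul_mem_graded (ht x) (ht y)),
        homOfLE_projMapOn φ (ht y) hd (ht x) (mul_comm _ _)
          (SetLike.mul_mem_graded (ht x) (ht y))])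
end Glue

/-! ## The surface

Blow up the seven `𝔽₂`-points of `ℙ²` with coordinates `(u : v : t)`. The anticanonical system of
the blow-up consists of the cubics through these points and is spanned by
`x₀ = v t (v + t)`, `x₁ = t u (t + u)`, `x₂ = u v (u + v)`; the sextic
`x₃ = u v t (u + v) (v + t) (t + u)`, a section of `-2K`, satisfies
`x₃² = x₀ x₁ x₂ (x₀ + x₁ + x₂)` in characteristic two. This is the equation in `ℙ(1,1,1,2)` of the
surface that is obtained by contracting the strict transforms of the seven `𝔽₂`-lines. -/

section Surface

open MvPolynomial

variable (k : Type u) [Field k]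

/-- The weights of the coordinates of `ℙ(1,1,1,2)`. -/
def weights : Fin 4 → ℕ := ![1, 1, 1, 2]

/-- The equation `x₃² = x₀ x₁ x₂ (x₀ + x₁ + x₂)`. -/
def equation : MvPolynomial (Fin 4) k := X 3 ^ 2 - X 0 * X 1 * X 2 * (X 0 + X 1 + X 2)

/-- The homogeneous coordinate ring of the surface. -/
abbrev CoordRing : Type u := MvPolynomial (Fin 4) k ⧸ Ideal.span {equation k}

/-- The quotient map from the polynomial ring. -/
abbrev toCoordRing : MvPolynomial (Fin 4) k →ₐ[k] CoordRing k :=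
  Ideal.Quotient.mkₐ k (Ideal.span {equation k})

/-- The grading of the coordinate ring induced by the weights. -/
def grading (n : ℕ) : Submodule k (CoordRing k) :=
  (weightedHomogeneousSubmodule k weights n).map (toCoordRing k).toLinearMap

theorem toCoordRing_mem_grading {n : ℕ} {p : MvPolynomial (Fin 4) k}
    (hp : p.IsWeightedHomogeneous weights n) : toCoordRing k p ∈ grading k n :=
  ⟨p, hp, rfl⟩

theorem equation_isWeightedHomogeneous : (equation k).IsWeightedHomogeneous weights 4 := by
  have h (i) := isWeightedHomogeneous_X k weights i
  have h1 : ∀ i : Fin 4, i ≠ 3 → weights i = 1 := by decide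
  refine (weightedHomogeneousSubmodule k weights 4).sub_mem ?_ ?_
  · exact (h 3).pow 2
  · exact (((h 0).mul (h 1)).mul (h 2)).mul (((weightedHomogeneousSubmodule k weights 1).add_mem
      ((weightedHomogeneousSubmodule k weights 1).add_mem (h 0) (h 1)) (h 2)))

instance : SetLike.GradedMonoid (grading k) where
  one_mem := ⟨1, isWeightedHomogeneous_one k weights, map_one (toCoordRing k)⟩
  mul_mem := by
    rintro i j _ _ ⟨p, hp, rfl⟩ ⟨q, hq, rfl⟩
    exact ⟨p * q, hp.mul hq, map_mul (toCoordRing k) p q⟩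

/-- Auxiliary map splitting a polynomial into its weighted homogeneous parts. -/
def decomposeAux : MvPolynomial (Fin 4) k →ₐ[k] DirectSum ℕ (fun i => grading k i) :=
  aeval fun i => DirectSum.of (fun n => grading k n) (weights i)
    ⟨toCoordRing k (X i), toCoordRing_mem_grading k (isWeightedHomogeneous_X k weights i)⟩

theorem coe_decomposeAux (p : MvPolynomial (Fin 4) k) :
    DirectSum.coeAlgHom (grading k) (decomposeAux k p) = toCoordRing k p := by
  have : (DirectSum.coeAlgHom (grading k)).comp (decomposeAux k) = toCoordRing k := by
    ext i
    simp [decomposeAux]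
  exact congr($this p)

theorem decomposeAux_monomial (d : Fin 4 →₀ ℕ) :
    ∃ y, decomposeAux k (monomial d 1) =
      DirectSum.of (fun n => grading k n) (Finsupp.weight weights d) y := by
  suffices ∃ n y, n = Finsupp.weight weights d ∧
      decomposeAux k (monomial d 1) = DirectSum.of (fun n => grading k n) n y by
    obtain ⟨n, y, rfl, h⟩ := this
    exact ⟨y, h⟩
  induction d using Finsupp.induction_linear with
  | zero => exact ⟨0, 1, by simp, by rw [monomial_zero', map_one, map_one]; rfl⟩
  | add d e hd he =>
    obtain ⟨n, y, hn, hy⟩ := hd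
    obtain ⟨m, z, hm, hz⟩ := he
    refine ⟨n + m, GradedMonoid.GMul.mul (A := fun n => grading k n) y z, by rw [map_add, hn, hm], ?_⟩
    rw [← one_mul (1 : k), ← monomial_mul, map_mul, hy, hz, DirectSum.of_mul_of]
  | single i n =>
    refine ⟨n • weights i, GradedMonoid.GMonoid.gnpow (A := fun n => grading k n) n ⟨toCoordRing k (X i),
      toCoordRing_mem_grading k (isWeightedHomogeneous_X k weights i)⟩,
      by rw [Finsupp.weight_single], ?_⟩
    rw [← X_pow_eq_monomial, map_pow, decomposeAux, aeval_X, DirectSum.ofPow]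

theorem decomposeAux_apply {n : ℕ} (p : MvPolynomial (Fin 4) k)
    (hp : p.IsWeightedHomogeneous weights n) :
    decomposeAux k p = DirectSum.of (fun n => grading k n) n
      ⟨toCoordRing k p, toCoordRing_mem_grading k hp⟩ := by
  obtain ⟨y, hy⟩ : ∃ y, decomposeAux k p = DirectSum.of (fun n => grading k n) n y := by
    suffices decomposeAux k p ∈ LinearMap.range (DirectSum.lof k ℕ (fun n => grading k n) n) by
      obtain ⟨y, hy⟩ := this
      exact ⟨y, hy.symm⟩
    rw [p.as_sum, map_sum]
    refine Submodule.sum_mem _ fun d hd => ?_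
    obtain ⟨y, hy⟩ := decomposeAux_monomial k d
    have hn := hp (mem_support_iff.mp hd)
    rw [← mul_one (coeff d p), ← smul_eq_mul, ← smul_monomial, map_smul, hy]
    subst hn
    exact Submodule.smul_mem _ _ ⟨y, rfl⟩
  have := coe_decomposeAux k p
  rw [hy, DirectSum.coeAlgHom_of] at this
  rw [hy]
  congr 1
  exact Subtype.ext this

instance : GradedAlgebra (grading k) :=
  GradedAlgebra.ofAlgHom (grading k)
    (Ideal.Quotient.liftₐ _ (decomposeAux k) (by
      intro a ha
      rw [Ideal.mem_span_singleton] at ha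
      obtain ⟨b, rfl⟩ := ha
      rw [map_mul, decomposeAux_apply k _ (equation_isWeightedHomogeneous k)]
      have : (⟨toCoordRing k (equation k), toCoordRing_mem_grading k
          (equation_isWeightedHomogeneous k)⟩ : grading k 4) = 0 :=
        Subtype.ext (Ideal.Quotient.eq_zero_iff_mem.mpr (Ideal.mem_span_singleton_self _))
      rw [this, map_zero, zero_mul]))
    (by
      apply Ideal.Quotient.algHom_ext
      refine AlgHom.ext fun p => ?_
      exact coe_decomposeAux k p)
    (by
      rintro n ⟨_, p, hp, rfl⟩
      exact decomposeAux_apply k p hp)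

/-- The surface `S` over `k`. -/
abbrev S : Scheme.{u} := Proj (grading k)

/-- The structure morphism of `S`. -/
abbrev sToSpec : S k ⟶ Spec (.of k) := projToSpec k (grading k)

/-- The inclusion `k[x₀, x₁, x₂] → k[x₀, x₁, x₂, x₃] / (equation)`. -/
def coverRingHom : homogeneousSubmodule (Fin 3) k →+*ᵍ grading k where
  toRingHom := (aeval fun i : Fin 3 => toCoordRing k (X i.castSucc)).toRingHom
  map_mem {n p} hp := by
    change aeval (fun i : Fin 3 => toCoordRing k (X i.castSucc)) p ∈ grading k n
    rw [p.as_sum, map_sum]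
    refine Submodule.sum_mem _ fun d hd => ?_
    have hdeg := hp (mem_support_iff.mp hd)
    rw [← mul_one (coeff d p), ← smul_eq_mul, ← smul_monomial, map_smul]
    refine Submodule.smul_mem _ _ ?_
    have hmem : (monomial (Finsupp.mapDomain Fin.castSucc d) (1 : k)) ∈
        weightedHomogeneousSubmodule k weights n := by
      refine isWeightedHomogeneous_monomial _ _ _ ?_
      rw [← hdeg, Finsupp.weight_apply, Finsupp.weight_apply,
        Finsupp.sum_mapDomain_index (by simp) (by intros; simp [add_mul])]
      refine Finsupp.sum_congr fun i _ => ?_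
      fin_cases i <;> rfl
    have : toCoordRing k (monomial (Finsupp.mapDomain Fin.castSucc d) (1 : k)) =
        aeval (fun i : Fin 3 => toCoordRing k (X i.castSucc)) (monomial d (1 : k)) := by
      rw [← rename_monomial]
      have : (toCoordRing k).comp (rename Fin.castSucc) =
          aeval (fun i : Fin 3 => toCoordRing k (X i.castSucc)) := by
        ext i
        simp
      exact congr($this (monomial d 1))
    rw [← this]
    exact toCoordRing_mem_grading k hmem

theorem iSup_basicOpen_eq_top :
    ⨆ i : Fin 3, Proj.basicOpen (grading k) (coverRingHom k (X i)) = ⊤ := by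
  refine top_le_iff.mp fun x _ => Opens.mem_iSup.mpr ?_
  by_contra! h
  simp only [Proj.mem_basicOpen, not_not] at h
  have hX (i : Fin 3) : toCoordRing k (X i.castSucc) ∈ x.asHomogeneousIdeal := by
    have := h i
    rwa [show coverRingHom k (X i) = toCoordRing k (X i.castSucc) from
      aeval_X (fun i : Fin 3 => toCoordRing k (X i.castSucc)) i] at this
  have heq : toCoordRing k (X 3) ^ 2 = toCoordRing k (X 0) *
      (toCoordRing k (X 1) * toCoordRing k (X 2) *
        (toCoordRing k (X 0) + toCoordRing k (X 1) + toCoordRing k (X 2))) := by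
    have : toCoordRing k (X 3 ^ 2 - X 0 * X 1 * X 2 * (X 0 + X 1 + X 2)) = 0 :=
      Ideal.Quotient.eq_zero_iff_mem.mpr (Ideal.mem_span_singleton_self (equation k))
    rw [map_sub, map_pow, sub_eq_zero] at this
    rw [this]
    simp only [map_mul, map_add]
    ring
  have h3 : toCoordRing k (X 3) ∈ x.asHomogeneousIdeal := by
    refine x.isPrime.mem_of_pow_mem 2 ?_
    rw [heq]
    exact Ideal.mul_mem_right _ _ (hX 0)
  have hall (i : Fin 4) : toCoordRing k (X i) ∈ x.asHomogeneousIdeal := by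
    fin_cases i
    exacts [hX 0, hX 1, hX 2, h3]
  obtain ⟨d, c, hd, hc, hcx⟩ := exists_homogeneous_notMem (grading k) x
  obtain ⟨p, hp, rfl⟩ := hc
  refine hcx ?_
  change toCoordRing k p ∈ x.asHomogeneousIdeal.toIdeal
  rw [p.as_sum, map_sum]
  refine Ideal.sum_mem _ fun e he => ?_
  have hwe : Finsupp.weight weights e = d := hp (mem_support_iff.mp he)
  obtain ⟨i, hi⟩ : ∃ i, e i ≠ 0 := by
    by_contra! h0
    have : e = 0 := Finsupp.ext h0
    rw [this, map_zero] at hwe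
    omega
  obtain ⟨q, hq⟩ : X i ∣ monomial e (coeff e p) := (X_dvd_monomial).mpr (Or.inr hi)
  rw [hq, map_mul]
  exact Ideal.mul_mem_right _ _ (hall i)

/-- The double cover `g : S ⟶ ℙ²`, `(x₀ : x₁ : x₂ : x₃) ↦ (x₀ : x₁ : x₂)`. -/
def g : S k ⟶ PSpace k 2 :=
  projMapOfCover (coverRingHom k) (fun i : Fin 3 => X i) one_pos
    (fun i => isHomogeneous_X k i) (iSup_basicOpen_eq_top k)

/-- The product of the equations of the `𝔽₂`-lines of `ℙ²` in the affine chart `t = 1`, with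
coordinates `u`, `v`; the seventh line `t = 0` is the line at infinity. -/
def linesProduct : MvPolynomial (Fin 2) k :=
  X 0 * X 1 * (X 0 + 1) * (X 1 + 1) * (X 0 + X 1) * (X 0 + X 1 + 1)

/-- The coordinate ring of the complement of the seven `𝔽₂`-lines in `ℙ²`. -/
abbrev LinesComplementRing : Type u := Localization.Away (linesProduct k)

/-- The sections `x₀, x₁, x₂` of `-K` and `x₃` of `-2K` on the blow-up of `ℙ²` in the seven
`𝔽₂`-points, in the affine chart `t = 1`. -/
def anticanonicalCoords : Fin 4 → MvPolynomial (Fin 2) k :=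
  ![X 1 * (X 1 + 1), X 0 * (X 0 + 1), X 0 * X 1 * (X 0 + X 1),
    X 0 * X 1 * (X 0 + X 1) * (X 1 + 1) * (X 0 + 1)]

section Anticanonical

variable [CharP k 2]

/-- The homomorphism `xᵢ ↦ xᵢ(u, v, 1)` on the homogeneous coordinate ring of `S`. -/
def anticanonicalRingHom : CoordRing k →ₐ[k] LinesComplementRing k :=
  (IsScalarTower.toAlgHom k (MvPolynomial (Fin 2) k) (LinesComplementRing k)).comp
    (Ideal.Quotient.liftₐ _ (aeval (anticanonicalCoords k)) (by
      intro a ha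
      rw [Ideal.mem_span_singleton] at ha
      obtain ⟨b, rfl⟩ := ha
      rw [map_mul]
      refine mul_eq_zero_of_left ?_ _
      have h2 : (2 : MvPolynomial (Fin 2) k) = 0 := CharTwo.two_eq_zero
      simp only [equation, anticanonicalCoords, map_sub, map_mul, map_pow, map_add, aeval_X,
        Matrix.cons_val]
      set u : MvPolynomial (Fin 2) k := X 0
      set v : MvPolynomial (Fin 2) k := X 1
      linear_combination (u ^ 3 * v ^ 3 * (u + v) * (v + 1) * (u + 1)) * h2))

theorem isUnit_anticanonicalRingHom_X_zero :
    IsUnit (anticanonicalRingHom k (toCoordRing k (X 0))) := by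
  have : anticanonicalRingHom k (toCoordRing k (X 0)) =
      algebraMap (MvPolynomial (Fin 2) k) (LinesComplementRing k) (X 1 * (X 1 + 1)) := by
    refine congr_arg (algebraMap (MvPolynomial (Fin 2) k) (LinesComplementRing k)) ?_
    exact aeval_X (anticanonicalCoords k) 0
  rw [this]
  have hdvd : (X 1 * (X 1 + 1) : MvPolynomial (Fin 2) k) ∣ linesProduct k :=
    ⟨X 0 * (X 0 + 1) * (X 0 + X 1) * (X 0 + X 1 + 1), by rw [linesProduct]; ring⟩
  exact isUnit_of_dvd_unit (map_dvd (algebraMap _ (LinesComplementRing k)) hdvd)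
    (IsLocalization.Away.algebraMap_isUnit (S := LinesComplementRing k) (linesProduct k))

theorem anticanonical_irrelevant :
    (HomogeneousIdeal.irrelevant (grading k)).toIdeal.map
      ((Scheme.ΓSpecIso (.of (LinesComplementRing k))).inv.hom.comp
        (anticanonicalRingHom k).toRingHom) = ⊤ := by
  refine Ideal.eq_top_of_isUnit_mem _ (x := (Scheme.ΓSpecIso (.of (LinesComplementRing k))).inv.hom
    (anticanonicalRingHom k (toCoordRing k (X 0)))) ?_ ?_
  · refine Ideal.mem_map_of_mem ((Scheme.ΓSpecIso (.of (LinesComplementRing k))).inv.hom.comp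
        (anticanonicalRingHom k).toRingHom) ?_
    refine HomogeneousIdeal.mem_irrelevant_of_mem (grading k) one_pos ?_
    exact toCoordRing_mem_grading k (isWeightedHomogeneous_X k weights 0)
  · exact (isUnit_anticanonicalRingHom_X_zero k).map _

/-- The morphism to `S` from the complement of the seven `𝔽₂`-lines in `ℙ²` that is given by the
sections `x₀, x₁, x₂, x₃` of the powers of the anticanonical sheaf of the blow-up. -/
def anticanonicalMap : Spec (.of (LinesComplementRing k)) ⟶ S k :=
  Proj.fromOfGlobalSections (grading k)
    ((Scheme.ΓSpecIso (.of (LinesComplementRing k))).inv.hom.comp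
      (anticanonicalRingHom k).toRingHom) (anticanonical_irrelevant k)

end Anticanonical

/-- The singular (non-smooth) points of `S`. -/
def singularPoints : Set (S k) := {x | x ∉ smoothLocus (sToSpec k)}

/-- The homogeneous ideal of the images in `ℙ²` of the singular points of `S`. -/
def pointsIdeal : Ideal (MvPolynomial (Fin 3) k) :=
  (ProjectiveSpectrum.vanishingIdeal
    (𝒜 := homogeneousSubmodule (Fin 3) k) (g k '' singularPoints k)).toIdeal

/-- The sheaf `I(1)` on `ℙ²`, where `I` is the ideal sheaf of the images of the singular points. -/
def idealSheafOne : (PSpace k 2).Modules :=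
  twist (homogeneousSubmodule (Fin 3) k) (pointsIdeal k) 1

end Surface

/-! ## Singularities of type `A₁`, del Pezzo surfaces, free curves -/

section Geometry

variable (k : Type u) [Field k]

/-- The coordinate ring `k[a, b, c] / (a b - c²)` of the quadric cone. -/
abbrev ConeRing : Type u :=
  MvPolynomial (Fin 3) k ⧸ Ideal.span
    {(MvPolynomial.X 0 * MvPolynomial.X 1 - MvPolynomial.X 2 ^ 2 : MvPolynomial (Fin 3) k)}

variable {k} {X : Scheme.{u}}

/-- `x` is a (split) `A₁`-singularity of the surface `X`: étale locally around `x`, the surface is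
isomorphic to the cone `a b = c²` around its vertex `a = b = c = 0`. -/
def IsA1Singularity (s : X ⟶ Spec (.of k)) (x : X) : Prop :=
  ∃ (U : Scheme.{u}) (e : U ⟶ X) (c : U ⟶ Spec (.of (ConeRing k))) (y : U),
    Etale e ∧ Etale c ∧
    e ≫ s = c ≫ Spec.map (CommRingCat.ofHom (algebraMap k (ConeRing k))) ∧
    e y = x ∧
    ∀ i, (Ideal.Quotient.mk _ (MvPolynomial.X i) : ConeRing k) ∈
      (show PrimeSpectrum (ConeRing k) from c y).asIdeal

/-- `X` is a Gorenstein log del Pezzo surface over `k` with at most `A₁`-singularities (hence normal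
with canonical, in particular klt, singularities) whose anticanonical sheaf is `h^* 𝒪(1)` for the
finite, not necessarily surjective, morphism `h : X ⟶ ℙᴺ` (hence is ample). The canonical sheaf is
the reflexive sheaf determined by the sheaf of two-forms on the smooth locus. -/
structure IsA1DelPezzo (s : X ⟶ Spec (.of k)) {N : ℕ} (h : X ⟶ PSpace k N) : Prop where
  isIntegral : IsIntegral X
  isProper : IsProper s
  smooth_two : SmoothOfRelativeDimension 2 (smoothLocusToSpec s)
  a1 (x : X) (hx : x ∉ smoothLocus s) : IsA1Singularity s x
  w : h ≫ pSpaceToSpec k N = s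
  isFinite : IsFinite h
  canonical : Nonempty (twoForms (smoothLocusToSpec s) ≅
    (Scheme.Modules.pullback ((smoothLocus s).ι ≫ h)).obj (pSpaceO k N (-1)))

/-- `f` is a free rational curve on the smooth `k`-scheme `X`: a nonconstant `k`-morphism
`ℙ¹ ⟶ X` such that `f^* T_X` is semi-ample. A vector bundle on `ℙ¹` is a direct sum of line
bundles `𝒪(a)`, so that it is semi-ample (all `a ≥ 0`) if and only if it is generated by its global
sections. -/
structure IsFreeCurve (s : X ⟶ Spec (.of k)) (f : PSpace k 1 ⟶ X) : Prop where
  w : f ≫ s = pSpaceToSpec k 1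
  nonconstant : (Set.range f).Nontrivial
  semiample : Nonempty (SheafOfModules.GeneratingSections
    ((Scheme.Modules.pullback f).obj (tangentSheaf s)))

end Geometry

end

end KollarSurface

/-! Write F = x₀x₁x₂(x₀ + x₁ + x₂) and Fᵢ for its partial derivatives. In characteristic two the
cover x₃² = F is purely inseparable, and the relation it imposes on differentials is dF = 0, which
does not involve dx₃. Moreover Fᵢ = xⱼxₗ(xⱼ + xₗ), so the Fᵢ are the 2×2 minors of the matrix with
rows (x₀, x₁, x₂) and (x₀², x₁², x₂²). Their common zeros are the points fixed by Frobenius, that is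
the seven 𝔽₂-points, and locally they generate the ideal I of these points.

The coordinate ring carries two derivations: W = ∂/∂x₃ (`derW`), of degree −2, and V = ∑ xᵢ²∂ᵢ
(`derV`), of degree 1, which kills F because ∑ xᵢ²Fᵢ is even. On functions of degree zero they take
values in 𝒪(−2) and in the twist by one of the ideal generated by I. In affine coordinates y, z, w
with w² = yz(1 + y + z), the module of differentials is generated by dy, dz, dw, and z(1 + z)dy +
y(1 + y)dz = 0. V kills dw and sends dy, dz to two generators of the twisted ideal, whose syzygies
are the multiples of this relation because y(1 + y) and z(1 + z) are coprime. W kills dy, dz and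
sends dw to a generator of 𝒪(−2). So (V, W) is an isomorphism of Ω¹ with g^*I(1) ⊕ g^*𝒪(−2); the
exact sequence even splits (`bijective_prod_of_d`, `exists_shortExact_differentials`).

On the smooth locus I becomes trivial. Hence Ω² is 𝒪(1) ⊗ 𝒪(−2) = 𝒪(−1), and the tangent sheaf is
𝒪(−1) ⊕ 𝒪(2). For a free curve f the quotient f^*g^*𝒪(−1) of f^*T would be globally generated, which
forces f to be constant. In the proof the sections xⱼ of 𝒪(1) inside Ω¹ give linear forms on T.
Applied to global generators of f^*T they yield constants on ℙ¹; they cannot all be zero, and a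
nonzero one confines f to the affine chart xⱼ ≠ 0 (`not_isFreeCurve_smoothLocus`).

Local geometry: where z(1 + z) is invertible, y is étale over the (z, w)-plane. Translations by
𝔽₂-points, corrected in w, preserve the equation, so every remaining point may be taken to be the
origin, where (y, z(1 + y + z), w) is étale over the cone. The open immersion follows from explicit
formulas for the inverse rational map.

The sheaf theory rests on two facts. Sections of a twist over D₊(h) are homogeneous fractions with
denominator hᴺ. And the sets D₊(h) with h from the plane form a basis of S (f and f² define the same
open set, and f² comes from the plane), over which S is free with basis 1, w
(`exists_basis_one_sqrt`). This gives finiteness, flatness and degree of g, and identifies the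
inverse images of twists. -/

namespace KollarSurface

noncomputable section

attribute [local instance] MvPolynomial.gradedAlgebra

/-! ### The coordinate ring as a quadratic extension of the plane, and two derivations of it -/

section Algebra

open MvPolynomial

variable (k : Type u) [Field k]

/-- The coordinates on the coordinate ring of the surface. -/
abbrev coord (i : Fin 4) : CoordRing k := toCoordRing k (X i)

/-- The inclusion of the coordinate ring of the plane in that of the surface. -/
abbrev incl : MvPolynomial (Fin 3) k →ₐ[k] CoordRing k :=
  aeval fun i : Fin 3 => toCoordRing k (X i.castSucc)

/-- The branch quartic. -/
def quartic : MvPolynomial (Fin 3) k := X 0 * X 1 * X 2 * (X 0 + X 1 + X 2)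

theorem incl_X (i : Fin 3) : incl k (X i) = coord k i.castSucc := aeval_X _ _

theorem coord_three_sq : coord k 3 ^ 2 = incl k (quartic k) := by
  have : toCoordRing k (X 3 ^ 2 - X 0 * X 1 * X 2 * (X 0 + X 1 + X 2)) = 0 :=
    Ideal.Quotient.eq_zero_iff_mem.mpr (Ideal.mem_span_singleton_self (equation k))
  rw [map_sub, sub_eq_zero, map_pow] at this
  rw [this, quartic]
  simp only [map_mul, map_add, incl_X]
  rfl

/-- Since x₃² comes from the plane, the span of 1 and x₃ over the polynomial ring in three variables
is stable under multiplication by every variable. -/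
theorem exists_normalForm (c : CoordRing k) : ∃ a b, c = incl k a + incl k b * coord k 3 := by
  obtain ⟨p, rfl⟩ := Ideal.Quotient.mk_surjective c
  change ∃ a b, toCoordRing k p = _
  induction p using MvPolynomial.induction_on with
  | C r => exact ⟨C r, 0, by rw [map_zero, zero_mul, add_zero, ← algebraMap_eq, ← algebraMap_eq,
      AlgHom.commutes, AlgHom.commutes]⟩
  | add p q hp hq =>
    obtain ⟨a, b, h⟩ := hp
    obtain ⟨a', b', h'⟩ := hq
    exact ⟨a + a', b + b', by simp only [map_add, h, h']; ring⟩
  | mul_X p i hp =>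
    obtain ⟨a, b, h⟩ := hp
    rw [map_mul, h]
    induction i using Fin.lastCases with
    | last =>
      refine ⟨b * quartic k, a, ?_⟩
      rw [map_mul, ← coord_three_sq]
      change (_ + _) * coord k 3 = _
      ring
    | cast i =>
      refine ⟨a * X i, b * X i, ?_⟩
      rw [map_mul, map_mul, incl_X]
      ring

/-- The coordinate ring, as the ring obtained by adjoining a square root of the quartic. -/
def toAdjoinRoot : CoordRing k →ₐ[k]
    AdjoinRoot (Polynomial.X ^ 2 - Polynomial.C (quartic k)) :=
  Ideal.Quotient.liftₐ _ (aeval (Fin.lastCases (AdjoinRoot.root _) fun i => AdjoinRoot.of _ (X i)))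
    (by
      intro a ha
      rw [Ideal.mem_span_singleton] at ha
      obtain ⟨b, rfl⟩ := ha
      rw [map_mul]
      refine mul_eq_zero_of_left ?_ _
      have h := AdjoinRoot.eval₂_root (Polynomial.X ^ 2 - Polynomial.C (quartic k))
      rw [Polynomial.eval₂_sub, Polynomial.eval₂_C, Polynomial.eval₂_pow, Polynomial.eval₂_X,
        quartic] at h
      simp only [equation, map_sub, map_mul, map_pow, map_add, aeval_X] at h ⊢
      exact h)

theorem toAdjoinRoot_incl (a : MvPolynomial (Fin 3) k) :
    toAdjoinRoot k (incl k a) = AdjoinRoot.of _ a := by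
  have : (toAdjoinRoot k).comp (incl k) = IsScalarTower.toAlgHom k (MvPolynomial (Fin 3) k) _ := by
    ext i
    rw [AlgHom.comp_apply, incl_X]
    refine (aeval_X _ _).trans ?_
    rw [Fin.lastCases_castSucc]
    rfl
  exact congr($this a)

theorem toAdjoinRoot_coord_three : toAdjoinRoot k (coord k 3) = AdjoinRoot.root _ :=
  (aeval_X _ _).trans (Fin.lastCases_last (n := 3))

/-- The equation is monic of degree two in x₃, so it divides no nonzero polynomial of degree at most
one in x₃. -/
theorem normalForm_eq_zero {a b : MvPolynomial (Fin 3) k}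
    (h : incl k a + incl k b * coord k 3 = 0) : a = 0 ∧ b = 0 := by
  replace h := congrArg (toAdjoinRoot k) h
  rw [map_add, map_mul, toAdjoinRoot_incl, toAdjoinRoot_incl, toAdjoinRoot_coord_three,
    map_zero] at h
  change AdjoinRoot.mk _ (Polynomial.C a) + AdjoinRoot.mk _ (Polynomial.C b) *
    AdjoinRoot.mk _ Polynomial.X = 0 at h
  rw [← map_mul, ← map_add, AdjoinRoot.mk_eq_zero] at h
  have hm := Polynomial.monic_X_pow_sub_C (quartic k) two_ne_zero
  have h0 : Polynomial.C a + Polynomial.C b * Polynomial.X = 0 := by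
    by_contra h0
    refine hm.not_dvd_of_degree_lt h0 ?_ h
    rw [Polynomial.degree_X_pow_sub_C two_pos, add_comm]
    exact Polynomial.degree_linear_le.trans_lt (by norm_num)
  constructor
  · simpa using congrArg (Polynomial.coeff · 0) h0
  · simpa using congrArg (Polynomial.coeff · 1) h0

theorem normalForm_inj {a b a' b' : MvPolynomial (Fin 3) k}
    (h : incl k a + incl k b * coord k 3 = incl k a' + incl k b' * coord k 3) :
    a = a' ∧ b = b' := by
  have := normalForm_eq_zero k (a := a - a') (b := b - b') (by
    rw [map_sub, map_sub]; linear_combination h)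
  simpa only [sub_eq_zero] using this

theorem incl_injective : Function.Injective (incl k) := fun a a' h =>
  (normalForm_inj k (b := 0) (b' := 0) (by rw [h])).1

theorem incl_mem_grading {n : ℕ} {a : MvPolynomial (Fin 3) k} (ha : a.IsHomogeneous n) :
    incl k a ∈ grading k n := (coverRingHom k).map_mem ha

theorem coord_mem_grading (i : Fin 4) : coord k i ∈ grading k (weights i) :=
  toCoordRing_mem_grading k (isWeightedHomogeneous_X k weights i)

theorem decompose_incl (a : MvPolynomial (Fin 3) k) (n : ℕ) :
    (DirectSum.decompose (grading k) (incl k a) n : CoordRing k) =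
      incl k (homogeneousComponent n a) := by
  conv_lhs => rw [← sum_homogeneousComponent a]
  rw [map_sum, DirectSum.decompose_sum, DFinsupp.finsetSum_apply, AddSubmonoidClass.coe_finsetSum]
  by_cases hn : n ∈ Finset.range (a.totalDegree + 1)
  · rw [Finset.sum_eq_single_of_mem n hn]
    · rw [DirectSum.decompose_of_mem_same]
      exact incl_mem_grading k (homogeneousComponent_isHomogeneous n a)
    · intro m _ hm
      exact DirectSum.decompose_of_mem_ne _
        (incl_mem_grading k (homogeneousComponent_isHomogeneous m a)) hm
  · rw [homogeneousComponent_eq_zero n a (by simpa [Nat.lt_succ_iff] using hn), map_zero]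
    refine Finset.sum_eq_zero fun m hm => ?_
    exact DirectSum.decompose_of_mem_ne _
        (incl_mem_grading k (homogeneousComponent_isHomogeneous m a)) (by rintro rfl; exact hn hm)

/-- Taking degree n components of a normal form keeps its shape. As x₃ has weight two, its
coefficient has degree n − 2 and is absent for n < 2. -/
theorem exists_homogeneous_normalForm {n : ℕ} {c : CoordRing k} (hc : c ∈ grading k n) :
    ∃ a b, c = incl k a + incl k b * coord k 3 ∧ a.IsHomogeneous n ∧
      ((n < 2 ∧ b = 0) ∨ ∃ m, n = m + 2 ∧ b.IsHomogeneous m) := by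
  obtain ⟨a, b, rfl⟩ := exists_normalForm k c
  have h := DirectSum.decompose_of_mem_same _ hc
  have h3 := coord_mem_grading k 3
  rw [DirectSum.decompose_add, DirectSum.add_apply, Submodule.coe_add, decompose_incl] at h
  rcases lt_or_ge n 2 with hn | hn
  · rw [DirectSum.coe_decompose_mul_of_right_mem_of_not_le (grading k) h3 (by simpa [weights] using hn),
      add_zero] at h
    exact ⟨_, 0, by rw [← h, map_zero, zero_mul, add_zero],
      homogeneousComponent_isHomogeneous n a, .inl ⟨hn, rfl⟩⟩
  · rw [DirectSum.coe_decompose_mul_of_right_mem_of_le (grading k) h3 (by simpa [weights] using hn),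
      decompose_incl] at h
    exact ⟨_, _, h.symm, homogeneousComponent_isHomogeneous n a,
      .inr ⟨n - 2, by omega, homogeneousComponent_isHomogeneous _ b⟩⟩

/-- The partial derivatives of the quartic. -/
def partials (i : Fin 3) : MvPolynomial (Fin 3) k := pderiv i (quartic k)

variable [CharP k 2]

theorem two_eq_zero_poly {σ : Type*} : (2 : MvPolynomial σ k) = 0 := CharTwo.two_eq_zero

theorem two_eq_zero_coordRing : (2 : CoordRing k) = 0 := by
  have : algebraMap k (CoordRing k) 2 = 0 := by rw [CharTwo.two_eq_zero (R := k), map_zero]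
  rwa [map_ofNat] at this

theorem partials_zero : partials k 0 = X 1 * X 2 * (X 1 + X 2) := by
  have h1 : (pderiv (0 : Fin 3)) (X 1 : MvPolynomial (Fin 3) k) = 0 := pderiv_X_of_ne (by decide)
  have h2 : (pderiv (0 : Fin 3)) (X 2 : MvPolynomial (Fin 3) k) = 0 := pderiv_X_of_ne (by decide)
  simp only [partials, quartic, Derivation.leibniz, map_add, pderiv_X_self, h1, h2, smul_eq_mul]
  linear_combination (X 0 * X 1 * X 2) * two_eq_zero_poly k (σ := Fin 3)

theorem partials_one : partials k 1 = X 0 * X 2 * (X 0 + X 2) := by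
  have h1 : (pderiv (1 : Fin 3)) (X 0 : MvPolynomial (Fin 3) k) = 0 := pderiv_X_of_ne (by decide)
  have h2 : (pderiv (1 : Fin 3)) (X 2 : MvPolynomial (Fin 3) k) = 0 := pderiv_X_of_ne (by decide)
  simp only [partials, quartic, Derivation.leibniz, map_add, pderiv_X_self, h1, h2, smul_eq_mul]
  linear_combination (X 0 * X 1 * X 2) * two_eq_zero_poly k (σ := Fin 3)

theorem partials_two : partials k 2 = X 0 * X 1 * (X 0 + X 1) := by
  have h1 : (pderiv (2 : Fin 3)) (X 0 : MvPolynomial (Fin 3) k) = 0 := pderiv_X_of_ne (by decide)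
  have h2 : (pderiv (2 : Fin 3)) (X 1 : MvPolynomial (Fin 3) k) = 0 := pderiv_X_of_ne (by decide)
  simp only [partials, quartic, Derivation.leibniz, map_add, pderiv_X_self, h1, h2, smul_eq_mul]
  linear_combination (X 0 * X 1 * X 2) * two_eq_zero_poly k (σ := Fin 3)

omit [CharP k 2] in
theorem X_add_X_ne_zero {i j : Fin 3} (hij : i ≠ j) : (X i + X j : MvPolynomial (Fin 3) k) ≠ 0 := by
  intro h
  have := congrArg (coeff (Finsupp.single i 1)) h
  simp [coeff_X, Finsupp.single_left_inj, hij.symm] at this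

theorem partials_ne_zero (i : Fin 3) : partials k i ≠ 0 := by
  fin_cases i
  · exact (partials_zero k).trans_ne
      (mul_ne_zero (mul_ne_zero (X_ne_zero _) (X_ne_zero _)) (X_add_X_ne_zero k (by decide)))
  · exact (partials_one k).trans_ne
      (mul_ne_zero (mul_ne_zero (X_ne_zero _) (X_ne_zero _)) (X_add_X_ne_zero k (by decide)))
  · exact (partials_two k).trans_ne
      (mul_ne_zero (mul_ne_zero (X_ne_zero _) (X_ne_zero _)) (X_add_X_ne_zero k (by decide)))

theorem partials_isHomogeneous (i : Fin 3) : (partials k i).IsHomogeneous 3 := by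
  have h (i : Fin 3) := isHomogeneous_X k i
  fin_cases i
  · exact (partials_zero k) ▸ ((h 1).mul (h 2)).mul ((h 1).add (h 2))
  · exact (partials_one k) ▸ ((h 0).mul (h 2)).mul ((h 0).add (h 2))
  · exact (partials_two k) ▸ ((h 0).mul (h 1)).mul ((h 0).add (h 1))

/-- The square of an element of the coordinate ring lies in the coordinate ring of the plane. -/
theorem sq_eq_incl (a b : MvPolynomial (Fin 3) k) :
    (incl k a + incl k b * coord k 3) ^ 2 = incl k (a ^ 2 + b ^ 2 * quartic k) := by
  simp only [map_add, map_mul, map_pow, ← coord_three_sq]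
  linear_combination (incl k a * incl k b * coord k 3) * two_eq_zero_coordRing k

/-- The quartic is not a square in the function field of the plane. Squares have zero derivative in
characteristic two, so applying ∂₀ leaves b²F₀ = 0 with F₀ ≠ 0. -/
theorem eq_zero_of_sq_add_sq_mul_quartic {a b : MvPolynomial (Fin 3) k}
    (h : a ^ 2 + b ^ 2 * quartic k = 0) : a = 0 ∧ b = 0 := by
  have h2 := two_eq_zero_poly k (σ := Fin 3)
  have hd := congrArg (pderiv (0 : Fin 3)) h
  rw [map_add, Derivation.leibniz, Derivation.leibniz_pow, Derivation.leibniz_pow, map_zero] at hd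
  change _ + (b ^ 2 • partials k 0 + _) = 0 at hd
  simp only [nsmul_eq_mul, smul_eq_mul, Nat.cast_ofNat, h2, zero_mul, mul_zero, add_zero,
    zero_add] at hd
  have hb : b = 0 := by
    rcases mul_eq_zero.mp hd with h | h
    · exact pow_eq_zero_iff two_ne_zero |>.mp h
    · exact absurd h (partials_ne_zero k 0)
  subst hb
  exact ⟨pow_eq_zero_iff two_ne_zero |>.mp (by simpa using h), rfl⟩

instance : Nontrivial (CoordRing k) := ⟨incl k 0, incl k 1, (incl_injective k).ne zero_ne_one⟩

/-- Squaring carries the coordinate ring into the polynomial ring of the plane, which is a domain,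
and sends no nonzero element to zero. -/
instance : IsDomain (CoordRing k) := by
  have : NoZeroDivisors (CoordRing k) := ⟨by
    intro c c' h
    obtain ⟨a, b, rfl⟩ := exists_normalForm k c
    obtain ⟨a', b', rfl⟩ := exists_normalForm k c'
    have h' := congrArg (· ^ 2) h
    simp only [mul_pow, sq_eq_incl] at h'
    rw [← map_mul, zero_pow two_ne_zero] at h'
    have := (map_eq_zero_iff _ (incl_injective k)).mp h'
    rcases mul_eq_zero.mp this with h | h
    · obtain ⟨rfl, rfl⟩ := eq_zero_of_sq_add_sq_mul_quartic k h
      left; simp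
    · obtain ⟨rfl, rfl⟩ := eq_zero_of_sq_add_sq_mul_quartic k h
      right; simp⟩
  exact NoZeroDivisors.to_isDomain _

-- A derivation that kills the generator of a principal ideal preserves the ideal, and so descends
-- to the quotient.
omit [CharP k 2] in
theorem toCoordRing_derivation_eq_zero {d : Derivation k (MvPolynomial (Fin 4) k)
    (MvPolynomial (Fin 4) k)} (hd : d (equation k) = 0) (x : MvPolynomial (Fin 4) k)
    (hx : toCoordRing k x = 0) : toCoordRing k (d x) = 0 := by
  obtain ⟨y, rfl⟩ := Ideal.mem_span_singleton.mp (Ideal.Quotient.eq_zero_iff_mem.mp hx)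
  have h0 : toCoordRing k (equation k) = 0 :=
    Ideal.Quotient.eq_zero_iff_mem.mpr (Ideal.mem_span_singleton_self _)
  rw [Derivation.leibniz, map_add, smul_eq_mul, smul_eq_mul, map_mul, map_mul, h0, zero_mul, hd,
    map_zero, mul_zero, add_zero]

/-- The derivative of x₃² is zero, so `v 3` is unrestricted and the only condition is ∑ vᵢFᵢ = 0. -/
theorem mkDerivation_equation_eq_zero (v : Fin 4 → MvPolynomial (Fin 4) k)
    (hv : v 0 * (X 1 * X 2 * (X 1 + X 2)) + v 1 * (X 0 * X 2 * (X 0 + X 2)) +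
      v 2 * (X 0 * X 1 * (X 0 + X 1)) = 0) : mkDerivation k v (equation k) = 0 := by
  simp only [equation, map_sub, Derivation.leibniz, Derivation.leibniz_pow, map_add,
    mkDerivation_X, smul_eq_mul, nsmul_eq_mul]
  linear_combination (-1) * hv + (X 3 * v 3 - X 0 * X 1 * X 2 * (v 0 + v 1 + v 2)) *
    two_eq_zero_poly k (σ := Fin 4)

/-- The derivation `∑ xᵢ² ∂ᵢ` of degree one. -/
def derV : Derivation k (CoordRing k) (CoordRing k) :=
  Derivation.liftOfSurjective (f := toCoordRing k) (Ideal.Quotient.mkₐ_surjective k _)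
    (d := mkDerivation k ![X 0 ^ 2, X 1 ^ 2, X 2 ^ 2, 0])
    (toCoordRing_derivation_eq_zero k (mkDerivation_equation_eq_zero k _ (by
      simp only [Matrix.cons_val]
      -- ∑ xᵢ²Fᵢ = 2x₀x₁x₂(x₀x₁ + x₀x₂ + x₁x₂).
      linear_combination (X 0 * X 1 * X 2 * (X 0 * X 1 + X 0 * X 2 + X 1 * X 2)) *
        two_eq_zero_poly k (σ := Fin 4))))

theorem derV_coord (i : Fin 4) :
    derV k (coord k i) = toCoordRing k (![X 0 ^ 2, X 1 ^ 2, X 2 ^ 2, 0] i) := by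
  rw [derV, Derivation.liftOfSurjective_apply, mkDerivation_X]

/-- The derivation `∂ / ∂ x₃` of degree minus two. -/
def derW : Derivation k (CoordRing k) (CoordRing k) :=
  Derivation.liftOfSurjective (f := toCoordRing k) (Ideal.Quotient.mkₐ_surjective k _)
    (d := mkDerivation k ![0, 0, 0, 1])
    (toCoordRing_derivation_eq_zero k (mkDerivation_equation_eq_zero k _ (by simp)))

theorem derW_coord (i : Fin 4) :
    derW k (coord k i) = toCoordRing k (![0, 0, 0, 1] i) := by
  rw [derW, Derivation.liftOfSurjective_apply, mkDerivation_X]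

end Algebra

/-! ### Morphisms of sheaves of modules on a basis, and a criterion for inverse images -/

section Basis

variable {X Y : Scheme.{u}}

/-- The sheaf of abelian groups underlying a sheaf of modules. -/
abbrev abSheaf (N : X.Modules) : TopCat.Sheaf Ab.{u} X := ⟨N.presheaf, N.isSheaf⟩

theorem section_ext_of_basis (N : X.Modules) {ι : Type u} {B : ι → X.Opens}
    (hB : Opens.IsBasis (Set.range B)) {U : X.Opens} {s t : Γ(N, U)}
    (h : ∀ i (hi : B i ≤ U), N.presheaf.map (homOfLE hi).op s = N.presheaf.map (homOfLE hi).op t) :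
    s = t := by
  refine (abSheaf N).eq_of_locally_eq' (ι := {i // B i ≤ U}) (fun i => B i.1) U
    (fun i => homOfLE i.2) ?_ s t (fun i => h i.1 i.2)
  intro x hx
  obtain ⟨_, ⟨i, rfl⟩, hxi, hi⟩ := Opens.isBasis_iff_nbhd.mp hB hx
  exact Opens.mem_iSup.mpr ⟨⟨i, hi⟩, hxi⟩

theorem map_map_homOfLE (N : X.Modules) {U V W : X.Opens} (h : V ≤ U) (h' : W ≤ V) (n : Γ(N, U)) :
    N.presheaf.map (homOfLE h').op (N.presheaf.map (homOfLE h).op n) =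
      N.presheaf.map (homOfLE (h'.trans h)).op n := by
  rw [← ConcreteCategory.comp_apply, ← Functor.map_comp]
  rfl

/-- A compatible family of linear maps on a basis of open sets extends to a morphism from a presheaf
of modules to a sheaf of modules. -/
theorem exists_presheaf_hom_of_basis (P : X.PresheafOfModules) (N : X.Modules) {ι : Type u}
    {B : ι → X.Opens} (hB : Opens.IsBasis (Set.range B))
    (χ : ∀ i, P.obj (op (B i)) →+ Γ(N, B i))
    (hsmul : ∀ i (r : X.ringCatSheaf.obj.obj (op (B i))) (m : P.obj (op (B i))),
      χ i (r • m) = (show Γ(X, B i) from r) • χ i m)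
    (hχ : ∀ i j (h : B j ≤ B i) (m : P.obj (op (B i))),
      χ j (P.presheaf.map (homOfLE h).op m) = N.presheaf.map (homOfLE h).op (χ i m)) :
    ∃ τ : P ⟶ N.val, ∀ i m, τ.app (op (B i)) m = χ i m := by
  let α : (inducedFunctor B).op ⋙ P.presheaf ⟶ (inducedFunctor B).op ⋙ N.presheaf :=
    { app := fun i => AddCommGrpCat.ofHom (χ i.unop)
      naturality := fun i j f => by
        ext m
        exact hχ i.unop j.unop f.unop.hom.le m }
  let β := TopCat.Sheaf.restrictHomEquivHom P.presheaf (abSheaf N) hB α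
  have hβ (i m) : β.app (op (B i)) m = χ i m :=
    congr($(TopCat.Sheaf.extend_hom_app P.presheaf (abSheaf N) hB α i) m)
  refine ⟨PresheafOfModules.homMk β fun U r m => ?_, hβ⟩
  refine section_ext_of_basis N hB (U := U.unop) fun i hi => ?_
  have hn (m : P.obj U) : N.presheaf.map (homOfLE hi).op (β.app U m) =
      χ i (P.presheaf.map (homOfLE hi).op m) :=
    (congr($(β.naturality (homOfLE hi).op) m)).symm.trans (hβ _ _)
  have h1 : P.presheaf.map (homOfLE hi).op (r • m) =
      X.ringCatSheaf.obj.map (homOfLE hi).op r •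
        (show P.obj (op (B i)) from P.presheaf.map (homOfLE hi).op m) :=
    P.map_smul (homOfLE hi).op r m
  refine (hn _).trans ((congrArg _ h1).trans ((hsmul i _ _).trans ?_))
  exact (congrArg _ (hn m).symm).trans (N.val.map_smul (homOfLE hi).op r (β.app U m)).symm

/-- A morphism of modules over a ring homomorphism through which every semilinear map to a module
over the target factors uniquely. -/
structure IsUniversalSemilinear {R S : Type u} [CommRing R] [CommRing S] (ρ : R →+* S)
    {M N : Type u} [AddCommGroup M] [Module R M] [AddCommGroup N] [Module S N] (φ : M → N) :
    Prop where
  span : Submodule.span S (Set.range φ) = ⊤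
  exists_lift (P : Type u) [AddCommGroup P] [Module S P] (ξ : M →+ P)
    (hξ : ∀ r m, ξ (r • m) = ρ r • ξ m) : ∃ χ : N →ₗ[S] P, ∀ m, χ (φ m) = ξ m

/-- Here N = φ(M) ⊕ w φ(M), so a semilinear ξ must extend as φ(m) + wφ(m') ↦ ξ(m) + wξ(m'). This
extension is linear over all of S because w² comes from R. -/
theorem IsUniversalSemilinear.of_basis_one_sqrt {R S : Type u} [CommRing R] [CommRing S]
    {ρ : R →+* S} {M N : Type u} [AddCommGroup M] [Module R M] [AddCommGroup N] [Module S N]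
    {φ : M →+ N} (hφ : ∀ r m, φ (r • m) = ρ r • φ m) (w : S) (q : R) (hw : w ^ 2 = ρ q)
    (hS : ∀ b, ∃ r r', b = ρ r + ρ r' * w) (hN : ∀ n, ∃ m m', n = φ m + w • φ m')
    (h0 : ∀ m m', φ m + w • φ m' = 0 → m = 0 ∧ m' = 0) : IsUniversalSemilinear ρ φ where
  span := by
    refine top_le_iff.mp fun n _ => ?_
    obtain ⟨m, m', rfl⟩ := hN n
    exact add_mem (Submodule.subset_span ⟨m, rfl⟩)
      (Submodule.smul_mem _ _ (Submodule.subset_span ⟨m', rfl⟩))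
  exists_lift P _ _ ξ hξ := by
    choose a b hab using hN
    have inj (m m' l l') (h : φ m + w • φ m' = φ l + w • φ l') : m = l ∧ m' = l' := by
      have := h0 (m - l) (m' - l') (by
        rw [map_sub, map_sub, smul_sub]; rw [← sub_eq_zero] at h; rw [← h]; abel)
      simpa only [sub_eq_zero] using this
    have key (m m') : a (φ m + w • φ m') = m ∧ b (φ m + w • φ m') = m' :=
      inj _ _ _ _ (hab _).symm
    refine ⟨{ toFun := fun n => ξ (a n) + w • ξ (b n), map_add' := ?_, map_smul' := ?_ }, ?_⟩
    · intro n n'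
      have h : n + n' = φ (a n + a n') + w • φ (b n + b n') := by
        conv_lhs => rw [hab n, hab n']
        rw [map_add, map_add, smul_add]; abel
      obtain ⟨h1, h2⟩ := key (a n + a n') (b n + b n')
      rw [h, h1, h2, map_add, map_add, smul_add]; abel
    · intro s n
      obtain ⟨r, r', rfl⟩ := hS s
      have h : (ρ r + ρ r' * w) • n = φ (r • a n + (r' * q) • b n) + w • φ (r • b n + r' • a n) := by
        conv_lhs => rw [hab n]
        simp only [map_add, hφ, smul_add, add_smul, map_mul, ← hw, smul_smul]
        rw [show ρ r' * w ^ 2 = ρ r' * w * w by ring, mul_comm w (ρ r), mul_comm w (ρ r'),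
          add_mul, add_smul]
        abel
      obtain ⟨h1, h2⟩ := key (r • a n + (r' * q) • b n) (r • b n + r' • a n)
      rw [h, h1, h2, RingHom.id_apply]
      simp only [map_add, hξ, smul_add, add_smul, map_mul, ← hw, smul_smul]
      rw [show ρ r' * w ^ 2 = ρ r' * w * w by ring, mul_comm w (ρ r), mul_comm w (ρ r'),
        add_mul, add_smul]
      abel
    · intro m
      obtain ⟨h1, h2⟩ := key m 0
      rw [map_zero, smul_zero, add_zero] at h1 h2
      change ξ (a (φ m)) + w • ξ (b (φ m)) = ξ m
      rw [h1, h2, map_zero, smul_zero, add_zero]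

/-- A morphism `M ⟶ ψ_* N` that is a base change on suitable open sets induces an isomorphism
from the inverse image of `M` to `N`. -/
theorem isIso_homEquiv_symm_of_basis (ψ : Y ⟶ X) {M : X.Modules} {N : Y.Modules}
    (φ : M ⟶ (Scheme.Modules.pushforward ψ).obj N) {ι : Type u} (B : ι → X.Opens)
    (hB : Opens.IsBasis (Set.range fun i => ψ ⁻¹ᵁ B i)) (hinf : ∀ i j, ∃ l, B l = B i ⊓ B j)
    (hnhds : ∀ (U : X.Opens) (y : Y), ψ y ∈ U → ∃ i, ψ y ∈ B i ∧ B i ≤ U)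
    (h : ∀ i, IsUniversalSemilinear (ψ.app (B i)).hom (N := Γ(N, ψ ⁻¹ᵁ B i)) (show Γ(M, B i) → Γ(N, ψ ⁻¹ᵁ B i) from φ.app (B i))) :
    IsIso (((Scheme.Modules.pullbackPushforwardAdjunction ψ).homEquiv M N).symm φ) := by
  set adj := Scheme.Modules.pullbackPushforwardAdjunction ψ
  -- By Yoneda and the adjunction, it suffices that morphisms N ⟶ N' correspond to morphisms M ⟶
  -- ψ_*N' through composition with φ; over each `B i` this is the universal property in `h`.
  rw [isIso_iff_coyoneda_map_bijective]
  intro N'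
  have hcomp (χ : N ⟶ N') : adj.homEquiv M N' ((adj.homEquiv M N).symm φ ≫ χ) =
      φ ≫ (Scheme.Modules.pushforward ψ).map χ := by
    rw [Adjunction.homEquiv_naturality_right, Equiv.apply_symm_apply]
  refine ⟨fun χ χ' hχ => ?_, fun ξ' => ?_⟩
  · replace hχ : φ ≫ (Scheme.Modules.pushforward ψ).map χ =
        φ ≫ (Scheme.Modules.pushforward ψ).map χ' := by
      rw [← hcomp, ← hcomp]; exact congrArg _ hχ
    refine (Scheme.Modules.toPresheaf Y).map_injective
      (TopCat.Sheaf.hom_ext (F := N.presheaf) (F' := abSheaf N') hB fun i => ?_)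
    let a : Γ(N, ψ ⁻¹ᵁ B i) →ₗ[Γ(Y, ψ ⁻¹ᵁ B i)] Γ(N', ψ ⁻¹ᵁ B i) :=
      { toFun := χ.app _, map_add' := map_add _, map_smul' := χ.app_smul }
    let b : Γ(N, ψ ⁻¹ᵁ B i) →ₗ[Γ(Y, ψ ⁻¹ᵁ B i)] Γ(N', ψ ⁻¹ᵁ B i) :=
      { toFun := χ'.app _, map_add' := map_add _, map_smul' := χ'.app_smul }
    have : a = b := by
      refine LinearMap.ext_on (h i).span ?_
      rintro _ ⟨m, rfl⟩
      exact congr($(congrArg (fun f => Scheme.Modules.Hom.app f (B i)) hχ) m)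
    ext n
    exact congr($this n)
  · obtain ⟨ξ, rfl⟩ := (adj.homEquiv M N').symm.surjective ξ'
    choose χ hχ using fun i => (h i).exists_lift Γ(N', ψ ⁻¹ᵁ B i)
      (ξ.app (B i)).hom (fun r m => ξ.app_smul r m)
    have hle (i l) (hil : B l ≤ B i) (n : Γ(N, ψ ⁻¹ᵁ B i)) :
        χ l (N.presheaf.map (homOfLE (ψ.preimage_mono hil)).op n) =
          N'.presheaf.map (homOfLE (ψ.preimage_mono hil)).op (χ i n) := by
      have hn : n ∈ Submodule.span Γ(Y, ψ ⁻¹ᵁ B i) 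
          (Set.range (show Γ(M, B i) → Γ(N, ψ ⁻¹ᵁ B i) from φ.app (B i))) := by
        rw [(h i).span]; trivial
      induction hn using Submodule.span_induction with
      | mem x hx =>
        obtain ⟨m, rfl⟩ := hx
        have h1 : N.presheaf.map (homOfLE (ψ.preimage_mono hil)).op (φ.app (B i) m) =
            φ.app (B l) (M.presheaf.map (homOfLE hil).op m) :=
          congr($(φ.mapPresheaf.naturality (homOfLE hil).op) m).symm
        have h2 : N'.presheaf.map (homOfLE (ψ.preimage_mono hil)).op (ξ.app (B i) m) =
            ξ.app (B l) (M.presheaf.map (homOfLE hil).op m) :=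
          congr($(ξ.mapPresheaf.naturality (homOfLE hil).op) m).symm
        rw [h1, hχ, hχ]
        exact h2.symm
      | zero => simp only [map_zero]
      | add x y _ _ hx hy => simp only [map_add, hx, hy]
      | smul r x _ hx => rw [Scheme.Modules.map_smul, map_smul, hx, map_smul,
          Scheme.Modules.map_smul]
    obtain ⟨τ, hτ⟩ := exists_presheaf_hom_of_basis N.val N' hB
      (fun i => (χ i).toAddMonoidHom) (fun i r m => map_smul (χ i) _ _) (by
      intro i j hij n
      -- An inclusion of preimages need not come from an inclusion of `B j` in `B i`. The
      -- intersection `B l` lies in both and has the same preimage as `B j`.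
      obtain ⟨l, hl⟩ := hinf i j
      have hli : B l ≤ B i := hl.trans_le inf_le_left
      have hlj : B l ≤ B j := hl.trans_le inf_le_right
      have he : ψ ⁻¹ᵁ B l = ψ ⁻¹ᵁ B j := by
        rw [hl]; exact inf_eq_right.mpr hij
      have hinj : Function.Injective (N'.presheaf.map (homOfLE (ψ.preimage_mono hlj)).op) := by
        have : IsIso (homOfLE (ψ.preimage_mono hlj)) := ⟨homOfLE he.ge, rfl, rfl⟩
        exact (ConcreteCategory.bijective_of_isIso _).1
      refine hinj ?_
      change Γ(N, ψ ⁻¹ᵁ B i) at n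
      change N'.presheaf.map (homOfLE (ψ.preimage_mono hlj)).op
          (χ j (N.presheaf.map (homOfLE hij).op n)) =
        N'.presheaf.map (homOfLE (ψ.preimage_mono hlj)).op (N'.presheaf.map (homOfLE hij).op (χ i n))
      rw [← hle j l hlj, map_map_homOfLE, map_map_homOfLE]
      exact hle i l hli n)
    refine ⟨⟨τ⟩, (adj.homEquiv M N').injective ?_⟩
    rw [Equiv.apply_symm_apply]
    refine (hcomp _).trans (Scheme.Modules.hom_ext _ _ fun U => ?_)
    ext m
    change τ.app (op (ψ ⁻¹ᵁ U)) (φ.app U m) = ξ.app U m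
    refine (abSheaf N').eq_of_locally_eq' (ι := {i // B i ≤ U}) (fun i => ψ ⁻¹ᵁ B i.1) (ψ ⁻¹ᵁ U)
      (fun i => homOfLE (ψ.preimage_mono i.2)) (fun y hy => ?_) _ _ (fun i => ?_)
    · obtain ⟨i, hyi, hi⟩ := hnhds U y hy
      exact Opens.mem_iSup.mpr ⟨⟨i, hi⟩, hyi⟩
    · have e1 : N'.presheaf.map (homOfLE (ψ.preimage_mono i.2)).op
          (τ.app (op (ψ ⁻¹ᵁ U)) (φ.app U m)) = τ.app (op (ψ ⁻¹ᵁ B i.1))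
            (N.presheaf.map (homOfLE (ψ.preimage_mono i.2)).op (φ.app U m)) :=
        (PresheafOfModules.naturality_apply τ (homOfLE (ψ.preimage_mono i.2)).op _).symm
      have e2 : N.presheaf.map (homOfLE (ψ.preimage_mono i.2)).op (φ.app U m) =
          φ.app (B i) (M.presheaf.map (homOfLE i.2).op m) :=
        congr($(φ.mapPresheaf.naturality (homOfLE i.2).op) m).symm
      have e3 : N'.presheaf.map (homOfLE (ψ.preimage_mono i.2)).op (ξ.app U m) =
          ξ.app (B i) (M.presheaf.map (homOfLE i.2).op m) :=
        congr($(ξ.mapPresheaf.naturality (homOfLE i.2).op) m).symm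
      refine e1.trans (((congrArg _ e2).trans ?_).trans e3.symm)
      exact (hτ i _).trans (hχ i _)

end Basis

/-! ### Sections of twisting sheaves as homogeneous fractions -/

section TwistSections

variable {k A : Type u} [CommRing k] [CommRing A] [Algebra k A]
  {𝒜 : ℕ → Submodule k A} [GradedAlgebra 𝒜] {J : Ideal A} {n : ℤ}

section General

theorem algebraMap_isUnit {x : ProjectiveSpectrum 𝒜} {b : A} (hb : b ∉ x.asHomogeneousIdeal) :
    IsUnit (algebraMap A (LocAt 𝒜 x) b) :=
  IsLocalization.map_units (LocAt 𝒜 x) (⟨b, hb⟩ : x.asHomogeneousIdeal.toIdeal.primeCompl)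

theorem eq_of_algebraMap_mul_eq {x : ProjectiveSpectrum 𝒜} {b : A}
    (hb : b ∉ x.asHomogeneousIdeal) {s t : LocAt 𝒜 x}
    (h : algebraMap A _ b * s = algebraMap A _ b * t) : s = t :=
  (algebraMap_isUnit hb).mul_left_cancel h

/-- The sections given by a fraction. -/
def fracSection (J : Ideal A) (n : ℤ) (U : (Opens (ProjectiveSpectrum.top 𝒜))ᵒᵖ) {i j : ℕ} {a b : A}
    (h : (i : ℤ) = j + n) (ha : a ∈ 𝒜 i) (hb : b ∈ 𝒜 j) (haJ : a ∈ J)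
    (hU : ∀ x : U.unop, b ∉ x.1.asHomogeneousIdeal) : twistSections 𝒜 J n U :=
  ⟨fun x => Localization.mk a ⟨b, hU x⟩, fun x => ⟨U.unop, x.2, 𝟙 _, i, j, a, b, h, ha, hb, haJ,
    fun y => ⟨hU y, by
      change algebraMap A _ b * Localization.mk a ⟨b, hU y⟩ = _
      rw [Localization.mk_eq_mk']
      exact IsLocalization.mk'_spec' _ _ ⟨b, hU y⟩⟩⟩⟩

theorem algebraMap_mul_fracSection {U : (Opens (ProjectiveSpectrum.top 𝒜))ᵒᵖ} {i j : ℕ} {a b : A}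
    (h : (i : ℤ) = j + n) (ha : a ∈ 𝒜 i) (hb : b ∈ 𝒜 j) (haJ : a ∈ J)
    (hU : ∀ x : U.unop, b ∉ x.1.asHomogeneousIdeal) (x : U.unop) :
    algebraMap A _ b * (fracSection J n U h ha hb haJ hU).1 x = algebraMap A _ a := by
  change algebraMap A _ b * Localization.mk a ⟨b, hU x⟩ = _
  rw [Localization.mk_eq_mk']
  exact IsLocalization.mk'_spec' _ _ ⟨b, hU x⟩

/-- The value of a regular function in the localization at a point. -/
abbrev regVal {U : (Opens (ProjectiveSpectrum.top 𝒜))ᵒᵖ}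
    (r : (ProjectiveSpectrum.Proj.structureSheaf 𝒜).1.obj U) (x : U.unop) : LocAt 𝒜 x.1 :=
  (r.1 x).val

theorem regVal_mem_twistSections {U : (Opens (ProjectiveSpectrum.top 𝒜))ᵒᵖ}
    (r : (ProjectiveSpectrum.Proj.structureSheaf 𝒜).1.obj U) :
    (fun x => regVal r x) ∈ twistSections 𝒜 ⊤ 0 U := by
  intro x
  obtain ⟨V, hV, iV, d, a, b, hb, hr⟩ := r.2 x
  refine ⟨V, hV, iV, d, d, a, b, by simp, a.2, b.2, trivial, fun y => ⟨hb y, ?_⟩⟩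
  change algebraMap A (LocAt 𝒜 y.1) b * (r.1 (iV y)).val = _
  rw [show r.1 (iV y) = _ from hr y, HomogeneousLocalization.val_mk, Localization.mk_eq_mk']
  exact IsLocalization.mk'_spec' _ _ ⟨b.1, hb y⟩

theorem reg_ext {U : (Opens (ProjectiveSpectrum.top 𝒜))ᵒᵖ}
    {r r' : (ProjectiveSpectrum.Proj.structureSheaf 𝒜).1.obj U}
    (h : ∀ x, regVal r x = regVal r' x) : r = r' :=
  Subtype.ext <| funext fun x => HomogeneousLocalization.val_injective _ (h x)

/-- The regular function given by a section of `𝒪(0)`. -/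
theorem exists_regVal_eq {U : (Opens (ProjectiveSpectrum.top 𝒜))ᵒᵖ} (s : twistSections 𝒜 J 0 U) :
    ∃ r : (ProjectiveSpectrum.Proj.structureSheaf 𝒜).1.obj U, ∀ x, regVal r x = s.1 x := by
  have h1 (x : ProjectiveSpectrum 𝒜) (hx : x ∈ U.unop) :
      ∃ z : HomogeneousLocalization.AtPrime 𝒜 x.asHomogeneousIdeal.toIdeal,
        z.val = s.1 ⟨x, hx⟩ := by
    obtain ⟨V, hV, iV, i, j, a, b, h, ha, hb, -, hs⟩ := s.2 ⟨x, hx⟩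
    obtain rfl : i = j := by simpa using h
    have hy := hs ⟨x, hV⟩
    refine ⟨.mk ⟨i, ⟨a, ha⟩, ⟨b, hb⟩, hy.1⟩, eq_of_algebraMap_mul_eq hy.1 (Eq.trans ?_ hy.2.symm)⟩
    rw [HomogeneousLocalization.val_mk, Localization.mk_eq_mk']
    exact IsLocalization.mk'_spec' _ _ ⟨b, hy.1⟩
  choose z hz using h1
  refine ⟨⟨fun x => z x.1 x.2, fun x => ?_⟩, fun x => hz x.1 x.2⟩
  obtain ⟨V, hV, iV, i, j, a, b, h, ha, hb, -, hs⟩ := s.2 x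
  obtain rfl : i = j := by simpa using h
  refine ⟨V, hV, iV, i, ⟨a, ha⟩, ⟨b, hb⟩, fun y => (hs y).1, fun y => ?_⟩
  refine HomogeneousLocalization.val_injective _ ((hz _ _).trans ?_)
  refine eq_of_algebraMap_mul_eq (hs y).1 ((hs y).2.trans (Eq.symm ?_))
  rw [HomogeneousLocalization.val_mk, Localization.mk_eq_mk']
  exact IsLocalization.mk'_spec' _ _ ⟨b, (hs y).1⟩

end General

variable [IsDomain A]

theorem algebraMap_locAt_injective (x : ProjectiveSpectrum 𝒜) :
    Function.Injective (algebraMap A (LocAt 𝒜 x)) :=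
  IsLocalization.injective _ x.asHomogeneousIdeal.toIdeal.primeCompl_le_nonZeroDivisors

theorem algebraMap_locAt_ne_zero (x : ProjectiveSpectrum 𝒜) {b : A} (hb : b ≠ 0) :
    algebraMap A (LocAt 𝒜 x) b ≠ 0 :=
  (map_ne_zero_iff _ (algebraMap_locAt_injective x)).mpr hb

omit [IsDomain A] in
theorem ne_zero_of_notMem {x : ProjectiveSpectrum 𝒜} {b : A} (hb : b ∉ x.asHomogeneousIdeal) :
    b ≠ 0 := by
  rintro rfl
  exact hb (zero_mem _)

/-- The generic point of `Proj A` for a graded domain `A`. -/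
def genericPt (x : ProjectiveSpectrum 𝒜) : ProjectiveSpectrum 𝒜 where
  asHomogeneousIdeal := ⊥
  isPrime := by
    rw [HomogeneousIdeal.toIdeal_bot]
    exact Ideal.isPrime_bot
  not_irrelevant_le h := x.not_irrelevant_le (h.trans bot_le)

theorem genericPt_mem {x : ProjectiveSpectrum 𝒜} {U : Opens (ProjectiveSpectrum.top 𝒜)}
    (hx : x ∈ U) : genericPt x ∈ U := by
  have h : genericPt x ≤ x := by
    rw [← ProjectiveSpectrum.as_ideal_le_as_ideal]
    exact bot_le
  rw [ProjectiveSpectrum.le_iff_mem_closure] at h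
  obtain ⟨y, hy, hy'⟩ := mem_closure_iff.mp h U.1 U.2 hx
  rwa [Set.mem_singleton_iff.mp hy'] at hy

/-- A fraction representing a section near one point represents it everywhere. -/
theorem algebraMap_mul_eq_of_mem {U : (Opens (ProjectiveSpectrum.top 𝒜))ᵒᵖ}
    (s : twistSections 𝒜 J n U) {a b : A} {x : U.unop}
    (h : algebraMap A _ b * s.1 x = algebraMap A _ a) (y : U.unop) :
    algebraMap A _ b * s.1 y = algebraMap A _ a := by
  have aux (z z' : U.unop) (hz : ∃ W : Opens (ProjectiveSpectrum.top 𝒜), z.1 ∈ W ∧ z'.1 ∈ W ∧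
      ∃ (iW : W ⟶ U.unop) (a' b' : A), ∀ w : W, b' ∉ w.1.asHomogeneousIdeal ∧
        algebraMap A _ b' * s.1 (iW w) = algebraMap A _ a')
      (h : algebraMap A _ b * s.1 z = algebraMap A _ a) :
      algebraMap A _ b * s.1 z' = algebraMap A _ a := by
    obtain ⟨W, hzW, hzW', iW, a', b', hs⟩ := hz
    have h1 : algebraMap A (LocAt 𝒜 z.1) b' * s.1 z = algebraMap A _ a' := (hs ⟨z, hzW⟩).2
    have h2 : algebraMap A (LocAt 𝒜 z'.1) b' * s.1 z' = algebraMap A _ a' := (hs ⟨z', hzW'⟩).2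
    have hab : b' * a = b * a' := by
      refine algebraMap_locAt_injective z.1 ?_
      rw [map_mul, map_mul, ← h, ← h1]
      ring
    refine eq_of_algebraMap_mul_eq (hs ⟨z', hzW'⟩).1 ?_
    have h3 := congrArg (algebraMap A (LocAt 𝒜 z'.1)) hab
    rw [map_mul, map_mul, ← h2] at h3
    exact Eq.trans (by ring) h3.symm
  obtain ⟨V, hV, iV, -, -, a', b', -, -, -, -, hs⟩ := s.2 x
  obtain ⟨W, hW, iW, -, -, a'', b'', -, -, -, -, ht⟩ := s.2 y
  -- The identity travels from x to the generic point and from there to y: each of the two local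
  -- fractions is valid at the generic point.
  have h1 := aux x ⟨genericPt x.1, genericPt_mem x.2⟩
    ⟨V, hV, genericPt_mem hV, iV, a', b', hs⟩ h
  exact aux ⟨genericPt y.1, genericPt_mem y.2⟩ y
    ⟨W, genericPt_mem hW, hW, iW, a'', b'', ht⟩ h1

/-- A fraction representing s near x also represents t at x, hence represents both everywhere. -/
theorem twistSections_ext {U : (Opens (ProjectiveSpectrum.top 𝒜))ᵒᵖ}
    {s t : twistSections 𝒜 J n U} {x : U.unop} (h : s.1 x = t.1 x) : s = t := by
  refine Subtype.ext (funext fun y => ?_)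
  obtain ⟨V, hV, iV, -, -, a, b, -, -, -, -, hs⟩ := s.2 x
  have hb := ne_zero_of_notMem (hs ⟨x, hV⟩).1
  have h1 := algebraMap_mul_eq_of_mem s (hs ⟨x, hV⟩).2 y
  have h3 : algebraMap A (LocAt 𝒜 x.1) b * t.1 x = algebraMap A _ a := by
    rw [← h]; exact (hs ⟨x, hV⟩).2
  have h2 := algebraMap_mul_eq_of_mem t h3 y
  exact mul_left_cancel₀ (algebraMap_locAt_ne_zero y.1 hb) (h1.trans h2.symm)

/-- In a graded domain, a nonzero component of a in degree l gives a nonzero component of ba in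
degree i + l, so only one l can occur. -/
theorem mem_graded_of_mul_mem {i m : ℕ} {a b : A} (hb : b ∈ 𝒜 i) (hb0 : b ≠ 0)
    (h : b * a ∈ 𝒜 m) : a = 0 ∨ ∃ l, m = i + l ∧ a ∈ 𝒜 l := by
  classical
  by_cases ha : a = 0
  · exact .inl ha
  right
  have key (l : ℕ) (hl : (DirectSum.decompose 𝒜 a l : A) ≠ 0) : m = i + l := by
    by_contra hne
    have h1 := DirectSum.coe_decompose_mul_of_left_mem_of_le 𝒜 (n := i + l) (b := a) hb (by omega)
    rw [DirectSum.decompose_of_mem_ne 𝒜 h hne, Nat.add_sub_cancel_left] at h1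
    exact mul_ne_zero hb0 hl h1.symm
  have hne : ∃ l, (DirectSum.decompose 𝒜 a l : A) ≠ 0 := by
    by_contra! h0
    refine ha ((DirectSum.decompose 𝒜).injective ?_)
    rw [DirectSum.decompose_zero]
    exact DFinsupp.ext fun l => Subtype.ext (h0 l)
  obtain ⟨l, hl⟩ := hne
  refine ⟨l, key l hl, ?_⟩
  have : a = DirectSum.decompose 𝒜 a l := by
    conv_lhs => rw [← DirectSum.sum_support_decompose 𝒜 a]
    refine Finset.sum_eq_single l (fun l' _ hl' => ?_) (fun h => ?_)
    · by_contra h0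
      have := key l' h0
      have := key l hl
      omega
    · simpa using h
  rw [this]
  exact SetLike.coe_mem _

/-- The sections of `J(n)~` over `D₊(h)` are the fractions `a / hᴺ`. -/
theorem exists_fraction_basicOpen {d : ℕ} {h : A} (hd : 0 < d) (hh : h ∈ 𝒜 d)
    (s : twistSections 𝒜 J n (op (ProjectiveSpectrum.basicOpen 𝒜 h))) :
    ∃ (N i : ℕ) (a : A), (i : ℤ) = (N * d : ℕ) + n ∧ a ∈ 𝒜 i ∧ a ∈ J ∧
      ∀ x, algebraMap A _ (h ^ N) * s.1 x = algebraMap A _ a := by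
  by_cases hne : ∃ x, x ∈ ProjectiveSpectrum.basicOpen 𝒜 h
  swap
  -- If D₊(h) is empty the numerator is 0, and the exponent only has to make the degree nonnegative.
  · refine ⟨n.natAbs, ((n.natAbs * d : ℕ) + n).toNat, 0, ?_, zero_mem _, zero_mem _,
      fun x => absurd ⟨x.1, x.2⟩ hne⟩
    have : n.natAbs ≤ n.natAbs * d := Nat.le_mul_of_pos_right _ hd
    generalize n.natAbs * d = m at this ⊢
    omega
  obtain ⟨x₀, hx₀⟩ := hne
  -- The ideal generated by the homogeneous global denominators of s. A homogeneous prime containing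
  -- it but not h would be a point of D₊(h) at which s has no local fraction; hence a power of h
  -- lies in it.
  let I : Ideal A := Ideal.span {b | SetLike.IsHomogeneousElem 𝒜 b ∧ ∃ a ∈ J,
    ∀ x : ProjectiveSpectrum.basicOpen 𝒜 h, algebraMap A _ b * s.1 x = algebraMap A _ a}
  have hI : I.IsHomogeneous 𝒜 := Ideal.homogeneous_span 𝒜 _ fun b hb => hb.1
  have hrad : h ∈ I.radical := by
    rw [hI.radical_eq, Ideal.mem_sInf]
    rintro P ⟨hP, hIP, hPp⟩
    by_contra hhP
    let p : ProjectiveSpectrum 𝒜 := ⟨⟨P, hP⟩, hPp, fun hle =>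
      hhP (hle (HomogeneousIdeal.mem_irrelevant_of_mem 𝒜 hd hh))⟩
    obtain ⟨V, hV, iV, i, j, a, b, -, -, hb, haJ, hs⟩ := s.2 ⟨p, hhP⟩
    have hp := hs ⟨p, hV⟩
    exact hp.1 (hIP (Ideal.subset_span ⟨⟨j, hb⟩, a, haJ,
      algebraMap_mul_eq_of_mem s (x := ⟨p, hhP⟩) hp.2⟩))
  obtain ⟨N₀, hN₀⟩ := hrad
  have hall (b : A) (hb : b ∈ I) : ∃ a ∈ J,
      ∀ x : ProjectiveSpectrum.basicOpen 𝒜 h, algebraMap A _ b * s.1 x = algebraMap A _ a := by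
    induction hb using Submodule.span_induction with
    | mem b hb => exact hb.2
    | zero => exact ⟨0, zero_mem _, fun x => by simp⟩
    | add b b' _ _ hb hb' =>
      obtain ⟨a, ha, h1⟩ := hb
      obtain ⟨a', ha', h2⟩ := hb'
      exact ⟨a + a', add_mem ha ha', fun x => by simp only [map_add, add_mul, h1, h2]⟩
    | smul c b _ hb =>
      obtain ⟨a, ha, h1⟩ := hb
      exact ⟨c * a, J.mul_mem_left _ ha, fun x => by
        simp only [smul_eq_mul, map_mul, mul_assoc, h1]⟩
  -- The extra exponent makes N·d + n nonnegative.
  let N := N₀ + n.natAbs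
  obtain ⟨a, haJ, ha⟩ := hall (h ^ N) (by
    rw [pow_add]; exact I.mul_mem_right _ hN₀)
  obtain ⟨V, hV, iV, i, j, a₀, b₀, hij, ha₀, hb₀, -, hs⟩ := s.2 ⟨x₀, hx₀⟩
  have h0 := hs ⟨x₀, hV⟩
  -- The numerator a is so far just an element of J; comparison with a local fraction a₀/b₀ shows
  -- that it is homogeneous of the right degree.
  have hmul : b₀ * a = h ^ N * a₀ := by
    refine algebraMap_locAt_injective x₀ ?_
    obtain ⟨z, h1, h2⟩ : ∃ z : LocAt 𝒜 x₀, algebraMap A _ b₀ * z = algebraMap A _ a₀ ∧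
      algebraMap A _ (h ^ N) * z = algebraMap A _ a := ⟨s.1 ⟨x₀, hx₀⟩, h0.2, ha ⟨x₀, hx₀⟩⟩
    rw [map_mul, map_mul, ← h1, ← h2]
    ring
  have hdeg := mem_graded_of_mul_mem hb₀ (ne_zero_of_notMem h0.1)
    (hmul ▸ SetLike.mul_mem_graded (SetLike.pow_mem_graded N hh) ha₀)
  have hpos : (n.natAbs : ℤ) ≤ N * d := by
    have : n.natAbs ≤ N * d := (Nat.le_add_left _ _).trans (Nat.le_mul_of_pos_right _ hd)
    exact_mod_cast this
  refine ⟨N, (N * d + n).toNat, a, by push_cast; omega, ?_, haJ, ha⟩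
  rcases hdeg with rfl | ⟨l, hl, hal⟩
  · exact zero_mem _
  · have : (N * d + n : ℤ).toNat = l := by
      have : (N * d + i : ℤ) = j + l := by exact_mod_cast hl
      omega
    rwa [this]

end TwistSections

/-! ### Derivations from the structure sheaf to a twist, induced by a graded derivation -/

section TwistDerivation

variable {k A : Type u} [Field k] [CommRing A] [Algebra k A] [IsDomain A]
  {𝒜 : ℕ → Submodule k A} [GradedAlgebra 𝒜] {J : Ideal A} {e : ℤ}

omit [IsDomain A] in
theorem exists_algebraMap_mul_eq {x : ProjectiveSpectrum 𝒜} (z : LocAt 𝒜 x) :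
    ∃ p : A × A, p.2 ∉ x.asHomogeneousIdeal ∧ algebraMap A _ p.2 * z = algebraMap A _ p.1 := by
  obtain ⟨⟨a, b⟩, h⟩ := IsLocalization.surj x.asHomogeneousIdeal.toIdeal.primeCompl z
  exact ⟨(a, b.1), b.2, by rw [mul_comm]; exact h⟩

/-- The extension of a derivation to the localization at a point. -/
def locDer (δ : Derivation k A A) (x : ProjectiveSpectrum 𝒜) (z : LocAt 𝒜 x) : LocAt 𝒜 x :=
  letI p := (exists_algebraMap_mul_eq z).choose
  Localization.mk (p.2 * δ p.1 - p.1 * δ p.2)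
    (⟨p.2 ^ 2, fun h => (exists_algebraMap_mul_eq z).choose_spec.1 (x.isPrime.mem_of_pow_mem 2 h)⟩ :
      x.asHomogeneousIdeal.toIdeal.primeCompl)

/-- The quotient rule does not depend on the chosen fraction: for a second fraction a'/b',
differentiate ba' = b'a. -/
theorem sq_mul_locDer (δ : Derivation k A A) {x : ProjectiveSpectrum 𝒜} {z : LocAt 𝒜 x} {a b : A}
    (h : algebraMap A _ b * z = algebraMap A _ a) :
    algebraMap A _ (b ^ 2) * locDer δ x z = algebraMap A _ (b * δ a - a * δ b) := by
  obtain ⟨h1, h2⟩ := (exists_algebraMap_mul_eq z).choose_spec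
  rw [locDer]
  set a' := (exists_algebraMap_mul_eq z).choose.1
  set b' := (exists_algebraMap_mul_eq z).choose.2
  have hab : b * a' = b' * a := by
    refine algebraMap_locAt_injective x ?_
    rw [map_mul, map_mul, ← h, ← h2]; ring
  have hd := congrArg δ hab
  rw [Derivation.leibniz, Derivation.leibniz] at hd
  simp only [smul_eq_mul] at hd
  have h3 : b' ^ 2 ∉ x.asHomogeneousIdeal := fun h => h1 (x.isPrime.mem_of_pow_mem 2 h)
  refine eq_of_algebraMap_mul_eq h3 ?_
  rw [mul_left_comm, Localization.mk_eq_mk']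
  rw [show algebraMap A (LocAt 𝒜 x) (b' ^ 2) * _ = _ from
    IsLocalization.mk'_spec' _ _ (⟨b' ^ 2, h3⟩ : x.asHomogeneousIdeal.toIdeal.primeCompl)]
  rw [← map_mul, ← map_mul]
  congr 1
  linear_combination (b * b') * hd - (b' * δ b + b * δ b') * hab

theorem locDer_add (δ : Derivation k A A) {x : ProjectiveSpectrum 𝒜} (z z' : LocAt 𝒜 x) :
    locDer δ x (z + z') = locDer δ x z + locDer δ x z' := by
  obtain ⟨⟨a, b⟩, hb, h⟩ := exists_algebraMap_mul_eq z
  obtain ⟨⟨a', b'⟩, hb', h'⟩ := exists_algebraMap_mul_eq z'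
  have h1 := sq_mul_locDer δ (add_aux 𝒜 x h h')
  have h2 := sq_mul_locDer δ h
  have h3 := sq_mul_locDer δ h'
  have hbb := mul_notMem 𝒜 x hb hb'
  refine eq_of_algebraMap_mul_eq (b := (b * b') ^ 2) (fun h => hbb (x.isPrime.mem_of_pow_mem 2 h)) ?_
  rw [h1]
  simp only [map_pow, map_mul, map_sub, Derivation.leibniz, map_add, smul_eq_mul] at *
  linear_combination -(algebraMap A (LocAt 𝒜 x) b') ^ 2 * h2 - (algebraMap A (LocAt 𝒜 x) b) ^ 2 * h3

theorem locDer_mul (δ : Derivation k A A) {x : ProjectiveSpectrum 𝒜} (z z' : LocAt 𝒜 x) :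
    locDer δ x (z * z') = z * locDer δ x z' + z' * locDer δ x z := by
  obtain ⟨⟨a, b⟩, hb, h⟩ := exists_algebraMap_mul_eq z
  obtain ⟨⟨a', b'⟩, hb', h'⟩ := exists_algebraMap_mul_eq z'
  have h0 : algebraMap A _ (b * b') * (z * z') = algebraMap A (LocAt 𝒜 x) (a * a') := by
    rw [map_mul, map_mul, ← h, ← h']; ring
  have h1 := sq_mul_locDer δ h0
  have h2 := sq_mul_locDer δ h
  have h3 := sq_mul_locDer δ h'
  have hbb := mul_notMem 𝒜 x hb hb'
  refine eq_of_algebraMap_mul_eq (b := (b * b') ^ 2) (fun h => hbb (x.isPrime.mem_of_pow_mem 2 h)) ?_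
  rw [h1]
  simp only [map_pow, map_mul, map_sub, Derivation.leibniz, smul_eq_mul, map_add] at *
  set ρ := algebraMap A (LocAt 𝒜 x)
  linear_combination -(ρ b') ^ 2 * z' * h2 - (ρ b) ^ 2 * z * h3 -
    ρ b * (ρ b' * ρ (δ a') - ρ a' * ρ (δ b')) * h - ρ b' * (ρ b * ρ (δ a) - ρ a * ρ (δ b)) * h'

theorem locDer_algebraMap (δ : Derivation k A A) {x : ProjectiveSpectrum 𝒜} (a : A) :
    locDer δ x (algebraMap A _ a) = algebraMap A _ (δ a) := by
  have := sq_mul_locDer δ (x := x) (z := algebraMap A _ a) (a := a) (b := 1) (by simp)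
  simpa using this

variable (𝒜 J e) in
/-- `δ` has degree `e` and the derivations of the rings of fractions of degree zero that it induces
have values in the sheaf `J(e)~`. -/
structure IsTwistDerivation (δ : Derivation k A A) : Prop where
  degree {i j : ℕ} {a : A} : (j : ℤ) = i + e → a ∈ 𝒜 i → δ a ∈ 𝒜 j
  -- The numerator bδ(a) − aδ(b) is required to lie in J only after multiplication by some c that
  -- does not vanish at x; 0 ≤ m + e keeps the degree of δ(ca) a natural number.
  mem (x : ProjectiveSpectrum 𝒜) : ∃ (m : ℕ) (c : A), c ∈ 𝒜 m ∧ c ∉ x.asHomogeneousIdeal ∧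
    0 ≤ m + e ∧ ∀ d a b, a ∈ 𝒜 d → b ∈ 𝒜 d → c * (b * δ a - a * δ b) ∈ J

variable {δ : Derivation k A A}

omit [IsDomain A] in
theorem algebraMap_mul_regVal {x : ProjectiveSpectrum 𝒜} {d : ℕ} {a b : 𝒜 d}
    (hb : b.1 ∈ x.asHomogeneousIdeal.toIdeal.primeCompl)
    {r : HomogeneousLocalization.AtPrime 𝒜 x.asHomogeneousIdeal.toIdeal}
    (hr : r = .mk ⟨d, a, b, hb⟩) :
    algebraMap A _ b.1 * r.val = algebraMap A (LocAt 𝒜 x) a.1 := by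
  rw [hr, HomogeneousLocalization.val_mk, Localization.mk_eq_mk']
  exact IsLocalization.mk'_spec' _ _ ⟨b.1, hb⟩

theorem IsTwistDerivation.locDer_regVal_mem (hδ : IsTwistDerivation 𝒜 J e δ)
    {U : (Opens (ProjectiveSpectrum.top 𝒜))ᵒᵖ}
    (r : (ProjectiveSpectrum.Proj.structureSheaf 𝒜).1.obj U) :
    (fun x : U.unop => locDer δ (x.1 : ProjectiveSpectrum 𝒜) (regVal r x) :
      ∀ x : U.unop, LocAt 𝒜 x.1) ∈ twistSections 𝒜 J e U := by
  intro x
  obtain ⟨V, hV, iV, d, a, b, hb, hr⟩ := r.2 x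
  obtain ⟨m, c, hc, hcx, hm, hJ⟩ := hδ.mem x.1
  have hdeg (p : 𝒜 d) : δ (c * p.1) ∈ 𝒜 (m + d + e).toNat :=
    hδ.degree (by push_cast; omega) (SetLike.mul_mem_graded hc p.2)
  -- The quotient rule is applied to ca/cb instead of a/b: the terms with δ(c) cancel and the
  -- numerator becomes c·c(bδ(a) − aδ(b)), which lies in J.
  refine ⟨V ⊓ ProjectiveSpectrum.basicOpen 𝒜 c, ⟨hV, hcx⟩, Opens.infLELeft _ _ ≫ iV,
    (m + d) + (m + d + e).toNat, 2 * (m + d), (c * b.1) * δ (c * a.1) - (c * a.1) * δ (c * b.1),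
    (c * b.1) ^ 2, by push_cast; omega, ?_, ?_, ?_, ?_⟩
  · exact sub_mem (SetLike.mul_mem_graded (SetLike.mul_mem_graded hc b.2) (hdeg a))
      (SetLike.mul_mem_graded (SetLike.mul_mem_graded hc a.2) (hdeg b))
  · exact SetLike.pow_mem_graded 2 (SetLike.mul_mem_graded hc b.2)
  · have : (c * b.1) * δ (c * a.1) - (c * a.1) * δ (c * b.1) =
        c * (c * (b.1 * δ a.1 - a.1 * δ b.1)) := by
      simp only [Derivation.leibniz, smul_eq_mul]; ring
    rw [this]
    exact J.mul_mem_left _ (hJ d _ _ a.2 b.2)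
  · intro y
    have hr' := algebraMap_mul_regVal (hb ⟨y.1, y.2.1⟩) (hr ⟨y.1, y.2.1⟩)
    refine ⟨fun h => mul_notMem 𝒜 y.1 y.2.2 (hb ⟨y.1, y.2.1⟩) (y.1.isPrime.mem_of_pow_mem 2 h),
      sq_mul_locDer δ ?_⟩
    rw [map_mul, map_mul, mul_assoc]
    exact congrArg _ hr'

/-- The value in `J(e)~` of the derivation `δ` at a regular function. -/
def twistDer (hδ : IsTwistDerivation 𝒜 J e δ) {U : (Opens (ProjectiveSpectrum.top 𝒜))ᵒᵖ}
    (r : (ProjectiveSpectrum.Proj.structureSheaf 𝒜).1.obj U) : twistSections 𝒜 J e U :=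
  ⟨_, hδ.locDer_regVal_mem r⟩

theorem topIso_inv_appTop (X : Scheme.{u}) :
    X.topIso.inv.appTop =
      X.presheaf.map (homOfLE (by simp) : (⊤ : X.Opens) ⟶ (⊤ : X.Opens).ι ''ᵁ ⊤).op := by
  have h : (⊤ : X.Opens).ι.appTop ≫ X.topIso.inv.appTop = 𝟙 _ := by
    rw [← Scheme.Hom.comp_appTop, Scheme.toIso_inv_ι, Scheme.Hom.id_appTop]
  have h' : (⊤ : X.Opens).ι.appTop ≫
      X.presheaf.map (homOfLE (by simp) : (⊤ : X.Opens) ⟶ (⊤ : X.Opens).ι ''ᵁ ⊤).op = 𝟙 _ := by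
    rw [Scheme.Opens.ι_appTop]
    exact (X.presheaf.map_comp _ _).symm.trans (X.presheaf.map_id _)
  have : IsIso X.topIso.hom.appTop := inferInstanceAs (IsIso (X.topIso.hom.app ⊤))
  exact (cancel_epi X.topIso.hom.appTop).mp (h.trans h'.symm)

-- The structure morphism passes through the spectrum of the degree zero part; as D₊(1) is
-- everything, scalars can be evaluated in the localization at 1.
omit [IsDomain A] in
theorem regVal_scalars (U : (Proj 𝒜).Opensᵒᵖ) (c : k) (x : U.unop) :
    regVal (𝒜 := 𝒜) (U := U) ((scalars (projToSpec k 𝒜) U).hom c) x =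
      algebraMap A (LocAt 𝒜 x.1) (algebraMap k A c) := by
  have hle : U.unop ≤ Proj.basicOpen 𝒜 1 := by rw [Proj.basicOpen_one]; exact le_top
  have h : scalars (projToSpec k 𝒜) U = CommRingCat.ofHom (algebraMap k (𝒜 0)) ≫
      CommRingCat.ofHom (HomogeneousLocalization.fromZeroRingHom 𝒜 (.powers 1)) ≫
        Proj.awayToSection 𝒜 1 ≫ (Proj 𝒜).presheaf.map (homOfLE hle).op := by
    rw [scalars, projToSpec, Proj.toSpecZero]
    simp only [Proj.basicOpenToSpec, Scheme.Hom.comp_appTop, Category.assoc]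
    rw [← Scheme.ΓSpecIso_inv_naturality_assoc, ← Scheme.ΓSpecIso_inv_naturality_assoc,
      ← Scheme.ΓSpecIso_inv_naturality_assoc, Scheme.Opens.toSpecΓ_appTop, Category.assoc,
      Iso.inv_hom_id_assoc]
    congr 3
    simp only [Scheme.Opens.topIso_inv, Scheme.isoOfEq_inv, Scheme.homOfLE_appTop]
    rw [topIso_inv_appTop]
    rfl
  rw [h]
  let z := HomogeneousLocalization.fromZeroRingHom 𝒜 (.powers 1) (algebraMap k (𝒜 0) c)
  refine (ProjectiveSpectrum.Proj.awayToSection_apply 𝒜 1 z ⟨x.1, hle x.2⟩).trans ?_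
  have hz : z.val = algebraMap A _ (algebraMap k A c) := by
    refine (HomogeneousLocalization.val_mk _).trans ?_
    exact Localization.mk_one_eq_algebraMap _
  rw [hz]
  exact IsLocalization.map_eq _ _

theorem twistDer_add (hδ : IsTwistDerivation 𝒜 J e δ) {U : (Opens (ProjectiveSpectrum.top 𝒜))ᵒᵖ}
    (r r' : (ProjectiveSpectrum.Proj.structureSheaf 𝒜).1.obj U) :
    twistDer hδ (r + r') = twistDer hδ r + twistDer hδ r' :=
  Subtype.ext <| funext fun x =>
    (congrArg (locDer δ (x.1 : ProjectiveSpectrum 𝒜)) (HomogeneousLocalization.val_add _ _)).trans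
      (locDer_add δ _ _)

theorem twistDer_mul (hδ : IsTwistDerivation 𝒜 J e δ) {U : (Opens (ProjectiveSpectrum.top 𝒜))ᵒᵖ}
    (r r' : (ProjectiveSpectrum.Proj.structureSheaf 𝒜).1.obj U) :
    twistDer hδ (r * r') = (⟨_, smul_mem_twistSections 𝒜 J e U r (twistDer hδ r')⟩ +
      ⟨_, smul_mem_twistSections 𝒜 J e U r' (twistDer hδ r)⟩ : twistSections 𝒜 J e U) :=
  Subtype.ext <| funext fun x =>
    (congrArg (locDer δ (x.1 : ProjectiveSpectrum 𝒜)) (HomogeneousLocalization.val_mul _ _)).trans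
      (locDer_mul δ _ _)

theorem twistDer_scalars (hδ : IsTwistDerivation 𝒜 J e δ) (U : (Proj 𝒜).Opensᵒᵖ) (c : k) :
    twistDer (U := U) hδ ((scalars (projToSpec k 𝒜) U).hom c) = 0 :=
  Subtype.ext <| funext fun x => by
    refine (congrArg (locDer δ (x.1 : ProjectiveSpectrum 𝒜)) (regVal_scalars U c x)).trans ?_
    refine (locDer_algebraMap _ _).trans ?_
    rw [Derivation.map_algebraMap, map_zero]
    rfl

/-- The derivation `𝒪 → J(e)~` induced by `δ`. -/
def twistDerivation (hδ : IsTwistDerivation 𝒜 J e δ) :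
    (twist 𝒜 J e).val.Derivation' (scalarsHom (projToSpec k 𝒜)) :=
  PresheafOfModules.Derivation'.mk (fun U => ModuleCat.Derivation.mk
    (fun r => twistDer (U := U) hδ r) (fun r r' => twistDer_add hδ r r')
    (fun r r' => twistDer_mul hδ r r') (fun c => twistDer_scalars hδ U c))
    (fun _ _ _ _ => rfl)

end TwistDerivation

/-! ### Sheafifications of presheaves that are known on a basis -/

section Sheafify

variable {X : Scheme.{u}}

/-- Sheafification is left adjoint to the inclusion of sheaves into presheaves. -/
def sheafifyAdj (X : Scheme.{u}) :
    PresheafOfModules.sheafification (𝟙 X.ringCatSheaf.obj) ⊣ Scheme.Modules.toPresheafOfModules X :=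
  PresheafOfModules.sheafificationAdjunction (𝟙 X.ringCatSheaf.obj)

/-- The map from a presheaf of modules to the associated sheaf. -/
def toSheafify (P : X.PresheafOfModules) : P ⟶ (sheafify P).val := (sheafifyAdj X).unit.app P

/-- The image of a section in the associated sheaf. -/
def sheafifySection {P : X.PresheafOfModules} {U : X.Opens} (p : P.obj (op U)) : Γ(sheafify P, U) :=
  (toSheafify P).app (op U) p

theorem exists_sheafify_desc {P : X.PresheafOfModules} {M : X.Modules} (v : P ⟶ M.val) :
    ∃ v' : sheafify P ⟶ M, ∀ (U : X.Opens) (p : P.obj (op U)),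
      v'.app U (sheafifySection p) = v.app (op U) p := by
  refine ⟨((sheafifyAdj X).homEquiv P M).symm v, fun U p => ?_⟩
  have := ((sheafifyAdj X).homEquiv_unit (X := P) (Y := M)
    (f := ((sheafifyAdj X).homEquiv P M).symm v)).symm.trans
    (((sheafifyAdj X).homEquiv P M).apply_symm_apply v)
  exact congr($(congrArg (fun f => PresheafOfModules.Hom.app f (op U)) this) p)

theorem sheafify_hom_ext {P : X.PresheafOfModules} {M : X.Modules} {f f' : sheafify P ⟶ M}
    (h : ∀ (U : X.Opens) (p : P.obj (op U)),
      f.app U (sheafifySection p) = f'.app U (sheafifySection p)) : f = f' := by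
  refine ((sheafifyAdj X).homEquiv P M).injective ?_
  refine ((sheafifyAdj X).homEquiv_unit (X := P) (Y := M) (f := f)).trans
    (Eq.trans ?_ ((sheafifyAdj X).homEquiv_unit (X := P) (Y := M) (f := f')).symm)
  refine PresheafOfModules.hom_ext fun U => ?_
  ext p
  exact h U.unop p

theorem modules_hom_ext_of_basis {M N : X.Modules} {ι : Type u} {B : ι → X.Opens}
    (hB : Opens.IsBasis (Set.range B)) {f f' : M ⟶ N}
    (h : ∀ i (m : Γ(M, B i)), f.app (B i) m = f'.app (B i) m) : f = f' :=
  (Scheme.Modules.toPresheaf X).map_injective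
    (TopCat.Sheaf.hom_ext (F := M.presheaf) (F' := abSheaf N) hB fun i => by
      ext m
      exact h i m)

theorem sheafifySection_map {P : X.PresheafOfModules} {U V : X.Opens} (h : V ≤ U)
    (p : P.obj (op U)) :
    (sheafify P).presheaf.map (homOfLE h).op (sheafifySection p) =
      sheafifySection (P.presheaf.map (homOfLE h).op p) :=
  (PresheafOfModules.naturality_apply (toSheafify P) (homOfLE h).op p).symm

theorem sheafify_hom_ext_of_basis {P : X.PresheafOfModules} {M : X.Modules} {ι : Type u}
    {B : ι → X.Opens} (hB : Opens.IsBasis (Set.range B)) {f f' : sheafify P ⟶ M}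
    (h : ∀ i (p : P.obj (op (B i))),
      f.app (B i) (sheafifySection p) = f'.app (B i) (sheafifySection p)) : f = f' := by
  refine sheafify_hom_ext fun U p => ?_
  refine section_ext_of_basis M hB fun i hi => ?_
  have key (f : sheafify P ⟶ M) : M.presheaf.map (homOfLE hi).op (f.app U (sheafifySection p)) =
      f.app (B i) (sheafifySection (P.presheaf.map (homOfLE hi).op p)) := by
    rw [← sheafifySection_map]
    exact congr($(f.mapPresheaf.naturality (homOfLE hi).op) _).symm
  exact (key f).trans ((h i _).trans (key f').symm)

/-- The inverse of (v, w) on the basic open sets glues to maps from M and N to the sheafification,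
and these split the maps induced by v and w. So the sequence obtained is split exact, although P is
only a presheaf and nothing is assumed off the basis. -/
theorem exists_shortExact_sheafify {P : X.PresheafOfModules} {M N : X.Modules} (v : P ⟶ M.val)
    (w : P ⟶ N.val) {ι : Type u} {B : ι → X.Opens} (hB : Opens.IsBasis (Set.range B))
    (h : ∀ i, Function.Bijective fun p : P.obj (op (B i)) =>
      ((v.app (op (B i)) p, w.app (op (B i)) p) : M.val.obj (op (B i)) × N.val.obj (op (B i)))) :
    ∃ (α : M ⟶ sheafify P) (β : sheafify P ⟶ N) (z : α ≫ β = 0),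
      (ShortComplex.mk α β z).ShortExact := by
  obtain ⟨v', hv'⟩ := exists_sheafify_desc v
  obtain ⟨w', hw'⟩ := exists_sheafify_desc w
  let e (i) : P.obj (op (B i)) ≃ₗ[X.ringCatSheaf.obj.obj (op (B i))]
      M.val.obj (op (B i)) × N.val.obj (op (B i)) :=
    LinearEquiv.ofBijective ((v.app (op (B i))).hom.prod (w.app (op (B i))).hom) (h i)
  have he1 (i x) : v.app (op (B i)) ((e i).symm x) = x.1 :=
    congrArg Prod.fst ((e i).apply_symm_apply x)
  have he2 (i x) : w.app (op (B i)) ((e i).symm x) = x.2 :=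
    congrArg Prod.snd ((e i).apply_symm_apply x)
  have hres (i j) (hij : B j ≤ B i) (x) : P.presheaf.map (homOfLE hij).op ((e i).symm x) =
      (e j).symm (M.presheaf.map (homOfLE hij).op x.1, N.presheaf.map (homOfLE hij).op x.2) := by
    refine (e j).injective ?_
    rw [LinearEquiv.apply_symm_apply]
    refine Prod.ext ?_ ?_
    · refine (PresheafOfModules.naturality_apply v (homOfLE hij).op _).trans ?_
      exact congrArg (M.presheaf.map (homOfLE hij).op) (he1 i x)
    · refine (PresheafOfModules.naturality_apply w (homOfLE hij).op _).trans ?_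
      exact congrArg (N.presheaf.map (homOfLE hij).op) (he2 i x)
  let χ (i) : M.val.obj (op (B i)) × N.val.obj (op (B i)) →ₗ[X.ringCatSheaf.obj.obj (op (B i))]
      (sheafify P).val.obj (op (B i)) :=
    ((toSheafify P).app (op (B i))).hom ∘ₗ (e i).symm.toLinearMap
  obtain ⟨α, hα⟩ := exists_presheaf_hom_of_basis M.val (sheafify P) hB
    (fun i => (χ i ∘ₗ LinearMap.inl _ _ _).toAddMonoidHom)
    (fun i r m => (χ i ∘ₗ LinearMap.inl _ _ _).map_smul r m) (fun i j hij m => by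
        refine Eq.trans ?_ (sheafifySection_map hij _).symm
        refine congrArg sheafifySection ((hres i j hij (m, 0)).trans ?_).symm
        exact congrArg (fun y => (e j).symm (M.presheaf.map (homOfLE hij).op m, y)) (map_zero _))
  obtain ⟨σ, hσ⟩ := exists_presheaf_hom_of_basis N.val (sheafify P) hB
    (fun i => (χ i ∘ₗ LinearMap.inr _ _ _).toAddMonoidHom)
    (fun i r m => (χ i ∘ₗ LinearMap.inr _ _ _).map_smul r m) (fun i j hij m => by
        refine Eq.trans ?_ (sheafifySection_map hij _).symm
        refine congrArg sheafifySection ((hres i j hij (0, m)).trans ?_).symm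
        exact congrArg (fun y => (e j).symm (y, N.presheaf.map (homOfLE hij).op m)) (map_zero _))
  replace hα (i) (m : Γ(M, B i)) : Scheme.Modules.Hom.app (⟨α⟩ : M ⟶ sheafify P) (B i) m =
      sheafifySection ((e i).symm (m, 0)) := hα i m
  replace hσ (i) (m : Γ(N, B i)) : Scheme.Modules.Hom.app (⟨σ⟩ : N ⟶ sheafify P) (B i) m =
      sheafifySection ((e i).symm (0, m)) := hσ i m
  have h1 : (⟨α⟩ : M ⟶ sheafify P) ≫ v' = 𝟙 M := modules_hom_ext_of_basis hB fun i m => by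
    refine (congrArg (v'.app (B i)) (hα i m)).trans ((hv' _ _).trans (he1 i _))
  have h2 : (⟨α⟩ : M ⟶ sheafify P) ≫ w' = 0 := modules_hom_ext_of_basis hB fun i m => by
    refine (congrArg (w'.app (B i)) (hα i m)).trans ((hw' _ _).trans (he2 i _))
  have h3 : (⟨σ⟩ : N ⟶ sheafify P) ≫ w' = 𝟙 N := modules_hom_ext_of_basis hB fun i m => by
    refine (congrArg (w'.app (B i)) (hσ i m)).trans ((hw' _ _).trans (he2 i _))
  have h4 : v' ≫ (⟨α⟩ : M ⟶ sheafify P) + w' ≫ (⟨σ⟩ : N ⟶ sheafify P) = 𝟙 _ :=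
    sheafify_hom_ext_of_basis hB fun i p => by
      change Scheme.Modules.Hom.app (⟨α⟩ : M ⟶ sheafify P) (B i) (v'.app (B i) (sheafifySection p)) +
        Scheme.Modules.Hom.app (⟨σ⟩ : N ⟶ sheafify P) (B i) (w'.app (B i) (sheafifySection p)) =
          sheafifySection p
      have e1 := (congrArg _ (hv' (B i) p)).trans (hα i (v.app (op (B i)) p))
      have e2 := (congrArg _ (hw' (B i) p)).trans (hσ i (w.app (op (B i)) p))
      refine (congrArg₂ (· + ·) e1 e2).trans ?_
      refine (map_add ((toSheafify P).app (op (B i))).hom _ _).symm.trans ?_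
      refine congrArg sheafifySection ?_
      rw [← map_add, Prod.mk_add_mk, add_zero, zero_add]
      exact (e i).symm_apply_apply p
  exact ⟨⟨α⟩, w', h2, ShortComplex.Splitting.shortExact
    { r := v', s := (⟨σ⟩ : N ⟶ sheafify P), f_r := h1, s_g := h3, id := h4 }⟩

theorem nonempty_sheafify_iso {P : X.PresheafOfModules} {M : X.Modules} (v : P ⟶ M.val)
    {ι : Type u} {B : ι → X.Opens} (hB : Opens.IsBasis (Set.range B))
    (h : ∀ i, Function.Bijective (v.app (op (B i)))) : Nonempty (sheafify P ≅ M) := by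
  obtain ⟨v', hv'⟩ := exists_sheafify_desc v
  let e (i) : P.obj (op (B i)) ≃ₗ[X.ringCatSheaf.obj.obj (op (B i))] M.val.obj (op (B i)) :=
    LinearEquiv.ofBijective (v.app (op (B i))).hom (h i)
  have he (i x) : v.app (op (B i)) ((e i).symm x) = x := (e i).apply_symm_apply x
  let χ (i) : M.val.obj (op (B i)) →ₗ[X.ringCatSheaf.obj.obj (op (B i))]
      (sheafify P).val.obj (op (B i)) :=
    ((toSheafify P).app (op (B i))).hom ∘ₗ (e i).symm.toLinearMap
  obtain ⟨α, hα⟩ := exists_presheaf_hom_of_basis M.val (sheafify P) hB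
    (fun i => (χ i).toAddMonoidHom) (fun i r m => (χ i).map_smul r m) (fun i j hij m => by
      refine Eq.trans ?_ (sheafifySection_map hij _).symm
      refine congrArg sheafifySection ((e j).injective ?_)
      refine ((e j).apply_symm_apply _).trans ?_
      refine Eq.trans ?_ (PresheafOfModules.naturality_apply v (homOfLE hij).op _).symm
      exact congrArg (M.presheaf.map (homOfLE hij).op) (he i m).symm)
  replace hα (i) (m : Γ(M, B i)) : Scheme.Modules.Hom.app (⟨α⟩ : M ⟶ sheafify P) (B i) m =
      sheafifySection ((e i).symm m) := hα i m
  refine ⟨⟨v', ⟨α⟩, sheafify_hom_ext_of_basis hB fun i p => ?_,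
    modules_hom_ext_of_basis hB fun i m => ?_⟩⟩
  · change Scheme.Modules.Hom.app (⟨α⟩ : M ⟶ sheafify P) (B i) (v'.app (B i) (sheafifySection p)) =
      sheafifySection p
    refine ((congrArg _ (hv' (B i) p)).trans (hα i (v.app (op (B i)) p))).trans ?_
    exact congrArg sheafifySection ((e i).symm_apply_apply p)
  · exact (congrArg (v'.app (B i)) (hα i m)).trans ((hv' _ _).trans (he i _))

end Sheafify

/-! ### Linear forms on differentials given by graded derivations -/

section DerivationMap

variable {k A : Type u} [Field k] [CommRing A] [Algebra k A] [IsDomain A]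
  {𝒜 : ℕ → Submodule k A} [GradedAlgebra 𝒜] {J : Ideal A} {e : ℤ} {δ : Derivation k A A}

/-- The linear map from differentials to `J(e)~` induced by the derivation `δ`. -/
def differentialsTo (hδ : IsTwistDerivation 𝒜 J e δ) :
    differentialsPresheaf (projToSpec k 𝒜) ⟶ (twist 𝒜 J e).val :=
  (PresheafOfModules.DifferentialsConstruction.isUniversal' (scalarsHom (projToSpec k 𝒜))).desc
    (twistDerivation hδ)

theorem differentialsTo_d (hδ : IsTwistDerivation 𝒜 J e δ) (U : (Proj 𝒜).Opensᵒᵖ)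
    (r : (Proj 𝒜).presheaf.obj U) :
    (differentialsTo hδ).app U (CommRingCat.KaehlerDifferential.d (f := scalars (projToSpec k 𝒜) U) r) =
      twistDer (U := U) hδ r :=
  PresheafOfModules.Derivation.congr_d
    ((PresheafOfModules.DifferentialsConstruction.isUniversal' (scalarsHom (projToSpec k 𝒜))).fac
      (twistDerivation hδ)) r

end DerivationMap

/-! ### The double cover on principal open sets and on points -/

section Glue

open HomogeneousLocalization Limits

variable {A B : Type u} {σ τ : Type u} [CommRing A] [CommRing B] [SetLike σ A]
  [AddSubgroupClass σ A] [SetLike τ B] [AddSubgroupClass τ B] {𝒜 : ℕ → σ} {ℬ : ℕ → τ}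
  [GradedRing 𝒜] [GradedRing ℬ] (φ : 𝒜 →+*ᵍ ℬ)
variable {ι : Type} (t : ι → A) {d : ℕ} (hd : 0 < d) (ht : ∀ i, t i ∈ 𝒜 d)
  (hcov : ⨆ i, Proj.basicOpen ℬ (φ (t i)) = ⊤)

theorem ι_projMapOfCover (i : ι) {e : ℕ} {r : A} (hr : r ∈ 𝒜 e) :
    (Proj.basicOpen ℬ (φ (t i * r))).ι ≫ projMapOfCover φ t hd ht hcov =
      projMapOn φ (t i * r) (SetLike.mul_mem_graded (ht i) hr) (hd.trans_le (d.le_add_right e)) := by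
  have hle : Proj.basicOpen ℬ (φ (t i * r)) ≤ Proj.basicOpen ℬ (φ (t i)) :=
    Proj.basicOpen_mono _ _ _ (map_dvd φ (dvd_mul_right _ _))
  rw [← homOfLE_projMapOn φ (ht i) hd hr rfl _ hle, ← Scheme.homOfLE_ι _ hle, Category.assoc]
  congr 1
  exact ((Proj ℬ).openCoverOfIsOpenCover (fun i => Proj.basicOpen ℬ (φ (t i))) hcov).ι_glueMorphisms
    _ _ i

theorem awayι_projMapOfCover (i : ι) {e : ℕ} {r : A} (hr : r ∈ 𝒜 e) :
    Proj.awayι ℬ (φ (t i * r)) (φ.2 (SetLike.mul_mem_graded (ht i) hr))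
        (hd.trans_le (d.le_add_right e)) ≫ projMapOfCover φ t hd ht hcov =
      Spec.map (CommRingCat.ofHom (Away.map φ (t i * r))) ≫
        Proj.awayι 𝒜 (t i * r) (SetLike.mul_mem_graded (ht i) hr) (hd.trans_le (d.le_add_right e)) := by
  rw [← Proj.basicOpenIsoSpec_inv_ι, Category.assoc, ι_projMapOfCover φ t hd ht hcov i hr,
    projMapOn, Iso.inv_comp_eq, Proj.basicOpenIsoSpec_hom]

end Glue

section Cover

open HomogeneousLocalization MvPolynomial

variable (k : Type u) [Field k]

/-- The cover is glued from the charts xᵢ ≠ 0, so it is described by ring homomorphisms on D₊(xᵢr),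
inside such a chart. -/
theorem awayι_g (i : Fin 3) {e : ℕ} {r : MvPolynomial (Fin 3) k} (hr : r.IsHomogeneous e) :
    Proj.awayι (grading k) (coverRingHom k (X i * r))
        ((coverRingHom k).2 (SetLike.mul_mem_graded (isHomogeneous_X k i) hr)) (by omega) ≫ g k =
      Spec.map (CommRingCat.ofHom (Away.map (coverRingHom k) (X i * r))) ≫
        Proj.awayι (homogeneousSubmodule (Fin 3) k) (X i * r)
          (SetLike.mul_mem_graded (isHomogeneous_X k i) hr) (by omega) :=
  awayι_projMapOfCover (coverRingHom k) (fun i : Fin 3 => X i) one_pos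
    (fun i => isHomogeneous_X k i) (iSup_basicOpen_eq_top k) i hr

theorem ι_g (i : Fin 3) {e : ℕ} {r : MvPolynomial (Fin 3) k} (hr : r.IsHomogeneous e) :
    (Proj.basicOpen (grading k) (coverRingHom k (X i * r))).ι ≫ g k =
      projMapOn (coverRingHom k) (X i * r) (SetLike.mul_mem_graded (isHomogeneous_X k i) hr)
        (by omega) :=
  ι_projMapOfCover (coverRingHom k) (fun i : Fin 3 => X i) one_pos
    (fun i => isHomogeneous_X k i) (iSup_basicOpen_eq_top k) i hr

theorem exists_X_notMem (x : S k) : ∃ i, coverRingHom k (X i) ∉ x.asHomogeneousIdeal := by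
  have : x ∈ ⨆ i : Fin 3, Proj.basicOpen (grading k) (coverRingHom k (X i)) := by
    rw [iSup_basicOpen_eq_top]; trivial
  exact Opens.mem_iSup.mp this

theorem awayMap_isLocalizationElem {A B : Type u} {σ τ : Type u} [CommRing A] [CommRing B]
    [SetLike σ A] [AddSubgroupClass σ A] [SetLike τ B] [AddSubgroupClass τ B] {𝒜 : ℕ → σ}
    {ℬ : ℕ → τ} [GradedRing 𝒜] [GradedRing ℬ] (φ : 𝒜 →+*ᵍ ℬ) {d e : ℕ} {t a : A} (ht : t ∈ 𝒜 d)
    (ha : a ∈ 𝒜 e) : Away.map φ t (Away.isLocalizationElem ht ha) =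
      Away.isLocalizationElem (φ.2 ht) (φ.2 ha) := by
  refine HomogeneousLocalization.val_injective _ ?_
  simp [Away.isLocalizationElem, Away.map_mk]

theorem mem_g_iff_of_pos (x : S k) {e : ℕ} (he : 0 < e) {a : MvPolynomial (Fin 3) k}
    (ha : a.IsHomogeneous e) :
    a ∈ (g k x).asHomogeneousIdeal ↔ coverRingHom k a ∈ x.asHomogeneousIdeal := by
  obtain ⟨i, hi⟩ := exists_X_notMem k x
  have h1 := (isHomogeneous_one (Fin 3) k)
  have hi' : x ∈ (Proj.awayι (grading k) (coverRingHom k (X i * 1))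
      ((coverRingHom k).2 (SetLike.mul_mem_graded (isHomogeneous_X k i) h1)) (by omega)).opensRange := by
    rw [Proj.opensRange_awayι]
    simpa using hi
  obtain ⟨y, rfl⟩ := hi'
  have h2 := congrArg (fun f => f ⁻¹ᵁ Proj.basicOpen (homogeneousSubmodule (Fin 3) k) a)
    (awayι_g k i h1)
  simp only [Scheme.Hom.comp_preimage] at h2
  rw [Proj.awayι_preimage_basicOpen (g_deg := ha) (hm' := he)] at h2
  have h3 := Proj.awayι_preimage_basicOpen (grading k)
      ((coverRingHom k).2 (SetLike.mul_mem_graded (isHomogeneous_X k i) h1)) (by omega)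
      ((coverRingHom k).2 ha) he
  rw [← awayMap_isLocalizationElem (coverRingHom k)
    (SetLike.mul_mem_graded (isHomogeneous_X k i) h1) ha] at h3
  exact not_iff_not.mp (iff_of_eq (congrArg (y ∈ ·) (h2.trans h3.symm)))

/-- Degree zero elements are covered by multiplying a with a coordinate xᵢ that does not vanish at
the point. -/
theorem mem_g_iff (x : S k) {e : ℕ} {a : MvPolynomial (Fin 3) k} (ha : a.IsHomogeneous e) :
    a ∈ (g k x).asHomogeneousIdeal ↔ coverRingHom k a ∈ x.asHomogeneousIdeal := by
  obtain ⟨i, hi⟩ := exists_X_notMem k x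
  have h1 := mem_g_iff_of_pos k x (by omega) ((isHomogeneous_X k i).mul ha)
  have h2 := mem_g_iff_of_pos k x one_pos (isHomogeneous_X k i)
  have hx := x.isPrime.mul_mem_iff_mem_or_mem (x := coverRingHom k (X i)) (y := coverRingHom k a)
  have hg := (g k x).isPrime.mul_mem_iff_mem_or_mem (x := X i) (y := a)
  rw [map_mul] at h1
  simp only [HomogeneousIdeal.mem_iff] at *
  tauto

theorem g_preimage_basicOpen {e : ℕ} {a : MvPolynomial (Fin 3) k} (ha : a.IsHomogeneous e) :
    g k ⁻¹ᵁ Proj.basicOpen (homogeneousSubmodule (Fin 3) k) a =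
      Proj.basicOpen (grading k) (coverRingHom k a) :=
  Opens.ext <| Set.ext fun x => not_iff_not.mpr (mem_g_iff k x ha)

theorem mem_toIdeal_iff_decompose {A : Type u} {R : Type u} [CommRing R] [CommRing A] [Algebra R A]
    {𝒜 : ℕ → Submodule R A} [GradedAlgebra 𝒜] (x : ProjectiveSpectrum 𝒜) (a : A) :
    a ∈ x.asHomogeneousIdeal.toIdeal ↔
      ∀ n, (DirectSum.decompose 𝒜 a n : A) ∈ x.asHomogeneousIdeal.toIdeal :=
  x.asHomogeneousIdeal.isHomogeneous.mem_iff

theorem g_asHomogeneousIdeal (x : S k) : (g k x).asHomogeneousIdeal.toIdeal =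
    x.asHomogeneousIdeal.toIdeal.comap (incl k) := by
  ext a
  refine (mem_toIdeal_iff_decompose (g k x) a).trans (Iff.trans ?_
    (mem_toIdeal_iff_decompose x (incl k a)).symm)
  refine forall_congr' fun n => ?_
  rw [decompose_incl]
  refine Iff.trans ?_ (mem_g_iff k x (homogeneousComponent_isHomogeneous n a))
  rw [← MvPolynomial.decomposition.decompose'_apply]
  rfl

theorem awayToSection_g (i : Fin 3) {e : ℕ} {r : MvPolynomial (Fin 3) k} (hr : r.IsHomogeneous e)
    (h : Proj.basicOpen (grading k) (coverRingHom k (X i * r)) ≤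
      g k ⁻¹ᵁ Proj.basicOpen (homogeneousSubmodule (Fin 3) k) (X i * r)) :
    Proj.awayToSection (homogeneousSubmodule (Fin 3) k) (X i * r) ≫ (g k).appLE _ _ h =
      CommRingCat.ofHom (Away.map (coverRingHom k) (X i * r)) ≫
        Proj.awayToSection (grading k) (coverRingHom k (X i * r)) := by
  have h1 : (g k).resLE _ _ h ≫ Proj.basicOpenToSpec (homogeneousSubmodule (Fin 3) k) (X i * r) =
      Proj.basicOpenToSpec (grading k) (coverRingHom k (X i * r)) ≫
        Spec.map (CommRingCat.ofHom (Away.map (coverRingHom k) (X i * r))) := by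
    have h2 := ι_g k i hr
    rw [← Scheme.Hom.resLE_comp_ι (g k) h, projMapOn, ← Proj.basicOpenIsoSpec_inv_ι,
      ← Category.assoc, ← Category.assoc, cancel_mono, Iso.eq_comp_inv,
      Proj.basicOpenIsoSpec_hom] at h2
    exact h2
  have h3 := congrArg Scheme.Hom.appTop h1
  have hA : (Proj.basicOpenToSpec (homogeneousSubmodule (Fin 3) k) (X i * r)).appTop = _ :=
    Proj.basicOpenToSpec_app_top _ _
  have hB : (Proj.basicOpenToSpec (grading k) (coverRingHom k (X i * r))).appTop = _ :=
    Proj.basicOpenToSpec_app_top _ _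
  have hC : ((g k).resLE _ _ h).appTop = _ := Scheme.Hom.resLE_app_top (g k) h
  rw [Scheme.Hom.comp_appTop, Scheme.Hom.comp_appTop, hA, hB, hC, Scheme.ΓSpecIso_naturality_assoc] at h3
  have h4 := congrArg (fun f => (Scheme.ΓSpecIso _).inv ≫ f ≫
    (Proj.basicOpen (grading k) (coverRingHom k (X i * r))).topIso.hom) h3
  simp only [Category.assoc, Iso.inv_hom_id_assoc, Iso.inv_hom_id, Category.comp_id] at h4
  exact h4

end Cover

/-! ### Pulling back sections along the double cover -/

section Basis

variable {k A : Type u} [CommRing k] [CommRing A] [Algebra k A]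
  {𝒜 : ℕ → Submodule k A} [GradedAlgebra 𝒜]

theorem exists_homogeneous_basicOpen_le {x : ProjectiveSpectrum 𝒜}
    {U : Opens (ProjectiveSpectrum.top 𝒜)} (hx : x ∈ U) : ∃ (d : ℕ) (f : A), f ∈ 𝒜 d ∧
      f ∉ x.asHomogeneousIdeal ∧ ProjectiveSpectrum.basicOpen 𝒜 f ≤ U := by
  obtain ⟨_, ⟨f, rfl⟩, hxf, hf⟩ := (ProjectiveSpectrum.isTopologicalBasis_basic_opens 𝒜).exists_subset_of_mem_open hx U.2
  have hxf' : x ∈ ProjectiveSpectrum.basicOpen 𝒜 f := hxf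
  rw [ProjectiveSpectrum.basicOpen_eq_union_of_projection] at hxf'
  obtain ⟨n, hn⟩ := Opens.mem_iSup.mp hxf'
  refine ⟨n, GradedRing.proj 𝒜 n f, SetLike.coe_mem _, hn, fun y hy => hf ?_⟩
  change y ∈ ProjectiveSpectrum.basicOpen 𝒜 f
  rw [ProjectiveSpectrum.basicOpen_eq_union_of_projection]
  exact Opens.mem_iSup.mpr ⟨n, hy⟩

theorem algebraMap_mul_awayToSection {f a : A} {N d : ℕ} (hf : f ∈ 𝒜 d) (ha : a ∈ 𝒜 (N • d))
    (x : ProjectiveSpectrum 𝒜) (hx : x ∈ ProjectiveSpectrum.basicOpen 𝒜 f) :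
    algebraMap A (LocAt 𝒜 x) (f ^ N) * regVal (𝒜 := 𝒜) (U := op (ProjectiveSpectrum.basicOpen 𝒜 f))
      (Proj.awayToSection 𝒜 f (HomogeneousLocalization.Away.mk 𝒜 hf N a ha)) ⟨x, hx⟩ =
        algebraMap A (LocAt 𝒜 x) a := by
  refine (congrArg _ (ProjectiveSpectrum.Proj.awayToSection_apply 𝒜 f _ ⟨x, hx⟩)).trans ?_
  rw [HomogeneousLocalization.Away.val_mk, Localization.mk_eq_mk', IsLocalization.map_mk']
  exact IsLocalization.mk'_spec' (LocAt 𝒜 x) a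
    (⟨f ^ N, fun h => hx (x.isPrime.mem_of_pow_mem N h)⟩ : x.asHomogeneousIdeal.toIdeal.primeCompl)

end Basis

section Cover

open HomogeneousLocalization MvPolynomial

variable (k : Type u) [Field k]

/-- Near g(x) the function is c/(xᵢf)ᴺ, whose pullback is explicit. Any other relation br = a
implies the polynomial identity bc = (xᵢf)ᴺa, and this can be carried to the surface; b may vanish
at the point. -/
theorem algebraMap_mul_regVal_g {U : (PSpace k 2).Opens} (r : Γ(PSpace k 2, U)) (x : S k)
    (hx : x ∈ g k ⁻¹ᵁ U) {a b : MvPolynomial (Fin 3) k}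
    (h : algebraMap _ (LocAt (homogeneousSubmodule (Fin 3) k) (g k x)) b *
      regVal (U := op U) r ⟨g k x, hx⟩ = algebraMap _ _ a) :
    algebraMap _ (LocAt (grading k) x) (incl k b) *
      regVal (U := op (g k ⁻¹ᵁ U)) ((g k).app U r) ⟨x, hx⟩ = algebraMap _ _ (incl k a) := by
  obtain ⟨e, f, hf, hfx, hfU⟩ := exists_homogeneous_basicOpen_le (𝒜 := homogeneousSubmodule (Fin 3) k)
    (x := g k x) (U := U) hx
  obtain ⟨i, hi⟩ := exists_X_notMem k x
  have hXf := SetLike.mul_mem_graded (isHomogeneous_X k i) hf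
  have hle : Proj.basicOpen (homogeneousSubmodule (Fin 3) k) (X i * f) ≤ U :=
    (Proj.basicOpen_mono _ _ _ (dvd_mul_left _ _)).trans hfU
  have hgx : g k x ∈ Proj.basicOpen (homogeneousSubmodule (Fin 3) k) (X i * f) :=
    mul_notMem _ _ (fun h => hi ((mem_g_iff k x (isHomogeneous_X k i)).mp h)) hfx
  have hpre := g_preimage_basicOpen k hXf
  obtain ⟨z, hz⟩ := (ConcreteCategory.bijective_of_isIso (Proj.basicOpenIsoAway
    (homogeneousSubmodule (Fin 3) k) (X i * f) hXf (by omega)).hom).2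
      ((PSpace k 2).presheaf.map (homOfLE hle).op r)
  obtain ⟨N, c, hc, rfl⟩ := Away.mk_surjective _ hXf z
  have h1 := algebraMap_mul_awayToSection hXf hc (g k x) hgx
  have h2 := algebraMap_mul_awayToSection (𝒜 := grading k) ((coverRingHom k).2 hXf) ((coverRingHom k).2 hc) x (hpre.le hgx)
  have h3 := congr($(awayToSection_g k i hf hpre.ge) (Away.mk _ hXf N c hc))
  rw [ConcreteCategory.comp_apply, ConcreteCategory.comp_apply] at h3
  have h4 : (g k).appLE _ _ hpre.ge ((PSpace k 2).presheaf.map (homOfLE hle).op r) =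
      (S k).presheaf.map (homOfLE (hpre.ge.trans ((g k).preimage_mono hle))).op ((g k).app U r) := by
    rw [← ConcreteCategory.comp_apply, Scheme.Hom.map_appLE]
    rfl
  obtain ⟨v, hv, hv'⟩ : ∃ v : LocAt (homogeneousSubmodule (Fin 3) k) (g k x),
      algebraMap _ _ ((X i * f) ^ N) * v = algebraMap _ _ c ∧
      algebraMap _ _ b * v = algebraMap _ _ a := by
    refine ⟨_, ?_, h⟩
    rw [← h1]
    exact congrArg (fun s => algebraMap _ _ ((X i * f) ^ N) * regVal s ⟨g k x, hgx⟩) hz.symm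
  have hab : b * c = (X i * f) ^ N * a := by
    refine algebraMap_locAt_injective (g k x) ?_
    rw [map_mul, map_mul, ← hv, ← hv']; ring
  obtain ⟨w, hw, hw'⟩ : ∃ w : LocAt (grading k) x, w = regVal (U := op (g k ⁻¹ᵁ U)) ((g k).app U r) ⟨x, hx⟩ ∧
      algebraMap _ _ (incl k ((X i * f) ^ N)) * w = algebraMap _ _ (incl k c) := by
    refine ⟨_, rfl, ?_⟩
    have h5 : Proj.awayToSection (grading k) (coverRingHom k (X i * f))
        (Away.mk (grading k) ((coverRingHom k).2 hXf) N (coverRingHom k c) ((coverRingHom k).2 hc)) =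
        (S k).presheaf.map (homOfLE (hpre.ge.trans ((g k).preimage_mono hle))).op
          ((g k).app U r) := by
      rw [← h4, ← hz, ← Away.map_mk]
      exact h3.symm
    rw [map_pow]
    refine Eq.trans ?_ h2
    exact congrArg (fun s => algebraMap _ _ (coverRingHom k (X i * f) ^ N) *
      regVal s ⟨x, hpre.le hgx⟩) h5.symm
  rw [← hw]
  have hne : incl k ((X i * f) ^ N) ∉ x.asHomogeneousIdeal := by
    rw [map_pow]
    exact fun h => hpre.le hgx (x.isPrime.mem_of_pow_mem N h)
  refine eq_of_algebraMap_mul_eq hne ?_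
  rw [mul_left_comm, hw', ← map_mul, ← map_mul, ← map_mul, ← map_mul, hab]

/-- The map of local rings of the cones. -/
def locMap (x : S k) :
    LocAt (homogeneousSubmodule (Fin 3) k) (g k x) →+* LocAt (grading k) x :=
  haveI := (g k x).isPrime
  haveI := x.isPrime
  Localization.localRingHom _ _ (incl k).toRingHom (g_asHomogeneousIdeal k x)

theorem locMap_algebraMap (x : S k) (a : MvPolynomial (Fin 3) k) :
    locMap k x (algebraMap _ _ a) = algebraMap _ _ (incl k a) :=
  haveI := (g k x).isPrime
  haveI := x.isPrime
  Localization.localRingHom_to_map _ _ _ (g_asHomogeneousIdeal k x) a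

theorem regVal_g {U : (PSpace k 2).Opens} (r : Γ(PSpace k 2, U)) (x : S k) (hx : x ∈ g k ⁻¹ᵁ U) :
    regVal (U := op (g k ⁻¹ᵁ U)) ((g k).app U r) ⟨x, hx⟩ =
      locMap k x (regVal (U := op U) r ⟨g k x, hx⟩) := by
  obtain ⟨⟨a, b⟩, hb, h⟩ := exists_algebraMap_mul_eq
    (regVal (𝒜 := homogeneousSubmodule (Fin 3) k) (U := op U) r ⟨g k x, hx⟩)
  have hb' : incl k b ∉ x.asHomogeneousIdeal := fun hb' => hb
    ((g_asHomogeneousIdeal k x).ge hb')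
  refine eq_of_algebraMap_mul_eq hb' ((algebraMap_mul_regVal_g k r x hx h).trans ?_)
  rw [← locMap_algebraMap, ← locMap_algebraMap, ← map_mul, ← h]

variable {k}

theorem IsTwistFraction.pull {J : Ideal (MvPolynomial (Fin 3) k)} {n : ℤ}
    {U : (PSpace k 2).Opens} (s : twistSections (homogeneousSubmodule (Fin 3) k) J n (op U)) :
    (fun x : (g k ⁻¹ᵁ U) => locMap k x.1 (s.1 ⟨g k x.1, x.2⟩) :
      ∀ x : (op (g k ⁻¹ᵁ U)).unop, LocAt (grading k) x.1) ∈
        twistSections (grading k) (J.map (incl k)) n (op (g k ⁻¹ᵁ U)) := by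
  intro x
  obtain ⟨V, hV, iV, i, j, a, b, h, ha, hb, haJ, hs⟩ := s.2 ⟨g k x.1, x.2⟩
  refine ⟨(g k ⁻¹ᵁ V : (S k).Opens), hV, homOfLE ((g k).preimage_mono iV.le), i, j, incl k a,
    incl k b, h, incl_mem_grading k ha, incl_mem_grading k hb, Ideal.mem_map_of_mem _ haJ,
    fun y => ⟨fun hy => (hs ⟨g k y.1, y.2⟩).1 ((g_asHomogeneousIdeal k y.1).ge hy), ?_⟩⟩
  change algebraMap _ (LocAt (grading k) y.1) (incl k b) * locMap k y.1 (s.1 ⟨g k y.1, iV.le y.2⟩) = _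
  exact ((congrArg (· * _) (locMap_algebraMap k y.1 b)).symm.trans
    (map_mul (locMap k y.1) _ _).symm).trans ((congrArg (locMap k y.1)
      (hs ⟨g k y.1, y.2⟩).2).trans (locMap_algebraMap k y.1 a))

variable (k) in
/-- Pulling back sections of `J(n)~` along the double cover. -/
def twistPull (J : Ideal (MvPolynomial (Fin 3) k)) (n : ℤ) (U : (PSpace k 2).Opens) :
    twistSections (homogeneousSubmodule (Fin 3) k) J n (op U) →+
      twistSections (grading k) (J.map (incl k)) n (op (g k ⁻¹ᵁ U)) where
  toFun s := ⟨_, IsTwistFraction.pull s⟩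
  map_zero' := Subtype.ext <| funext fun x => map_zero (locMap k x.1)
  map_add' _ _ := Subtype.ext <| funext fun x => map_add (locMap k x.1) _ _

variable (k) in
/-- The map `J(n)~ → g_* (JC)(n)~`. -/
def twistPullHom (J : Ideal (MvPolynomial (Fin 3) k)) (n : ℤ) :
    twist (homogeneousSubmodule (Fin 3) k) J n ⟶
      (Scheme.Modules.pushforward (g k)).obj (twist (grading k) (J.map (incl k)) n) :=
  ⟨PresheafOfModules.homMk
    { app := fun U => AddCommGrpCat.ofHom (twistPull k J n U.unop)
      naturality := fun U V i => rfl }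
    (fun U r s => Subtype.ext <| funext fun x => by
      refine (map_mul (locMap k x.1) _ _).trans ?_
      exact congrArg (· * _) (regVal_g k (U := U.unop) r x.1 x.2).symm)⟩

end Cover

/-! ### Existence of fractions on arbitrary and on principal open sets -/

section Fractions

variable {k A : Type u} [CommRing k] [CommRing A] [Algebra k A]
  {𝒜 : ℕ → Submodule k A} [GradedAlgebra 𝒜] {J : Ideal A} {n : ℤ}

theorem pow_notMem {x : ProjectiveSpectrum 𝒜} {a : A} (ha : a ∉ x.asHomogeneousIdeal) (N : ℕ) :
    a ^ N ∉ x.asHomogeneousIdeal := fun h => ha (x.isPrime.mem_of_pow_mem N h)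

theorem exists_twistSection (J : Ideal A) (n : ℤ) {U : (Opens (ProjectiveSpectrum.top 𝒜))ᵒᵖ} {i j : ℕ} {a b : A}
    (h : (i : ℤ) = j + n) (ha : a ∈ 𝒜 i) (hb : b ∈ 𝒜 j) (haJ : a ∈ J)
    (hU : ∀ x : U.unop, b ∉ x.1.asHomogeneousIdeal) :
    ∃ s : twistSections 𝒜 J n U, ∀ x, algebraMap A (LocAt 𝒜 x.1) b * s.1 x = algebraMap A _ a :=
  ⟨fracSection J n U h ha hb haJ hU, algebraMap_mul_fracSection h ha hb haJ hU⟩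

theorem exists_reg {U : (Opens (ProjectiveSpectrum.top 𝒜))ᵒᵖ} {i : ℕ} {a b : A}
    (ha : a ∈ 𝒜 i) (hb : b ∈ 𝒜 i) (hU : ∀ x : U.unop, b ∉ x.1.asHomogeneousIdeal) :
    ∃ r : (ProjectiveSpectrum.Proj.structureSheaf 𝒜).1.obj U,
      ∀ x, algebraMap A (LocAt 𝒜 x.1) b * regVal r x = algebraMap A _ a := by
  obtain ⟨s, hs⟩ := exists_twistSection ⊤ 0 (by simp) ha hb trivial hU
  obtain ⟨r, hr⟩ := exists_regVal_eq s
  exact ⟨r, fun x => by rw [hr]; exact hs x⟩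

theorem exists_fraction [IsDomain A] {d : ℕ} {h : A} (hd : 0 < d) (hh : h ∈ 𝒜 d)
    {U : (Opens (ProjectiveSpectrum.top 𝒜))ᵒᵖ} (hU : U.unop = ProjectiveSpectrum.basicOpen 𝒜 h)
    (s : twistSections 𝒜 J n U) :
    ∃ (N i : ℕ) (a : A), (i : ℤ) = (N * d : ℕ) + n ∧ a ∈ 𝒜 i ∧ a ∈ J ∧
      ∀ x : U.unop, algebraMap A (LocAt 𝒜 x.1) (h ^ N) * s.1 x = algebraMap A _ a := by
  obtain ⟨U⟩ := U
  subst hU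
  exact exists_fraction_basicOpen hd hh s

theorem exists_reg_fraction [IsDomain A] {d : ℕ} {h : A} (hd : 0 < d) (hh : h ∈ 𝒜 d)
    {U : (Opens (ProjectiveSpectrum.top 𝒜))ᵒᵖ} (hU : U.unop = ProjectiveSpectrum.basicOpen 𝒜 h)
    (r : (ProjectiveSpectrum.Proj.structureSheaf 𝒜).1.obj U) :
    ∃ (N : ℕ) (a : A), a ∈ 𝒜 (N * d) ∧
      ∀ x : U.unop, algebraMap A (LocAt 𝒜 x.1) (h ^ N) * regVal r x = algebraMap A _ a := by
  obtain ⟨N, i, a, hi, ha, -, h⟩ := exists_fraction hd hh hU ⟨_, regVal_mem_twistSections r⟩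
  obtain rfl : i = N * d := by omega
  exact ⟨N, a, ha, h⟩

end Fractions

/-! ### Principal open sets of the plane give a basis of the surface -/

section Basis

open MvPolynomial

variable (k : Type u) [Field k]

/-- Homogeneous polynomials that are divisible by a variable. -/
def CoverIndex : Type u :=
  {h : MvPolynomial (Fin 3) k // ∃ (i : Fin 3) (e : ℕ) (r : MvPolynomial (Fin 3) k),
    r.IsHomogeneous e ∧ h = X i * r}

variable {k}

theorem CoverIndex.exists_isHomogeneous (h : CoverIndex k) : ∃ d, 0 < d ∧ h.1.IsHomogeneous d := by
  obtain ⟨_, i, e, r, hr, rfl⟩ := h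
  exact ⟨1 + e, by omega, (isHomogeneous_X k i).mul hr⟩

/-- The principal open subset of the plane. -/
def pOpen (h : CoverIndex k) : (PSpace k 2).Opens :=
  Proj.basicOpen (homogeneousSubmodule (Fin 3) k) h.1

/-- The principal open subset of the surface. -/
def sOpen (h : CoverIndex k) : (S k).Opens := Proj.basicOpen (grading k) (incl k h.1)

theorem g_preimage_pOpen (h : CoverIndex k) : g k ⁻¹ᵁ pOpen h = sOpen h := by
  obtain ⟨d, -, hd⟩ := h.exists_isHomogeneous
  exact g_preimage_basicOpen k hd

theorem pOpen_inf (h h' : CoverIndex k) : ∃ l : CoverIndex k, pOpen l = pOpen h ⊓ pOpen h' := by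
  obtain ⟨h, i, e, r, hr, rfl⟩ := h
  obtain ⟨h', i', e', r', hr', rfl⟩ := h'
  exact ⟨⟨X i * r * (X i' * r'), i, _, r * (X i' * r'), hr.mul ((isHomogeneous_X k i').mul hr'),
    mul_assoc _ _ _⟩, Proj.basicOpen_mul _ _ _⟩

theorem exists_pOpen_le {U : (PSpace k 2).Opens} {x : S k} (hx : g k x ∈ U) :
    ∃ h : CoverIndex k, g k x ∈ pOpen h ∧ pOpen h ≤ U := by
  obtain ⟨e, f, hf, hfx, hfU⟩ := exists_homogeneous_basicOpen_le
    (𝒜 := homogeneousSubmodule (Fin 3) k) (x := g k x) (U := U) hx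
  obtain ⟨i, hi⟩ := exists_X_notMem k x
  exact ⟨⟨X i * f, i, e, f, hf, rfl⟩,
    mul_notMem _ _ (fun h => hi ((mem_g_iff k x (isHomogeneous_X k i)).mp h)) hfx,
    (Proj.basicOpen_mono _ _ _ (dvd_mul_left _ _)).trans hfU⟩

theorem incl_isHomogeneous {n : ℕ} {a : MvPolynomial (Fin 3) k} (h : incl k a ∈ grading k n) :
    a.IsHomogeneous n := by
  have := DirectSum.decompose_of_mem_same _ h
  rw [decompose_incl] at this
  rw [← incl_injective k this]
  exact homogeneousComponent_isHomogeneous n a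

variable [CharP k 2]

/-- For homogeneous f on the surface D₊(f) = D₊(f²), and f² comes from the plane. The factor xᵢ
makes the product a `CoverIndex`, and p can be any form that does not vanish at x. -/
theorem exists_sOpen_le {U : (S k).Opens} {x : S k} (hx : x ∈ U) (p : MvPolynomial (Fin 3) k)
    {d : ℕ} (hp : p.IsHomogeneous d) (hpx : incl k p ∉ x.asHomogeneousIdeal) :
    ∃ h : CoverIndex k, p ∣ h.1 ∧ x ∈ sOpen h ∧ sOpen h ≤ U := by
  obtain ⟨e, f, hf, hfx, hfU⟩ := exists_homogeneous_basicOpen_le (𝒜 := grading k) (x := x) (U := U) hx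
  obtain ⟨i, hi⟩ := exists_X_notMem k x
  obtain ⟨a, b, rfl⟩ := exists_normalForm k f
  have hsq : (incl k a + incl k b * coord k 3) ^ 2 = incl k (a ^ 2 + b ^ 2 * quartic k) :=
    sq_eq_incl k a b
  have hhom := incl_isHomogeneous (hsq ▸ SetLike.pow_mem_graded 2 hf)
  refine ⟨⟨X i * ((a ^ 2 + b ^ 2 * quartic k) * p), i, _, _, hhom.mul hp, rfl⟩, ⟨X i * (a ^ 2 + b ^ 2 * quartic k), by ring⟩, ?_, ?_⟩
  · change incl k _ ∉ x.asHomogeneousIdeal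
    rw [map_mul, map_mul, ← hsq]
    exact mul_notMem _ x hi (mul_notMem _ x (fun h => hfx (x.isPrime.mem_of_pow_mem 2 h)) hpx)
  · refine le_trans ?_ hfU
    refine Proj.basicOpen_mono _ _ _ ?_
    rw [map_mul, map_mul, ← hsq, pow_two]
    exact ⟨incl k (X i) * ((incl k a + incl k b * coord k 3) * incl k p), by ring⟩

theorem isBasis_sOpen : Opens.IsBasis (Set.range (sOpen (k := k))) := by
  refine Opens.isBasis_iff_nbhd.mpr fun {U x} hx => ?_
  obtain ⟨h, -, hxh, hle⟩ := exists_sOpen_le hx 1 (isHomogeneous_one _ k) (by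
    rw [map_one]; exact (Ideal.ne_top_iff_one _).mp x.isPrime.ne_top)
  exact ⟨_, ⟨h, rfl⟩, hxh, hle⟩

variable (k) in
/-- The generic point of the surface. -/
def eta : ProjectiveSpectrum (grading k) where
  asHomogeneousIdeal := ⊥
  isPrime := by
    rw [HomogeneousIdeal.toIdeal_bot]
    exact Ideal.isPrime_bot
  not_irrelevant_le h := by
    have h1 : coord k 0 ∈ (⊥ : HomogeneousIdeal (grading k)) :=
      h (HomogeneousIdeal.mem_irrelevant_of_mem (grading k) one_pos (coord_mem_grading k 0))
    have h2 : incl k (X 0) = 0 := by rw [incl_X]; exact h1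
    exact X_ne_zero (R := k) (0 : Fin 3) (incl_injective k (h2.trans (map_zero _).symm))

theorem notMem_eta {c : CoordRing k} (hc : c ≠ 0) : c ∉ (eta k).asHomogeneousIdeal := hc

end Basis

/-! ### The inverse image of a twist is the twist by the extended ideal -/

section Pullback

open MvPolynomial

variable {k : Type u} [Field k]

theorem exists_normalForm_of_mem_map {J : Ideal (MvPolynomial (Fin 3) k)} {c : CoordRing k}
    (hc : c ∈ J.map (incl k)) : ∃ a ∈ J, ∃ b ∈ J, c = incl k a + incl k b * coord k 3 := by
  induction hc using Submodule.span_induction with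
  | mem x hx =>
    obtain ⟨a, ha, rfl⟩ := hx
    exact ⟨a, ha, 0, zero_mem _, by simp⟩
  | zero => exact ⟨0, zero_mem _, 0, zero_mem _, by simp⟩
  | add x y _ _ hx hy =>
    obtain ⟨a, ha, b, hb, rfl⟩ := hx
    obtain ⟨a', ha', b', hb', rfl⟩ := hy
    exact ⟨_, add_mem ha ha', _, add_mem hb hb', by simp only [map_add]; ring⟩
  | smul r x _ hx =>
    obtain ⟨a, ha, b, hb, rfl⟩ := hx
    obtain ⟨c, d, rfl⟩ := exists_normalForm k r
    refine ⟨_, add_mem (J.mul_mem_left c ha) (J.mul_mem_left (d * quartic k) hb), _,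
      add_mem (J.mul_mem_left c hb) (J.mul_mem_left d ha), ?_⟩
    simp only [map_add, map_mul, ← coord_three_sq, smul_eq_mul]
    ring

/-- The coefficient of x₃ has degree n − 2; multiplied by xᵢ² it has degree n, uniformly in n. This
is also what is needed when x₃ is replaced by w = x₃/xᵢ². -/
theorem exists_homogeneous_normalForm_of_mem_map {J : Ideal (MvPolynomial (Fin 3) k)}
    {c : CoordRing k} (hc : c ∈ J.map (incl k)) {n : ℕ} (hcn : c ∈ grading k n) (i : Fin 3) :
    ∃ a ∈ J, ∃ b ∈ J, c = incl k a + incl k b * coord k 3 ∧ a.IsHomogeneous n ∧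
      (b * X i ^ 2).IsHomogeneous n := by
  obtain ⟨a, ha, b, hb, rfl⟩ := exists_normalForm_of_mem_map hc
  obtain ⟨a', b', h, ha', hb'⟩ := exists_homogeneous_normalForm k hcn
  obtain ⟨rfl, rfl⟩ := normalForm_inj k h
  refine ⟨a, ha, b, hb, rfl, ha', ?_⟩
  rcases hb' with ⟨-, rfl⟩ | ⟨m, rfl, hb'⟩
  · rw [zero_mul]; exact isHomogeneous_zero _ _ _
  · exact hb'.mul ((isHomogeneous_X k i).pow 2)

theorem notMem_of_mem_preimage {h : CoverIndex k} {x : S k} (hx : x ∈ g k ⁻¹ᵁ pOpen h) :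
    incl k h.1 ∉ x.asHomogeneousIdeal :=
  (g_preimage_pOpen h).le hx

theorem algebraMap_mul_twistPull {J : Ideal (MvPolynomial (Fin 3) k)} {n : ℤ}
    {U : (PSpace k 2).Opens} {m : twistSections (homogeneousSubmodule (Fin 3) k) J n (op U)}
    {a b : MvPolynomial (Fin 3) k}
    (hm : ∀ y : U, algebraMap _ (LocAt (homogeneousSubmodule (Fin 3) k) y.1) b * m.1 y =
      algebraMap _ _ a) (x : S k) (hx : x ∈ g k ⁻¹ᵁ U) :
    algebraMap _ (LocAt (grading k) x) (incl k b) * (twistPull k J n U m).1 ⟨x, hx⟩ =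
      algebraMap _ _ (incl k a) :=
  ((congrArg (· * _) (locMap_algebraMap k x b)).symm.trans
    (map_mul (locMap k x) _ _).symm).trans ((congrArg (locMap k x)
      (hm ⟨g k x, hx⟩)).trans (locMap_algebraMap k x a))

theorem algebraMap_mul_app {U : (PSpace k 2).Opens} {r : Γ(PSpace k 2, U)}
    {a b : MvPolynomial (Fin 3) k}
    (hr : ∀ y : U, algebraMap _ (LocAt (homogeneousSubmodule (Fin 3) k) y.1) b *
      regVal (U := op U) r y = algebraMap _ _ a) (x : S k) (hx : x ∈ g k ⁻¹ᵁ U) :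
    algebraMap _ (LocAt (grading k) x) (incl k b) *
      regVal (U := op (g k ⁻¹ᵁ U)) ((g k).app U r) ⟨x, hx⟩ = algebraMap _ _ (incl k a) :=
  algebraMap_mul_regVal_g k r x hx (hr ⟨g k x, hx⟩)

theorem eq_zero_of_fraction_zero {A : Type u} [CommRing A] [Algebra k A] {𝒜 : ℕ → Submodule k A}
    [GradedAlgebra 𝒜] {J : Ideal A} {n : ℤ} {U : (Opens (ProjectiveSpectrum.top 𝒜))ᵒᵖ}
    {m : twistSections 𝒜 J n U} {b : A} (hb : ∀ x : U.unop, b ∉ x.1.asHomogeneousIdeal)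
    (hm : ∀ x : U.unop, algebraMap A (LocAt 𝒜 x.1) b * m.1 x = algebraMap A _ 0) : m = 0 :=
  Subtype.ext <| funext fun x => eq_of_algebraMap_mul_eq (hb x) (by
    rw [hm x, map_zero]; exact (mul_zero _).symm)

variable [CharP k 2]

/-- The map `J(n)~ → g_* (JC)(n)~` on sections. -/
def twistPullApp (J : Ideal (MvPolynomial (Fin 3) k)) (n : ℤ) (U : (PSpace k 2).Opens) :
    Γ(twist (homogeneousSubmodule (Fin 3) k) J n, U) →+
      Γ(twist (grading k) (J.map (incl k)) n, g k ⁻¹ᵁ U) :=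
  ((twistPullHom k J n).app U).hom

set_option maxHeartbeats 1000000 in
/-- On a principal open subset the double cover has the basis `1, w` with `w` a square root. -/
theorem exists_basis_one_sqrt (J : Ideal (MvPolynomial (Fin 3) k)) (n : ℤ) (h : CoverIndex k) :
    ∃ (w : Γ(S k, g k ⁻¹ᵁ pOpen h)) (q : Γ(PSpace k 2, pOpen h)), w ^ 2 = (g k).app (pOpen h) q ∧
      (∀ b : Γ(S k, g k ⁻¹ᵁ pOpen h), ∃ r r' : Γ(PSpace k 2, pOpen h),
        b = (g k).app (pOpen h) r + (g k).app (pOpen h) r' * w) ∧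
      (∀ s, ∃ m m', s = twistPullApp J n (pOpen h) m + w • twistPullApp J n (pOpen h) m') ∧
      ∀ m m', twistPullApp J n (pOpen h) m + w • twistPullApp J n (pOpen h) m' = 0 →
        m = 0 ∧ m' = 0 := by
  obtain ⟨i, e, r, hr, hf⟩ := h.2
  have hhom : h.1.IsHomogeneous (1 + e) := hf ▸ (isHomogeneous_X k i).mul hr
  have hhN (N : ℕ) : h.1 ^ N ∈ homogeneousSubmodule (Fin 3) k (N * (1 + e)) :=
    SetLike.pow_mem_graded (A := homogeneousSubmodule (Fin 3) k) N hhom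
  have hX := (isHomogeneous_X k i).pow (R := k) 2
  have hpU (y : (op (pOpen h)).unop) : h.1 ∉ y.1.asHomogeneousIdeal := y.2
  have hpX (y : (op (pOpen h)).unop) : X i ^ 2 ∉ y.1.asHomogeneousIdeal := by
    refine pow_notMem (fun hy => hpU y ?_) 2
    rw [hf]
    exact Ideal.mul_mem_right r y.1.asHomogeneousIdeal.toIdeal hy
  have hsU (x : (op (g k ⁻¹ᵁ pOpen h)).unop) : incl k h.1 ∉ x.1.asHomogeneousIdeal :=
    notMem_of_mem_preimage x.2
  have hsX (x : (op (g k ⁻¹ᵁ pOpen h)).unop) : incl k (X i ^ 2) ∉ x.1.asHomogeneousIdeal := by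
    rw [map_pow]
    refine pow_notMem (fun hy => hsU x ?_) 2
    rw [hf, map_mul]
    exact Ideal.mul_mem_right (incl k r) x.1.asHomogeneousIdeal.toIdeal hy
  -- The square root is w = x₃/xᵢ², and its square is q = F/xᵢ⁴, a function on the plane.
  obtain ⟨w, hw⟩ := exists_reg (U := op (g k ⁻¹ᵁ pOpen h)) (coord_mem_grading k 3)
    (incl_mem_grading k hX) hsX
  have hquartic : (quartic k).IsHomogeneous 4 :=
    (((isHomogeneous_X k 0).mul (isHomogeneous_X k 1)).mul (isHomogeneous_X k 2)).mul
      (((isHomogeneous_X k 0).add (isHomogeneous_X k 1)).add (isHomogeneous_X k 2))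
  obtain ⟨q, hq⟩ := exists_reg (𝒜 := homogeneousSubmodule (Fin 3) k) (U := op (pOpen h)) hquartic
    (((isHomogeneous_X k i).pow (R := k) 4)) (b := X i ^ 4)
    (fun y => by rw [show (X i ^ 4 : MvPolynomial (Fin 3) k) = (X i ^ 2) ^ 2 by ring]
                 exact pow_notMem (hpX y) 2)
  have hqs := algebraMap_mul_app (k := k) (r := q) hq
  refine ⟨w, q, ?_, ?_, fun s => ?_, fun m m' hmm => ?_⟩
  · refine reg_ext fun x => ?_
    have h1 := hw x
    have h2 := hqs x.1 x.2
    change regVal (U := op (g k ⁻¹ᵁ pOpen h)) (w ^ 2) x = regVal ((g k).app (pOpen h) q) x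
    have h3 : regVal (U := op (g k ⁻¹ᵁ pOpen h)) (w ^ 2) x = regVal w x * regVal w x := by
      rw [pow_two]
      exact HomogeneousLocalization.val_mul _ _
    refine h3.trans (eq_of_algebraMap_mul_eq (pow_notMem (hsX x) 2) ?_)
    rw [← map_pow, show (X i ^ 2 : MvPolynomial (Fin 3) k) ^ 2 = X i ^ 4 by ring]
    refine Eq.trans ?_ h2.symm
    rw [← coord_three_sq, map_pow _ (coord k 3), ← h1]
    simp only [map_pow]
    ring
  · intro b
    obtain ⟨N, a, ha, hb⟩ := exists_reg_fraction (by omega) (incl_mem_grading k hhom)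
      (g_preimage_pOpen h) b
    obtain ⟨a0, -, a1, -, rfl, h0, h1⟩ := exists_homogeneous_normalForm_of_mem_map
      (J := ⊤) (by rw [Ideal.map_top]; trivial) ha i
    obtain ⟨r0, hr0⟩ := exists_reg (U := op (pOpen h)) h0
      (hhN N) (fun y => pow_notMem (hpU y) N)
    obtain ⟨r1, hr1⟩ := exists_reg (U := op (pOpen h)) h1
      (hhN N) (fun y => pow_notMem (hpU y) N)
    refine ⟨r0, r1, reg_ext fun x => ?_⟩
    have e0 := algebraMap_mul_app hr0 x.1 x.2
    have e1 := algebraMap_mul_app hr1 x.1 x.2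
    have e2 := hw x
    have e3 := hb x
    have e4 : regVal (U := op (g k ⁻¹ᵁ pOpen h))
        ((g k).app (pOpen h) r0 + (g k).app (pOpen h) r1 * (show Γ(S k, g k ⁻¹ᵁ pOpen h) from w)) x =
        regVal ((g k).app (pOpen h) r0) x + regVal ((g k).app (pOpen h) r1) x * regVal w x :=
      (HomogeneousLocalization.val_add _ _).trans
        (congrArg _ (HomogeneousLocalization.val_mul _ _))
    refine Eq.trans ?_ e4.symm
    refine eq_of_algebraMap_mul_eq (mul_notMem _ _ (hsX x) (pow_notMem (hsU x) N)) ?_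
    obtain ⟨v0, h0, h0'⟩ : ∃ v, regVal (U := op (g k ⁻¹ᵁ pOpen h)) ((g k).app (pOpen h) r0) x = v ∧
        algebraMap _ (LocAt (grading k) x.1) (incl k (h.1 ^ N)) * v = algebraMap _ _ (incl k a0) :=
      ⟨_, rfl, e0⟩
    obtain ⟨v1, h1, h1'⟩ : ∃ v, regVal (U := op (g k ⁻¹ᵁ pOpen h)) ((g k).app (pOpen h) r1) x = v ∧
        algebraMap _ (LocAt (grading k) x.1) (incl k (h.1 ^ N)) * v =
          algebraMap _ _ (incl k (a1 * X i ^ 2)) :=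
      ⟨_, rfl, e1⟩
    rw [h0, h1]
    simp only [map_mul, map_add, map_pow] at h0' h1' e2 e3 ⊢
    linear_combination (algebraMap _ (LocAt (grading k) x.1) (incl k (X i))) ^ 2 * (e3 - h0') -
      (algebraMap _ (LocAt (grading k) x.1) (incl k (X i))) ^ 2 * regVal w x * h1' -
      algebraMap _ (LocAt (grading k) x.1) (incl k a1) *
        (algebraMap _ (LocAt (grading k) x.1) (incl k (X i))) ^ 2 * e2
  · obtain ⟨N, j, a, hj, ha, haJ, hb⟩ := exists_fraction (by omega) (incl_mem_grading k hhom)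
      (g_preimage_pOpen h) s
    obtain ⟨a0, ha0, a1, ha1, rfl, h0, h1⟩ := exists_homogeneous_normalForm_of_mem_map haJ ha i
    obtain ⟨m0, hm0⟩ := exists_twistSection (U := op (pOpen h)) J n hj h0
      (hhN N) ha0 (fun y => pow_notMem (hpU y) N)
    obtain ⟨m1, hm1⟩ := exists_twistSection (U := op (pOpen h)) J n hj h1
      (hhN N) (J.mul_mem_right _ ha1) (fun y => pow_notMem (hpU y) N)
    refine ⟨m0, m1, Subtype.ext <| funext fun x => ?_⟩
    have e0 := algebraMap_mul_twistPull hm0 x.1 x.2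
    have e1 := algebraMap_mul_twistPull hm1 x.1 x.2
    have e2 := hw x
    have e3 := hb x
    change s.1 x = (twistPull k J n (pOpen h) m0).1 ⟨x.1, x.2⟩ +
      regVal w x * (twistPull k J n (pOpen h) m1).1 ⟨x.1, x.2⟩
    refine eq_of_algebraMap_mul_eq (mul_notMem _ _ (hsX x) (pow_notMem (hsU x) N)) ?_
    simp only [map_mul, map_add, map_pow] at e0 e1 e2 e3 ⊢
    linear_combination (algebraMap _ (LocAt (grading k) x.1) (incl k (X i))) ^ 2 * (e3 - e0) -
      (algebraMap _ (LocAt (grading k) x.1) (incl k (X i))) ^ 2 * regVal w x * e1 -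
      algebraMap _ (LocAt (grading k) x.1) (incl k a1) *
        (algebraMap _ (LocAt (grading k) x.1) (incl k (X i))) ^ 2 * e2
  · by_cases hh : h.1 = 0
    · have h0 (y : (op (pOpen h)).unop) : False := hpU y (by rw [hh]; exact zero_mem _)
      exact ⟨Subtype.ext <| funext fun y => (h0 y).elim, Subtype.ext <| funext fun y => (h0 y).elim⟩
    obtain ⟨N, j, a, hj, ha, -, hb⟩ := exists_fraction (U := op (pOpen h)) (by omega) hhom rfl m
    obtain ⟨N', j', a', hj', ha', -, hb'⟩ := exists_fraction (U := op (pOpen h)) (by omega) hhom rfl m'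
    -- For uniqueness denominators are cleared at the generic point, where the vanishing of m + wm'
    -- becomes the vanishing of a normal form.
    have hx : eta k ∈ g k ⁻¹ᵁ pOpen h := (g_preimage_pOpen h).ge
      (notMem_eta ((map_ne_zero_iff _ (incl_injective k)).mpr hh))
    obtain ⟨v, v', z, e0, e1, e2, e3⟩ : ∃ v v' z : LocAt (grading k) (eta k),
        algebraMap _ (LocAt (grading k) (eta k)) (incl k (h.1 ^ N)) * v =
          algebraMap _ _ (incl k a) ∧
        algebraMap _ (LocAt (grading k) (eta k)) (incl k (h.1 ^ N')) * v' =
          algebraMap _ _ (incl k a') ∧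
        algebraMap _ (LocAt (grading k) (eta k)) (incl k (X i ^ 2)) * z =
          algebraMap _ _ (coord k 3) ∧ v + z * v' = 0 :=
      ⟨_, _, _, algebraMap_mul_twistPull hb _ hx, algebraMap_mul_twistPull hb' _ hx, hw ⟨_, hx⟩,
        congr($(hmm).1 ⟨_, hx⟩)⟩
    have key : incl k (h.1 ^ N' * X i ^ 2 * a) + incl k (h.1 ^ N * a') * coord k 3 = 0 := by
      refine algebraMap_locAt_injective (eta k) ?_
      rw [map_mul (incl k), map_mul (incl k), map_mul (incl k), map_add, map_mul, map_mul, map_mul,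
        map_mul, map_zero, ← e0, ← e1, ← e2]
      linear_combination algebraMap _ (LocAt (grading k) (eta k)) (incl k (h.1 ^ N)) *
        algebraMap _ (LocAt (grading k) (eta k)) (incl k (h.1 ^ N')) *
        algebraMap _ (LocAt (grading k) (eta k)) (incl k (X i ^ 2)) * e3
    obtain ⟨ha0, ha0'⟩ := normalForm_eq_zero k key
    have hX0 : (X i : MvPolynomial (Fin 3) k) ≠ 0 := X_ne_zero i
    obtain rfl : a = 0 := (mul_eq_zero.mp ha0).resolve_left
      (mul_ne_zero (pow_ne_zero _ hh) (pow_ne_zero _ hX0))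
    obtain rfl : a' = 0 := (mul_eq_zero.mp ha0').resolve_left (pow_ne_zero _ hh)
    exact ⟨eq_zero_of_fraction_zero (fun y => pow_notMem (hpU y) N) hb,
      eq_zero_of_fraction_zero (fun y => pow_notMem (hpU y) N') hb'⟩

theorem isUniversalSemilinear_twistPull (J : Ideal (MvPolynomial (Fin 3) k)) (n : ℤ)
    (h : CoverIndex k) : IsUniversalSemilinear ((g k).app (pOpen h)).hom
      (M := Γ(twist (homogeneousSubmodule (Fin 3) k) J n, pOpen h))
      (N := Γ(twist (grading k) (J.map (incl k)) n, g k ⁻¹ᵁ pOpen h))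
      ((twistPullHom k J n).app (pOpen h)) := by
  obtain ⟨w, q, h1, h2, h3, h4⟩ := exists_basis_one_sqrt J n h
  exact IsUniversalSemilinear.of_basis_one_sqrt (φ := twistPullApp J n (pOpen h))
    (fun r m => Scheme.Modules.Hom.app_smul (twistPullHom k J n) r m) w q h1 h2 h3 h4

theorem isIso_twistPullHom (J : Ideal (MvPolynomial (Fin 3) k)) (n : ℤ) :
    IsIso (((Scheme.Modules.pullbackPushforwardAdjunction (g k)).homEquiv _ _).symm
      (twistPullHom k J n)) := by
  refine isIso_homEquiv_symm_of_basis (g k) _ (pOpen (k := k)) ?_ pOpen_inf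
    (fun U y => exists_pOpen_le) (isUniversalSemilinear_twistPull J n)
  have : (fun h : CoverIndex k => g k ⁻¹ᵁ pOpen h) = sOpen := funext g_preimage_pOpen
  rw [this]
  exact isBasis_sOpen

end Pullback

/-! ### Étale quadratic equations and the affine surface w² = yz(1 + y + z) -/

section Quadratic

variable {A L : Type u} [CommRing A] [CommRing L] [Algebra A L]

/-- In characteristic two, an algebra that is generated by a root of a quadratic polynomial
`α t² + β t + γ` with `β` invertible is formally étale. -/
theorem formallyEtale_of_quadratic (h2 : (2 : A) = 0) (α β γ : A) (t : L)
    (hβ : IsUnit (algebraMap A L β))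
    (ht : algebraMap A L α * t ^ 2 + algebraMap A L β * t + algebraMap A L γ = 0)
    (hlift : ∀ (T : Type u) [CommRing T] [Algebra A T] (t' : T),
      algebraMap A T α * t' ^ 2 + algebraMap A T β * t' + algebraMap A T γ = 0 →
      IsUnit (algebraMap A T β) → ∃ φ : L →ₐ[A] T, φ t = t')
    (hext : ∀ (T : Type u) [CommRing T] [Algebra A T] (φ φ' : L →ₐ[A] T), φ t = φ' t → φ = φ') :
    Algebra.FormallyEtale A L := by
  refine Algebra.FormallyEtale.iff_comp_bijective.mpr fun T _ _ I hI => ?_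
  have h2T : (2 : T) = 0 := by
    have := congrArg (algebraMap A T) h2
    rwa [map_ofNat, map_zero] at this
  have hmul {a b : T} (ha : a ∈ I) (hb : b ∈ I) : a * b = 0 := by
    have := Ideal.mul_mem_mul ha hb
    rwa [← pow_two, hI] at this
  have hunit (φ : L →ₐ[A] T ⧸ I) : IsUnit (algebraMap A T β) := by
    have h1 : IsUnit (Ideal.Quotient.mk I (algebraMap A T β)) := by
      have := hβ.map φ
      rwa [AlgHom.commutes] at this
    obtain ⟨c, hc⟩ := Ideal.Quotient.mk_surjective (↑h1.unit⁻¹ : T ⧸ I)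
    have h3 : algebraMap A T β * c - 1 ∈ I := by
      rw [← Ideal.Quotient.eq, map_mul, hc, map_one]
      exact h1.mul_val_inv
    -- If βc = 1 + ε with ε² = 0, then c(1 − ε) is an inverse of β.
    refine IsUnit.of_mul_eq_one (c * (2 - algebraMap A T β * c)) ?_
    linear_combination - hmul h3 h3
  constructor
  · intro φ φ' h
    refine hext T φ φ' ?_
    have hd : φ t - φ' t ∈ I := by
      rw [← Ideal.Quotient.eq]
      exact congr($h t)
    have h1 := congrArg φ ht
    have h3 := congrArg φ' ht
    simp only [map_add, map_mul, map_pow, AlgHom.commutes, map_zero] at h1 h3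
    refine sub_eq_zero.mp ((hunit ((Ideal.Quotient.mkₐ A I).comp φ)).mul_left_cancel ?_)
    linear_combination h1 - h3 - algebraMap A T α * hmul hd hd +
      algebraMap A T α * φ' t * (φ' t - φ t) * h2T
  · intro φ
    obtain ⟨t₀, ht₀⟩ := Ideal.Quotient.mk_surjective (φ t)
    obtain ⟨b, hb⟩ := (hunit φ).exists_right_inv
    set f := algebraMap A T α * t₀ ^ 2 + algebraMap A T β * t₀ + algebraMap A T γ with hf
    have hfI : f ∈ I := by
      rw [← Ideal.Quotient.eq_zero_iff_mem]
      have h1 := congrArg φ ht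
      simp only [map_add, map_mul, map_pow, AlgHom.commutes, map_zero, ← ht₀] at h1
      rw [hf]
      simp only [map_add, map_mul, map_pow]
      exact h1
    -- A Newton step: in characteristic two the derivative of the quadratic is β, with inverse b,
    -- and the error left after the correction is a multiple of f² = 0.
    obtain ⟨ψ, hψ⟩ := hlift T (t₀ + b * f) (by
      linear_combination f * hb + algebraMap A T α * b ^ 2 * hmul hfI hfI +
        (algebraMap A T α * t₀ * b * f + f) * h2T + (-1) * hf) (hunit φ)
    refine ⟨ψ, hext (T ⧸ I) _ _ ?_⟩
    change Ideal.Quotient.mk I (ψ t) = φ t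
    rw [hψ, ← ht₀, map_add, map_mul, Ideal.Quotient.eq_zero_iff_mem.mpr hfI, mul_zero, add_zero]

end Quadratic

section SmoothPolynomial

theorem isStandardSmooth_mvPolynomial (k : Type u) [CommRing k] [Nontrivial k] (n : ℕ) :
    Algebra.IsStandardSmoothOfRelativeDimension n k (MvPolynomial (Fin n) k) := by
  have : Algebra.IsStandardSmooth k (MvPolynomial (Fin n) k) :=
    .of_basis_kaehlerDifferential (KaehlerDifferential.mvPolynomialBasis k (Fin n)) (by
      rintro _ ⟨i, rfl⟩
      exact ⟨MvPolynomial.X i, (KaehlerDifferential.mvPolynomialBasis_apply k (Fin n) i).symm⟩)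
  rw [Algebra.IsStandardSmoothOfRelativeDimension.iff_of_isStandardSmooth,
    rank_eq_card_basis (KaehlerDifferential.mvPolynomialBasis k (Fin n))]
  simp

end SmoothPolynomial

section Chart

variable {k R : Type u} [Field k] [CommRing R]

/-- The `k`-algebra `R` is generated by `y, z, w` with the only relation `w² = y z (1 + y + z)`. -/
structure IsChart (κ : k →+* R) (y z w : R) : Prop where
  sq : w ^ 2 = y * z * (1 + y + z)
  surj (r : R) : ∃ P : MvPolynomial (Fin 3) k, P.eval₂ κ ![y, z, w] = r
  exists_lift (T : Type u) [CommRing T] (κ' : k →+* T) (y' z' w' : T) :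
    w' ^ 2 = y' * z' * (1 + y' + z') →
      ∃ φ : R →+* T, φ.comp κ = κ' ∧ φ y = y' ∧ φ z = z' ∧ φ w = w'

variable {κ : k →+* R} {y z w : R}

theorem IsChart.hom_ext (h : IsChart κ y z w) {T : Type*} [CommRing T] {φ φ' : R →+* T}
    (hκ : φ.comp κ = φ'.comp κ) (hy : φ y = φ' y) (hz : φ z = φ' z) (hw : φ w = φ' w) :
    φ = φ' := by
  ext r
  obtain ⟨P, rfl⟩ := h.surj r
  rw [MvPolynomial.hom_eval₂, MvPolynomial.hom_eval₂, hκ]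
  congr 1
  funext i
  fin_cases i
  exacts [hy, hz, hw]

/-- The origin y = z = w = 0 has residue field k: every function is its constant term modulo y, z,
w. -/
theorem IsChart.exists_sub_mem (h : IsChart κ y z w) (r : R) :
    ∃ c : k, r - κ c ∈ Ideal.span {y, z, w} := by
  obtain ⟨P, rfl⟩ := h.surj r
  induction P using MvPolynomial.induction_on with
  | C c => exact ⟨c, by simp⟩
  | add p q hp hq =>
    obtain ⟨c, hc⟩ := hp
    obtain ⟨d, hd⟩ := hq
    refine ⟨c + d, ?_⟩
    rw [MvPolynomial.eval₂_add, map_add, add_sub_add_comm]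
    exact add_mem hc hd
  | mul_X p i _ =>
    refine ⟨0, ?_⟩
    rw [MvPolynomial.eval₂_mul, MvPolynomial.eval₂_X, map_zero, sub_zero]
    refine Ideal.mul_mem_left _ _ (Ideal.subset_span ?_)
    fin_cases i <;> simp

variable [CharP k 2]

theorem IsChart.two_eq_zero (_ : IsChart κ y z w) : (2 : R) = 0 := by
  have := congrArg κ (CharTwo.two_eq_zero (R := k))
  rwa [map_ofNat, map_zero] at this

/-- For idempotent a, b, translating (y, z) by (a, b) changes yz(1 + y + z) by a square, namely that
of b(y + a) + a(z + b) + ab; adding this to w restores the equation. So the translations by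
𝔽₂-points act on the chart, and any 𝔽₂-point can be made the origin. -/
theorem IsChart.translate (h : IsChart κ y z w) {a b : k} (ha : a ^ 2 = a) (hb : b ^ 2 = b) :
    IsChart κ (y + κ a) (z + κ b) (w + κ b * (y + κ a) + κ a * (z + κ b) + κ (a * b)) := by
  have hR := h.two_eq_zero
  have key (T : Type u) [CommRing T] (h2 : (2 : T) = 0) (a b y z : T) (ha : a ^ 2 = a)
      (hb : b ^ 2 = b) : y * z * (1 + y + z) + (b * (y + a) + a * (z + b) + a * b) ^ 2 =
        (y + a) * (z + b) * (1 + (y + a) + (z + b)) := by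
    grind
  have sqadd (T : Type u) [CommRing T] (h2 : (2 : T) = 0) (s t : T) :
      (s + t) ^ 2 = s ^ 2 + t ^ 2 := by linear_combination s * t * h2
  refine ⟨?_, fun r => ?_, fun T _ κ' y' z' w' hw => ?_⟩
  · rw [add_assoc, add_assoc, sqadd R hR, h.sq, ← key R hR (κ a) (κ b) y z
      (by rw [← map_pow, ha]) (by rw [← map_pow, hb]), map_mul]
    ring
  · obtain ⟨P, rfl⟩ := h.surj r
    -- The substitution inverse to the translation.
    refine ⟨MvPolynomial.bind₁ ![.X 0 - .C a, .X 1 - .C b,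
      .X 2 - .C b * .X 0 - .C a * .X 1 - .C (a * b)] P, ?_⟩
    change MvPolynomial.eval₂Hom κ _ (MvPolynomial.bind₁ _ P) = _
    rw [MvPolynomial.eval₂Hom_bind₁]
    change MvPolynomial.eval₂ _ _ _ = _
    congr 1
    funext i
    fin_cases i <;> simp
    ring
  · have h2 : (2 : T) = 0 := by
      have := congrArg κ' (CharTwo.two_eq_zero (R := k))
      rwa [map_ofNat, map_zero] at this
    obtain ⟨φ, hφ, hy, hz, hw⟩ := h.exists_lift T κ' (y' + κ' a) (z' + κ' b)
      (w' + (κ' b * y' + κ' a * z' + κ' (a * b))) (by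
        rw [← key T h2 (κ' a) (κ' b) y' z' (by rw [← map_pow, ha]) (by rw [← map_pow, hb]),
          sqadd T h2, hw, map_mul]
        linear_combination -(2 * κ' a * κ' b * (κ' b * y' + κ' a * z' + κ' a * κ' b) +
          2 * (κ' a * κ' b) ^ 2) * h2)
    have hφ' (c : k) : φ (κ c) = κ' c := congr($hφ c)
    have h0 (c : k) : κ' c + κ' c = 0 := by rw [← two_mul, h2, zero_mul]
    refine ⟨φ, hφ, ?_, ?_, ?_⟩
    · rw [map_add, hy, hφ', add_assoc, h0, add_zero]
    · rw [map_add, hz, hφ', add_assoc, h0, add_zero]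
    · simp only [map_add, map_mul, hy, hz, hw, hφ']
      linear_combination (κ' b * y' + κ' a * z' + 3 * κ' a * κ' b) * h2

end Chart

section Chart

variable {k R : Type u} [Field k] [CommRing R] {κ : k →+* R} {y z w : R}

theorem IsChart.finiteType (h : IsChart κ y z w) : κ.FiniteType := by
  algebraize [κ]
  refine Algebra.FiniteType.of_surjective (MvPolynomial.aeval (R := k) ![y, z, w]) fun r => ?_
  obtain ⟨P, hP⟩ := h.surj r
  exact ⟨P, hP⟩

theorem IsChart.finiteType_away (h : IsChart κ y z w) (L : Type u) [CommRing L] [Algebra R L]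
    (f : R) [IsLocalization.Away f L] : ((algebraMap R L).comp κ).FiniteType := by
  have h1 : (algebraMap R L).FiniteType := by
    rw [RingHom.finiteType_algebraMap]
    have := IsLocalization.Away.finitePresentation f (S := L)
    infer_instance
  exact h1.comp h.finiteType

theorem IsChart.hom_ext_away (h : IsChart κ y z w) {L : Type u} [CommRing L] [Algebra R L]
    (f : R) [IsLocalization.Away f L] {T : Type*} [CommRing T] {φ φ' : L →+* T}
    (hκ : φ.comp ((algebraMap R L).comp κ) = φ'.comp ((algebraMap R L).comp κ))
    (hy : φ (algebraMap R L y) = φ' (algebraMap R L y))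
    (hz : φ (algebraMap R L z) = φ' (algebraMap R L z))
    (hw : φ (algebraMap R L w) = φ' (algebraMap R L w)) : φ = φ' :=
  IsLocalization.ringHom_ext (.powers f)
    (h.hom_ext (φ := φ.comp (algebraMap R L)) (φ' := φ'.comp (algebraMap R L)) hκ hy hz hw)

theorem IsChart.exists_lift_away (h : IsChart κ y z w) {L : Type u} [CommRing L] [Algebra R L]
    (f : R) [IsLocalization.Away f L] {T : Type u} [CommRing T] (κ' : k →+* T) (y' z' w' : T)
    (hT : w' ^ 2 = y' * z' * (1 + y' + z'))
    (hf : ∀ φ : R →+* T, φ.comp κ = κ' → φ y = y' → φ z = z' → φ w = w' → IsUnit (φ f)) :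
    ∃ φ : L →+* T, φ.comp ((algebraMap R L).comp κ) = κ' ∧ φ (algebraMap R L y) = y' ∧
      φ (algebraMap R L z) = z' ∧ φ (algebraMap R L w) = w' := by
  obtain ⟨φ, hκ, hy, hz, hw⟩ := h.exists_lift T κ' y' z' w' hT
  have hu := hf φ hκ hy hz hw
  refine ⟨IsLocalization.Away.lift f hu, ?_, ?_, ?_, ?_⟩
  · rw [← RingHom.comp_assoc, IsLocalization.Away.lift_comp, hκ]
  · rw [IsLocalization.Away.lift_eq, hy]
  · rw [IsLocalization.Away.lift_eq, hz]
  · rw [IsLocalization.Away.lift_eq, hw]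

variable [CharP k 2]

/-- Read as an equation for y over k[z, w], the relation is zy² + z(1 + z)y + w² = 0. Where z(1 + z)
is invertible, the chart is therefore étale over the plane with coordinates z, w. -/
theorem IsChart.isStandardSmooth (h : IsChart κ y z w) (L : Type u) [CommRing L] [Algebra R L]
    [IsLocalization.Away (z * (1 + z)) L] :
    ((algebraMap R L).comp κ).IsStandardSmoothOfRelativeDimension 2 := by
  set κL := (algebraMap R L).comp κ with hκL
  have hfin := h.finiteType_away L (z * (1 + z))
  rw [← hκL] at hfin
  algebraize [κL]
  let A := MvPolynomial (Fin 2) k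
  let : Algebra A L := (MvPolynomial.eval₂Hom κL ![algebraMap R L z, algebraMap R L w]).toAlgebra
  have hA (P : A) : algebraMap A L P = P.eval₂ κL ![algebraMap R L z, algebraMap R L w] := rfl
  have : IsScalarTower k A L := .of_algebraMap_eq fun c => (MvPolynomial.eval₂_C _ _ c).symm
  have h2 : (2 : A) = 0 := CharTwo.two_eq_zero
  have hX0 : algebraMap A L (.X 0) = algebraMap R L z := MvPolynomial.eval₂_X _ _ _
  have hX1 : algebraMap A L (.X 1) = algebraMap R L w := MvPolynomial.eval₂_X _ _ _
  have h2L : (2 : L) = 0 := by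
    have := congrArg (algebraMap A L) h2
    rwa [map_ofNat, map_zero] at this
  have hu : IsUnit (algebraMap R L (z * (1 + z))) := IsLocalization.Away.algebraMap_isUnit _
  have hsq := congrArg (algebraMap R L) h.sq
  simp only [map_mul, map_add, map_pow, map_one] at hu hsq
  have : Algebra.FormallyEtale A L := by
    refine formallyEtale_of_quadratic h2 (.X 0) (.X 0 * (1 + .X 0)) (.X 1 ^ 2) (algebraMap R L y)
      ?_ ?_ ?_ ?_
    · simpa only [map_mul, map_add, map_one, hX0] using hu
    · simp only [map_mul, map_add, map_one, map_pow, hX0, hX1]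
      linear_combination hsq + algebraMap R L y * algebraMap R L z * (1 + algebraMap R L y + algebraMap R L z) * h2L
    · intro T _ _ t ht hβ
      simp only [map_mul, map_add, map_one, map_pow] at ht hβ
      have h2T : (2 : T) = 0 := by
        have := congrArg (algebraMap A T) h2
        rwa [map_ofNat, map_zero] at this
      obtain ⟨φ, hκ, hy, hz, hw⟩ := h.exists_lift_away (L := L) (z * (1 + z)) ((algebraMap A T).comp MvPolynomial.C) t
        (algebraMap A T (.X 0)) (algebraMap A T (.X 1)) (by
          linear_combination ht - algebraMap A T (.X 0) * t * (1 + t + algebraMap A T (.X 0)) * h2T) (by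
          intro φ _ _ hz _
          simpa only [map_mul, map_add, map_one, hz] using hβ)
      refine ⟨{ toRingHom := φ, commutes' := fun P => ?_ }, hy⟩
      change φ (P.eval₂ κL _) = _
      rw [MvPolynomial.hom_eval₂, hκ]
      have : algebraMap A T = MvPolynomial.eval₂Hom ((algebraMap A T).comp MvPolynomial.C)
        (fun i => algebraMap A T (.X i)) := by
        ext i <;> simp
      refine Eq.trans ?_ congr($this.symm P)
      change _ = MvPolynomial.eval₂ _ _ P
      congr 1
      funext i
      fin_cases i
      exacts [hz, hw]
    · intro T _ _ φ φ' ht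
      refine AlgHom.coe_ringHom_injective (h.hom_ext_away (z * (1 + z)) ?_ ht ?_ ?_)
      · ext c
        change φ (algebraMap k L c) = φ' (algebraMap k L c)
        rw [IsScalarTower.algebraMap_apply k A L]
        exact (φ.commutes _).trans (φ'.commutes _).symm
      · change φ _ = φ' _
        rw [← hX0, φ.commutes, φ'.commutes]
      · change φ _ = φ' _
        rw [← hX1, φ.commutes, φ'.commutes]
  have : Algebra.FinitePresentation k L := Algebra.FinitePresentation.of_finiteType.mp inferInstance
  have : Algebra.FinitePresentation A L := .of_restrict_scalars_finitePresentation k A L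
  have : Algebra.Etale A L := {}
  have := isStandardSmooth_mvPolynomial k 2
  have : Algebra.IsStandardSmoothOfRelativeDimension 0 A L :=
    Algebra.Etale.iff_isStandardSmoothOfRelativeDimension_zero.mp inferInstance
  exact Algebra.IsStandardSmoothOfRelativeDimension.trans 2 0 k A L

/-- The map from the coordinate ring of the cone to a chart. -/
theorem IsChart.exists_etale_cone (h : IsChart κ y z w) (L : Type u) [CommRing L] [Algebra R L]
    [IsLocalization.Away (1 + y) L] : ∃ φ : ConeRing k →+* L, φ.Etale ∧
      φ.comp (algebraMap k (ConeRing k)) = (algebraMap R L).comp κ ∧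
      ∀ i, φ (Ideal.Quotient.mk _ (MvPolynomial.X i)) =
        algebraMap R L (![y, z * (1 + y + z), w] i) := by
  set κL := (algebraMap R L).comp κ with hκL
  have hfin := h.finiteType_away L (1 + y)
  rw [← hκL] at hfin
  algebraize [κL]
  have hR := h.two_eq_zero
  let φ : ConeRing k →ₐ[k] L := Ideal.Quotient.liftₐ _
    (MvPolynomial.aeval fun i => algebraMap R L (![y, z * (1 + y + z), w] i)) (by
      intro a ha
      obtain ⟨b, rfl⟩ := Ideal.mem_span_singleton.mp ha
      rw [map_mul]
      refine mul_eq_zero_of_left ?_ _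
      simp only [map_sub, map_mul, map_pow, MvPolynomial.aeval_X, Matrix.cons_val]
      simp only [← map_mul, ← map_pow, ← map_sub]
      rw [h.sq, ← map_zero (algebraMap R L)]
      congr 1
      ring)
  have hφ (i) : φ (Ideal.Quotient.mk _ (MvPolynomial.X i)) =
      algebraMap R L (![y, z * (1 + y + z), w] i) := MvPolynomial.aeval_X _ i
  refine ⟨φ.toRingHom, ?_, ?_, hφ⟩
  swap
  · ext c; exact φ.commutes c
  let : Algebra (ConeRing k) L := φ.toRingHom.toAlgebra
  have hX0 : algebraMap (ConeRing k) L (Ideal.Quotient.mk _ (MvPolynomial.X 0)) =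
    algebraMap R L y := hφ 0
  have hX1 : algebraMap (ConeRing k) L (Ideal.Quotient.mk _ (MvPolynomial.X 1)) =
    algebraMap R L (z * (1 + y + z)) := hφ 1
  have hX2 : algebraMap (ConeRing k) L (Ideal.Quotient.mk _ (MvPolynomial.X 2)) =
    algebraMap R L w := hφ 2
  have : IsScalarTower k (ConeRing k) L := .of_algebraMap_eq fun c => (φ.commutes c).symm
  have h2 : (2 : ConeRing k) = 0 := by
    have := congrArg (algebraMap k (ConeRing k)) (CharTwo.two_eq_zero (R := k))
    rwa [map_ofNat, map_zero] at this
  have h2L : (2 : L) = 0 := by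
    have := congrArg (algebraMap _ L) h2
    rwa [map_ofNat, map_zero] at this
  have hu : IsUnit (algebraMap R L (1 + y)) := IsLocalization.Away.algebraMap_isUnit _
  have : Algebra.FormallyEtale (ConeRing k) L := by
    -- Over the cone with a = y, b = z(1 + y + z), c = w, the coordinate z is a root of z² + (1 +
    -- a)z + b, whose derivative is 1 + a.
    refine formallyEtale_of_quadratic h2 1 (1 + Ideal.Quotient.mk _ (.X 0))
      (Ideal.Quotient.mk _ (.X 1)) (algebraMap R L z) ?_ ?_ ?_ ?_
    · rw [map_add, hX0, map_one]
      simpa using hu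
    · rw [map_add, hX0, hX1, map_one]
      simp only [map_mul, map_add, map_one]
      linear_combination algebraMap R L z * (1 + algebraMap R L y + algebraMap R L z) * h2L
    · intro T _ _ t ht hβ
      have h2T : (2 : T) = 0 := by
        have := congrArg (algebraMap (ConeRing k) T) h2
        rwa [map_ofNat, map_zero] at this
      rw [map_add, map_one] at ht hβ
      have hrel : algebraMap (ConeRing k) T (Ideal.Quotient.mk _ (.X 0)) *
          algebraMap (ConeRing k) T (Ideal.Quotient.mk _ (.X 1)) =
          algebraMap (ConeRing k) T (Ideal.Quotient.mk _ (.X 2)) ^ 2 := by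
        rw [← map_mul, ← map_pow, ← map_mul, ← map_pow]
        congr 1
        exact Ideal.Quotient.eq.mpr (Ideal.mem_span_singleton_self _)
      obtain ⟨ψ, hκ, hy, hz, hw⟩ := h.exists_lift_away (L := L) (1 + y)
        ((algebraMap (ConeRing k) T).comp (algebraMap k (ConeRing k)))
        (algebraMap (ConeRing k) T (Ideal.Quotient.mk _ (.X 0))) t
        (algebraMap (ConeRing k) T (Ideal.Quotient.mk _ (.X 2))) (by
          linear_combination -hrel + algebraMap (ConeRing k) T (Ideal.Quotient.mk _ (.X 0)) * ht -
            algebraMap (ConeRing k) T (Ideal.Quotient.mk _ (.X 0)) * t * (1 + algebraMap (ConeRing k) T (Ideal.Quotient.mk _ (.X 0)) + t) * h2T) (by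
          intro φ _ hy _ _
          simpa only [map_mul, map_add, map_one, hy] using hβ)
      have hc : ψ.comp φ.toRingHom = algebraMap (ConeRing k) T := by
        refine Ideal.Quotient.ringHom_ext (MvPolynomial.ringHom_ext (fun c => ?_) fun i => ?_)
        · refine Eq.trans ?_ congr($hκ c)
          exact congrArg ψ (φ.commutes c)
        · change ψ (φ _) = _
          rw [hφ]
          fin_cases i
          · exact hy
          · change ψ (algebraMap R L (z * (1 + y + z))) = algebraMap (ConeRing k) T (Ideal.Quotient.mk _ (.X 1))
            simp only [map_mul, map_add, map_one, hy, hz]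
            linear_combination ht - algebraMap (ConeRing k) T (Ideal.Quotient.mk _ (.X 1)) * h2T
          · exact hw
      exact ⟨{ toRingHom := ψ, commutes' := fun P => congr($hc P) }, hz⟩
    · intro T _ _ ψ ψ' ht
      refine AlgHom.coe_ringHom_injective (h.hom_ext_away (1 + y) ?_ ?_ ht ?_)
      · ext c
        change ψ (algebraMap k L c) = ψ' (algebraMap k L c)
        rw [IsScalarTower.algebraMap_apply k (ConeRing k) L]
        exact (ψ.commutes _).trans (ψ'.commutes _).symm
      · change ψ _ = ψ' _
        rw [← hX0, ψ.commutes, ψ'.commutes]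
      · change ψ _ = ψ' _
        rw [← hX2, ψ.commutes, ψ'.commutes]
  have : Algebra.FinitePresentation k L := Algebra.FinitePresentation.of_finiteType.mp inferInstance
  have : Algebra.FinitePresentation (ConeRing k) L := .of_restrict_scalars_finitePresentation k _ L
  have : Algebra.Etale (ConeRing k) L := {}
  exact this

omit [CharP k 2] in
variable (k) in
theorem exists_nilpotent_of_order_three :
    ∃ (T : Type u) (_ : CommRing T) (_ : Algebra k T) (t : T), t ^ 3 = 0 ∧ t ^ 2 ≠ 0 := by
  refine ⟨Polynomial k ⧸ Ideal.span {(Polynomial.X ^ 3 : Polynomial k)}, inferInstance,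
    inferInstance, Ideal.Quotient.mk _ Polynomial.X, ?_, fun h0 => ?_⟩
  · rw [← map_pow]
    exact Ideal.Quotient.eq_zero_iff_mem.mpr (Ideal.mem_span_singleton_self _)
  · rw [← map_pow, Ideal.Quotient.eq_zero_iff_mem, Ideal.mem_span_singleton,
      Polynomial.X_pow_dvd_iff] at h0
    simpa using h0 2 (by norm_num)

omit [CharP k 2] in
/-- No neighbourhood of the origin in a chart is smooth. -/
theorem IsChart.not_formallySmooth (h : IsChart κ y z w) (f : R)
    (hf : f ∉ Ideal.span {y, z, w}) (L : Type u) [CommRing L] [Algebra R L]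
    [IsLocalization.Away f L] : ¬ ((algebraMap R L).comp κ).FormallySmooth := by
  intro hs
  set κL := (algebraMap R L).comp κ with hκL
  algebraize [κL]
  -- Smoothness is tested by lifting modulo t² to a ring with t³ = 0 ≠ t². The point (t, t, 0)
  -- satisfies the equation modulo t², but for every lift yz(1 + y + z) = t² while w² = 0.
  obtain ⟨T, _, _, t, ht, ht2⟩ := exists_nilpotent_of_order_three k
  let I : Ideal T := Ideal.span {t ^ 2}
  have hI : I ^ 2 = ⊥ := by
    rw [Ideal.span_singleton_pow, Ideal.span_singleton_eq_bot]
    linear_combination t * ht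
  have htI : (Ideal.Quotient.mk I t) ^ 2 = 0 := by
    rw [← map_pow]
    exact Ideal.Quotient.eq_zero_iff_mem.mpr (Ideal.mem_span_singleton_self _)
  obtain ⟨c, hc⟩ := h.exists_sub_mem f
  have hc0 : c ≠ 0 := by
    rintro rfl
    rw [map_zero, sub_zero] at hc
    exact hf hc
  obtain ⟨φ, hκ, hy, hz, hw⟩ := h.exists_lift_away (L := L) f (algebraMap k (T ⧸ I))
    (Ideal.Quotient.mk I t) (Ideal.Quotient.mk I t) 0 (by linear_combination -(1 + 2 * Ideal.Quotient.mk I t) * htI) (by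
      intro φ hκ hy hz hw
      have h1 : φ (f - κ c) ∈ Ideal.span {Ideal.Quotient.mk I t} := by
        have : Ideal.span {y, z, w} ≤ (Ideal.span {Ideal.Quotient.mk I t}).comap φ := by
          rw [Ideal.span_le]
          rintro _ (rfl | rfl | rfl)
          · exact hy ▸ Ideal.mem_span_singleton_self _
          · exact hz ▸ Ideal.mem_span_singleton_self _
          · change φ _ ∈ Ideal.span _
            rw [hw]; exact zero_mem _
        exact this hc
      obtain ⟨m, hm⟩ := Ideal.mem_span_singleton.mp h1
      have h2 : φ (κ c) = algebraMap k (T ⧸ I) c := congr($hκ c)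
      rw [map_sub, h2] at hm
      have h3 : IsUnit (algebraMap k (T ⧸ I) c ^ 2) := ((IsUnit.mk0 c hc0).map _).pow 2
      -- The image of f is c + tm with c ≠ 0 and t² = 0; its product with c − tm is c².
      refine isUnit_of_mul_isUnit_left (y := algebraMap k (T ⧸ I) c - Ideal.Quotient.mk I t * m) ?_
      convert h3 using 1
      linear_combination (algebraMap k (T ⧸ I) c - Ideal.Quotient.mk I t * m) * hm - m ^ 2 * htI)
  let φ' : L →ₐ[k] T ⧸ I := { toRingHom := φ, commutes' := fun c => congr($hκ c) }
  obtain ⟨ψ, hψ⟩ := Algebra.FormallySmooth.comp_surjective k L I hI φ'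
  have hmem (l : L) (s : T) (hs : φ l = Ideal.Quotient.mk I s) : ∃ m, ψ l = s + t ^ 2 * m := by
    have h1 : Ideal.Quotient.mk I (ψ l) = Ideal.Quotient.mk I s :=
      (congr($hψ l) : Ideal.Quotient.mk I (ψ l) = φ l).trans hs
    obtain ⟨m, hm⟩ := Ideal.mem_span_singleton.mp (Ideal.Quotient.eq.mp h1)
    exact ⟨m, by linear_combination hm⟩
  obtain ⟨α, hα⟩ := hmem _ _ hy
  obtain ⟨β, hβ⟩ := hmem _ _ hz
  obtain ⟨γ, hγ⟩ := hmem _ 0 (by rw [hw, map_zero])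
  have hsq := congrArg (fun r => ψ (algebraMap R L r)) h.sq
  simp only [map_mul, map_add, map_pow, map_one, hα, hβ, hγ] at hsq
  refine ht2 ?_
  linear_combination -hsq + (t * γ ^ 2 - ((α + β + t * α * β) + (2 + t * (α + β)) +
    t * (α + β + t * α * β) * (2 + t * (α + β)))) * ht

end Chart

/-! ### Values of regular functions and dehomogenization -/

section Values

variable {k A : Type u} [CommRing k] [CommRing A] [Algebra k A]
  {𝒜 : ℕ → Submodule k A} [GradedAlgebra 𝒜]

/-- The value of a regular function in the local ring of the cone. -/
def valHom (U : (Proj 𝒜).Opens) (x : ProjectiveSpectrum 𝒜) (hx : x ∈ U) :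
    Γ(Proj 𝒜, U) →+* LocAt 𝒜 x where
  toFun r := regVal (U := op U) r ⟨x, hx⟩
  map_one' := HomogeneousLocalization.val_one
  map_mul' _ _ := HomogeneousLocalization.val_mul _ _
  map_zero' := HomogeneousLocalization.val_zero
  map_add' _ _ := HomogeneousLocalization.val_add _ _

theorem valHom_ext {U : (Proj 𝒜).Opens} {r r' : Γ(Proj 𝒜, U)}
    (h : ∀ x hx, valHom U x hx r = valHom U x hx r') : r = r' :=
  reg_ext (U := op U) fun x => h x.1 x.2

theorem valHom_injective [IsDomain A] {U : (Proj 𝒜).Opens} (x : ProjectiveSpectrum 𝒜) (hx : x ∈ U) :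
    Function.Injective (valHom U x hx) := fun r r' h =>
  reg_ext (U := op U) fun y => by
    have : (⟨_, regVal_mem_twistSections (U := op U) r⟩ : twistSections 𝒜 ⊤ 0 (op U)) =
        ⟨_, regVal_mem_twistSections (U := op U) r'⟩ := twistSections_ext (x := ⟨x, hx⟩) h
    exact congr($(this).1 y)

theorem mem_basicOpen_iff {U : (Proj 𝒜).Opens} {r : Γ(Proj 𝒜, U)} {x : ProjectiveSpectrum 𝒜}
    (hx : x ∈ U) {a b : A} (hb : b ∉ x.asHomogeneousIdeal)
    (h : algebraMap A (LocAt 𝒜 x) b * valHom U x hx r = algebraMap A _ a) :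
    x ∈ (Proj 𝒜).basicOpen r ↔ a ∉ x.asHomogeneousIdeal := by
  have h1 : IsUnit ((Proj 𝒜).presheaf.germ U x hx r) ↔ IsUnit (valHom U x hx r) := by
    refine Iff.trans ?_ (HomogeneousLocalization.isUnit_iff_isUnit_val 𝒜 x.asHomogeneousIdeal.toIdeal _).symm
    rw [← Proj.stalkIso'_germ 𝒜 U x hx r]
    exact (MulEquiv.isUnit_map (Proj.stalkIso' 𝒜 x)).symm
  refine (Scheme.mem_basicOpen (Proj 𝒜) r x hx).trans (h1.trans ?_)
  rw [← (algebraMap_isUnit hb).mul_right_iff, mul_comm, h]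
  exact IsLocalization.AtPrime.isUnit_to_map_iff (LocAt 𝒜 x) x.asHomogeneousIdeal.toIdeal a

/-- A ring homomorphism on the cone that makes f invertible restricts to degree zero fractions.
Stating the result with cleared denominators allows it to be used with the values at points. -/
theorem exists_hom_of_basicOpen {f : A} {d : ℕ} (hf : f ∈ 𝒜 d) (hd : 0 < d) {T : Type u}
    [CommRing T] (θ : A →+* T) (hθ : IsUnit (θ f)) :
    ∃ φ : Γ(Proj 𝒜, Proj.basicOpen 𝒜 f) →+* T, ∀ (r : Γ(Proj 𝒜, Proj.basicOpen 𝒜 f)) (N : ℕ)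
      (a : A), a ∈ 𝒜 (N * d) → (∀ x hx, algebraMap A (LocAt 𝒜 x) (f ^ N) * valHom _ x hx r =
        algebraMap A _ a) → θ f ^ N * φ r = θ a := by
  let e := Proj.basicOpenIsoAway 𝒜 f hf hd
  let ψ : Localization.Away f →+* T := IsLocalization.Away.lift f hθ
  refine ⟨(ψ.comp (algebraMap (HomogeneousLocalization.Away 𝒜 f) (Localization.Away f))).comp
    e.inv.hom, fun r N a ha h => ?_⟩
  have hr : r = e.hom (HomogeneousLocalization.Away.mk 𝒜 hf N a ha) := by
    refine valHom_ext fun x hx => eq_of_algebraMap_mul_eq (pow_notMem hx N) ?_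
    rw [h x hx]
    exact (algebraMap_mul_awayToSection hf ha x hx).symm
  have h1 : e.inv r = HomogeneousLocalization.Away.mk 𝒜 hf N a ha := by
    rw [hr]
    exact congr($(e.hom_inv_id) _)
  change θ f ^ N * ψ (e.inv r).val = θ a
  rw [h1]
  refine Eq.trans ?_ (IsLocalization.Away.lift_eq (S := Localization.Away f) f hθ a)
  have h2 : algebraMap A _ f ^ N * (HomogeneousLocalization.Away.mk 𝒜 hf N a ha).val =
      algebraMap A (Localization.Away f) a := by
    rw [HomogeneousLocalization.Away.val_mk, Localization.mk_eq_mk', ← map_pow]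
    exact IsLocalization.mk'_spec' _ a (⟨f ^ N, N, rfl⟩ : Submonoid.powers f)
  have h3 := congrArg ψ h2
  rw [map_mul, map_pow] at h3
  refine Eq.trans (congrArg (· ^ N * _) ?_) h3
  exact (IsLocalization.Away.lift_eq (S := Localization.Away f) f hθ f).symm

end Values

section Scaling

open MvPolynomial

theorem aeval_of_isWeightedHomogeneous {R B σ : Type*} [CommRing R] [CommRing B] [Algebra R B]
    {w : σ → ℕ} {n : ℕ} {p : MvPolynomial σ R} (hp : p.IsWeightedHomogeneous w n) (t : B)
    (v v' : σ → B) (h : ∀ i, v i = t ^ w i * v' i) : aeval v p = t ^ n * aeval v' p := by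
  classical
  rw [p.as_sum, map_sum, map_sum, Finset.mul_sum]
  refine Finset.sum_congr rfl fun d hd => ?_
  rw [aeval_monomial, aeval_monomial, ← hp (mem_support_iff.mp hd)]
  rw [mul_left_comm]
  congr 1
  rw [Finsupp.weight_apply, Finsupp.sum, Finsupp.prod, Finsupp.prod, ← Finset.prod_pow_eq_pow_sum,
    ← Finset.prod_mul_distrib]
  refine Finset.prod_congr rfl fun i _ => ?_
  rw [h, mul_pow, smul_eq_mul, ← pow_mul, mul_comm (d i)]

end Scaling

/-! ### The three affine charts of the surface -/

section SurfaceChart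

open MvPolynomial

variable (k : Type u) [Field k]

theorem eq_add_two_of_ne : ∀ m i : Fin 3, ¬m = i → ¬m = i + 1 → m = i + 2 := by decide

theorem quartic_eq (i : Fin 3) :
    quartic k = X i * X (i + 1) * X (i + 2) * (X i + X (i + 1) + X (i + 2)) := by
  fin_cases i <;> simp [quartic] <;> ring

theorem coord_three_sq_eq (i : Fin 3) : coord k 3 ^ 2 = incl k (X i) * incl k (X (i + 1)) *
    incl k (X (i + 2)) * (incl k (X i) + incl k (X (i + 1)) + incl k (X (i + 2))) := by
  rw [coord_three_sq, quartic_eq k i]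
  simp only [map_mul, map_add]

/-- The open subset of the surface where the `i`-th coordinate does not vanish. -/
def chartOpen (i : Fin 3) : (S k).Opens := Proj.basicOpen (grading k) (incl k (X i))

/-- The point with affine coordinates `y, z, w`, in homogeneous coordinates. -/
def chartPoint {T : Type*} [One T] (i : Fin 3) (y z w : T) : Fin 4 → T :=
  Fin.lastCases w fun m => if m = i then 1 else if m = i + 1 then y else z

theorem chartPoint_lift {T : Type u} [CommRing T] (κ : k →+* T) (i : Fin 3) {y z w : T}
    (h : w ^ 2 = y * z * (1 + y + z)) : ∃ θ : CoordRing k →+* T, (∀ c, θ (algebraMap k _ c) = κ c) ∧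
      θ (incl k (X i)) = 1 ∧ θ (incl k (X (i + 1))) = y ∧ θ (incl k (X (i + 2))) = z ∧
      θ (coord k 3) = w := by
  algebraize [κ]
  have h3 (m : Fin 3) : chartPoint i y z w m.castSucc = if m = i then 1 else if m = i + 1 then y else z :=
    Fin.lastCases_castSucc _
  have hw : chartPoint i y z w 3 = w := Fin.lastCases_last
  let θ : CoordRing k →ₐ[k] T := Ideal.Quotient.liftₐ _ (aeval (chartPoint i y z w)) (by
    intro a ha
    obtain ⟨b, rfl⟩ := Ideal.mem_span_singleton.mp ha
    rw [map_mul]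
    refine mul_eq_zero_of_left ?_ _
    simp only [equation, map_sub, map_mul, map_pow, map_add, aeval_X]
    have h0 := h3 0
    have h1 := h3 1
    have h2 := h3 2
    simp only [Fin.castSucc_zero, Fin.castSucc_one, show (Fin.castSucc 2 : Fin 4) = 2 from rfl] at h0 h1 h2
    rw [hw, h0, h1, h2, h]
    fin_cases i <;> simp <;> ring)
  have hθ (m : Fin 4) : θ (coord k m) = chartPoint i y z w m := aeval_X _ m
  refine ⟨θ.toRingHom, θ.commutes, ?_, ?_, ?_, (hθ 3).trans hw⟩
  · rw [incl_X]
    exact (hθ _).trans ((h3 i).trans (if_pos rfl))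
  · rw [incl_X]
    exact (hθ _).trans ((h3 (i + 1)).trans (by fin_cases i <;> simp))
  · rw [incl_X]
    exact (hθ _).trans ((h3 (i + 2)).trans (by fin_cases i <;> simp))

variable {k}

/-- The affine coordinates on an open subset of the chart with index `i`. -/
structure IsAffineCoords (i : Fin 3) {U : (S k).Opens} (y z w : Γ(S k, U)) : Prop where
  y (x : S k) (hx : x ∈ U) : algebraMap _ (LocAt (grading k) x) (incl k (X i)) *
    valHom U x hx y = algebraMap _ _ (incl k (X (i + 1)))
  z (x : S k) (hx : x ∈ U) : algebraMap _ (LocAt (grading k) x) (incl k (X i)) *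
    valHom U x hx z = algebraMap _ _ (incl k (X (i + 2)))
  w (x : S k) (hx : x ∈ U) : algebraMap _ (LocAt (grading k) x) (incl k (X i)) ^ 2 *
    valHom U x hx w = algebraMap _ _ (coord k 3)

theorem incl_X_mem (i : Fin 3) : incl k (X i) ∈ grading k 1 :=
  incl_mem_grading k (isHomogeneous_X k i)

variable (k) in
theorem exists_isAffineCoords (i : Fin 3) : ∃ y z w : Γ(S k, chartOpen k i), IsAffineCoords i y z w := by
  obtain ⟨y, hy⟩ := exists_reg (U := op (chartOpen k i)) (incl_X_mem (i + 1)) (incl_X_mem (k := k) i) (fun x => x.2)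
  obtain ⟨z, hz⟩ := exists_reg (U := op (chartOpen k i)) (incl_X_mem (i + 2)) (incl_X_mem (k := k) i) (fun x => x.2)
  have h2 : incl k (X i) ^ 2 ∈ grading k 2 := SetLike.pow_mem_graded 2 (incl_X_mem (k := k) i)
  obtain ⟨w, hw⟩ := exists_reg (U := op (chartOpen k i)) (coord_mem_grading k 3) h2
    (fun x => pow_notMem x.2 2)
  refine ⟨y, z, w, fun x hx => hy ⟨x, hx⟩, fun x hx => hz ⟨x, hx⟩, fun x hx => ?_⟩
  rw [← map_pow]
  exact hw ⟨x, hx⟩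

variable [CharP k 2] {i : Fin 3} {y z w : Γ(S k, chartOpen k i)}

omit [CharP k 2] in
theorem valHom_scalars (U : (S k).Opens) (x : S k) (hx : x ∈ U) (c : k) :
    valHom U x hx ((scalars (sToSpec k) (op U)).hom c) =
      algebraMap _ (LocAt (grading k) x) (algebraMap k (CoordRing k) c) :=
  regVal_scalars (op U) c ⟨x, hx⟩

-- Dehomogenization: dividing by xᵢⁿ replaces the homogeneous coordinates by 1, y, z and w.
omit [CharP k 2] in
theorem IsAffineCoords.exists_eval₂ {U : (S k).Opens} {y z w : Γ(S k, U)}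
    (h : IsAffineCoords i y z w) {n : ℕ} {a : CoordRing k} (ha : a ∈ grading k n) :
    ∃ P : MvPolynomial (Fin 3) k, ∀ x hx, algebraMap _ (LocAt (grading k) x) (incl k (X i)) ^ n *
      valHom U x hx (P.eval₂ (scalars (sToSpec k) (op U)).hom ![y, z, w]) = algebraMap _ _ a := by
  obtain ⟨p, hp, rfl⟩ := ha
  refine ⟨aeval (chartPoint i (X 0) (X 1) (X 2)) p, fun x hx => ?_⟩
  have hκ : (valHom U x hx).comp (scalars (sToSpec k) (op U)).hom =
      algebraMap k (LocAt (grading k) x) := by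
    ext c
    exact valHom_scalars U x hx c
  let v : Fin 3 → LocAt (grading k) x := fun m => valHom U x hx (![y, z, w] m)
  have h1 : valHom U x hx (eval₂ (scalars (sToSpec k) (op U)).hom
      ![y, z, w] (aeval (chartPoint i (X 0) (X 1) (X 2)) p)) =
      aeval (chartPoint i (v 0) (v 1) (v 2)) p := by
    rw [hom_eval₂, hκ]
    change aeval v _ = _
    rw [← AlgHom.comp_apply, comp_aeval]
    congr 2
    funext m
    induction m using Fin.lastCases with
    | last => simp only [chartPoint, Fin.lastCases_last, aeval_X]
    | cast m =>
      simp only [chartPoint, Fin.lastCases_castSucc]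
      split_ifs <;> simp only [map_one, aeval_X]
  rw [h1]
  have h2 : (IsScalarTower.toAlgHom k (CoordRing k) (LocAt (grading k) x)).comp (toCoordRing k) =
      aeval (fun m => algebraMap _ (LocAt (grading k) x) (coord k m)) := by
    ext m
    rw [aeval_X]
    rfl
  refine Eq.trans ?_ congr($h2.symm p)
  refine (aeval_of_isWeightedHomogeneous hp (algebraMap _ (LocAt (grading k) x) (incl k (X i))) _
    (chartPoint i (v 0) (v 1) (v 2)) ?_).symm
  intro m
  induction m using Fin.lastCases with
  | last =>
    simp only [chartPoint, Fin.lastCases_last]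
    exact (h.w x hx).symm
  | cast m =>
    have hm : weights m.castSucc = 1 := by fin_cases m <;> rfl
    simp only [chartPoint, Fin.lastCases_castSucc]
    rw [hm, pow_one, ← incl_X]
    split_ifs with h1 h2
    · rw [h1, mul_one]
    · rw [h2]; exact (h.y x hx).symm
    · obtain rfl : m = i + 2 := eq_add_two_of_ne m i h1 h2
      exact (h.z x hx).symm

omit [CharP k 2] in
theorem IsAffineCoords.sq {U : (S k).Opens} {y z w : Γ(S k, U)} (h : IsAffineCoords i y z w)
    (hU : U ≤ chartOpen k i) : w ^ 2 = y * z * (1 + y + z) := by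
  refine valHom_ext fun x hx => eq_of_algebraMap_mul_eq (pow_notMem (hU hx) 4) ?_
  have h1 := h.y x hx
  have h2 := h.z x hx
  have h3 := h.w x hx
  have h4 := congrArg (algebraMap _ (LocAt (grading k) x)) (coord_three_sq_eq k i)
  simp only [map_mul, map_add, map_pow, map_one, ← h1, ← h2, ← h3] at h4 ⊢
  linear_combination h4

/-- Generation is dehomogenization of numerators. For the universal property, a solution of the
affine equation defines a homomorphism on the cone with xᵢ ↦ 1. -/
theorem IsAffineCoords.isChart (h : IsAffineCoords i y z w) :
    IsChart (scalars (sToSpec k) (op (chartOpen k i))).hom y z w where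
  sq := h.sq fun x hx => hx
  surj r := by
    obtain ⟨N, a, ha, hr⟩ := exists_reg_fraction (U := op (chartOpen k i)) one_pos (incl_X_mem (k := k) i) rfl r
    rw [mul_one] at ha
    obtain ⟨P, hP⟩ := h.exists_eval₂ ha
    refine ⟨P, valHom_ext fun x hx => eq_of_algebraMap_mul_eq (pow_notMem hx N) ?_⟩
    rw [map_pow, hP]
    have := hr ⟨x, hx⟩
    rw [map_pow] at this
    exact this.symm
  exists_lift T _ κ' y' z' w' hT := by
    obtain ⟨θ, hκ, hi, hy, hz, hw⟩ := chartPoint_lift k κ' i hT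
    obtain ⟨φ, hφ⟩ := exists_hom_of_basicOpen (incl_X_mem (k := k) i) one_pos θ
      (by rw [hi]; exact isUnit_one)
    refine ⟨φ, ?_, ?_, ?_, ?_⟩
    · ext c
      have := hφ ((scalars (sToSpec k) (op (chartOpen k i))).hom c) 0 (algebraMap k _ c)
        (by rw [zero_mul]; exact SetLike.algebraMap_mem_graded (grading k) c)
        (fun x hx => by rw [pow_zero, map_one, one_mul]; exact valHom_scalars (chartOpen k i) x hx c)
      rw [hi, one_pow, one_mul, hκ] at this
      exact this
    · have := hφ y 1 _ (incl_X_mem (i + 1)) (fun x hx => by rw [pow_one]; exact h.y x hx)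
      rwa [hi, one_pow, one_mul, hy] at this
    · have := hφ z 1 _ (incl_X_mem (i + 2)) (fun x hx => by rw [pow_one]; exact h.z x hx)
      rwa [hi, one_pow, one_mul, hz] at this
    · have := hφ w 2 _ (coord_mem_grading k 3) (fun x hx => by rw [map_pow]; exact h.w x hx)
      rwa [hi, one_pow, one_mul, hw] at this

end SurfaceChart

/-! ### Smoothness in terms of rings of sections -/

section Smoothness

variable {k : Type u} [Field k] {X : Scheme.{u}} (s : X ⟶ Spec (.of k))

theorem scalars_map {U V : X.Opens} (h : V ≤ U) :
    scalars s (op U) ≫ X.presheaf.map (homOfLE h).op = scalars s (op V) := by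
  simp only [scalars, Category.assoc, ← Functor.map_comp]
  rfl

theorem algebraMap_comp_scalars {U : X.Opens} (f : Γ(X, U)) :
    (algebraMap Γ(X, U) Γ(X, X.basicOpen f)).comp (scalars s (op U)).hom =
      (scalars s (op (X.basicOpen f))).hom :=
  congrArg CommRingCat.Hom.hom (scalars_map s (X.basicOpen_le f))

theorem appLE_ι_comp (V W : X.Opens) :
    (V.ι ≫ s).appLE ⊤ (V.ι ⁻¹ᵁ W) le_top =
      (Scheme.ΓSpecIso (.of k)).hom ≫ scalars s (op W) ≫ V.ι.app W := by
  have h1 : (V.ι ≫ s).appLE ⊤ (V.ι ⁻¹ᵁ W) le_top =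
      (V.ι ≫ s).app ⊤ ≫ V.toScheme.presheaf.map (homOfLE le_top).op := rfl
  rw [scalars, Category.assoc, Category.assoc, Iso.hom_inv_id_assoc, Scheme.Hom.naturality,
    h1, Scheme.Hom.comp_app]
  exact Category.assoc _ _ _

theorem appLE_ι_comp_hom {V W : X.Opens} (hWV : W ≤ V) : ∃ (e : k ≃+* Γ(Spec (.of k), ⊤))
    (e' : Γ(X, W) ≃+* Γ(V.toScheme, V.ι ⁻¹ᵁ W)), ((V.ι ≫ s).appLE ⊤ (V.ι ⁻¹ᵁ W) le_top).hom =
      (e' : _ →+* _).comp ((scalars s (op W)).hom.comp (e.symm : _ →+* _)) := by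
  have : IsIso (V.ι.app W) := V.ι.isIso_app W (by rwa [Scheme.Opens.opensRange_ι])
  refine ⟨(Scheme.ΓSpecIso (.of k)).symm.commRingCatIsoToRingEquiv,
    (asIso (V.ι.app W)).commRingCatIsoToRingEquiv, ?_⟩
  rw [appLE_ι_comp]
  rfl

theorem smoothOfRelativeDimension_of_cover {n : ℕ} {V : X.Opens}
    (h : ∀ x ∈ V, ∃ W : X.Opens, IsAffineOpen W ∧ x ∈ W ∧ W ≤ V ∧
      (scalars s (op W)).hom.IsStandardSmoothOfRelativeDimension n) :
    SmoothOfRelativeDimension n (V.ι ≫ s) where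
  exists_isStandardSmoothOfRelativeDimension x := by
    obtain ⟨W, hW, hxW, hWV, hsm⟩ := h x.1 x.2
    obtain ⟨e, e', he⟩ := appLE_ι_comp_hom s hWV
    refine ⟨⊤, isAffineOpen_top _, V.ι ⁻¹ᵁ W,
      hW.preimage_of_isOpenImmersion V.ι (by rwa [Scheme.Opens.opensRange_ι]), hxW, le_top, ?_⟩
    rw [he, show n = 0 + (n + 0) by omega]
    exact (RingHom.IsStandardSmoothOfRelativeDimension.equiv e').comp
      (hsm.comp (RingHom.IsStandardSmoothOfRelativeDimension.equiv e.symm))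

theorem le_smoothLocus {n : ℕ} {W : X.Opens} (hW : IsAffineOpen W)
    (h : (scalars s (op W)).hom.IsStandardSmoothOfRelativeDimension n) : W ≤ smoothLocus s :=
  le_sSup (by
    have := smoothOfRelativeDimension_of_cover s (V := W) fun x hx => ⟨W, hW, hx, le_rfl, h⟩
    exact SmoothOfRelativeDimension.smooth n (W.ι ≫ s))

/-- A smooth neighbourhood is shrunk to a basic open set of the given affine chart, since the
obstruction to lifting is computed for localizations of the chart. -/
theorem exists_formallySmooth {x : X} (hx : x ∈ smoothLocus s) {U : X.Opens} (hU : IsAffineOpen U)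
    (hxU : x ∈ U) : ∃ f : Γ(X, U), x ∈ X.basicOpen f ∧
      (scalars s (op (X.basicOpen f))).hom.FormallySmooth := by
  obtain ⟨V, hV, hxV⟩ : ∃ V : X.Opens, Smooth (V.ι ≫ s) ∧ x ∈ V := Opens.mem_sSup.mp hx
  obtain ⟨f, hf, hxf⟩ := hU.exists_basicOpen_le ⟨x, hxV⟩ hxU
  refine ⟨f, hxf, ?_⟩
  obtain ⟨e, e', he⟩ := appLE_ι_comp_hom s hf
  have h1 := ((V.ι ≫ s).smooth_appLE (isAffineOpen_top _)
    ((hU.basicOpen f).preimage_of_isOpenImmersion V.ι (by rwa [Scheme.Opens.opensRange_ι]))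
    le_top).formallySmooth
  rw [he] at h1
  have h2 := ((RingHom.FormallySmooth.of_bijective (f := (e : k →+* _)) e.bijective).comp h1).comp
    (RingHom.FormallySmooth.of_bijective (f := e'.symm.toRingHom) e'.symm.bijective)
  convert h2 using 1
  ext c
  simp

end Smoothness

/-! ### The origin of a chart -/

section ChartPoint

variable {k : Type u} [Field k] {X : Scheme.{u}} {s : X ⟶ Spec (.of k)}
  {U : X.Opens} {p q r : Γ(X, U)} {x : X}

theorem notMem_basicOpen_of_mem_span {t : Set Γ(X, U)} (hxU : x ∈ U)
    (ht : ∀ f ∈ t, x ∉ X.basicOpen f) {f : Γ(X, U)} (hf : f ∈ Ideal.span t) :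
    x ∉ X.basicOpen f := by
  have h1 : Ideal.span t ≤
      (IsLocalRing.maximalIdeal (X.presheaf.stalk x)).comap (X.presheaf.germ U x hxU).hom := by
    refine Ideal.span_le.mpr fun f hf => ?_
    exact fun h => ht f hf ((Scheme.mem_basicOpen X f x hxU).mpr h)
  exact fun h => h1 hf ((Scheme.mem_basicOpen X f x hxU).mp h)

/-- `x` is the origin of a chart of `X`. -/
structure IsChartOrigin (s : X ⟶ Spec (.of k)) (U : X.Opens) (p q r : Γ(X, U)) (x : X) :
    Prop where
  mem : x ∈ U
  notMem : ∀ f ∈ ({p, q, r} : Set Γ(X, U)), x ∉ X.basicOpen f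

/-- Modulo (p, q, r) every function is a constant c, and its nonvanishing at the origin means c ≠ 0.
-/
theorem IsChartOrigin.mem_basicOpen_iff (hx : IsChartOrigin s U p q r x)
    (h : IsChart (scalars s (op U)).hom p q r) (f : Γ(X, U)) :
    x ∈ X.basicOpen f ↔ f ∉ Ideal.span {p, q, r} := by
  refine ⟨fun hf hf' => notMem_basicOpen_of_mem_span hx.mem hx.notMem hf' hf, fun hf => ?_⟩
  obtain ⟨c, hc⟩ := h.exists_sub_mem f
  have hc0 : c ≠ 0 := by
    rintro rfl
    rw [map_zero, sub_zero] at hc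
    exact hf hc
  by_contra hxf
  refine notMem_basicOpen_of_mem_span (t := {f, f - (scalars s (op U)).hom c})
    (f := (scalars s (op U)).hom c) hx.mem ?_ ?_ ?_
  · rintro _ (rfl | rfl)
    · exact hxf
    · exact notMem_basicOpen_of_mem_span hx.mem hx.notMem hc
  · have h1 := Ideal.subset_span (show f ∈ ({f, f - (scalars s (op U)).hom c} : Set _) by simp)
    have h2 := Ideal.subset_span (show f - (scalars s (op U)).hom c ∈
      ({f, f - (scalars s (op U)).hom c} : Set _) by simp)
    have := sub_mem h1 h2
    rwa [sub_sub_cancel] at this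
  · rw [Scheme.mem_basicOpen X _ x hx.mem]
    exact ((IsUnit.mk0 c hc0).map (scalars s (op U)).hom).map (X.presheaf.germ U x hx.mem).hom

theorem IsChartOrigin.notMem_smoothLocus (hx : IsChartOrigin s U p q r x) (hU : IsAffineOpen U)
    (h : IsChart (scalars s (op U)).hom p q r) : x ∉ smoothLocus s := fun hxs => by
  obtain ⟨f, hxf, hf⟩ := exists_formallySmooth s hxs hU hx.mem
  have := hU.isLocalization_basicOpen f
  refine h.not_formallySmooth f ((hx.mem_basicOpen_iff h f).mp hxf) Γ(X, X.basicOpen f) ?_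
  rwa [algebraMap_comp_scalars]

/-- By the description of the basic open sets containing an origin, two origins have the same
neighbourhoods, and schemes are T₀. -/
theorem IsChartOrigin.unique {x' : X} (hx : IsChartOrigin s U p q r x)
    (hx' : IsChartOrigin s U p q r x') (hU : IsAffineOpen U)
    (h : IsChart (scalars s (op U)).hom p q r) : x = x' := by
  refine (inseparable_iff_forall_isOpen.mpr fun O hO => ?_).eq
  suffices ∀ {y y' : X}, IsChartOrigin s U p q r y → IsChartOrigin s U p q r y' → y ∈ O → y' ∈ O from
    ⟨this hx hx', this hx' hx⟩
  intro y y' hy hy' hyO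
  obtain ⟨f, hf, hxf⟩ := hU.exists_basicOpen_le (V := ⟨O, hO⟩) ⟨y, hyO⟩ hy.mem
  exact hf ((hy'.mem_basicOpen_iff h f).mpr ((hy.mem_basicOpen_iff h f).mp hxf))

theorem IsChart.exists_isChartOrigin (hU : IsAffineOpen U)
    (h : IsChart (scalars s (op U)).hom p q r) : ∃ x, IsChartOrigin s U p q r x := by
  obtain ⟨φ, -, hp, hq, hr⟩ := h.exists_lift k (RingHom.id k) 0 0 0 (by simp)
  let y : Spec Γ(X, U) := ⟨RingHom.ker φ, RingHom.ker_isPrime φ⟩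
  refine ⟨hU.fromSpec y, ?_, fun f hf hxf => ?_⟩
  · exact hU.opensRange_fromSpec.le ⟨y, rfl⟩
  · have h1 : y ∈ hU.fromSpec ⁻¹ᵁ X.basicOpen f := hxf
    rw [hU.fromSpec_preimage_basicOpen] at h1
    refine h1 (RingHom.mem_ker.mpr ?_)
    rcases hf with rfl | rfl | rfl
    exacts [hp, hq, hr]

/-- The étale neighbourhood is the open set where 1 + p is invertible, with its étale map to the
cone. -/
theorem IsChartOrigin.isA1Singularity [CharP k 2] (hx : IsChartOrigin s U p q r x)
    (hU : IsAffineOpen U) (h : IsChart (scalars s (op U)).hom p q r) : IsA1Singularity s x := by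
  let V := X.basicOpen (1 + p)
  have hV : IsAffineOpen V := hU.basicOpen (1 + p)
  have := hU.isLocalization_basicOpen (1 + p)
  obtain ⟨φ, hφ, hφk, hφi⟩ := h.exists_etale_cone Γ(X, V)
  have hxV : x ∈ V := by
    refine (hx.mem_basicOpen_iff h _).mpr fun h1 => ?_
    have h2 : (1 : Γ(X, U)) ∈ Ideal.span {p, q, r} := by
      have := sub_mem h1 (Ideal.subset_span (show p ∈ ({p, q, r} : Set _) by simp))
      rwa [add_sub_cancel_right] at this
    refine notMem_basicOpen_of_mem_span hx.mem hx.notMem h2 ?_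
    rw [X.basicOpen_of_isUnit isUnit_one]
    exact hx.mem
  rw [algebraMap_comp_scalars] at hφk
  have : IsIso V.toSpecΓ := hV.isoSpec.isIso_hom
  have hE : Etale (Spec.map (CommRingCat.ofHom φ)) :=
    (HasRingHomProperty.Spec_iff (P := @Etale)).mpr hφ
  refine ⟨V.toScheme, V.ι, V.toSpecΓ ≫ Spec.map (CommRingCat.ofHom φ), ⟨x, hxV⟩, inferInstance,
    inferInstance, ?_, rfl, fun i => ?_⟩
  · rw [Category.assoc, ← Spec.map_comp, ← CommRingCat.ofHom_comp, hφk]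
    change V.ι ≫ s = V.toSpecΓ ≫ Spec.map (scalars s (op V))
    have h1 : Spec.map (scalars s (op V)) = Spec.map (X.presheaf.map (homOfLE le_top).op) ≫
        Spec.map s.appTop ≫ Spec.map (Scheme.ΓSpecIso (.of k)).inv := by
      rw [scalars, Spec.map_comp, Spec.map_comp, Category.assoc]
    rw [h1, Scheme.Opens.toSpecΓ_SpecMap_presheaf_map_top_assoc, ← Scheme.toSpecΓ_naturality_assoc,
      toSpecΓ_SpecMap_ΓSpecIso_inv]
    exact (congrArg _ (Category.comp_id s)).symm
  · change φ _ ∈ (V.toSpecΓ ⟨x, hxV⟩).asIdeal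
    rw [hφi]
    by_contra hm
    have h1 : (⟨x, hxV⟩ : V.toScheme) ∈ V.toSpecΓ ⁻¹ᵁ PrimeSpectrum.basicOpen
      (algebraMap Γ(X, U) Γ(X, V) (![p, q * (1 + p + q), r] i)) := hm
    rw [Scheme.Opens.toSpecΓ_preimage_basicOpen] at h1
    have h2 : x ∈ X.basicOpen (X.presheaf.map (homOfLE (X.basicOpen_le (1 + p))).op
      (![p, q * (1 + p + q), r] i)) := h1
    rw [Scheme.basicOpen_res] at h2
    refine notMem_basicOpen_of_mem_span hx.mem hx.notMem ?_ h2.2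
    fin_cases i
    · exact Ideal.subset_span (by simp)
    · exact Ideal.mul_mem_right _ _ (Ideal.subset_span (by simp))
    · exact Ideal.subset_span (by simp)

end ChartPoint

/-! ### The singular points: Jacobian criterion, type and number -/

section SingularPoints

open MvPolynomial

variable {k : Type u} [Field k] [CharP k 2]

theorem partials_eq (i : Fin 3) :
    partials k i = X (i + 1) * X (i + 2) * (X (i + 1) + X (i + 2)) := by
  fin_cases i
  · exact partials_zero k
  · refine (partials_one k).trans ?_
    simp only [Fin.mk_one, show (1 + 1 : Fin 3) = 2 from rfl, show (1 + 2 : Fin 3) = 0 from rfl]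
    ring
  · exact partials_two k

omit [CharP k 2] in
theorem isAffineOpen_chartOpen (i : Fin 3) : IsAffineOpen (chartOpen k i) :=
  Proj.isAffineOpen_basicOpen (grading k) _ (incl_X_mem i) one_pos

omit [CharP k 2] in
theorem exists_mem_chartOpen (x : S k) : ∃ i, x ∈ chartOpen k i := exists_X_notMem k x

/-- The product `z (1 + z)` of affine coordinates is given by a partial derivative. -/
theorem IsAffineCoords.mem_basicOpen_mul {i : Fin 3} {y z w : Γ(S k, chartOpen k i)}
    (h : IsAffineCoords i y z w) {x : S k} (hx : x ∈ chartOpen k i) :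
    x ∈ (S k).basicOpen (z * (1 + z)) ↔ incl k (partials k (i + 1)) ∉ x.asHomogeneousIdeal := by
  refine mem_basicOpen_iff hx (pow_notMem hx 3) ?_
  have h2 := h.z x hx
  rw [partials_eq, show i + 1 + 1 = i + 2 by fin_cases i <;> rfl, show i + 1 + 2 = i by fin_cases i <;> rfl]
  simp only [map_mul, map_add, map_pow, map_one, ← h2]
  ring

theorem IsAffineCoords.isStandardSmooth {i : Fin 3} {y z w : Γ(S k, chartOpen k i)}
    (h : IsAffineCoords i y z w) :
    (scalars (sToSpec k) (op ((S k).basicOpen (z * (1 + z))))).hom.IsStandardSmoothOfRelativeDimension 2 := by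
  have := (isAffineOpen_chartOpen (k := k) i).isLocalization_basicOpen (z * (1 + z))
  rw [← algebraMap_comp_scalars]
  exact h.isChart.isStandardSmooth _

theorem exists_smooth_neighborhood {x : S k} {m : Fin 3}
    (hx : incl k (partials k m) ∉ x.asHomogeneousIdeal) :
    ∃ W : (S k).Opens, IsAffineOpen W ∧ x ∈ W ∧
      (scalars (sToSpec k) (op W)).hom.IsStandardSmoothOfRelativeDimension 2 := by
  -- On the chart with index i = m + 2 one has z(1 + z) = Fᵢ₊₁/xᵢ³, and i + 1 = m modulo three.
  obtain ⟨y, z, w, h⟩ := exists_isAffineCoords k (m + 2)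
  have hm : m + 2 + 1 = m := by fin_cases m <;> rfl
  have hxU : x ∈ chartOpen k (m + 2) := fun h1 => hx (by
    rw [partials_eq, map_mul, map_mul]
    exact Ideal.mul_mem_right _ _ (Ideal.mul_mem_left _ _ h1))
  refine ⟨_, (isAffineOpen_chartOpen (m + 2)).basicOpen (z * (1 + z)),
    (h.mem_basicOpen_mul hxU).mpr (by rwa [hm]), h.isStandardSmooth⟩

theorem IsAffineCoords.isChartOrigin_iff {i : Fin 3} {y z w : Γ(S k, chartOpen k i)}
    (h : IsAffineCoords i y z w) {a b : k} (ha : a ^ 2 = a) (hb : b ^ 2 = b) {x : S k}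
    {κ : k →+* Γ(S k, chartOpen k i)} (hκ : κ = (scalars (sToSpec k) (op (chartOpen k i))).hom) :
    IsChartOrigin (sToSpec k) (chartOpen k i) (y + κ a) (z + κ b)
      (w + κ b * (y + κ a) + κ a * (z + κ b) + κ (a * b)) x ↔ x ∈ chartOpen k i ∧
        incl k (X (i + 1) + C a * X i) ∈ x.asHomogeneousIdeal ∧
        incl k (X (i + 2) + C b * X i) ∈ x.asHomogeneousIdeal := by
  have hC (c : k) : incl k (C c) = algebraMap k _ c := (incl k).commutes c
  have hp (hx : x ∈ chartOpen k i) : x ∈ (S k).basicOpen (y + κ a) ↔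
      incl k (X (i + 1) + C a * X i) ∉ x.asHomogeneousIdeal := by
    refine mem_basicOpen_iff hx hx ?_
    have h1 := h.y x hx
    rw [map_add, hκ, valHom_scalars (chartOpen k i) x hx a, map_add, map_add, map_mul, map_mul, ← h1, hC]
    ring
  have hq (hx : x ∈ chartOpen k i) : x ∈ (S k).basicOpen (z + κ b) ↔
      incl k (X (i + 2) + C b * X i) ∉ x.asHomogeneousIdeal := by
    refine mem_basicOpen_iff hx hx ?_
    have h1 := h.z x hx
    rw [map_add, hκ, valHom_scalars (chartOpen k i) x hx b, map_add, map_add, map_mul, map_mul, ← h1, hC]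
    ring
  refine ⟨fun hx => ⟨hx.mem, ?_, ?_⟩, fun ⟨hxU, h1, h2⟩ => ⟨hxU, ?_⟩⟩
  · exact not_not.mp (mt (hp hx.mem).mpr (hx.notMem _ (by simp)))
  · exact not_not.mp (mt (hq hx.mem).mpr (hx.notMem _ (by simp)))
  · rintro f (rfl | rfl | rfl)
    · exact fun h => (hp hxU).mp h h1
    · exact fun h => (hq hxU).mp h h2
    -- The third coordinate vanishes as soon as the first two do, because its square is a multiple
    -- of their product.
    · intro hf
      have h3 := (hκ ▸ h.isChart.translate ha hb).sq
      have h4 : x ∈ (S k).basicOpen ((y + κ a) * ((z + κ b) * (1 + (y + κ a) + (z + κ b)))) := by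
        rw [← mul_assoc, ← h3, Scheme.basicOpen_pow _ _ two_pos]
        exact hf
      rw [Scheme.basicOpen_mul] at h4
      exact (hp hxU).mp h4.1 h1

theorem IsAffineCoords.exists_isChartOrigin {i : Fin 3} {y z w : Γ(S k, chartOpen k i)}
    (h : IsAffineCoords i y z w) {a b : k} (ha : a ^ 2 = a) (hb : b ^ 2 = b) :
    ∃ x : S k, x ∈ chartOpen k i ∧ x ∉ smoothLocus (sToSpec k) ∧
        incl k (X (i + 1) + C a * X i) ∈ x.asHomogeneousIdeal ∧
        incl k (X (i + 2) + C b * X i) ∈ x.asHomogeneousIdeal := by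
  have hc := h.isChart.translate ha hb
  obtain ⟨x, hx⟩ := hc.exists_isChartOrigin (isAffineOpen_chartOpen i)
  exact ⟨x, hx.mem, hx.notMem_smoothLocus (isAffineOpen_chartOpen i) hc,
    ((h.isChartOrigin_iff ha hb rfl).mp hx).2⟩

-- One of the three factors vanishes at x and it is not xᵢ, so the ratio xⱼ/xᵢ is 0 or 1; the
-- recorded equivalence tells which.
omit [CharP k 2] in
theorem exists_sq_eq_self_of_mem {x : S k} {i : Fin 3} (hx : x ∈ chartOpen k i) {j : Fin 3}
    (h : incl k (X i * X j * (X i + X j)) ∈ x.asHomogeneousIdeal) :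
    ∃ a : k, a ^ 2 = a ∧ incl k (X j + C a * X i) ∈ x.asHomogeneousIdeal ∧
      (a = 0 ↔ incl k (X j) ∈ x.asHomogeneousIdeal) := by
  rw [map_mul, map_mul] at h
  rcases x.isPrime.mem_or_mem h with h | h
  · rcases x.isPrime.mem_or_mem h with h | h
    · exact absurd h hx
    · exact ⟨0, by simp, by simpa using h, by simpa using h⟩
  · refine ⟨1, by simp, by rw [map_one, one_mul, add_comm]; exact h,
      iff_of_false one_ne_zero fun h1 => hx ?_⟩
    have := sub_mem (show incl k (X i + X j) ∈ x.asHomogeneousIdeal.toIdeal from h) h1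
    rwa [map_add, add_sub_cancel_right] at this

theorem exists_isChartOrigin {x : S k} {i : Fin 3} (hx : x ∈ chartOpen k i)
    (hF : ∀ m, incl k (partials k m) ∈ x.asHomogeneousIdeal) :
    ∃ a b : k, a ^ 2 = a ∧ b ^ 2 = b ∧ 
        incl k (X (i + 1) + C a * X i) ∈ x.asHomogeneousIdeal ∧
        incl k (X (i + 2) + C b * X i) ∈ x.asHomogeneousIdeal ∧
        (a = 0 ↔ incl k (X (i + 1)) ∈ x.asHomogeneousIdeal) ∧
        (b = 0 ↔ incl k (X (i + 2)) ∈ x.asHomogeneousIdeal) := by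
  obtain ⟨a, ha, ha1, ha0⟩ := exists_sq_eq_self_of_mem (j := i + 1) hx (by
    convert hF (i + 2) using 2
    rw [partials_eq]
    congr 3 <;> fin_cases i <;> rfl)
  obtain ⟨b, hb, hb1, hb0⟩ := exists_sq_eq_self_of_mem (j := i + 2) hx (by
    convert hF (i + 1) using 2
    rw [partials_eq, mul_comm (X i), add_comm (X i)]
    congr 3 <;> fin_cases i <;> rfl)
  exact ⟨a, b, ha, hb, ha1, hb1, ha0, hb0⟩

/-- If some Fₘ is nonzero at the point, a chart is étale over the plane there. If all vanish, the
coordinate ratios lie in 𝔽₂, and a translated chart has the point as its origin, where smoothness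
fails. -/
theorem mem_singularPoints_iff {x : S k} :
    x ∈ singularPoints k ↔ ∀ m, incl k (partials k m) ∈ x.asHomogeneousIdeal := by
  refine ⟨fun hx m => ?_, fun hF => ?_⟩
  · by_contra hm
    obtain ⟨W, hW, hxW, hsm⟩ := exists_smooth_neighborhood hm
    exact hx (le_smoothLocus _ hW hsm hxW)
  · obtain ⟨i, hi⟩ := exists_mem_chartOpen x
    obtain ⟨y, z, w, h⟩ := exists_isAffineCoords k i
    obtain ⟨a, b, ha, hb, ha1, hb1, -⟩ := exists_isChartOrigin hi hF
    exact ((h.isChartOrigin_iff ha hb rfl).mpr ⟨hi, ha1, hb1⟩).notMem_smoothLocus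
      (isAffineOpen_chartOpen i) (h.isChart.translate ha hb)

theorem isA1Singularity_of_notMem_smoothLocus (x : S k) (hx : x ∉ smoothLocus (sToSpec k)) :
    IsA1Singularity (sToSpec k) x := by
  obtain ⟨i, hi⟩ := exists_mem_chartOpen x
  obtain ⟨y, z, w, h⟩ := exists_isAffineCoords k i
  obtain ⟨a, b, ha, hb, ha1, hb1, -⟩ := exists_isChartOrigin hi (mem_singularPoints_iff.mp hx)
  exact ((h.isChartOrigin_iff ha hb rfl).mpr ⟨hi, ha1, hb1⟩).isA1Singularity
    (isAffineOpen_chartOpen i) (h.isChart.translate ha hb)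

theorem mem_smoothLocus_iff {x : S k} :
    x ∈ smoothLocus (sToSpec k) ↔ ∃ m, incl k (partials k m) ∉ x.asHomogeneousIdeal := by
  have := (mem_singularPoints_iff (x := x)).not
  rwa [not_forall, singularPoints, Set.mem_ofPred_eq, not_not] at this

variable (k) in
theorem smoothOfRelativeDimension_smoothLocus :
    SmoothOfRelativeDimension 2 (smoothLocusToSpec (sToSpec k)) :=
  smoothOfRelativeDimension_of_cover _ fun x hx => by
    obtain ⟨m, hm⟩ := mem_smoothLocus_iff.mp hx
    obtain ⟨W, hW, hxW, hsm⟩ := exists_smooth_neighborhood hm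
    exact ⟨W, hW, hxW, le_smoothLocus _ hW hsm, hsm⟩

open Classical in
/-- The coordinates that vanish at a point. -/
def vanishingCoords (x : S k) : Finset (Fin 3) :=
  Finset.univ.filter fun j => incl k (X j) ∈ x.asHomogeneousIdeal

omit [CharP k 2] in
theorem mem_vanishingCoords {x : S k} {j : Fin 3} :
    j ∈ vanishingCoords x ↔ incl k (X j) ∈ x.asHomogeneousIdeal := by
  simp [vanishingCoords]

/-- The coordinate ratios are 0 or 1, so a singular point is determined by the set of coordinates
vanishing at it. -/
theorem vanishingCoords_injOn : Set.InjOn (vanishingCoords (k := k)) (singularPoints k) := by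
  intro x hx x' hx' hxx'
  have key (j : Fin 3) : incl k (X j) ∈ x.asHomogeneousIdeal ↔
      incl k (X j) ∈ x'.asHomogeneousIdeal := by
    rw [← mem_vanishingCoords, ← mem_vanishingCoords, hxx']
  obtain ⟨i, hi⟩ := exists_mem_chartOpen x
  have hi' : x' ∈ chartOpen k i := fun h => hi ((key i).mpr h)
  obtain ⟨y, z, w, h⟩ := exists_isAffineCoords k i
  obtain ⟨a, b, ha, hb, ha1, hb1, ha0, hb0⟩ := exists_isChartOrigin hi (mem_singularPoints_iff.mp hx)
  obtain ⟨a', b', ha', hb', ha1', hb1', ha0', hb0'⟩ :=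
    exists_isChartOrigin hi' (mem_singularPoints_iff.mp hx')
  have hk {c c' : k} (hc : c ^ 2 = c) (hc' : c' ^ 2 = c') (h : c = 0 ↔ c' = 0) : c = c' := by
    have h01 {c : k} (hc : c ^ 2 = c) : c = 0 ∨ c = 1 := by
      exact IsIdempotentElem.iff_eq_zero_or_one.mp ((sq c).symm.trans hc)
    grind
  obtain rfl : a = a' := hk ha ha' (by rw [ha0, ha0', key])
  obtain rfl : b = b' := hk hb hb' (by rw [hb0, hb0', key])
  exact ((h.isChartOrigin_iff ha hb rfl).mpr ⟨hi, ha1, hb1⟩).unique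
    ((h.isChartOrigin_iff ha hb rfl).mpr ⟨hi', ha1', hb1'⟩)
    (isAffineOpen_chartOpen i) (h.isChart.translate ha hb)

/-- Each proper subset T of the coordinates is realized by the 𝔽₂-point with coordinates 0 on T and
1 off T. -/
theorem vanishingCoords_image :
    vanishingCoords '' singularPoints k = {T : Finset (Fin 3) | T ≠ Finset.univ} := by
  ext T
  refine ⟨?_, fun hT => ?_⟩
  · rintro ⟨x, -, rfl⟩ h
    obtain ⟨i, hi⟩ := exists_mem_chartOpen x
    exact hi (mem_vanishingCoords.mp (h ▸ Finset.mem_univ i))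
  · obtain ⟨i, hi⟩ : ∃ i, i ∉ T := by
      by_contra! h
      exact hT (Finset.eq_univ_of_forall h)
    obtain ⟨y, z, w, h⟩ := exists_isAffineCoords k i
    let a (j : Fin 3) : k := if j ∈ T then 0 else 1
    have ha (j) : a j ^ 2 = a j := by
      simp only [a]
      split_ifs <;> simp
    obtain ⟨x, hxi, hx, h1, h2⟩ := h.exists_isChartOrigin (ha (i + 1)) (ha (i + 2))
    have key {j : Fin 3} (hj : incl k (X j + C (a j) * X i) ∈ x.asHomogeneousIdeal) :
        incl k (X j) ∈ x.asHomogeneousIdeal ↔ j ∈ T := by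
      by_cases hjT : j ∈ T
      · simp only [a, if_pos hjT, map_zero, zero_mul, add_zero] at hj
        exact iff_of_true hj hjT
      · simp only [a, if_neg hjT, map_one, one_mul, map_add] at hj
        refine iff_of_false (fun h1 => hxi ?_) hjT
        have := sub_mem (show _ ∈ x.asHomogeneousIdeal.toIdeal from hj) h1
        rwa [add_sub_cancel_left] at this
    refine ⟨x, hx, Finset.ext fun j => mem_vanishingCoords.trans ?_⟩
    by_cases h0 : j = i
    · subst h0
      exact iff_of_false hxi hi
    by_cases h01 : j = i + 1
    · subst h01
      exact key h1
    obtain rfl := eq_add_two_of_ne j i h0 h01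
    exact key h2

variable (k) in
theorem ncard_singularPoints : (singularPoints k).ncard = 7 := by
  -- There are 2³ − 1 proper subsets of a set with three elements.
  rw [← vanishingCoords_injOn.ncard_image, vanishingCoords_image,
    Set.ncard_eq_toFinset_card']
  decide

end SingularPoints

/-! ### The ideal of the seven points is locally generated by partial derivatives -/

section PointsIdeal

open MvPolynomial

variable {k : Type u} [Field k] [CharP k 2]

omit [CharP k 2] in
theorem mem_pointsIdeal_iff {n : ℕ} {c : MvPolynomial (Fin 3) k} (hc : c.IsHomogeneous n) :
    c ∈ pointsIdeal k ↔ ∀ x ∈ singularPoints k, incl k c ∈ x.asHomogeneousIdeal := by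
  refine (ProjectiveSpectrum.mem_vanishingIdeal (𝒜 := homogeneousSubmodule (Fin 3) k) _ _).trans ?_
  refine ⟨fun h x hx => (mem_g_iff k x hc).mp (h _ ⟨x, hx, rfl⟩), ?_⟩
  rintro h _ ⟨x, hx, rfl⟩
  exact (mem_g_iff k x hc).mpr (h x hx)

theorem partials_mem_pointsIdeal (m : Fin 3) : partials k m ∈ pointsIdeal k :=
  (mem_pointsIdeal_iff (partials_isHomogeneous k m)).mpr fun _ hx => mem_singularPoints_iff.mp hx m

/-- Polynomials that vanish at the points `(1 : a : b)` with `a, b ∈ 𝔽₂`. -/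
def affinePointsIdeal (k : Type u) [Field k] (i : Fin 3) : Ideal (MvPolynomial (Fin 3) k) :=
  Ideal.span {X (i + 1) * (X (i + 1) + X i), X (i + 2) * (X (i + 2) + X i)}

omit [CharP k 2] in
theorem mul_left_mem_affinePointsIdeal (i : Fin 3) (c : MvPolynomial (Fin 3) k) :
    c * (X (i + 1) * (X (i + 1) + X i)) ∈ affinePointsIdeal k i ∧
      c * (X (i + 2) * (X (i + 2) + X i)) ∈ affinePointsIdeal k i :=
  ⟨Ideal.mul_mem_left _ _ (Ideal.subset_span (by simp)),
    Ideal.mul_mem_left _ _ (Ideal.subset_span (by simp))⟩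

/-- The homogeneous coordinates of the point `(1 : a : b)`. -/
def planePoint {R : Type*} [One R] (i : Fin 3) (a b : R) (m : Fin 3) : R :=
  if m = i then 1 else if m = i + 1 then a else b

/-- The point `(1 : a : b)`, with homogeneous coordinates scaled by `X i`. -/
def scaledPoint {k : Type u} [Field k] (i : Fin 3) (a b : MvPolynomial (Fin 3) k) :
    Fin 3 → MvPolynomial (Fin 3) k := fun m => X i * planePoint i a b m

/-- Interpolation at the points `(1 : a : b)` with `a, b ∈ 𝔽₂`. -/
theorem interpolation (i : Fin 3) (c : MvPolynomial (Fin 3) k) :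
    X i ^ 2 * c - (aeval (scaledPoint i 0 0) c * ((X (i + 1) + X i) * (X (i + 2) + X i)) +
      aeval (scaledPoint i 1 0) c * (X (i + 1) * (X (i + 2) + X i)) +
      aeval (scaledPoint i 0 1) c * ((X (i + 1) + X i) * X (i + 2)) +
      aeval (scaledPoint i 1 1) c * (X (i + 1) * X (i + 2))) ∈ affinePointsIdeal k i := by
  have h2 := two_eq_zero_poly k (σ := Fin 3)
  induction c using MvPolynomial.induction_on with
  | C c =>
    -- The four interpolation factors add up to xᵢ² in characteristic two.
    convert zero_mem (affinePointsIdeal k i) using 1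
    simp only [aeval_C, algebraMap_eq]
    linear_combination (-C c * (2 * X (i + 1) * X (i + 2) + X i * X (i + 1) + X i * X (i + 2))) * h2
  | add p q hp hq =>
    convert add_mem hp hq using 1
    simp only [map_add]
    ring
  | mul_X p m hp =>
    have h1 := mul_left_mem_affinePointsIdeal (k := k) i
    by_cases hm : m = i
    · subst hm
      convert Ideal.mul_mem_left _ (X m) hp using 1
      simp only [map_mul, aeval_X, scaledPoint, planePoint, if_true, mul_one]
      ring
    by_cases hm1 : m = i + 1
    · subst hm1
      -- At a point with first coordinate a, replacing xᵢ₊₁ by axᵢ costs a multiple of xᵢ₊₁(xᵢ₊₁ +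
      -- xᵢ): the interpolation factor supplies whichever of the two linear forms is missing.
      have := add_mem (Ideal.mul_mem_left _ (X (i + 1)) hp) 
        (h1 (aeval (scaledPoint i 0 0) p * (X (i + 2) + X i) +
          aeval (scaledPoint i 1 0) p * (X (i + 2) + X i) +
          aeval (scaledPoint i 0 1) p * X (i + 2) + 
          aeval (scaledPoint i 1 1) p * X (i + 2))).1
      convert this using 1
      simp only [map_mul, aeval_X, scaledPoint, planePoint, if_neg hm, if_true,
        mul_one, mul_zero]
      linear_combination (-(aeval (scaledPoint i 1 0) p * X (i + 1) * (X (i + 2) + X i) +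
        aeval (scaledPoint i 1 1) p * X (i + 1) * X (i + 2)) * X i) * h2
    · obtain rfl := eq_add_two_of_ne m i hm hm1
      have := add_mem (Ideal.mul_mem_left _ (X (i + 2)) hp)
        (h1 (aeval (scaledPoint i 0 0) p * (X (i + 1) + X i) +
          aeval (scaledPoint i 1 0) p * X (i + 1) +
          aeval (scaledPoint i 0 1) p * (X (i + 1) + X i) + 
          aeval (scaledPoint i 1 1) p * X (i + 1))).2
      convert this using 1
      simp only [map_mul, aeval_X, scaledPoint, planePoint, if_neg hm, if_neg hm1,
        mul_one, mul_zero]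
      linear_combination (-(aeval (scaledPoint i 0 1) p * X (i + 2) * (X (i + 1) + X i) +
        aeval (scaledPoint i 1 1) p * X (i + 1) * X (i + 2)) * X i) * h2

/-- In the residue domain of the singular point above (1 : a : b), the other coordinates are a and b
times xᵢ. So the class of c is xᵢⁿ times its value at (1 : a : b), and xᵢ is nonzero there. -/
theorem aeval_planePoint_eq_zero {n : ℕ} {c : MvPolynomial (Fin 3) k} (hc : c.IsHomogeneous n)
    (hcp : c ∈ pointsIdeal k) (i : Fin 3) {a b : k} (ha : a ^ 2 = a) (hb : b ^ 2 = b) :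
    aeval (planePoint i a b) c = 0 := by
  obtain ⟨y, z, w, h⟩ := exists_isAffineCoords k i
  obtain ⟨x, hxi, hx, h1, h2⟩ := h.exists_isChartOrigin ha hb
  have hcx := (mem_pointsIdeal_iff hc).mp hcp x hx
  by_contra h0
  have h2' := two_eq_zero_coordRing k
  let π := Ideal.Quotient.mk x.asHomogeneousIdeal.toIdeal
  have hdom : IsDomain (CoordRing k ⧸ x.asHomogeneousIdeal.toIdeal) :=
    (Ideal.Quotient.isDomain_iff_prime _).mpr x.isPrime
  have hC (c : k) : incl k (C c) = algebraMap k _ c := (incl k).commutes c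
  have key {j : Fin 3} {a : k} (h : incl k (X j + C a * X i) ∈ x.asHomogeneousIdeal) :
      π (incl k (X j)) = π (incl k (X i)) * algebraMap k _ a := by
    have h3 : π (incl k (X j + C a * X i)) = 0 := Ideal.Quotient.eq_zero_iff_mem.mpr h
    rw [map_add, map_mul, map_add, map_mul, hC] at h3
    have h4 : π 2 = 0 := by rw [h2', map_zero]
    rw [map_ofNat] at h4
    have h5 : π (algebraMap k (CoordRing k) a) = algebraMap k _ a := rfl
    rw [h5] at h3
    linear_combination h3 - π (incl k (X i)) * algebraMap k _ a * h4
  have h3 : (Ideal.Quotient.mkₐ k x.asHomogeneousIdeal.toIdeal).comp (incl k) =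
      aeval (fun m => π (incl k (X m))) := by
    ext m
    rw [aeval_X]
    rfl
  have h4 : π (incl k c) = π (incl k (X i)) ^ n *
      aeval (fun m => algebraMap k (CoordRing k ⧸ x.asHomogeneousIdeal.toIdeal) (planePoint i a b m)) c := by
    refine Eq.trans congr($h3 c) (aeval_of_isWeightedHomogeneous hc _ _ _ fun m => ?_)
    rw [Pi.one_apply, pow_one]
    by_cases hm : m = i
    · subst hm
      simp [planePoint]
    by_cases hm1 : m = i + 1
    · subst hm1
      rw [key h1, planePoint, if_neg hm, if_pos rfl]
    · obtain rfl := eq_add_two_of_ne m i hm hm1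
      rw [key h2, planePoint, if_neg hm, if_neg hm1]
  rw [show π (incl k c) = 0 from Ideal.Quotient.eq_zero_iff_mem.mpr hcx] at h4
  have h5 : aeval (fun m => algebraMap k (CoordRing k ⧸ x.asHomogeneousIdeal.toIdeal)
      (planePoint i a b m)) c = algebraMap k _ (aeval (planePoint i a b) c) :=
    aeval_algebraMap_apply _ _ _
  rw [h5] at h4
  have h6 : π (incl k (X i)) ≠ 0 := fun h => hxi (Ideal.Quotient.eq_zero_iff_mem.mp h)
  exact mul_ne_zero (pow_ne_zero n h6) (((IsUnit.mk0 _ h0).map (algebraMap k _)).ne_zero) h4.symm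

/-- All four values in the interpolation formula vanish. -/
theorem mem_affinePointsIdeal {n : ℕ} {c : MvPolynomial (Fin 3) k} (hc : c.IsHomogeneous n)
    (hcp : c ∈ pointsIdeal k) (i : Fin 3) : X i ^ 2 * c ∈ affinePointsIdeal k i := by
  have h0 {a b : k} (ha : a ^ 2 = a) (hb : b ^ 2 = b) {v : Fin 3 → MvPolynomial (Fin 3) k}
      (hv : v = fun m => algebraMap k _ (planePoint i a b m)) : aeval (fun m => X i * v m) c = 0 := by
    rw [aeval_of_isWeightedHomogeneous hc (X i) (fun m => X i * v m) v fun m => by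
      rw [Pi.one_apply, pow_one], hv]
    have h1 : aeval (fun m => algebraMap k (MvPolynomial (Fin 3) k) (planePoint i a b m)) c =
        algebraMap k _ (aeval (planePoint i a b) c) := aeval_algebraMap_apply _ _ _
    rw [h1, aeval_planePoint_eq_zero hc hcp i ha hb, map_zero, mul_zero]
  have h1 := interpolation i c
  have hp (a b : k) : (fun m => algebraMap k (MvPolynomial (Fin 3) k) (planePoint i a b m)) =
      planePoint i (algebraMap k _ a) (algebraMap k _ b) := by
    funext m
    simp only [planePoint, apply_ite (algebraMap k (MvPolynomial (Fin 3) k)), map_one]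
  unfold scaledPoint at h1
  rw [h0 (a := 0) (b := 0) (by simp) (by simp) (by rw [hp, map_zero]),
    h0 (a := 1) (b := 0) (by simp) (by simp) (by rw [hp, map_zero, map_one]),
    h0 (a := 0) (b := 1) (by simp) (by simp) (by rw [hp, map_zero, map_one]),
    h0 (a := 1) (b := 1) (by simp) (by simp) (by rw [hp, map_one])] at h1
  simpa using h1

/-- Locally, the ideal of the points is generated by two partial derivatives. -/
theorem exists_eq_partials_combination {n : ℕ} {c : MvPolynomial (Fin 3) k} (hc : c.IsHomogeneous n)
    (hcp : c ∈ pointsIdeal k) (i : Fin 3) : ∃ p q, p.IsHomogeneous n ∧ q.IsHomogeneous n ∧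
      X i ^ 3 * c = p * partials k (i + 1) + q * partials k (i + 2) := by
  obtain ⟨p, q, h⟩ := Ideal.mem_span_pair.mp (mem_affinePointsIdeal hc hcp i)
  -- Multiplied by xᵢ, the two generators of the affine ideal become Fᵢ₊₂ and Fᵢ₊₁. Afterwards
  -- homogeneous components of the coefficients are taken.
  have h1 : X i ^ 3 * c = q * partials k (i + 1) + p * partials k (i + 2) := by
    rw [partials_eq, partials_eq, show i + 1 + 1 = i + 2 by fin_cases i <;> rfl,
      show i + 1 + 2 = i by fin_cases i <;> rfl, show i + 2 + 1 = i by fin_cases i <;> rfl,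
      show i + 2 + 2 = i + 1 by fin_cases i <;> rfl]
    linear_combination -X i * h
  refine ⟨homogeneousComponent n q, homogeneousComponent n p, homogeneousComponent_isHomogeneous n q,
    homogeneousComponent_isHomogeneous n p, ?_⟩
  have hd (a : MvPolynomial (Fin 3) k) (m : ℕ) :
      (DirectSum.decompose (homogeneousSubmodule (Fin 3) k) a m : MvPolynomial (Fin 3) k) =
        homogeneousComponent m a := by
    exact decomposition.decompose'_apply a m
  have h3 := congrArg (fun a => (DirectSum.decompose (homogeneousSubmodule (Fin 3) k) a (n + 3) :
    MvPolynomial (Fin 3) k)) h1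
  simp only [DirectSum.decompose_add, DirectSum.add_apply, Submodule.coe_add] at h3
  rw [DirectSum.coe_decompose_mul_add_of_right_mem (homogeneousSubmodule (Fin 3) k)
      (partials_isHomogeneous k (i + 1)),
    DirectSum.coe_decompose_mul_add_of_right_mem (homogeneousSubmodule (Fin 3) k)
      (partials_isHomogeneous k (i + 2)),
    DirectSum.decompose_of_mem_same _ (show _ ∈ homogeneousSubmodule (Fin 3) k (n + 3) from
      (add_comm n 3) ▸ ((isHomogeneous_X k i).pow 3).mul hc), hd, hd] at h3
  exact h3

end PointsIdeal

/-! ### The two derivations V and W have values in the expected twists -/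

section Weighted

open MvPolynomial

variable {σ R : Type*} [CommRing R]

theorem mkDerivation_fin_four (v : Fin 4 → MvPolynomial (Fin 4) R) (p : MvPolynomial (Fin 4) R) :
    mkDerivation R v p =
      v 0 * pderiv 0 p + v 1 * pderiv 1 p + v 2 * pderiv 2 p + v 3 * pderiv 3 p := by
  have : mkDerivation R v = v 0 • pderiv 0 + v 1 • pderiv 1 + v 2 • pderiv 2 + v 3 • pderiv 3 := by
    refine derivation_ext fun i => ?_
    rw [mkDerivation_X]
    fin_cases i <;> simp [pderiv_X]
  rw [this]
  rfl

theorem isWeightedHomogeneous_mul_pderiv {w : σ → ℕ} {n m e : ℕ} {p q : MvPolynomial σ R} {j : σ}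
    (hp : p.IsWeightedHomogeneous w n) (hq : q.IsWeightedHomogeneous w e) (h : e + n = m + w j) :
    (q * pderiv j p).IsWeightedHomogeneous w m := by
  by_cases hj : w j ≤ n
  · rw [show m = e + (n - w j) by omega]
    exact hq.mul (hp.pderiv (by omega))
  -- A variable of weight larger than the degree of p does not occur in p.
  · rw [pderiv_eq_zero_of_notMem_vars, mul_zero]
    · exact isWeightedHomogeneous_zero _ _ _
    · intro hjv
      obtain ⟨d, hd, hjd⟩ := mem_vars_iff_mem_support _ |>.mp hjv
      have h1 := Finsupp.le_weight_of_ne_zero' w (Finsupp.mem_support_iff.mp hjd)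
      rw [hp (mem_support_iff.mp hd)] at h1
      exact hj h1

end Weighted

section TwistDerivations

open MvPolynomial

variable {k : Type u} [Field k] [CharP k 2]

theorem derV_toCoordRing (p : MvPolynomial (Fin 4) k) : derV k (toCoordRing k p) = toCoordRing k
    (X 0 ^ 2 * pderiv 0 p + X 1 ^ 2 * pderiv 1 p + X 2 ^ 2 * pderiv 2 p) := by
  rw [derV, Derivation.liftOfSurjective_apply, mkDerivation_fin_four]
  simp

theorem derW_toCoordRing (p : MvPolynomial (Fin 4) k) :
    derW k (toCoordRing k p) = toCoordRing k (pderiv 3 p) := by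
  rw [derW, Derivation.liftOfSurjective_apply, mkDerivation_fin_four]
  simp

/-- In degree `d`, the derivation `derV` agrees with `d xᵢ` up to elements of the ideal of the
points. -/
theorem mul_derV_sub_mem {d : ℕ} {a : CoordRing k} (ha : a ∈ grading k d) (i : Fin 3) :
    incl k (X i) * (derV k a - incl k (X i) * (d * a)) ∈ (pointsIdeal k).map (incl k) := by
  obtain ⟨p, hp, rfl⟩ := ha
  change incl k (X i) * (derV k (toCoordRing k p) - incl k (X i) * (d * toCoordRing k p)) ∈ _
  -- Euler's formula; the term of x₃ drops out because its weight two is zero in k.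
  have h1 := hp.sum_weight_X_mul_pderiv
  rw [Fin.sum_univ_four] at h1
  simp only [weights, Matrix.cons_val, one_smul, nsmul_eq_mul, Nat.cast_ofNat] at h1
  rw [two_eq_zero_poly, zero_mul, add_zero] at h1
  have h2 := congrArg (toCoordRing k) h1
  have hX (j : Fin 3) : toCoordRing k (X j.castSucc) = incl k (X j) := (incl_X k j).symm
  have hX0 := hX 0
  have hX1 := hX 1
  have hX2 := hX 2
  simp only [Fin.castSucc_zero, Fin.castSucc_one, show (Fin.castSucc 2 : Fin 4) = 2 from rfl] at hX0 hX1 hX2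
  simp only [map_add, map_mul, map_natCast] at h2
  rw [derV_toCoordRing, ← h2]
  simp only [map_add, map_mul, map_pow, hX0, hX1, hX2]
  -- Up to sign this is xᵢxⱼ(xᵢ + xⱼ), which is zero or a partial derivative: at the seven points V
  -- agrees with xᵢ times the Euler field.
  have hm (j : Fin 3) : incl k (X i) * (incl k (X j) ^ 2 - incl k (X i) * incl k (X j)) ∈
      (pointsIdeal k).map (incl k) := by
    have h3 (m : Fin 3) := Ideal.mem_map_of_mem (incl k) (partials_mem_pointsIdeal (k := k) m)
    have h4 := two_eq_zero_coordRing k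
    by_cases hji : j = i
    · subst hji
      convert zero_mem ((pointsIdeal k).map (incl k)) using 1
      ring
    by_cases hj1 : j = i + 1
    · subst hj1
      convert h3 (i + 2) using 1
      rw [partials_eq, show i + 2 + 1 = i by fin_cases i <;> rfl,
        show i + 2 + 2 = i + 1 by fin_cases i <;> rfl]
      simp only [map_mul, map_add]
      linear_combination -(incl k (X i) ^ 2 * incl k (X (i + 1))) * h4
    · obtain rfl := eq_add_two_of_ne j i hji hj1
      convert h3 (i + 1) using 1
      rw [partials_eq, show i + 1 + 1 = i + 2 by fin_cases i <;> rfl,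
        show i + 1 + 2 = i by fin_cases i <;> rfl]
      simp only [map_mul, map_add]
      linear_combination -(incl k (X i) ^ 2 * incl k (X (i + 2))) * h4
  have h5 := add_mem (add_mem (Ideal.mul_mem_right (toCoordRing k (pderiv 0 p)) _ (hm 0))
    (Ideal.mul_mem_right (toCoordRing k (pderiv 1 p)) _ (hm 1)))
    (Ideal.mul_mem_right (toCoordRing k (pderiv 2 p)) _ (hm 2))
  convert h5 using 1
  ring

variable (k) in
theorem isTwistDerivation_derV :
    IsTwistDerivation (grading k) ((pointsIdeal k).map (incl k)) 1 (derV k) where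
  degree {i j a} hij ha := by
    obtain ⟨p, hp, rfl⟩ := ha
    change derV k (toCoordRing k p) ∈ _
    rw [derV_toCoordRing]
    refine toCoordRing_mem_grading k ?_
    have h (m : Fin 4) (hm : weights m = 1) :
        (X m ^ 2 * pderiv m p).IsWeightedHomogeneous weights j :=
      isWeightedHomogeneous_mul_pderiv hp ((isWeightedHomogeneous_X k weights m).pow 2)
        (by rw [hm, smul_eq_mul]; omega)
    exact ((h 0 rfl).add (h 1 rfl)).add (h 2 rfl)
  mem x := by
    obtain ⟨i, hi⟩ := exists_mem_chartOpen x
    refine ⟨1, incl k (X i), incl_X_mem i, hi, by norm_num, fun d a b ha hb => ?_⟩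
    -- The Euler terms d·xᵢab of the two summands cancel.
    have h1 := sub_mem (Ideal.mul_mem_left _ b (mul_derV_sub_mem ha i))
      (Ideal.mul_mem_left _ a (mul_derV_sub_mem hb i))
    convert h1 using 1
    ring

variable (k) in
theorem isTwistDerivation_derW : IsTwistDerivation (grading k) ⊤ (-2) (derW k) where
  degree {i j a} hij ha := by
    obtain ⟨p, hp, rfl⟩ := ha
    change derW k (toCoordRing k p) ∈ _
    rw [derW_toCoordRing]
    refine toCoordRing_mem_grading k ?_
    exact hp.pderiv (show j + 2 = i by omega)
  mem x := by
    obtain ⟨i, hi⟩ := exists_mem_chartOpen x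
    exact ⟨2, incl k (X i) ^ 2, SetLike.pow_mem_graded 2 (incl_X_mem i), pow_notMem hi 2,
      by norm_num, fun _ _ _ _ _ => trivial⟩

end TwistDerivations

/-! ### Generators and relations for differentials on a chart -/

section Kaehler

open CommRingCat.KaehlerDifferential (d)

variable {A B : CommRingCat.{u}} (σ : A ⟶ B)

theorem kaehler_span_range_d : Submodule.span B (Set.range (d (f := σ))) = ⊤ := by
  let := σ.hom.toAlgebra
  exact KaehlerDifferential.span_range_derivation A B

theorem d_add (b b' : B) : d (f := σ) (b + b') = d (f := σ) b + d (f := σ) b' :=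
  ModuleCat.Derivation.d_add _ b b'

theorem d_mul (b b' : B) : d (f := σ) (b * b') = b • d (f := σ) b' + b' • d (f := σ) b :=
  ModuleCat.Derivation.d_mul _ b b'

theorem d_map (a : A) : d (f := σ) (σ.hom a) = 0 :=
  ModuleCat.Derivation.d_map (CommRingCat.KaehlerDifferential.D σ) a

theorem d_one : d (f := σ) 1 = 0 := by
  have := d_map σ 1
  rwa [map_one] at this

theorem d_eval₂_mem (v : Fin 3 → B) (P : MvPolynomial (Fin 3) A) :
    d (f := σ) (P.eval₂ σ.hom v) ∈ Submodule.span B (Set.range fun i => d (f := σ) (v i)) := by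
  induction P using MvPolynomial.induction_on with
  | C c =>
    rw [MvPolynomial.eval₂_C, d_map]
    exact zero_mem _
  | add p q hp hq =>
    rw [MvPolynomial.eval₂_add, d_add]
    exact add_mem hp hq
  | mul_X p i hp =>
    rw [MvPolynomial.eval₂_mul, MvPolynomial.eval₂_X, d_mul]
    exact add_mem (Submodule.smul_mem _ _ (Submodule.subset_span ⟨i, rfl⟩))
      (Submodule.smul_mem _ _ hp)

/-- Every function is P/H with P and H polynomials in y, z, w and H a unit, and the Leibniz rule for
H·r = P expresses dr. -/
theorem exists_eq_combination_d {y z w : B} (h : ∀ r, ∃ H, IsUnit H ∧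
    (∃ Q : MvPolynomial (Fin 3) A, H = Q.eval₂ σ.hom ![y, z, w]) ∧
    ∃ P : MvPolynomial (Fin 3) A, H * r = P.eval₂ σ.hom ![y, z, w])
    (ω : CommRingCat.KaehlerDifferential σ) :
    ∃ a b c : B, ω = a • d (f := σ) y + b • d (f := σ) z + c • d (f := σ) w := by
  have key : Submodule.span B (Set.range fun i => d (f := σ) (![y, z, w] i)) = ⊤ := by
    rw [eq_top_iff, ← kaehler_span_range_d, Submodule.span_le]
    rintro _ ⟨r, rfl⟩
    obtain ⟨H, ⟨H, rfl⟩, ⟨Q, hQ⟩, P, hP⟩ := h r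
    have h1 := d_eval₂_mem σ ![y, z, w] P
    rw [← hP, d_mul, hQ] at h1
    have h2 := (Submodule.add_mem_iff_left _ (Submodule.smul_mem _ r
      (d_eval₂_mem σ ![y, z, w] Q))).mp h1
    rw [← hQ] at h2
    have h3 := Submodule.smul_mem _ (↑H⁻¹ : B) h2
    rwa [smul_smul, Units.inv_mul, one_smul] at h3
  have hω : ω ∈ Submodule.span B (Set.range fun i => d (f := σ) (![y, z, w] i)) := by
    rw [key]; trivial
  obtain ⟨c, hc⟩ := (Submodule.mem_span_range_iff_exists_fun B).mp hω
  refine ⟨c 0, c 1, c 2, ?_⟩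
  rw [← hc, Fin.sum_univ_three]
  rfl

/-- Differentiating the equation gives this relation because 2w dw = 0; dw remains free. -/
theorem d_relation {y z w : B} (h2 : (2 : B) = 0) (h : w ^ 2 = y * z * (1 + y + z)) :
    (z * (1 + z)) • d (f := σ) y + (y * (1 + y)) • d (f := σ) z = 0 := by
  have h1 := congrArg (d (f := σ)) h
  simp only [pow_two, d_mul, d_add, d_one] at h1
  have h3 (m : CommRingCat.KaehlerDifferential σ) : (2 : B) • m = 0 := by rw [h2, zero_smul]
  linear_combination (norm := module) -h1 + w • h3 (d (f := σ) w) - (y * z) • h3 (d (f := σ) y) -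
    (y * z) • h3 (d (f := σ) z)

/-- A criterion for the splitting of the module of differentials into two quotients. -/
theorem kaehler_prod_bijective {M N : Type*} [AddCommGroup M] [AddCommGroup N] [Module B M]
    [Module B N] {y z w P Q : B} (hspan : ∀ ω : CommRingCat.KaehlerDifferential σ,
      ∃ a b c : B, ω = a • d (f := σ) y + b • d (f := σ) z + c • d (f := σ) w)
    (hrel : P • d (f := σ) y + Q • d (f := σ) z = 0)
    (p : CommRingCat.KaehlerDifferential σ →ₗ[B] M) (q : CommRingCat.KaehlerDifferential σ →ₗ[B] N)
    (hpw : p (d (f := σ) w) = 0) (hqy : q (d (f := σ) y) = 0) (hqz : q (d (f := σ) z) = 0)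
    (hM : ∀ m, ∃ a b : B, a • p (d (f := σ) y) + b • p (d (f := σ) z) = m)
    (hN : ∀ n, ∃ c : B, c • q (d (f := σ) w) = n)
    (hM' : ∀ a b : B, a • p (d (f := σ) y) + b • p (d (f := σ) z) = 0 → ∃ c, a = c * P ∧ b = c * Q)
    (hN' : ∀ c : B, c • q (d (f := σ) w) = 0 → c = 0) :
    Function.Bijective fun ω => (p ω, q ω) := by
  refine ⟨?_, fun ⟨m, n⟩ => ?_⟩
  · refine (injective_iff_map_eq_zero (p.prod q)).mpr fun ω hω => ?_
    obtain ⟨a, b, c, rfl⟩ := hspan ω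
    have hp : p _ = 0 := congrArg Prod.fst hω
    have hq : q _ = 0 := congrArg Prod.snd hω
    simp only [ map_add, map_smul, hpw, hqy, hqz, smul_zero, add_zero,
      zero_add] at hp hq
    obtain rfl := hN' c hq
    obtain ⟨e, rfl, rfl⟩ := hM' a b hp
    rw [zero_smul, add_zero, mul_smul, mul_smul, ← smul_add, hrel, smul_zero]
  · obtain ⟨a, b, hm⟩ := hM m
    obtain ⟨c, hn⟩ := hN n
    refine ⟨a • d (f := σ) y + b • d (f := σ) z + c • d (f := σ) w, ?_⟩
    simp only [map_add, map_smul, hpw, hqy, hqz, smul_zero, add_zero, zero_add, hm, hn]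

end Kaehler

/-! ### The only syzygy between the two local generators of the ideal -/

section Coprime

open MvPolynomial

variable {k : Type u} [Field k]

/-- The hypothesis `hP` says that P does not involve the prime element `X l`, so `X l` cannot divide
P. -/
theorem X_dvd_of_mul_eq {σ : Type*} [DecidableEq σ] {l : σ} {a P b : MvPolynomial σ k}
    (hP : aeval (Function.update X l (0 : MvPolynomial σ k)) P = P) (hP0 : P ≠ 0)
    (h : a * P = X l * b) : X l ∣ a := by
  refine (X_prime.dvd_or_dvd ⟨b, h⟩).resolve_right fun ⟨c, hc⟩ => hP0 ?_
  rw [← hP, hc, map_mul, aeval_X, Function.update_self, zero_mul]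

/-- The change of variable replacing `X l` by `X l - X i` fixes P and reduces the divisor to a
variable. -/
theorem add_dvd_of_mul_eq {σ : Type*} [DecidableEq σ] {i l : σ} (hil : i ≠ l) {a P b : MvPolynomial σ k}
    (hP : ∀ q : MvPolynomial σ k, aeval (Function.update X l q) P = P) (hP0 : P ≠ 0)
    (h : a * P = (X l + X i) * b) : (X l + X i) ∣ a := by
  let τ : MvPolynomial σ k →ₐ[k] MvPolynomial σ k := aeval (Function.update X l (X l - X i))
  let τ' : MvPolynomial σ k →ₐ[k] MvPolynomial σ k := aeval (Function.update X l (X l + X i))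
  have hτ : τ'.comp τ = AlgHom.id k _ := by
    ext j
    by_cases hj : j = l
    · subst hj
      simp [τ, τ', hil]
    · simp [τ, τ', hj]
  have h1 := congrArg τ h
  have hl : τ (X l + X i) = X l := by simp [τ, hil]
  rw [map_mul, map_mul, hl, show τ P = P from hP _] at h1
  obtain ⟨c, hc⟩ := X_dvd_of_mul_eq (hP 0) hP0 h1
  refine ⟨τ' c, ?_⟩
  have h2 := congrArg τ' hc
  rw [map_mul, show τ' (τ a) = a from congr($hτ a)] at h2
  rw [h2]
  simp [τ']

/-- The linear factors `X l` and `X l + X i` are coprime to the quadric in `X j`, so they are split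
off from a one after the other. -/
theorem exists_eq_mul_of_mul_eq_mul {i j l : Fin 3} (hij : i ≠ j) (hil : i ≠ l) (hjl : j ≠ l)
    {a b : MvPolynomial (Fin 3) k} (h : a * (X j * (X j + X i)) = b * (X l * (X l + X i))) :
    ∃ c, a = c * (X l * (X l + X i)) ∧ b = c * (X j * (X j + X i)) := by
  have hP0 : (X j * (X j + X i) : MvPolynomial (Fin 3) k) ≠ 0 :=
    mul_ne_zero (X_ne_zero j) (X_add_X_ne_zero k hij.symm)
  have hP (q : MvPolynomial (Fin 3) k) : aeval (Function.update X l q)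
      (X j * (X j + X i) : MvPolynomial (Fin 3) k) = X j * (X j + X i) := by
    simp [hjl, hil]
  obtain ⟨a, rfl⟩ := X_dvd_of_mul_eq (a := a) (b := (X l + X i) * b) (hP 0) hP0
    (by rw [h]; ring)
  have h1 : a * (X j * (X j + X i)) = (X l + X i) * b :=
    mul_left_cancel₀ (X_ne_zero l) (by linear_combination h)
  obtain ⟨c, rfl⟩ := add_dvd_of_mul_eq hil hP hP0 h1
  refine ⟨c, by ring, mul_left_cancel₀ (X_add_X_ne_zero k hil.symm) ?_⟩
  linear_combination -h1

theorem exists_eq_mul_of_mul_incl_eq {i j l : Fin 3} (hij : i ≠ j) (hil : i ≠ l) (hjl : j ≠ l)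
    {a b : CoordRing k} (h : a * incl k (X j * (X j + X i)) = b * incl k (X l * (X l + X i))) :
    ∃ c, a = c * incl k (X l * (X l + X i)) ∧ b = c * incl k (X j * (X j + X i)) := by
  obtain ⟨a0, a1, rfl⟩ := exists_normalForm k a
  obtain ⟨b0, b1, rfl⟩ := exists_normalForm k b
  obtain ⟨h0, h1⟩ := normalForm_inj k (a := a0 * (X j * (X j + X i)))
    (b := a1 * (X j * (X j + X i))) (a' := b0 * (X l * (X l + X i)))
    (b' := b1 * (X l * (X l + X i))) (by
      rw [map_mul _ a0, map_mul _ a1, map_mul _ b0, map_mul _ b1]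
      linear_combination h)
  obtain ⟨c0, rfl, rfl⟩ := exists_eq_mul_of_mul_eq_mul hij hil hjl h0
  obtain ⟨c1, rfl, rfl⟩ := exists_eq_mul_of_mul_eq_mul hij hil hjl h1
  refine ⟨incl k c0 + incl k c1 * coord k 3, ?_, ?_⟩
  · rw [map_mul _ c0, map_mul _ c1]; ring
  · rw [map_mul _ c0, map_mul _ c1]; ring

end Coprime

/-! ### V and W on the affine coordinates, and the modules they generate -/

section LocalForms

open MvPolynomial

variable {k : Type u} [Field k] {i : Fin 3} {U : (S k).Opens} {y z w : Γ(S k, U)}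

theorem exists_isAffineCoords_of_le (hU : U ≤ chartOpen k i) :
    ∃ y z w : Γ(S k, U), IsAffineCoords i y z w := by
  obtain ⟨y, z, w, h⟩ := exists_isAffineCoords k i
  exact ⟨(S k).presheaf.map (homOfLE hU).op y, (S k).presheaf.map (homOfLE hU).op z,
    (S k).presheaf.map (homOfLE hU).op w, fun x hx => h.y x (hU hx), fun x hx => h.z x (hU hx),
    fun x hx => h.w x (hU hx)⟩

theorem sOpen_le_chartOpen {h : CoverIndex k} (hi : X i ∣ h.1) : sOpen h ≤ chartOpen k i :=
  Proj.basicOpen_mono _ _ _ (map_dvd (incl k) hi)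

theorem two_eq_zero_of_scalars [CharP k 2] : (2 : Γ(S k, U)) = 0 := by
  have := congrArg (scalars (sToSpec k) (op U)).hom (CharTwo.two_eq_zero (R := k))
  rwa [map_ofNat, map_zero] at this

variable (k) in
/-- The ideal of the singular points. -/
abbrev singularIdeal : Ideal (CoordRing k) := (pointsIdeal k).map (incl k)

variable (k) in
/-- The vector field `∑ xᵢ² ∂ᵢ` with values in `𝒪(1)`. -/
abbrev vectorV [CharP k 2] (U : (S k).Opens) (r : Γ(S k, U)) :
    Γ(twist (grading k) (singularIdeal k) 1, U) :=
  twistDer (U := op U) (isTwistDerivation_derV k) r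

variable (k) in
/-- The vector field `∂ / ∂ x₃` with values in `𝒪(-2)`. -/
abbrev vectorW [CharP k 2] (U : (S k).Opens) (r : Γ(S k, U)) : Γ(twist (grading k) ⊤ (-2), U) :=
  twistDer (U := op U) (isTwistDerivation_derW k) r

/-- The value of a section of a twist. -/
def twistVal {J : Ideal (CoordRing k)} {n : ℤ} (m : Γ(twist (grading k) J n, U))
    (x : ProjectiveSpectrum (grading k)) (hx : x ∈ U) : LocAt (grading k) x := m.1 ⟨x, hx⟩

theorem twistVal_ext {J : Ideal (CoordRing k)} {n : ℤ} {m m' : Γ(twist (grading k) J n, U)}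
    (h : ∀ x hx, twistVal m x hx = twistVal m' x hx) : m = m' :=
  Subtype.ext (funext fun x => h x.1 x.2)

theorem twistVal_add {J : Ideal (CoordRing k)} {n : ℤ} (m m' : Γ(twist (grading k) J n, U))
    (x : ProjectiveSpectrum (grading k)) (hx : x ∈ U) : twistVal (m + m') x hx = twistVal m x hx + twistVal m' x hx := rfl

theorem twistVal_smul {J : Ideal (CoordRing k)} {n : ℤ} (r : Γ(S k, U))
    (m : Γ(twist (grading k) J n, U)) (x : ProjectiveSpectrum (grading k)) (hx : x ∈ U) :
    twistVal (r • m) x hx = valHom U x hx r * twistVal m x hx := rfl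

theorem twistVal_zero {J : Ideal (CoordRing k)} {n : ℤ} (x : ProjectiveSpectrum (grading k)) (hx : x ∈ U) :
    twistVal (0 : Γ(twist (grading k) J n, U)) x hx = 0 := rfl

theorem exists_valHom {n : ℕ} {a b : CoordRing k} (ha : a ∈ grading k n) (hb : b ∈ grading k n)
    (hU : ∀ x ∈ U, b ∉ (x : ProjectiveSpectrum (grading k)).asHomogeneousIdeal) : ∃ r : Γ(S k, U),
      ∀ x hx, algebraMap _ (LocAt (grading k) x) b * valHom U x hx r = algebraMap _ _ a := by
  obtain ⟨r, hr⟩ := exists_reg (U := op U) ha hb fun x => hU x.1 x.2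
  exact ⟨r, fun x hx => hr ⟨x, hx⟩⟩

theorem exists_valHom_fraction [CharP k 2] {d : ℕ} {h : CoordRing k} (hd : 0 < d)
    (hh : h ∈ grading k d) (hU : U = Proj.basicOpen (grading k) h) (r : Γ(S k, U)) :
    ∃ (N : ℕ) (a : CoordRing k), a ∈ grading k (N * d) ∧ ∀ x hx,
      algebraMap _ (LocAt (grading k) x) h ^ N * valHom U x hx r = algebraMap _ _ a := by
  obtain ⟨N, a, ha, hr⟩ := exists_reg_fraction (U := op U) hd hh hU r
  exact ⟨N, a, ha, fun x hx => by rw [← map_pow]; exact hr ⟨x, hx⟩⟩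

theorem exists_twistVal_fraction [CharP k 2] {J : Ideal (CoordRing k)} {n : ℤ} {d : ℕ}
    {h : CoordRing k} (hd : 0 < d) (hh : h ∈ grading k d) (hU : U = Proj.basicOpen (grading k) h)
    (m : Γ(twist (grading k) J n, U)) : ∃ (N e : ℕ) (a : CoordRing k), (e : ℤ) = (N * d : ℕ) + n ∧
      a ∈ grading k e ∧ a ∈ J ∧ ∀ x hx,
        algebraMap _ (LocAt (grading k) x) h ^ N * twistVal m x hx = algebraMap _ _ a := by
  obtain ⟨N, e, a, he, ha, haJ, hm⟩ := exists_fraction (U := op U) hd hh hU m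
  exact ⟨N, e, a, he, ha, haJ, fun x hx => by rw [← map_pow]; exact hm ⟨x, hx⟩⟩

/-- The unit H is a power of h/xᵢᵈ, the dehomogenization of the equation h; it absorbs the
denominator of r. -/
theorem exists_unit_eval₂ {h : CoverIndex k} [CharP k 2] (hU : U = sOpen h)
    (hi : X i ∣ h.1) (hc : IsAffineCoords i y z w) (r : Γ(S k, U)) : ∃ H, IsUnit H ∧
    (∃ Q : MvPolynomial (Fin 3) k, H = Q.eval₂ (scalars (sToSpec k) (op U)).hom ![y, z, w]) ∧
    ∃ P : MvPolynomial (Fin 3) k, H * r = P.eval₂ (scalars (sToSpec k) (op U)).hom ![y, z, w] := by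
  obtain ⟨d, hd, hhd⟩ := h.exists_isHomogeneous
  have hh := incl_mem_grading k hhd
  have hhx (x : ProjectiveSpectrum (grading k)) (hx : x ∈ U) : incl k h.1 ∉ x.asHomogeneousIdeal := hU.le hx
  have hix (x : ProjectiveSpectrum (grading k)) (hx : x ∈ U) : incl k (X i) ∉ x.asHomogeneousIdeal :=
    sOpen_le_chartOpen hi (hU.le hx)
  obtain ⟨N, a, ha, hr⟩ := exists_valHom_fraction hd hh hU r
  obtain ⟨P, hP⟩ := hc.exists_eval₂ ha
  obtain ⟨Q, hQ⟩ := hc.exists_eval₂ hh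
  obtain ⟨v, hv⟩ := exists_valHom (SetLike.pow_mem_graded d (incl_X_mem (k := k) i))
    (b := incl k h.1) (by rwa [smul_eq_mul, mul_one]) hhx
  set H := Q.eval₂ (scalars (sToSpec k) (op U)).hom ![y, z, w]
  refine ⟨H ^ N, IsUnit.pow N (IsUnit.of_mul_eq_one v ?_), ⟨Q ^ N, (eval₂_pow _ _).symm⟩, P, ?_⟩
  · refine valHom_ext fun x hx => eq_of_algebraMap_mul_eq (pow_notMem (hix x hx) d) ?_
    have h1 := hv x hx
    have h2 := hQ x hx
    rw [map_pow] at h1 ⊢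
    rw [map_mul, map_one, mul_one, ← mul_assoc, h2, h1]
  · refine valHom_ext fun x hx => eq_of_algebraMap_mul_eq (pow_notMem (hix x hx) (N * d)) ?_
    have h1 := hr x hx
    have h2 := hQ x hx
    rw [map_pow, hP x hx, ← h1, ← h2, map_mul, map_pow]
    ring

variable [CharP k 2]

theorem derV_incl_X (i : Fin 3) : derV k (incl k (X i)) = incl k (X i) ^ 2 := by
  rw [incl_X, derV_coord]
  fin_cases i <;> exact map_pow _ _ _

theorem derV_coord_three : derV k (coord k 3) = 0 := by
  rw [derV_coord]
  simp

theorem derW_incl_X (i : Fin 3) : derW k (incl k (X i)) = 0 := by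
  rw [incl_X, derW_coord]
  fin_cases i <;> exact map_zero _

theorem derW_coord_three : derW k (coord k 3) = 1 := by
  rw [derW_coord]
  simp

theorem incl_partials_add_two (i : Fin 3) : incl k (partials k (i + 2)) =
    incl k (X i) * incl k (X (i + 1)) * (incl k (X i) + incl k (X (i + 1))) := by
  rw [partials_eq, show i + 2 + 1 = i by fin_cases i <;> rfl,
    show i + 2 + 2 = i + 1 by fin_cases i <;> rfl, map_mul, map_mul, map_add]

theorem incl_partials_add_one (i : Fin 3) : incl k (partials k (i + 1)) =
    incl k (X i) * incl k (X (i + 2)) * (incl k (X i) + incl k (X (i + 2))) := by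
  rw [partials_eq, show i + 1 + 1 = i + 2 by fin_cases i <;> rfl,
    show i + 1 + 2 = i by fin_cases i <;> rfl, map_mul, map_mul, map_add]
  ring

section Values

variable (hc : IsAffineCoords i y z w) (x : ProjectiveSpectrum (grading k)) (hx : x ∈ U)
include hc

/-- V(xᵢ₊₁/xᵢ) = xᵢ₊₁(xᵢ₊₁ + xᵢ)/xᵢ = Fᵢ₊₂/xᵢ². -/
theorem sq_mul_vectorV_y : algebraMap _ _ (incl k (X i)) ^ 2 * twistVal (vectorV k U y) x hx =
    algebraMap _ _ (incl k (partials k (i + 2))) := by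
  have h1 := sq_mul_locDer (derV k) (hc.y x hx)
  rw [map_pow] at h1
  refine h1.trans ?_
  rw [derV_incl_X, derV_incl_X, incl_partials_add_two]
  congr 1
  linear_combination (-(incl k (X i) ^ 2 * incl k (X (i + 1)))) * two_eq_zero_coordRing k

theorem sq_mul_vectorV_z : algebraMap _ _ (incl k (X i)) ^ 2 * twistVal (vectorV k U z) x hx =
    algebraMap _ _ (incl k (partials k (i + 1))) := by
  have h1 := sq_mul_locDer (derV k) (hc.z x hx)
  rw [map_pow] at h1
  refine h1.trans ?_
  rw [derV_incl_X, derV_incl_X, incl_partials_add_one]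
  congr 1
  linear_combination (-(incl k (X i) ^ 2 * incl k (X (i + 2)))) * two_eq_zero_coordRing k

omit hc [CharP k 2] in
theorem eq_zero_of_pow_mul {v : LocAt (grading k) x} {a : CoordRing k} {N : ℕ}
    (ha : a ∉ x.asHomogeneousIdeal) (h : algebraMap _ (LocAt (grading k) x) (a ^ N) * v = 0) :
    v = 0 :=
  eq_of_algebraMap_mul_eq (pow_notMem ha N) (by rw [h, mul_zero])

/-- V kills x₃, and the derivative of the denominator xᵢ² carries the factor 2. -/
theorem vectorV_w (hix : x ∈ chartOpen k i) : twistVal (vectorV k U w) x hx = 0 := by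
  have h1 := sq_mul_locDer (derV k) (b := incl k (X i) ^ 2) ((congrArg (· * _) (map_pow _ _ 2)).trans (hc.w x hx))
  refine eq_zero_of_pow_mul (N := 4) x hix (Eq.trans ?_ (h1.trans ?_))
  · rw [← pow_mul]
    rfl
  · rw [derV_coord_three, Derivation.leibniz_pow, derV_incl_X]
    refine (congrArg _ ?_).trans (map_zero _)
    linear_combination (-coord k 3 * incl k (X i) ^ 3) * two_eq_zero_coordRing k

theorem vectorW_y (hix : x ∈ chartOpen k i) : twistVal (vectorW k U y) x hx = 0 := by
  have h1 := sq_mul_locDer (derW k) (hc.y x hx)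
  refine eq_zero_of_pow_mul (N := 2) x hix (h1.trans ?_)
  rw [derW_incl_X, derW_incl_X, mul_zero, mul_zero, sub_zero, map_zero]

theorem vectorW_z (hix : x ∈ chartOpen k i) : twistVal (vectorW k U z) x hx = 0 := by
  have h1 := sq_mul_locDer (derW k) (hc.z x hx)
  refine eq_zero_of_pow_mul (N := 2) x hix (h1.trans ?_)
  rw [derW_incl_X, derW_incl_X, mul_zero, mul_zero, sub_zero, map_zero]

theorem sq_mul_vectorW_w (hix : x ∈ chartOpen k i) :
    algebraMap _ _ (incl k (X i)) ^ 2 * twistVal (vectorW k U w) x hx = 1 := by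
  have h1 := sq_mul_locDer (derW k) (b := incl k (X i) ^ 2) ((congrArg (· * _) (map_pow _ _ 2)).trans (hc.w x hx))
  refine eq_of_algebraMap_mul_eq (pow_notMem hix 2) ?_
  rw [derW_coord_three, Derivation.leibniz_pow, derW_incl_X, smul_zero, smul_zero, mul_zero,
    sub_zero, mul_one] at h1
  simp only [map_pow] at h1 ⊢
  rw [mul_one, ← mul_assoc, ← pow_two]
  exact h1

end Values

section Modules

variable {h : CoverIndex k} (hU : U = sOpen h) (hi : X i ∣ h.1) (hc : IsAffineCoords i y z w)
include hU hi hc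

theorem exists_smul_vectorW (n : Γ(twist (grading k) ⊤ (-2), U)) :
    ∃ c : Γ(S k, U), c • vectorW k U w = n := by
  obtain ⟨d, hd, hhd⟩ := h.exists_isHomogeneous
  have hh := incl_mem_grading k hhd
  have hhx (x : ProjectiveSpectrum (grading k)) (hx : x ∈ U) : incl k h.1 ∉ x.asHomogeneousIdeal := hU.le hx
  have hix (x : ProjectiveSpectrum (grading k)) (hx : x ∈ U) : x ∈ chartOpen k i := sOpen_le_chartOpen hi (hU.le hx)
  obtain ⟨N, e, a, he, ha, -, hn⟩ := exists_twistVal_fraction hd hh hU n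
  have hdeg : N • d = 2 • 1 + e := by simp only [smul_eq_mul]; omega
  obtain ⟨c, hr⟩ := exists_valHom (U := U) (a := incl k (X i) ^ 2 * a) (b := incl k h.1 ^ N)
    (SetLike.mul_mem_graded (SetLike.pow_mem_graded 2 (incl_X_mem (k := k) i)) ha)
    (hdeg ▸ SetLike.pow_mem_graded N hh)
    (fun x hx => pow_notMem (hhx x hx) N)
  refine ⟨c, twistVal_ext fun x hx => eq_of_algebraMap_mul_eq
    (mul_notMem _ x (pow_notMem (hix x hx) 2) (pow_notMem (hhx x hx) N)) ?_⟩
  have h1 := sq_mul_vectorW_w hc x hx (hix x hx)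
  have h2 := hr x hx
  have h3 := hn x hx
  rw [twistVal_smul]
  simp only [map_mul, map_pow] at h1 h2 h3 ⊢
  linear_combination h2 - algebraMap _ (LocAt (grading k) x) (incl k (X i)) ^ 2 * h3 +
    algebraMap _ (LocAt (grading k) x) (incl k h.1) ^ N * valHom U x hx c * h1

theorem eq_zero_of_smul_vectorW (c : Γ(S k, U)) (h0 : c • vectorW k U w = 0) : c = 0 := by
  have hix (x : ProjectiveSpectrum (grading k)) (hx : x ∈ U) : x ∈ chartOpen k i := sOpen_le_chartOpen hi (hU.le hx)
  refine valHom_ext fun x hx => ?_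
  have h1 := sq_mul_vectorW_w hc x hx (hix x hx)
  have h2 := congrArg (fun m => twistVal m x hx) h0
  rw [twistVal_smul, twistVal_zero] at h2
  rw [map_zero]
  linear_combination algebraMap _ (LocAt (grading k) x) (incl k (X i)) ^ 2 * h2 -
    valHom U x hx c * h1

/-- Locally the ideal is generated by Fᵢ₊₁ and Fᵢ₊₂, which are V(z) and V(y) up to the unit xᵢ²; the
two parts c₀ and c₁x₃ of a numerator are expressed by them separately. -/
theorem exists_smul_vectorV (m : Γ(twist (grading k) (singularIdeal k) 1, U)) :
    ∃ a b : Γ(S k, U), a • vectorV k U y + b • vectorV k U z = m := by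
  obtain ⟨d, hd, hhd⟩ := h.exists_isHomogeneous
  have hh := incl_mem_grading k hhd
  have hhx (x : ProjectiveSpectrum (grading k)) (hx : x ∈ U) : incl k h.1 ∉ x.asHomogeneousIdeal := hU.le hx
  have hix (x : ProjectiveSpectrum (grading k)) (hx : x ∈ U) : x ∈ chartOpen k i := sOpen_le_chartOpen hi (hU.le hx)
  obtain ⟨N, e, c, he, hce, hcJ, hm⟩ := exists_twistVal_fraction hd hh hU m
  obtain ⟨c0, h0, c1, h1, rfl, hc0, hc1⟩ := exists_homogeneous_normalForm_of_mem_map hcJ hce i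
  obtain ⟨p0, q0, hp0, hq0, h0⟩ := exists_eq_partials_combination hc0 h0 i
  obtain ⟨p1, q1, hp1, hq1, h1⟩ := exists_eq_partials_combination hc1 (Ideal.mul_mem_right _ _ h1) i
  -- Coefficients of the form (xᵢ²p + qx₃)/(xᵢ³hᴺ): the x₃-part was multiplied by an additional xᵢ²
  -- to have degree e, and xᵢ² balances this in the other part.
  have key {p q : MvPolynomial (Fin 3) k} (hp : p.IsHomogeneous e) (hq : q.IsHomogeneous e) :
      ∃ r : Γ(S k, U), ∀ x hx, algebraMap _ (LocAt (grading k) x) (incl k (X i) ^ 3 * incl k h.1 ^ N) *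
        valHom U x hx r =
          algebraMap _ _ (incl k (X i) ^ 2 * incl k p + incl k q * coord k 3) := by
    have hdeg : 3 • 1 + N • d = 2 • 1 + e := by simp only [smul_eq_mul]; omega
    refine exists_valHom (n := 2 • 1 + e) (add_mem ?_ ?_) (hdeg ▸ SetLike.mul_mem_graded
      (SetLike.pow_mem_graded 3 (incl_X_mem (k := k) i)) (SetLike.pow_mem_graded N hh))
      (fun x hx => mul_notMem _ x (pow_notMem (hix x hx) 3) (pow_notMem (hhx x hx) N))
    · exact SetLike.mul_mem_graded (SetLike.pow_mem_graded 2 (incl_X_mem i)) (incl_mem_grading k hp)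
    · rw [add_comm]
      exact SetLike.mul_mem_graded (incl_mem_grading k hq) (coord_mem_grading k 3)
  obtain ⟨a, ha⟩ := key hq0 hq1
  obtain ⟨b, hb⟩ := key hp0 hp1
  refine ⟨a, b, twistVal_ext fun x hx => eq_of_algebraMap_mul_eq
    (mul_notMem _ x (pow_notMem (hix x hx) 5) (pow_notMem (hhx x hx) N)) ?_⟩
  have e1 := sq_mul_vectorV_y hc x hx
  have e2 := sq_mul_vectorV_z hc x hx
  have e3 := ha x hx
  have e4 := hb x hx
  have e5 := hm x hx
  have e6 := congrArg (fun t => algebraMap _ (LocAt (grading k) x) (incl k t)) h0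
  have e7 := congrArg (fun t => algebraMap _ (LocAt (grading k) x) (incl k t)) h1
  rw [twistVal_add, twistVal_smul, twistVal_smul]
  simp only [map_mul, map_pow, map_add] at e1 e2 e3 e4 e5 e6 e7 ⊢
  generalize algebraMap _ (LocAt (grading k) x) (incl k (X i)) = t at *
  linear_combination t ^ 2 * twistVal (vectorV k U y) x hx * e3 +
    t ^ 2 * twistVal (vectorV k U z) x hx * e4 - t ^ 5 * e5 - t ^ 2 * e6 - 
    algebraMap _ (LocAt (grading k) x) (coord k 3) * e7 +
    (t ^ 2 * algebraMap _ (LocAt (grading k) x) (incl k q0) +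
      algebraMap _ (LocAt (grading k) x) (incl k q1) * algebraMap _ _ (coord k 3)) * e1 +
    (t ^ 2 * algebraMap _ (LocAt (grading k) x) (incl k p0) +
      algebraMap _ (LocAt (grading k) x) (incl k p1) * algebraMap _ _ (coord k 3)) * e2

omit hU hi hc [CharP k 2] in
theorem valHom_eq_of_fractions (x : ProjectiveSpectrum (grading k)) (hx : x ∈ U) {v a r : Γ(S k, U)}
    {K α c l : CoordRing k} (hK : K ∉ x.asHomogeneousIdeal)
    (hr : algebraMap _ (LocAt (grading k) x) K * valHom U x hx r = algebraMap _ _ (incl k (X i) ^ 2 * c))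
    (ha : algebraMap _ (LocAt (grading k) x) K * valHom U x hx a = algebraMap _ _ α)
    (hl : algebraMap _ (LocAt (grading k) x) (incl k (X i)) * valHom U x hx v = algebraMap _ _ l)
    (hα : α = c * (l * (l + incl k (X i)))) : valHom U x hx a = valHom U x hx (r * (v * (1 + v))) := by
  refine eq_of_algebraMap_mul_eq hK ?_
  simp only [hα, map_mul, map_pow, map_add, map_one, ← hl] at hr ha ⊢
  linear_combination ha - valHom U x hx v * (1 + valHom U x hx v) * hr

omit hU hi in
theorem cross_mul_eq (x : ProjectiveSpectrum (grading k)) (hx : x ∈ U) (a b : Γ(S k, U))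
    (hab : a • vectorV k U y + b • vectorV k U z = 0) {α β η θ : CoordRing k}
    (ha : algebraMap _ (LocAt (grading k) x) η * valHom U x hx a = algebraMap _ _ α)
    (hb : algebraMap _ (LocAt (grading k) x) θ * valHom U x hx b = algebraMap _ _ β) :
    incl k (X i) * ((θ * α) * incl k (X (i + 1) * (X (i + 1) + X i))) =
      incl k (X i) * ((η * β) * incl k (X (i + 2) * (X (i + 2) + X i))) := by
  refine algebraMap_locAt_injective x ?_
  have e1 := sq_mul_vectorV_y hc x hx
  have e2 := sq_mul_vectorV_z hc x hx
  have e5 := congrArg (fun m => twistVal m x hx) hab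
  rw [twistVal_add, twistVal_smul, twistVal_smul, twistVal_zero] at e5
  rw [incl_partials_add_two] at e1
  rw [incl_partials_add_one] at e2
  have e6 := congrArg (algebraMap _ (LocAt (grading k) x)) (two_eq_zero_coordRing k)
  simp only [map_mul, map_add, map_zero, map_ofNat] at e1 e2 e6 ⊢
  set ρ := algebraMap (CoordRing k) (LocAt (grading k) x)
  set t := ρ (incl k (X i))
  set l := ρ (incl k (X (i + 2)))
  linear_combination t ^ 2 * ρ η * ρ θ * e5 - ρ θ * t ^ 2 * twistVal (vectorV k U y) x hx * ha -
    ρ η * t ^ 2 * twistVal (vectorV k U z) x hx * hb - ρ θ * ρ α * e1 -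
    ρ η * ρ β * e2 - t * ρ η * ρ β * l * (l + t) * e6

/-- With denominators cleared, a relation between V(y) and V(z) is a relation between two coprime
quadrics, hence a multiple of the one between dy and dz. -/
theorem exists_eq_mul_of_smul_vectorV (a b : Γ(S k, U))
    (hab : a • vectorV k U y + b • vectorV k U z = 0) :
    ∃ c, a = c * (z * (1 + z)) ∧ b = c * (y * (1 + y)) := by
  by_cases hne : ∃ x : S k, x ∈ U
  swap
  · exact ⟨0, valHom_ext fun x hx => (hne ⟨x, hx⟩).elim, valHom_ext fun x hx => (hne ⟨x, hx⟩).elim⟩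
  obtain ⟨x₀, hx₀⟩ : ∃ x : ProjectiveSpectrum (grading k), x ∈ U := hne
  obtain ⟨d, hd, hhd⟩ := h.exists_isHomogeneous
  have hh := incl_mem_grading k hhd
  have hhx (x : ProjectiveSpectrum (grading k)) (hx : x ∈ U) : incl k h.1 ∉ x.asHomogeneousIdeal := hU.le hx
  have hix (x : ProjectiveSpectrum (grading k)) (hx : x ∈ U) : x ∈ chartOpen k i := sOpen_le_chartOpen hi (hU.le hx)
  obtain ⟨N, α, hα, ha⟩ := exists_valHom_fraction hd hh hU a
  obtain ⟨M, β, hβ, hb⟩ := exists_valHom_fraction hd hh hU b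
  have key : (incl k h.1 ^ M * α) * incl k (X (i + 1) * (X (i + 1) + X i)) =
      (incl k h.1 ^ N * β) * incl k (X (i + 2) * (X (i + 2) + X i)) := by
    have hXi : incl k (X i) ≠ 0 := ne_zero_of_notMem (hix x₀ hx₀)
    exact mul_left_cancel₀ hXi (cross_mul_eq hc x₀ hx₀ a b hab (by rw [map_pow]; exact ha x₀ hx₀)
      (by rw [map_pow]; exact hb x₀ hx₀))
  obtain ⟨c, hc1, hc2⟩ := exists_eq_mul_of_mul_incl_eq (by fin_cases i <;> decide)
    (by fin_cases i <;> decide) (by fin_cases i <;> decide) key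
  have hX2 (j : Fin 3) : X j * (X j + X i) ∈ homogeneousSubmodule (Fin 3) k 2 :=
    (isHomogeneous_X k j).mul ((isHomogeneous_X k j).add (isHomogeneous_X k i))
  -- The factor c comes from divisibility alone; its degree follows from that of its product with a
  -- quadric, and xᵢ² replaces the quadric to give the degree of the denominator.
  have hcdeg : incl k (X i) ^ 2 * c ∈ grading k (M • d + N * d) := by
    have h1 : incl k (X (i + 2) * (X (i + 2) + X i)) * c ∈ grading k (M • d + N * d) := by
      rw [mul_comm (incl k _) c, ← hc1]
      exact SetLike.mul_mem_graded (SetLike.pow_mem_graded M hh) hα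
    rcases mem_graded_of_mul_mem (incl_mem_grading k (hX2 (i + 2))) (fun h0 =>
      mul_ne_zero (X_ne_zero (R := k) (i + 2)) (X_add_X_ne_zero k (by fin_cases i <;> decide))
        (incl_injective k (h0.trans (map_zero _).symm))) h1 with h2 | ⟨l, hl, h2⟩
    · rw [h2, mul_zero]
      exact zero_mem _
    · rw [hl]
      exact SetLike.mul_mem_graded (SetLike.pow_mem_graded 2 (incl_X_mem i)) h2
  obtain ⟨r, hr⟩ := exists_valHom (U := U) hcdeg (SetLike.mul_mem_graded
    (SetLike.pow_mem_graded M hh) (SetLike.pow_mem_graded N hh)) 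
    (fun x hx => mul_notMem _ x (pow_notMem (hhx x hx) M) (pow_notMem (hhx x hx) N))
  have hK (x : ProjectiveSpectrum (grading k)) (hx : x ∈ U) :=
    mul_notMem _ x (pow_notMem (hhx x hx) M) (pow_notMem (hhx x hx) N)
  refine ⟨r, valHom_ext fun x hx => valHom_eq_of_fractions x hx (hK x hx) (hr x hx) ?_
    (hc.z x hx) (hc1.trans (by rw [map_mul, map_add])),
    valHom_ext fun x hx => valHom_eq_of_fractions x hx (hK x hx) (hr x hx) ?_
    (hc.y x hx) (hc2.trans (by rw [map_mul, map_add]))⟩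
  · have e2 := congrArg (algebraMap _ (LocAt (grading k) x) (incl k h.1) ^ M * ·) (ha x hx)
    simp only [map_mul, map_pow] at e2 ⊢
    rw [mul_assoc]
    exact e2
  · have e2 := congrArg (algebraMap _ (LocAt (grading k) x) (incl k h.1) ^ N * ·) (hb x hx)
    simp only [map_mul, map_pow] at e2 ⊢
    refine Eq.trans ?_ e2
    ring

end Modules

end LocalForms

/-! ### The exact sequence for the differentials -/

theorem exists_shortExact_of_iso {C : Type*} [Category C] [Abelian C] {A A' B Q Q' : C}
    (e : A' ≅ A) (e' : Q' ≅ Q) {α : A ⟶ B} {β : B ⟶ Q} {w : α ≫ β = 0}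
    (h : (ShortComplex.mk α β w).ShortExact) :
    ∃ (α : A' ⟶ B) (β : B ⟶ Q') (w : α ≫ β = 0), (ShortComplex.mk α β w).ShortExact :=
  ⟨e.hom ≫ α, β ≫ e'.inv, by rw [Category.assoc, reassoc_of% w]; simp,
    ShortComplex.shortExact_of_iso (S₁ := ShortComplex.mk α β w)
      (ShortComplex.isoMk e.symm (Iso.refl _) e'.symm (by simp) (by simp)) h⟩

section ExactSequence

open MvPolynomial

variable (k : Type u) [Field k] [CharP k 2]

/-- The map `Ω¹ → J(1)~` given by the vector field `∑ xᵢ² ∂ᵢ`. -/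
abbrev formsToV : differentialsPresheaf (sToSpec k) ⟶ (twist (grading k) (singularIdeal k) 1).val :=
  differentialsTo (isTwistDerivation_derV k)

/-- The map `Ω¹ → 𝒪(-2)` given by the vector field `∂ / ∂ x₃`. -/
abbrev formsToW : differentialsPresheaf (sToSpec k) ⟶ (twist (grading k) ⊤ (-2)).val :=
  differentialsTo (isTwistDerivation_derW k)

variable {k} {U : (S k).Opens}

/-- `formsToV` on sections. -/
def formV (U : (S k).Opens) : CommRingCat.KaehlerDifferential (scalars (sToSpec k) (op U)) →ₗ[Γ(S k, U)]
    Γ(twist (grading k) (singularIdeal k) 1, U) := ((formsToV k).app (op U)).hom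

/-- `formsToW` on sections. -/
def formW (U : (S k).Opens) : CommRingCat.KaehlerDifferential (scalars (sToSpec k) (op U)) →ₗ[Γ(S k, U)]
    Γ(twist (grading k) ⊤ (-2), U) := ((formsToW k).app (op U)).hom

theorem formV_d (r : Γ(S k, U)) : formV U (CommRingCat.KaehlerDifferential.d r) = vectorV k U r :=
  differentialsTo_d (isTwistDerivation_derV k) (op U) r

theorem formW_d (r : Γ(S k, U)) : formW U (CommRingCat.KaehlerDifferential.d r) = vectorW k U r :=
  differentialsTo_d (isTwistDerivation_derW k) (op U) r

-- This is the splitting of Ω¹ on a basic open set. The structure map σ is a variable so that the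
-- result also applies to the smooth locus, whose scalars equal those of S only up to a proved
-- equality.
open CommRingCat.KaehlerDifferential (d) in
theorem bijective_prod_of_d {h : CoverIndex k} (hU : U = sOpen h)
    {σ : CommRingCat.of k ⟶ (S k).presheaf.obj (op U)} (hσ : σ = scalars (sToSpec k) (op U))
    (v : CommRingCat.KaehlerDifferential σ →ₗ[Γ(S k, U)] Γ(twist (grading k) (singularIdeal k) 1, U))
    (v' : CommRingCat.KaehlerDifferential σ →ₗ[Γ(S k, U)] Γ(twist (grading k) ⊤ (-2), U))
    (hv : ∀ r, v (d (f := σ) r) = vectorV k U r) (hv' : ∀ r, v' (d (f := σ) r) = vectorW k U r) :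
    Function.Bijective fun ω => (v ω, v' ω) := by
  subst hσ
  obtain ⟨i, e, r, -, hr⟩ := h.2
  have hi : X i ∣ h.1 := ⟨r, hr⟩
  have hUi : U ≤ chartOpen k i := hU.trans_le (sOpen_le_chartOpen hi)
  obtain ⟨y, z, w, hc⟩ := exists_isAffineCoords_of_le hUi
  refine kaehler_prod_bijective (scalars (sToSpec k) (op U)) (y := y) (z := z) (w := w)
    (exists_eq_combination_d _ (exists_unit_eval₂ hU hi hc))
    (d_relation _ two_eq_zero_of_scalars (hc.sq hUi)) v v' ?_ ?_ ?_ ?_ ?_ ?_ ?_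
  · rw [hv]
    exact twistVal_ext fun x hx => vectorV_w hc x hx (hUi hx)
  · rw [hv']
    exact twistVal_ext fun x hx => vectorW_y hc x hx (hUi hx)
  · rw [hv']
    exact twistVal_ext fun x hx => vectorW_z hc x hx (hUi hx)
  · rw [hv, hv]
    exact exists_smul_vectorV hU hi hc
  · rw [hv']
    exact exists_smul_vectorW hU hi hc
  · rw [hv, hv]
    exact exists_eq_mul_of_smul_vectorV hU hi hc
  · rw [hv']
    exact eq_zero_of_smul_vectorW hU hi hc

theorem formV_formW_bijective {h : CoverIndex k} (hU : U = sOpen h) :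
    Function.Bijective fun ω => (formV U ω, formW U ω) :=
  bijective_prod_of_d hU rfl _ _ formV_d formW_d

theorem nonempty_pullback_twist_iso (J : Ideal (MvPolynomial (Fin 3) k)) (n : ℤ) :
    Nonempty ((Scheme.Modules.pullback (g k)).obj (twist (homogeneousSubmodule (Fin 3) k) J n) ≅
      twist (grading k) (J.map (incl k)) n) :=
  have := isIso_twistPullHom J n
  ⟨asIso (((Scheme.Modules.pullbackPushforwardAdjunction (g k)).homEquiv _ _).symm
    (twistPullHom k J n))⟩

variable (k) in
theorem exists_shortExact_differentials :
    ∃ (α : (Scheme.Modules.pullback (g k)).obj (idealSheafOne k) ⟶ differentials (sToSpec k))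
      (β : differentials (sToSpec k) ⟶ (Scheme.Modules.pullback (g k)).obj (pSpaceO k 2 (-2)))
      (w : α ≫ β = 0), (ShortComplex.mk α β w).ShortExact := by
  obtain ⟨α, β, w, h⟩ := exists_shortExact_sheafify (formsToV k) (formsToW k) isBasis_sOpen
    fun i => formV_formW_bijective (h := i) rfl
  obtain ⟨e⟩ := nonempty_pullback_twist_iso (pointsIdeal k) 1
  obtain ⟨e'⟩ := nonempty_pullback_twist_iso (⊤ : Ideal (MvPolynomial (Fin 3) k)) (-2)
  rw [Ideal.map_top] at e'
  exact exists_shortExact_of_iso e e' h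

end ExactSequence

/-! ### Finiteness, flatness and degree of the cover; properness and integrality of S -/

section FiniteFlat

/-- The elements 1 and w form a basis, so T is free of rank two over R. -/
theorem finite_flat_of_basis {R T : Type u} [CommRing R] [CommRing T] [Nontrivial R] (φ : R →+* T) (w : T)
    (hs : ∀ b, ∃ r r', b = φ r + φ r' * w) (h0 : ∀ r r', φ r + φ r' * w = 0 → r = 0 ∧ r' = 0) :
    φ.Finite ∧ φ.Flat ∧ ∀ x, φ.finrank x = 2 := by
  algebraize [φ]
  let l : (Fin 2 → R) →ₗ[R] T := Fintype.linearCombination R ![1, w]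
  have hl (v : Fin 2 → R) : l v = φ (v 0) + φ (v 1) * w := by
    simp [l, Fintype.linearCombination_apply, Fin.sum_univ_two, Algebra.smul_def,
      RingHom.algebraMap_toAlgebra]
  let e : (Fin 2 → R) ≃ₗ[R] T := LinearEquiv.ofBijective l ⟨by
    rw [← LinearMap.ker_eq_bot, LinearMap.ker_eq_bot']
    intro v hv
    obtain ⟨ha, hb⟩ := h0 _ _ ((hl v).symm.trans hv)
    ext i
    fin_cases i
    exacts [ha, hb], fun b => by
    obtain ⟨r, r', rfl⟩ := hs b
    exact ⟨![r, r'], hl _⟩⟩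
  have h1 : Module.Finite R T := Module.Finite.equiv e
  have h2 : Module.Free R T := Module.Free.of_equiv e
  refine ⟨h1, ?_, fun x => ?_⟩
  · exact (inferInstance : Module.Flat R T)
  · change Module.rankAtStalk T x = 2
    rw [Module.rankAtStalk_eq_finrank_of_free, Pi.natCast_apply, ← e.finrank_eq]
    simp

theorem finite_flat_of_cover {X Y : Scheme.{u}} (f : X ⟶ Y) {ι : Type} (D : ι → Y.Opens)
    (hD : ⨆ i, D i = ⊤) (hne : ∀ i, Nontrivial Γ(Y, D i)) (hDa : ∀ i, IsAffineOpen (D i))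
    (hDf : ∀ i, IsAffineOpen (f ⁻¹ᵁ D i))
    (hs : ∀ i, ∃ w, (∀ b, ∃ r r', b = f.app (D i) r + f.app (D i) r' * w) ∧
      ∀ r r', f.app (D i) r + f.app (D i) r' * w = 0 → r = 0 ∧ r' = 0) :
    IsFinite f ∧ Flat f ∧ ∀ y, f.finrank y = 2 := by
  have key (i) := finite_flat_of_basis (f.app (D i)).hom (hs i).choose
    (hs i).choose_spec.1 (hs i).choose_spec.2
  have hpb (i) : IsPullback (f ⁻¹ᵁ D i).toSpecΓ (f ∣_ D i) (Spec.map (f.app (D i)))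
      (D i).toSpecΓ := by
    have : IsAffine (D i) := hDa i
    have : IsAffine (f ⁻¹ᵁ D i) := hDf i
    have h1 : IsIso (D i).toSpecΓ := by rw [Scheme.Opens.toSpecΓ]; infer_instance
    have h2 : IsIso (f ⁻¹ᵁ D i).toSpecΓ := by rw [Scheme.Opens.toSpecΓ]; infer_instance
    refine .of_horiz_isIso ⟨?_⟩
    have := Scheme.Opens.toSpecΓ_SpecMap_appLE f (D i) (f ⁻¹ᵁ D i) le_rfl
    rwa [Scheme.Hom.app_eq_appLE, ← Scheme.Hom.resLE_eq_morphismRestrict]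
  have hSpec (i) : IsFinite (Spec.map (f.app (D i))) ∧ Flat (Spec.map (f.app (D i))) :=
    ⟨(IsFinite.SpecMap_iff _).mpr (key i).1, Flat.SpecMap_iff.mpr (key i).2.1⟩
  have : IsZariskiLocalAtTarget @IsFinite.{u} := @HasAffineProperty.instIsZariskiLocalAtTarget _ _
    IsFinite.instHasAffinePropertyAndIsAffineFiniteCarrierObjOppositeOpensCarrierCarrierCommRingCatPresheafOpOpensTopHomAppTop
  have : IsZariskiLocalAtTarget @Flat.{u} :=
    HasRingHomProperty.instIsZariskiLocalAtTarget @Flat (Q := RingHom.Flat)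
  have hfin : IsFinite f := IsZariskiLocalAtTarget.of_iSup_eq_top (P := @IsFinite.{u}) D hD fun i =>
    MorphismProperty.of_isPullback (hpb i) (hSpec i).1
  have hflat : Flat f := IsZariskiLocalAtTarget.of_iSup_eq_top (P := @Flat.{u}) D hD fun i =>
    MorphismProperty.of_isPullback (hpb i) (hSpec i).2
  refine ⟨hfin, hflat, fun y => ?_⟩
  obtain ⟨i, hi⟩ : ∃ i, y ∈ D i := Opens.mem_iSup.mp (hD ▸ trivial : y ∈ ⨆ i, D i)
  have := (hSpec i).1
  have := (hSpec i).2
  have h1 := Scheme.Hom.finrank_of_isPullback _ _ _ _ (isPullback_morphismRestrict f (D i)).flip ⟨y, hi⟩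
  have h2 := Scheme.Hom.finrank_of_isPullback _ _ _ _ (hpb i) ⟨y, hi⟩
  refine h1.symm.trans (h2.trans ?_)
  rw [Scheme.Hom.finrank_SpecMap_eq_finrank (key i).1 (key i).2.1]
  exact (key i).2.2 _

/-- Proj is proper over the spectrum of the degree zero part because A is of finite type, and that
spectrum is closed in Spec k. -/
theorem structureMap_of_surjective {A : Type u} (k : Type u) [Field k] [CommRing A] [Algebra k A]
    [Algebra.FiniteType k A] (𝒜 : ℕ → Submodule k A) [GradedAlgebra 𝒜]
    (h : Function.Surjective (algebraMap k (𝒜 0))) : IsProper (projToSpec k 𝒜) := by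
  have : @IsScalarTower k (𝒜 0) A Algebra.toSMul Algebra.toSMul Algebra.toSMul :=
    .of_algebraMap_eq fun _ => rfl
  have : Algebra.FiniteType (𝒜 0) A := .of_restrictScalars_finiteType k (𝒜 0) A
  have : IsClosedImmersion (Spec.map (CommRingCat.ofHom (algebraMap k (𝒜 0)))) :=
    IsClosedImmersion.spec_of_surjective _ h
  rw [projToSpec]
  infer_instance

open MvPolynomial

theorem algebraMap_grading_zero_surjective (k : Type u) [Field k] :
    Function.Surjective (algebraMap k (grading k 0)) := by
  rintro ⟨c, hc⟩
  obtain ⟨a, b, rfl, ha, hb⟩ := exists_homogeneous_normalForm k hc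
  rcases hb with ⟨-, rfl⟩ | ⟨m, hm, -⟩
  · refine ⟨coeff 0 a, Subtype.ext ?_⟩
    have h1 : a = C (coeff 0 a) := totalDegree_eq_zero_iff_eq_C.mp (by
      simpa using ha.totalDegree_le)
    change algebraMap k (CoordRing k) (coeff 0 a) = _
    refine ((incl k).commutes _).symm.trans ((congrArg (incl k) h1.symm).trans ?_)
    change _ = incl k a + incl k 0 * coord k 3
    rw [map_zero, zero_mul, add_zero]
  · omega

end FiniteFlat

section Geometry

open MvPolynomial HomogeneousLocalization

variable (k : Type u) [Field k]

instance isProper_sToSpec : IsProper (sToSpec k) :=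
  structureMap_of_surjective k _ (algebraMap_grading_zero_surjective k)

variable {k} in
theorem exists_X_notMem_pSpace {n : ℕ} (y : PSpace k n) :
    ∃ i, (X i : MvPolynomial (Fin (n + 1)) k) ∉ y.asHomogeneousIdeal := by
  by_contra! hall
  obtain ⟨d, c, hd, hc, hcy⟩ := exists_homogeneous_notMem (homogeneousSubmodule (Fin (n + 1)) k) y
  refine hcy ?_
  change c ∈ y.asHomogeneousIdeal.toIdeal
  rw [c.as_sum]
  refine Ideal.sum_mem _ fun e he => ?_
  have hwe := hc (mem_support_iff.mp he)
  obtain ⟨i, hi⟩ : ∃ i, e i ≠ 0 := by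
    by_contra! h0
    have : e = 0 := Finsupp.ext h0
    rw [this, map_zero] at hwe
    omega
  obtain ⟨q, hq⟩ : X i ∣ monomial e (coeff e c) := (X_dvd_monomial).mpr (Or.inr hi)
  rw [hq]
  exact Ideal.mul_mem_right _ _ (hall i)

theorem g_pSpaceToSpec : g k ≫ pSpaceToSpec k 2 = sToSpec k := by
  refine Scheme.Cover.hom_ext ((S k).openCoverOfIsOpenCover
    (fun i : Fin 3 => Proj.basicOpen (grading k) (coverRingHom k (X i * 1)))
    (by simp only [mul_one]; exact iSup_basicOpen_eq_top k)) _ _ fun (i : Fin 3) => ?_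
  have ht := (coverRingHom k).2 (SetLike.mul_mem_graded (isHomogeneous_X k i)
    (isHomogeneous_one (Fin 3) k))
  have h := awayι_g k i (isHomogeneous_one (Fin 3) k)
  have h1 : (Proj.basicOpen (grading k) (coverRingHom k (X i * 1))).ι =
      (Proj.basicOpenIsoSpec (grading k) (coverRingHom k (X i * 1)) ht (by omega)).hom ≫
        Proj.awayι _ _ ht (by omega) :=
    (Iso.hom_inv_id_assoc (Proj.basicOpenIsoSpec _ _ ht (by omega)) _).symm
  refine (congrArg (· ≫ _) h1).trans (Eq.trans ?_ (congrArg (· ≫ _) h1).symm)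
  refine (Category.assoc _ _ _).trans (Eq.trans ?_ (Category.assoc _ _ _).symm)
  refine congrArg _ ?_
  change Proj.awayι _ _ ht _ ≫ g k ≫ Proj.toSpecZero _ ≫ Spec.map _ =
    Proj.awayι _ _ ht _ ≫ Proj.toSpecZero _ ≫ Spec.map _
  refine ((Category.assoc _ _ _).symm.trans (congrArg (· ≫ _) h)).trans ?_
  rw [Category.assoc, Proj.awayι_toSpecZero_assoc, Proj.awayι_toSpecZero_assoc, ← Spec.map_comp, ← Spec.map_comp, ← Spec.map_comp]
  refine congrArg Spec.map (CommRingCat.hom_ext (RingHom.ext fun c => ?_))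
  refine HomogeneousLocalization.val_injective _ ?_
  have h3 : coverRingHom k (algebraMap k _ c) = algebraMap k _ c := (incl k).commutes c
  change (Away.map (coverRingHom k) (X i * 1) (HomogeneousLocalization.mk
    ⟨0, ⟨algebraMap k _ c, _⟩, ⟨1, _⟩, _⟩)).val = (HomogeneousLocalization.mk
    ⟨0, ⟨algebraMap k _ c, _⟩, ⟨1, _⟩, _⟩).val
  rw [Away.map, HomogeneousLocalization.map_mk]
  rw [HomogeneousLocalization.val_mk, HomogeneousLocalization.val_mk]
  simp only [h3, map_one]

variable [CharP k 2]

theorem finite_flat_g : IsFinite (g k) ∧ Flat (g k) ∧ ∀ y, (g k).finrank y = 2 := by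
  let h (i : Fin 3) : CoverIndex k := ⟨X i, i, 0, 1, isHomogeneous_one _ _, (mul_one _).symm⟩
  refine finite_flat_of_cover (g k) (fun i => pOpen (h i)) ?_ ?_ ?_ ?_ fun i => ?_
  · refine top_le_iff.mp fun y _ => Opens.mem_iSup.mpr (exists_X_notMem_pSpace y)
  · intro i
    exact LocallyRingedSpace.component_nontrivial (X := (PSpace k 2).toLocallyRingedSpace) (pOpen (h i))
      (hU := ⟨⟨g k (eta k), (g_preimage_pOpen (h i)).ge
        (notMem_eta ((map_ne_zero_iff _ (incl_injective k)).mpr (X_ne_zero i)))⟩⟩)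
  · intro i
    exact Proj.isAffineOpen_basicOpen _ _ (isHomogeneous_X k i) one_pos
  · intro i
    rw [g_preimage_pOpen]
    exact Proj.isAffineOpen_basicOpen _ _ (incl_X_mem i) one_pos
  · obtain ⟨w, q, -, hb, -, h0⟩ := exists_basis_one_sqrt ⊤ 0 (h i)
    refine ⟨w, hb, fun r r' hr => ?_⟩
    have h1 := h0 ⟨_, regVal_mem_twistSections (U := op (pOpen (h i))) r⟩
      ⟨_, regVal_mem_twistSections (U := op (pOpen (h i))) r'⟩ (Subtype.ext <| funext fun x => by
        have e0 := regVal_g k r x.1 x.2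
        have e1 := regVal_g k r' x.1 x.2
        change locMap k x.1 (regVal (U := op (pOpen (h i))) r ⟨g k x.1, x.2⟩) +
          regVal (U := op (g k ⁻¹ᵁ pOpen (h i))) w x *
            locMap k x.1 (regVal (U := op (pOpen (h i))) r' ⟨g k x.1, x.2⟩) = 0
        rw [← e0, ← e1, mul_comm]
        exact ((HomogeneousLocalization.val_add _ _).trans
          (congrArg _ (HomogeneousLocalization.val_mul _ _))).symm.trans
            (congrArg (fun s => regVal (U := op (g k ⁻¹ᵁ pOpen (h i))) s x) hr |>.trans
              HomogeneousLocalization.val_zero))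
    exact ⟨reg_ext fun x => congr($(h1.1).1 x).trans (HomogeneousLocalization.val_zero).symm, reg_ext fun x => congr($(h1.2).1 x).trans (HomogeneousLocalization.val_zero).symm⟩

instance isIntegral_S : IsIntegral (S k) where
  nonempty := ⟨eta k⟩
  component_integral U hU := by
    obtain ⟨x⟩ := hU
    exact (valHom_injective (𝒜 := grading k) x.1 x.2).isDomain _

end Geometry

/-! ### Two-forms from pairs of linear forms on differentials -/

section Alternating

variable {R M A B N : Type u} [CommRing R] [AddCommGroup M] [AddCommGroup A] [AddCommGroup B]
  [AddCommGroup N] [Module R M] [Module R A] [Module R B] [Module R N]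

/-- The alternating form `(m, m') ↦ a(m) b(m') - a(m') b(m)`. -/
def wedgeForm (a : M →ₗ[R] A) (b : M →ₗ[R] B) (μ : A →ₗ[R] B →ₗ[R] N) : M [⋀^Fin 2]→ₗ[R] N where
  toFun v := μ (a (v 0)) (b (v 1)) - μ (a (v 1)) (b (v 0))
  map_update_add' v i x y := by
    fin_cases i <;> simp [Function.update_of_ne] <;> abel
  map_update_smul' v i c x := by
    fin_cases i <;> simp [Function.update_of_ne, smul_sub]
  map_eq_zero_of_eq' v i j hv hij := by
    fin_cases i <;> fin_cases j <;> simp_all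

/-- If e₁, e₂ span M, then e₁ ∧ e₂ spans the exterior square, so only its image has to be a basis of
the target. -/
theorem exteriorPower_two_bijective (f : ⋀[R]^2 M →ₗ[R] N) (e₁ e₂ : M)
    (hspan : ∀ m, ∃ r r' : R, m = r • e₁ + r' • e₂)
    (hf : Function.Bijective fun r : R => r • f (exteriorPower.ιMulti R 2 ![e₁, e₂])) :
    Function.Bijective f := by
  have key (x : ⋀[R]^2 M) : ∃ r : R, x = r • exteriorPower.ιMulti R 2 ![e₁, e₂] := by
    have hx : x ∈ Submodule.span R (Set.range (exteriorPower.ιMulti R 2 (M := M))) := by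
      rw [exteriorPower.ιMulti_span]; trivial
    induction hx using Submodule.span_induction with
    | mem x hx =>
      obtain ⟨v, rfl⟩ := hx
      obtain ⟨a, b, h0⟩ := hspan (v 0)
      obtain ⟨c, d, h1⟩ := hspan (v 1)
      have hv : v = ![a • e₁ + b • e₂, c • e₁ + d • e₂] := by
        ext i; fin_cases i
        exacts [h0, h1]
      let F (m m' : M) : ⋀[R]^2 M := exteriorPower.ιMulti R 2 ![m, m']
      have hadd (m m' n : M) : F (m + m') n = F m n + F m' n := AlternatingMap.map_vecCons_add _ _ _ _
      have hsmul (r : R) (m n : M) : F (r • m) n = r • F m n := AlternatingMap.map_vecCons_smul _ _ _ _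
      have hself (m : M) : F m m = 0 :=
        AlternatingMap.map_eq_zero_of_eq _ _ (i := 0) (j := 1) rfl (by decide)
      have hswap (m n : M) : F m n = -F n m := by
        have h := hself (m + n)
        rw [hadd] at h
        have e (x : M) : F x (m + n) = F x m + F x n := by
          have h2 (y : M) : Function.update ![x, m] 1 y = ![x, y] := by
            ext i; fin_cases i <;> simp
          have := (exteriorPower.ιMulti R 2 (M := M)).map_update_add ![x, m] 1 m n
          rwa [h2, h2, h2] at this
        rw [e, e, hself, hself, zero_add, add_zero] at h
        exact eq_neg_of_add_eq_zero_left h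
      refine ⟨a * d - b * c, ?_⟩
      rw [hv]
      change F (a • e₁ + b • e₂) (c • e₁ + d • e₂) = (a * d - b * c) • F e₁ e₂
      rw [hadd, hsmul, hsmul, hswap e₁, hswap e₂, hadd, hadd, hsmul, hsmul, hsmul, hsmul, hself, hself,
        hswap e₂ e₁]
      module
    | zero => exact ⟨0, (zero_smul _ _).symm⟩
    | add x y _ _ hx hy =>
      obtain ⟨r, rfl⟩ := hx
      obtain ⟨r', rfl⟩ := hy
      exact ⟨r + r', (add_smul _ _ _).symm⟩
    | smul c x _ hx =>
      obtain ⟨r, rfl⟩ := hx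
      exact ⟨c * r, (mul_smul _ _ _).symm⟩
  constructor
  · rw [injective_iff_map_eq_zero]
    intro x hx
    obtain ⟨r, rfl⟩ := key x
    rw [map_smul] at hx
    have : r = 0 := hf.1 (by simpa using hx)
    rw [this, zero_smul]
  · intro n
    obtain ⟨r, hr⟩ := hf.2 n
    exact ⟨r • exteriorPower.ιMulti R 2 ![e₁, e₂], (map_smul _ _ _).trans hr⟩

end Alternating

section TwoForms

variable {k : Type u} [Field k] {X : Scheme.{u}} (s : X ⟶ Spec (.of k))

/-- The presheaf of modules `U ↦ ⋀² Ω¹_{Γ(X, U)/k}`. -/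
def twoFormsPresheaf : X.PresheafOfModules :=
  PresheafOfModules.ofPresheaf (R := X.ringCatSheaf.obj) (twoFormsPresheafAb s)
    fun _ _ i r m => (extSqMap _ (differentialsRes s i)).map_smulₛₗ r m

/-- The pairing of a and b, antisymmetrized, defines the map on two-forms. Compatibility with
restriction is checked on decomposable forms, which span. `L` is `v` over U, seen as a linear map.
-/
theorem exists_twoFormsPresheaf_hom {A B M : X.Modules} (a : differentialsPresheaf s ⟶ A.val)
    (b : differentialsPresheaf s ⟶ B.val)
    (μ : ∀ U : X.Opens, Γ(A, U) →ₗ[Γ(X, U)] Γ(B, U) →ₗ[Γ(X, U)] Γ(M, U))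
    (hμ : ∀ {U V : X.Opensᵒᵖ} (i : U ⟶ V) m n, M.presheaf.map i (μ U.unop m n) =
      μ V.unop (A.presheaf.map i m) (B.presheaf.map i n)) :
    ∃ v : twoFormsPresheaf s ⟶ M.val, ∀ U : X.Opens, ∃ L : ⋀[Γ(X, U)]^2
        (CommRingCat.KaehlerDifferential (scalars s (op U))) →ₗ[Γ(X, U)] Γ(M, U),
      (∀ x, v.app (op U) x = L x) ∧ ∀ ω ω', L (exteriorPower.ιMulti _ 2 ![ω, ω']) =
        μ U (a.app (op U) ω) (b.app (op U) ω') - μ U (a.app (op U) ω') (b.app (op U) ω) := by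
  let a' (U : X.Opens) : CommRingCat.KaehlerDifferential (scalars s (op U)) →ₗ[Γ(X, U)] Γ(A, U) :=
    (a.app (op U)).hom
  let b' (U : X.Opens) : CommRingCat.KaehlerDifferential (scalars s (op U)) →ₗ[Γ(X, U)] Γ(B, U) :=
    (b.app (op U)).hom
  let L (U : X.Opens) : ⋀[Γ(X, U)]^2 (CommRingCat.KaehlerDifferential (scalars s (op U))) →ₗ[Γ(X, U)]
      Γ(M, U) := exteriorPower.alternatingMapLinearEquiv (wedgeForm (a' U) (b' U) (μ U))
  have hL (U : X.Opens) (ω : Fin 2 → CommRingCat.KaehlerDifferential (scalars s (op U))) :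
      L U (exteriorPower.ιMulti _ 2 ω) =
        μ U (a' U (ω 0)) (b' U (ω 1)) - μ U (a' U (ω 1)) (b' U (ω 0)) :=
    exteriorPower.alternatingMapLinearEquiv_apply_ιMulti _ _
  have hnat {U V : X.Opensᵒᵖ} (i : U ⟶ V) (x : ⋀[Γ(X, U.unop)]^2
      (CommRingCat.KaehlerDifferential (scalars s U))) :
      L V.unop (extSqMap _ (differentialsRes s i) x) = M.presheaf.map i (L U.unop x) := by
    let f := (L V.unop).toAddMonoidHom.comp (extSqMap _ (differentialsRes s i)).toAddMonoidHom
    let f' := (M.presheaf.map i).hom.comp (L U.unop).toAddMonoidHom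
    have hx : x ∈ Submodule.span Γ(X, U.unop) (Set.range (exteriorPower.ιMulti Γ(X, U.unop) 2
        (M := CommRingCat.KaehlerDifferential (scalars s U)))) := by
      rw [exteriorPower.ιMulti_span]; trivial
    induction hx using Submodule.span_induction with
    | mem x hx =>
      obtain ⟨ω, rfl⟩ := hx
      have ha (ω) : a' V.unop (differentialsRes s i ω) = A.presheaf.map i (a' U.unop ω) :=
        PresheafOfModules.naturality_apply a i ω
      have hb (ω) : b' V.unop (differentialsRes s i ω) = B.presheaf.map i (b' U.unop ω) :=
        PresheafOfModules.naturality_apply b i ω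
      have h1 := extSqMap_ιMulti (X.presheaf.map i).hom (differentialsRes s i) ω
      refine (congrArg (L V.unop) h1).trans ((hL _ _).trans ?_)
      refine Eq.trans ?_ (congrArg (M.presheaf.map i) (hL _ _)).symm
      rw [map_sub, hμ, hμ, ha, ha, hb, hb]
    | zero => exact (map_zero f).trans (map_zero f').symm
    | add x y _ _ hx hy =>
      exact (map_add f x y).trans ((congrArg₂ (· + ·) hx hy).trans (map_add f' x y).symm)
    | smul r x _ hx =>
      refine (congrArg (L V.unop) ((extSqMap _ (differentialsRes s i)).map_smulₛₗ r x)).trans ?_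
      refine ((L V.unop).map_smul _ _).trans ((congrArg _ hx).trans ?_)
      refine (Scheme.Modules.map_smul M i.unop r (L U.unop x)).symm.trans ?_
      exact congrArg (M.presheaf.map i) ((L U.unop).map_smul r x).symm
  exact ⟨PresheafOfModules.homMk
    { app := fun U => AddCommGrpCat.ofHom (L U.unop).toAddMonoidHom
      naturality := fun U V i => by
        ext x
        exact hnat i x }
    (fun U r m => (L U.unop).map_smul r m), fun U => ⟨L U, fun x => rfl, fun ω ω' => hL U ![ω, ω']⟩⟩

end TwoForms

/-! ### Products of twists, and restriction of V and W to open subschemes -/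

section Pairing

variable {k A : Type u} [CommRing k] [CommRing A] [Algebra k A]
  {𝒜 : ℕ → Submodule k A} [GradedAlgebra 𝒜]

theorem mul_mem_twistSections {J J' : Ideal A} {n n' m : ℤ} (h : n + n' = m)
    {U : (Opens (ProjectiveSpectrum.top 𝒜))ᵒᵖ} (s : twistSections 𝒜 J n U)
    (t : twistSections 𝒜 J' n' U) : (fun x => s.1 x * t.1 x) ∈ twistSections 𝒜 ⊤ m U := by
  intro x
  obtain ⟨V, hV, iV, p, q, a, b, h1, ha, hb, -, hs⟩ := s.2 x
  obtain ⟨W, hW, iW, p', q', a', b', h2, ha', hb', -, ht⟩ := t.2 x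
  refine ⟨V ⊓ W, ⟨hV, hW⟩, Opens.infLELeft _ _ ≫ iV, p + p', q + q', a * a', b * b',
    by push_cast; omega, SetLike.mul_mem_graded ha ha', SetLike.mul_mem_graded hb hb', trivial, ?_⟩
  intro y
  have e1 := hs ⟨y.1, y.2.1⟩
  have e2 := ht ⟨y.1, y.2.2⟩
  refine ⟨mul_notMem 𝒜 y.1 e1.1 e2.1, ?_⟩
  rw [map_mul, map_mul, ← e1.2, ← e2.2]
  exact mul_mul_mul_comm _ _ _ _

/-- The multiplication `J(n)~ × J'(n')~ → 𝒪(n + n')`. -/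
def twistMul (J J' : Ideal A) {n n' m : ℤ} (h : n + n' = m) (U : (Proj 𝒜).Opens) :
    Γ(twist 𝒜 J n, U) →ₗ[Γ(Proj 𝒜, U)] Γ(twist 𝒜 J' n', U) →ₗ[Γ(Proj 𝒜, U)] Γ(twist 𝒜 ⊤ m, U) :=
  LinearMap.mk₂ _ (fun s t => (⟨_, mul_mem_twistSections h s t⟩ : twistSections 𝒜 ⊤ m (op U)))
    (fun _ _ _ => Subtype.ext <| funext fun _ => add_mul _ _ _)
    (fun _ _ _ => Subtype.ext <| funext fun _ => mul_assoc _ _ _)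
    (fun _ _ _ => Subtype.ext <| funext fun _ => mul_add _ _ _)
    (fun _ _ _ => Subtype.ext <| funext fun _ => mul_left_comm _ _ _)

end Pairing

section OpenSubschemes

variable {k A : Type u} [Field k] [CommRing A] [Algebra k A] [IsDomain A]
  {𝒜 : ℕ → Submodule k A} [GradedAlgebra 𝒜] {J : Ideal A} {e : ℤ} {δ : Derivation k A A}

theorem scalars_ι {X : Scheme.{u}} (s : X ⟶ Spec (.of k)) (O : X.Opens) (V : O.toScheme.Opens) :
    scalars (O.ι ≫ s) (op V) = scalars s (op (O.ι ''ᵁ V)) := by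
  rw [scalars, scalars, Scheme.Hom.comp_appTop, Scheme.Opens.ι_appTop]
  refine congrArg ((Scheme.ΓSpecIso (.of k)).inv ≫ ·) ?_
  refine (Category.assoc _ _ _).trans (congrArg (s.appTop ≫ ·) ?_)
  exact (X.presheaf.map_comp _ _).symm

theorem smul_restrict {X : Scheme.{u}} (M : X.Modules) (O : X.Opens) (V : O.toScheme.Opens)
    (r : Γ(O.toScheme, V)) (m : Γ(M.restrict O.ι, V)) :
    r • m = (show Γ(M.restrict O.ι, V) from
      (show Γ(X, O.ι ''ᵁ V) from r) • (show Γ(M, O.ι ''ᵁ V) from m)) := by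
  change (show Γ(M.restrict O.ι, V) from (show Γ(X, O.ι ''ᵁ V) from (O.ι.appIso V).inv r) •
    (show Γ(M, O.ι ''ᵁ V) from m)) = _
  rw [Scheme.Opens.ι_appIso]
  rfl

/-- The derivation `𝒪 → J(e)~` induced by `δ` on an open subscheme. -/
def twistDerivationOn (hδ : IsTwistDerivation 𝒜 J e δ) (O : (Proj 𝒜).Opens) :
    ((twist 𝒜 J e).restrict O.ι).val.Derivation' (scalarsHom (O.ι ≫ projToSpec k 𝒜)) :=
  PresheafOfModules.Derivation'.mk (fun U => ModuleCat.Derivation.mk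
    (fun r => twistDer (U := op (O.ι ''ᵁ U.unop)) hδ r) (fun r r' => twistDer_add hδ r r')
    (fun r r' => (twistDer_mul hδ r r').trans (congrArg₂ (· + ·)
      (smul_restrict (twist 𝒜 J e) O U.unop r (twistDer (U := op (O.ι ''ᵁ U.unop)) hδ r')).symm
      (smul_restrict (twist 𝒜 J e) O U.unop r' (twistDer (U := op (O.ι ''ᵁ U.unop)) hδ r)).symm))
    (fun c => by
      refine Eq.trans ?_ (twistDer_scalars hδ (op (O.ι ''ᵁ U.unop)) c)
      exact congrArg (fun σ => twistDer (U := op (O.ι ''ᵁ U.unop)) hδ (CommRingCat.Hom.hom σ c))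
        (scalars_ι (projToSpec k 𝒜) O U.unop)))
    (fun _ _ _ _ => rfl)

/-- The linear map from differentials to `J(e)~` induced by the derivation `δ` on an open
subscheme. -/
def differentialsOnTo (hδ : IsTwistDerivation 𝒜 J e δ) (O : (Proj 𝒜).Opens) :
    differentialsPresheaf (O.ι ≫ projToSpec k 𝒜) ⟶ ((twist 𝒜 J e).restrict O.ι).val :=
  (PresheafOfModules.DifferentialsConstruction.isUniversal' (scalarsHom (O.ι ≫ projToSpec k 𝒜))).desc
    (twistDerivationOn hδ O)

theorem differentialsOnTo_d (hδ : IsTwistDerivation 𝒜 J e δ) (O : (Proj 𝒜).Opens)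
    (V : O.toScheme.Opens) (r : Γ(O.toScheme, V)) :
    (differentialsOnTo hδ O).app (op V)
      (CommRingCat.KaehlerDifferential.d (f := scalars (O.ι ≫ projToSpec k 𝒜) (op V)) r) =
      twistDer (U := op (O.ι ''ᵁ V)) hδ r :=
  PresheafOfModules.Derivation.congr_d
    ((PresheafOfModules.DifferentialsConstruction.isUniversal'
      (scalarsHom (O.ι ≫ projToSpec k 𝒜))).fac (twistDerivationOn hδ O)) r

end OpenSubschemes

/-! ### The canonical sheaf of the smooth locus -/

section Canonical

open MvPolynomial

variable (k : Type u) [Field k] [CharP k 2]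

/-- The principal open subsets on which one of the partial derivatives does not vanish. -/
def SmoothIndex : Type u := {h : CoverIndex k // ∃ i, partials k (i + 1) ∣ h.1}

variable {k}

theorem SmoothIndex.sOpen_le (h : SmoothIndex k) : sOpen h.1 ≤ smoothLocus (sToSpec k) := by
  obtain ⟨h, i, hi⟩ := h
  exact fun x hx => mem_smoothLocus_iff.mpr ⟨i + 1, fun hx' => hx
    (Ideal.mem_of_dvd _ (map_dvd (incl k) hi) hx')⟩

/-- The basic open subsets of the smooth locus. -/
def smoothOpen (h : SmoothIndex k) : (smoothLocus (sToSpec k)).toScheme.Opens :=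
  (smoothLocus (sToSpec k)).ι ⁻¹ᵁ sOpen h.1

theorem image_smoothOpen (h : SmoothIndex k) :
    (smoothLocus (sToSpec k)).ι ''ᵁ smoothOpen h = sOpen h.1 := by
  rw [smoothOpen, Scheme.Hom.image_preimage_eq_opensRange_inf, Scheme.Opens.opensRange_ι]
  exact inf_eq_right.mpr h.sOpen_le

theorem exists_smoothOpen_le {U : (smoothLocus (sToSpec k)).toScheme.Opens}
    {x : (smoothLocus (sToSpec k)).toScheme} (hx : x ∈ U) :
    ∃ h, x ∈ smoothOpen h ∧ smoothOpen h ≤ U := by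
  obtain ⟨m, hm⟩ := mem_smoothLocus_iff.mp x.2
  obtain ⟨h, hd, hxh, hle⟩ := exists_sOpen_le (U := (smoothLocus (sToSpec k)).ι ''ᵁ U) (x := x.1)
    ⟨x, hx, rfl⟩ (partials k m) (partials_isHomogeneous k m) hm
  refine ⟨⟨h, m + 2, ?_⟩, hxh, fun y hy => ?_⟩
  · rwa [show m + 2 + 1 = m by fin_cases m <;> rfl]
  · obtain ⟨y', hy', h'⟩ := hle hy
    rwa [← Subtype.ext h']

theorem isBasis_smoothOpen : Opens.IsBasis (Set.range (smoothOpen (k := k))) :=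
  Opens.isBasis_iff_nbhd.mpr fun hx => by
    obtain ⟨h, hxh, hle⟩ := exists_smoothOpen_le hx
    exact ⟨_, ⟨h, rfl⟩, hxh, hle⟩

theorem X_dvd_partials (i : Fin 3) : X i ∣ partials k (i + 1) := by
  rw [partials_eq, show i + 1 + 2 = i by fin_cases i <;> rfl]
  exact ⟨X (i + 1 + 1) * (X (i + 1 + 1) + X i), by ring⟩

variable {U : (S k).Opens} {h : CoverIndex k} {i : Fin 3} {y z w : Γ(S k, U)}

/-- Where Fᵢ₊₁ is invertible, so is xᵢ, and Fᵢ₊₁/xᵢ⁴ is a generator of 𝒪(−1), since 3 − 4 = −1. -/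
theorem bijective_smul_of_fraction (hU : U = sOpen h) (hi : partials k (i + 1) ∣ h.1)
    (n : Γ(twist (grading k) ⊤ (-1), U)) (hn : ∀ x hx,
      algebraMap _ (LocAt (grading k) x) (incl k (X i)) ^ 4 * twistVal n x hx =
        algebraMap _ _ (incl k (partials k (i + 1)))) :
    Function.Bijective fun r : Γ(S k, U) => r • n := by
  obtain ⟨d, hd, hhd⟩ := h.exists_isHomogeneous
  have hh := incl_mem_grading k hhd
  have hhx (x : ProjectiveSpectrum (grading k)) (hx : x ∈ U) : incl k h.1 ∉ x.asHomogeneousIdeal := hU.le hx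
  have hFx (x : ProjectiveSpectrum (grading k)) (hx : x ∈ U) :
      incl k (partials k (i + 1)) ∉ x.asHomogeneousIdeal := fun hx' => hhx x hx
    (Ideal.mem_of_dvd _ (map_dvd (incl k) hi) hx')
  have hix (x : ProjectiveSpectrum (grading k)) (hx : x ∈ U) : incl k (X i) ∉ x.asHomogeneousIdeal :=
    fun hx' => hFx x hx (Ideal.mem_of_dvd _ (map_dvd (incl k) (X_dvd_partials i)) hx')
  constructor
  · intro r r' hrr
    refine valHom_ext fun x hx => eq_of_algebraMap_mul_eq (hFx x hx) ?_
    have h1 := congrArg (fun m => twistVal m x hx) hrr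
    have h2 := hn x hx
    simp only [twistVal_smul] at h1
    rw [← h2]
    linear_combination algebraMap _ (LocAt (grading k) x) (incl k (X i)) ^ 4 * h1
  · intro m
    obtain ⟨N, e, a, he, ha, -, hm⟩ := exists_twistVal_fraction hd hh hU m
    have hdeg : 3 + N • d = 4 • 1 + e := by simp only [smul_eq_mul]; omega
    obtain ⟨c, hr⟩ := exists_valHom (U := U) (a := incl k (X i) ^ 4 * a)
      (b := incl k (partials k (i + 1)) * incl k h.1 ^ N)
      (SetLike.mul_mem_graded (SetLike.pow_mem_graded 4 (incl_X_mem (k := k) i)) ha)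
      (hdeg ▸ SetLike.mul_mem_graded (incl_mem_grading k (partials_isHomogeneous k (i + 1)))
        (SetLike.pow_mem_graded N hh))
      fun x hx => mul_notMem _ x (hFx x hx) (pow_notMem (hhx x hx) N)
    refine ⟨c, twistVal_ext fun x hx => eq_of_algebraMap_mul_eq (pow_notMem (hix x hx) 4) ?_⟩
    refine eq_of_algebraMap_mul_eq (pow_notMem (hhx x hx) N) ?_
    have h1 := hr x hx
    have h2 := hm x hx
    have h3 := hn x hx
    simp only [twistVal_smul, map_mul, map_pow] at h1 h2 h3 ⊢
    linear_combination h1 + algebraMap _ (LocAt (grading k) x) (incl k h.1) ^ N * valHom U x hx c * h3 -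
      algebraMap _ (LocAt (grading k) x) (incl k (X i)) ^ 4 * h2

theorem isUnit_mul_one_add (hU : U = sOpen h) (hi : partials k (i + 1) ∣ h.1)
    (hc : IsAffineCoords i y z w) : IsUnit (z * (1 + z)) := by
  have hFx (x : ProjectiveSpectrum (grading k)) (hx : x ∈ U) :
      incl k (partials k (i + 1)) ∉ x.asHomogeneousIdeal := fun hx' => hU.le hx
    (Ideal.mem_of_dvd _ (map_dvd (incl k) hi) hx')
  obtain ⟨r, hr⟩ := exists_valHom (SetLike.pow_mem_graded 3 (incl_X_mem (k := k) i))
    (incl_mem_grading k (partials_isHomogeneous k (i + 1))) hFx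
  refine IsUnit.of_mul_eq_one r (valHom_ext fun x hx => eq_of_algebraMap_mul_eq (hFx x hx) ?_)
  have h1 := hr x hx
  have h2 := hc.z x hx
  rw [incl_partials_add_one] at h1 ⊢
  simp only [map_mul, map_add, map_pow, map_one, ← h2] at h1 ⊢
  linear_combination valHom U x hx z * (1 + valHom U x hx z) * h1

-- With z(1 + z) invertible, the relation between dy and dz expresses dy by dz.
open CommRingCat.KaehlerDifferential (d) in
theorem exists_eq_combination_d_two (hU : U = sOpen h) (hi : partials k (i + 1) ∣ h.1)
    (hc : IsAffineCoords i y z w) {σ : CommRingCat.of k ⟶ (S k).presheaf.obj (op U)}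
    (hσ : σ = scalars (sToSpec k) (op U)) (ω : CommRingCat.KaehlerDifferential σ) :
    ∃ b c : Γ(S k, U), ω = b • d (f := σ) z + c • d (f := σ) w := by
  subst hσ
  have hi' : X i ∣ h.1 := (X_dvd_partials i).trans hi
  have hUi : U ≤ chartOpen k i := hU.trans_le (sOpen_le_chartOpen hi')
  obtain ⟨a, b, c, rfl⟩ := exists_eq_combination_d _ (exists_unit_eval₂ hU hi' hc) ω
  obtain ⟨r, hr⟩ := (isUnit_mul_one_add hU hi hc).exists_right_inv
  have h1 := d_relation (scalars (sToSpec k) (op U)) two_eq_zero_of_scalars (hc.sq hUi)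
  refine ⟨b - a * r * (y * (1 + y)), c, ?_⟩
  have h2 : (z * (1 + z) * r) • d (f := scalars (sToSpec k) (op U)) y =
      d (f := scalars (sToSpec k) (op U)) y := by rw [hr, one_smul]
  linear_combination (norm := module) (a * r) • h1 - a • h2

end Canonical

section RestrictedForms

open MvPolynomial

variable (k : Type u) [Field k] [CharP k 2]

abbrev smoothV : differentialsPresheaf (smoothLocusToSpec (sToSpec k)) ⟶
    ((twist (grading k) (singularIdeal k) 1).restrict (smoothLocus (sToSpec k)).ι).val :=
  differentialsOnTo (isTwistDerivation_derV k) _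

abbrev smoothW : differentialsPresheaf (smoothLocusToSpec (sToSpec k)) ⟶
    ((twist (grading k) ⊤ (-2)).restrict (smoothLocus (sToSpec k)).ι).val :=
  differentialsOnTo (isTwistDerivation_derW k) _

variable {k}

/-- A bilinear map of modules restricted to an open subscheme. -/
def restrictPairing {X : Scheme.{u}} (O : X.Opens) {A B M : X.Modules}
    (μ : ∀ U : X.Opens, Γ(A, U) →ₗ[Γ(X, U)] Γ(B, U) →ₗ[Γ(X, U)] Γ(M, U)) (V : O.toScheme.Opens) :
    Γ(A.restrict O.ι, V) →ₗ[Γ(O.toScheme, V)] Γ(B.restrict O.ι, V) →ₗ[Γ(O.toScheme, V)]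
      Γ(M.restrict O.ι, V) :=
  LinearMap.mk₂ _ (fun m n => (show Γ(M, O.ι ''ᵁ V) from μ (O.ι ''ᵁ V) m n))
    (fun m m' n => congr($((μ (O.ι ''ᵁ V)).map_add m m') n))
    (fun r m n => (congrArg (fun l => μ (O.ι ''ᵁ V) l n) (smul_restrict A O V r m)).trans
      (congr($((μ (O.ι ''ᵁ V)).map_smul r m) n).trans (smul_restrict M O V r _).symm))
    (fun m n n' => ((μ (O.ι ''ᵁ V)) m).map_add n n')
    (fun r m n => (congrArg (μ (O.ι ''ᵁ V) m) (smul_restrict B O V r n)).trans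
      (((μ (O.ι ''ᵁ V) m).map_smul r n).trans (smul_restrict M O V r _).symm))

-- The isomorphism is V ∧ W. On a basic open set Ω² is generated by dz ∧ dw, and V(w) = 0, so the
-- value is V(z)W(w) = Fᵢ₊₁/xᵢ⁴, a generator of 𝒪(−1).
variable (k) in
theorem nonempty_twoForms_iso : Nonempty (twoForms (smoothLocusToSpec (sToSpec k)) ≅
    (twist (grading k) ⊤ (-1)).restrict (smoothLocus (sToSpec k)).ι) := by
  obtain ⟨v, hv⟩ := exists_twoFormsPresheaf_hom (smoothLocusToSpec (sToSpec k)) (smoothV k) (smoothW k)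
    (M := (twist (grading k) ⊤ (-1)).restrict (smoothLocus (sToSpec k)).ι)
    (restrictPairing (smoothLocus (sToSpec k)) (twistMul (singularIdeal k) ⊤ (m := -1) (by norm_num)))
    (fun i m n => rfl)
  refine nonempty_sheafify_iso v isBasis_smoothOpen fun h => ?_
  obtain ⟨L, hL, hL'⟩ := hv (smoothOpen h)
  suffices Function.Bijective L from (funext hL : _ = ⇑L) ▸ this
  obtain ⟨i, hi⟩ := h.2
  have hU := image_smoothOpen h
  have hUi : (smoothLocus (sToSpec k)).ι ''ᵁ smoothOpen h ≤ chartOpen k i :=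
    hU.trans_le (sOpen_le_chartOpen ((X_dvd_partials i).trans hi))
  obtain ⟨y, z, w, hc⟩ := exists_isAffineCoords_of_le hUi
  let σ := scalars (smoothLocusToSpec (sToSpec k)) (op (smoothOpen h))
  have hσ : σ = scalars (sToSpec k) (op ((smoothLocus (sToSpec k)).ι ''ᵁ smoothOpen h)) :=
    scalars_ι _ _ _
  refine exteriorPower_two_bijective L (CommRingCat.KaehlerDifferential.d (f := σ) z)
    (CommRingCat.KaehlerDifferential.d (f := σ) w) (exists_eq_combination_d_two hU hi hc hσ) ?_
  let U := (smoothLocus (sToSpec k)).ι ''ᵁ smoothOpen h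
  let μ := twistMul (𝒜 := grading k) (singularIdeal k) ⊤ (n := 1) (n' := -2) (m := -1) (by norm_num)
  let n₀ : Γ(twist (grading k) ⊤ (-1), U) :=
    μ U (vectorV k U z) (vectorW k U w) - μ U (vectorV k U w) (vectorW k U z)
  have h0 : L (exteriorPower.ιMulti _ 2 ![CommRingCat.KaehlerDifferential.d (f := σ) z,
      CommRingCat.KaehlerDifferential.d (f := σ) w]) = n₀ := by
    refine (hL' _ _).trans (congrArg₂ (· - ·) ?_ ?_)
    · exact congrArg₂ (fun m n => μ U m n)
        (differentialsOnTo_d (isTwistDerivation_derV k) _ (smoothOpen h) z)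
        (differentialsOnTo_d (isTwistDerivation_derW k) _ (smoothOpen h) w)
    · exact congrArg₂ (fun m n => μ U m n)
        (differentialsOnTo_d (isTwistDerivation_derV k) _ (smoothOpen h) w)
        (differentialsOnTo_d (isTwistDerivation_derW k) _ (smoothOpen h) z)
  rw [h0]
  have hb := bijective_smul_of_fraction hU hi n₀ fun x hx => ?_
  · exact (congrArg Function.Bijective (funext fun r =>
      smul_restrict (twist (grading k) ⊤ (-1)) _ (smoothOpen h) r n₀)).mpr hb
  · have e1 := sq_mul_vectorV_z hc x hx
    have e2 := sq_mul_vectorW_w hc x hx (hUi hx)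
    have e3 := vectorV_w hc x hx (hUi hx)
    have e4 : twistVal n₀ x hx = twistVal (vectorV k U z) x hx * twistVal (vectorW k U w) x hx -
      twistVal (vectorV k U w) x hx * twistVal (vectorW k U z) x hx := rfl
    rw [e4, e3, ← e1]
    linear_combination algebraMap _ (LocAt (grading k) x) (incl k (X i)) ^ 2 *
      twistVal (vectorV k U z) x hx * e2

variable (k) in
theorem nonempty_twoForms_iso_pullback : Nonempty (twoForms (smoothLocusToSpec (sToSpec k)) ≅
    (Scheme.Modules.pullback ((smoothLocus (sToSpec k)).ι ≫ g k)).obj (pSpaceO k 2 (-1))) := by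
  obtain ⟨e⟩ := nonempty_twoForms_iso k
  obtain ⟨e'⟩ := nonempty_pullback_twist_iso (⊤ : Ideal (MvPolynomial (Fin 3) k)) (-1)
  rw [Ideal.map_top] at e'
  exact ⟨e ≪≫ (Scheme.Modules.restrictFunctor _).mapIso e'.symm ≪≫
    (Scheme.Modules.restrictFunctorIsoPullback _).app _ ≪≫ (Scheme.Modules.pullbackComp _ _).app _⟩

variable (k) in
theorem isA1DelPezzo : IsA1DelPezzo (sToSpec k) (g k) where
  isIntegral := inferInstance
  isProper := inferInstance
  smooth_two := smoothOfRelativeDimension_smoothLocus k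
  a1 := isA1Singularity_of_notMem_smoothLocus
  w := g_pSpaceToSpec k
  isFinite := (finite_flat_g k).1
  canonical := nonempty_twoForms_iso_pullback k

end RestrictedForms

/-! ### A criterion for an open immersion of an affine scheme into Proj -/

section FromOfGlobalSections

variable {σ A : Type u} [CommRing A] [SetLike σ A] [AddSubgroupClass σ A] {𝒜 : ℕ → σ} [GradedRing 𝒜]
  {X : Scheme.{u}} (f : A →+* Γ(X, ⊤))

theorem bijective_away_map {T : Type*} [CommRing T] (f : A →+* T) {t : A} {d : ℕ} (ht : t ∈ 𝒜 d) (hu : IsUnit (f t))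
    (hinj : ∀ n a, a ∈ 𝒜 n → f a = 0 → a = 0)
    (hsurj : ∀ x, ∃ n a, a ∈ 𝒜 (n * d) ∧ f t ^ n * x = f a)
    (hle : Submonoid.powers t ≤ (Submonoid.powers (f t)).comap f) :
    Function.Bijective ((IsLocalization.map (S := Localization.Away t)
      (Localization.Away (f t)) f hle).comp
        (algebraMap (HomogeneousLocalization.Away 𝒜 t) (Localization.Away t))) := by
  have hbij : Function.Bijective (algebraMap T (Localization.Away (f t))) :=
    (IsLocalization.atUnit T (Localization.Away (f t)) (f t) hu).bijective
  have hmk (n : ℕ) (a : A) (ha : a ∈ 𝒜 (n * d)) :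
      algebraMap T (Localization.Away (f t)) (f t) ^ n *
        IsLocalization.map (S := Localization.Away t) (Localization.Away (f t)) f hle
          (HomogeneousLocalization.Away.mk 𝒜 ht n a ha).val = algebraMap T _ (f a) := by
    rw [← IsLocalization.map_eq (S := Localization.Away t) hle a,
      ← IsLocalization.map_eq (S := Localization.Away t) hle t, ← map_pow, ← map_mul]
    congr 1
    rw [HomogeneousLocalization.Away.val_mk, Localization.mk_eq_mk', ← map_pow]
    exact IsLocalization.mk'_spec' (Localization.Away t) a (⟨t ^ n, n, rfl⟩ : Submonoid.powers t)
  have hu' : IsUnit (algebraMap T (Localization.Away (f t)) (f t)) := hu.map _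
  constructor
  · rw [injective_iff_map_eq_zero]
    intro r hr
    obtain ⟨n, a, ha, rfl⟩ := HomogeneousLocalization.Away.mk_surjective 𝒜 ht r
    have h := hmk n a ha
    rw [show IsLocalization.map (S := Localization.Away t) (Localization.Away (f t)) f hle
          (HomogeneousLocalization.Away.mk 𝒜 ht n a ha).val = 0 from hr, mul_zero] at h
    have ha0 := hinj _ a ha (hbij.1 (h.symm.trans (map_zero _).symm))
    subst ha0
    refine HomogeneousLocalization.val_injective _ ?_
    rw [HomogeneousLocalization.Away.val_mk, Localization.mk_zero, HomogeneousLocalization.val_zero]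
  · intro x
    obtain ⟨x, rfl⟩ := hbij.2 x
    obtain ⟨n, a, ha, h⟩ := hsurj x
    refine ⟨HomogeneousLocalization.Away.mk 𝒜 ht n a ha, (hu'.pow n).mul_left_cancel ?_⟩
    refine (hmk n a ha).trans ?_
    rw [← h, map_mul, map_pow]

/-- As f(t) is a unit, X maps into D₊(t), and the hypotheses say that the degree zero fractions with
denominator a power of t are exactly Γ(X, ⊤). Injectivity is asked only for homogeneous elements: f
itself may have a kernel. -/
theorem isOpenImmersion_fromOfGlobalSections [IsAffine X]
    (hf : (HomogeneousIdeal.irrelevant 𝒜).toIdeal.map f = ⊤) {t : A} {d : ℕ} (ht : t ∈ 𝒜 d)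
    (hd : 0 < d) (hu : IsUnit (f t)) (hinj : ∀ n a, a ∈ 𝒜 n → f a = 0 → a = 0)
    (hsurj : ∀ x, ∃ n a, a ∈ 𝒜 (n * d) ∧ f t ^ n * x = f a) :
    IsOpenImmersion (Proj.fromOfGlobalSections 𝒜 f hf) := by
  have htop : Proj.fromOfGlobalSections 𝒜 f hf ⁻¹ᵁ Proj.basicOpen 𝒜 t = ⊤ :=
    (Proj.fromOfGlobalSections_preimage_basicOpen 𝒜 f hf hd ht).trans
      (X.basicOpen_of_isUnit hu)
  have h1 : IsIso (Proj.toBasicOpenOfGlobalSections 𝒜 f rfl hd ht) := by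
    have hle : Submonoid.powers t ≤ (Submonoid.powers (f t)).comap f := by
      rw [← Submonoid.map_le_iff_le_comap, Submonoid.map_powers]
    have : IsIso (CommRingCat.ofHom ((IsLocalization.map (S := Localization.Away t)
      (Localization.Away (f t)) f hle).comp
        (algebraMap (HomogeneousLocalization.Away 𝒜 t) (Localization.Away t)))) :=
      (ConcreteCategory.isIso_iff_bijective _).mpr (bijective_away_map f ht hu hinj hsurj hle)
    unfold Proj.toBasicOpenOfGlobalSections
    have h4 : IsIso (X.toSpecΓ ∣_ PrimeSpectrum.basicOpen (f t)) :=
      (isPullback_morphismRestrict _ _).isIso_fst_of_isIso (inferInstanceAs (IsIso X.toSpecΓ))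
    have h5 : IsIso (Spec.map (CommRingCat.ofHom ((IsLocalization.map (S := Localization.Away t)
      (Localization.Away (f t)) f hle).comp
        (algebraMap (HomogeneousLocalization.Away 𝒜 t) (Localization.Away t))))) := inferInstance
    have h6 := IsIso.comp_isIso' (f := (basicOpenIsoSpecAway (f t)).hom) inferInstance h5
    have h7 := IsIso.comp_isIso' h4 h6
    have h8 := IsIso.comp_isIso' (f := (X.isoOfEq (X.toSpecΓ_preimage_basicOpen (f t))).inv) inferInstance h7
    exact IsIso.comp_isIso' h8 inferInstance
  have h2 : IsOpenImmersion ((Proj.fromOfGlobalSections 𝒜 f hf ⁻¹ᵁ Proj.basicOpen 𝒜 t).ι ≫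
      Proj.fromOfGlobalSections 𝒜 f hf) := by
    rw [← morphismRestrict_ι, Proj.fromOfGlobalSections_morphismRestrict 𝒜 f hf hd ht]
    infer_instance
  have h3 : IsIso (Proj.fromOfGlobalSections 𝒜 f hf ⁻¹ᵁ Proj.basicOpen 𝒜 t).ι := by
    rw [htop, ← Scheme.topIso_hom]
    infer_instance
  exact (MorphismProperty.cancel_left_of_respectsIso @IsOpenImmersion _ _).mp h2

end FromOfGlobalSections

/-! ### The complement of the seven lines as an open subset of S -/

section Anticanonical

open MvPolynomial

variable (k : Type u) [Field k] [CharP k 2]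

omit [CharP k 2] in
theorem linesProduct_ne_zero : linesProduct k ≠ 0 := by
  have h (i : Fin 2) : (X i : MvPolynomial (Fin 2) k) ≠ 0 := X_ne_zero i
  have h' (p : MvPolynomial (Fin 2) k) (v : Fin 2 → k) (hv : eval v p ≠ 0) : p ≠ 0 := by
    rintro rfl
    exact hv (map_zero _)
  refine mul_ne_zero (mul_ne_zero (mul_ne_zero (mul_ne_zero (mul_ne_zero (h 0) (h 1)) ?_) ?_) ?_) ?_
  · exact h' _ 0 (by simp)
  · exact h' _ 0 (by simp)
  · exact h' _ ![1, 0] (by simp)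
  · exact h' _ 0 (by simp)

-- The inverse rational map. The formulas for u and v are quotients of products of the 𝔽₂-linear
-- forms in which all but one factor cancel, as `anticanonical_factorizations` shows; t is the
-- scalar by which the homogeneous coordinates of the point are rescaled to those of its image.
omit [CharP k 2] in
theorem anticanonical_inverse_identities {K : Type*} [Field K] (h2 : (2 : K) = 0) {x y z q : K}
    (hx : x ≠ 0) (hD : y * z + q ≠ 0)
    (hq : q ^ 2 = x * y * z * (x + y + z)) :
    let u := z * (q + x * y) / (x * (y * z + q))
    let v := z * (x + z) / (y * z + q)
    let t := z * (x + z) * (z * (x + y + z) + q) / (x * (y * z + q) ^ 2)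
    v * (v + 1) = t * x ∧ u * (u + 1) = t * y ∧ u * v * (u + v) = t * z ∧
      u * v * (u + v) * (v + 1) * (u + 1) = t ^ 2 * q := by
  intro u v t
  have hu : u * (x * (y * z + q)) = z * (q + x * y) := div_mul_cancel₀ _ (mul_ne_zero hx hD)
  have hv : v * (y * z + q) = z * (x + z) := div_mul_cancel₀ _ hD
  have ht : t * (x * (y * z + q) ^ 2) = z * (x + z) * (z * (x + y + z) + q) :=
    div_mul_cancel₀ _ (mul_ne_zero hx (pow_ne_zero 2 hD))
  have hu1 : (u + 1) * (x * (y * z + q)) = q * (x + z) := by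
    linear_combination hu + x * y * z * h2
  have hv1 : (v + 1) * (y * z + q) = z * (x + y + z) + q := by
    linear_combination hv
  have huv : (u + v) * (x * (y * z + q)) = z * (q + x * (x + y + z)) := by
    linear_combination hu + x * hv
  have e2 : v * (v + 1) = t * x := by
    refine mul_right_cancel₀ (pow_ne_zero 2 hD) ?_
    linear_combination (v + 1) * (y * z + q) * hv + z * (x + z) * hv1 - ht
  have e3 : u * (u + 1) = t * y := by
    refine mul_right_cancel₀ (pow_ne_zero 2 (mul_ne_zero hx hD)) ?_
    linear_combination (u + 1) * (x * (y * z + q)) * hu + z * (q + x * y) * hu1 - x * y * ht +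
      z * (x + z) * hq
  have e4 : u * v * (u + v) = t * z := by
    refine mul_right_cancel₀ (mul_ne_zero (pow_ne_zero 2 hx) (pow_ne_zero 3 hD)) ?_
    have e : z * (q + x * y) * (z * (x + z)) * (z * (q + x * (x + y + z))) =
        z * (x * (y * z + q)) * (z * (x + z) * (z * (x + y + z) + q)) := by
      linear_combination z ^ 2 * (x + z) * (z - x) * hq
    calc _ = (u * (x * (y * z + q))) * (v * (y * z + q)) * ((u + v) * (x * (y * z + q))) := by ring
      _ = z * (x * (y * z + q)) * (t * (x * (y * z + q) ^ 2)) := by rw [hu, hv, huv, ht, e]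
      _ = _ := by ring
  refine ⟨e2, e3, e4, ?_⟩
  rw [e4]
  refine mul_right_cancel₀ (mul_ne_zero hx (pow_ne_zero 2 hD)) ?_
  linear_combination t * z * (v + 1) * (y * z + q) * hu1 + t * z * q * (x + z) * hv1 - t * q * ht

theorem exists_inverse_anticanonicalCoords :
    ∃ (ψ : MvPolynomial (Fin 2) k →ₐ[k] FractionRing (CoordRing k)) (t : FractionRing (CoordRing k)),
      t ≠ 0 ∧ ∀ i, ψ (anticanonicalCoords k i) = t ^ weights i * algebraMap _ _ (coord k i) := by
  have h2 : (2 : FractionRing (CoordRing k)) = 0 := by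
    rw [← map_ofNat (algebraMap (CoordRing k) (FractionRing (CoordRing k))),
      two_eq_zero_coordRing, map_zero]
  have hne (a b : MvPolynomial (Fin 3) k) (h : a ≠ 0 ∨ b ≠ 0) :
      algebraMap _ (FractionRing (CoordRing k)) (incl k a + incl k b * coord k 3) ≠ 0 := by
    intro h0
    have := normalForm_eq_zero k ((FaithfulSMul.algebraMap_injective _ _) (h0.trans (map_zero _).symm))
    tauto
  have hX (i : Fin 3) : algebraMap _ (FractionRing (CoordRing k)) (coord k i.castSucc) ≠ 0 := by
    have := hne (X i) 0 (Or.inl (X_ne_zero i))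
    rwa [map_zero, zero_mul, add_zero, incl_X] at this
  have hXX : algebraMap _ (FractionRing (CoordRing k)) (coord k 0 + coord k 2) ≠ 0 := by
    have := hne (X 0 + X 2) 0 (Or.inl (X_add_X_ne_zero k (by decide)))
    rwa [map_zero, zero_mul, add_zero, map_add, incl_X, incl_X] at this
  have hD := hne (X 1 * X 2) 1 (Or.inr one_ne_zero)
  have hE := hne (X 2 * (X 0 + X 1 + X 2)) 1 (Or.inr one_ne_zero)
  simp only [map_one, one_mul, map_add, map_mul, incl_X] at hD hE hXX
  have hq := congrArg (algebraMap _ (FractionRing (CoordRing k))) (coord_three_sq k)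
  simp only [quartic, map_add, map_mul, map_pow, incl_X] at hq
  have h0 := hX 0
  have h2' := hX 2
  change algebraMap _ _ (coord k 0) ≠ 0 at h0
  change algebraMap _ _ (coord k 2) ≠ 0 at h2'
  change _ = algebraMap _ _ (coord k 0) * algebraMap _ _ (coord k 1) * algebraMap _ _ (coord k 2) *
    (algebraMap _ _ (coord k 0) + algebraMap _ _ (coord k 1) + algebraMap _ _ (coord k 2)) at hq
  change algebraMap _ _ (coord k 1) * algebraMap _ _ (coord k 2) + _ ≠ 0 at hD
  change algebraMap _ _ (coord k 2) * (algebraMap _ _ (coord k 0) + algebraMap _ _ (coord k 1) +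
    algebraMap _ _ (coord k 2)) + _ ≠ 0 at hE
  set x := algebraMap _ (FractionRing (CoordRing k)) (coord k 0) with hx
  set y := algebraMap _ (FractionRing (CoordRing k)) (coord k 1) with hy
  set z := algebraMap _ (FractionRing (CoordRing k)) (coord k 2) with hz
  set q := algebraMap _ (FractionRing (CoordRing k)) (coord k 3) with hqq
  refine ⟨aeval ![z * (q + x * y) / (x * (y * z + q)), z * (x + z) / (y * z + q)],
    z * (x + z) * (z * (x + y + z) + q) / (x * (y * z + q) ^ 2), ?_, fun i => ?_⟩
  · exact div_ne_zero (mul_ne_zero (mul_ne_zero h2' hXX) hE) (mul_ne_zero h0 (pow_ne_zero 2 hD))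
  · obtain ⟨e2, e3, e4, e5⟩ := anticanonical_inverse_identities h2 h0 hD hq
    have hw : weights i = ![1, 1, 1, 2] i := rfl
    rw [hw]
    fin_cases i
    all_goals simp only [anticanonicalCoords, map_mul, map_add, map_one, aeval_X, Matrix.cons_val,
      Fin.reduceFinMk, Fin.zero_eta, Fin.mk_one, pow_one]
    exacts [e2, e3, e4, e5]

/-- Composition with the inverse rational map multiplies a form of degree n by tⁿ, with t ≠ 0. -/
theorem eq_zero_of_anticanonicalRingHom_eq_zero {n : ℕ} {a : CoordRing k} (ha : a ∈ grading k n)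
    (h : anticanonicalRingHom k a = 0) : a = 0 := by
  obtain ⟨ψ, t, ht, hψ⟩ := exists_inverse_anticanonicalCoords k
  obtain ⟨p, hp, rfl⟩ := ha
  have h0 : aeval (anticanonicalCoords k) p = 0 :=
    (IsLocalization.injective (LinesComplementRing k)
      (powers_le_nonZeroDivisors_of_noZeroDivisors (linesProduct_ne_zero k)))
      (h.trans (map_zero _).symm)
  have h1 : ψ (aeval (anticanonicalCoords k) p) = t ^ n * algebraMap _ _ (toCoordRing k p) := by
    have hc : algebraMap _ (FractionRing (CoordRing k)) (toCoordRing k p) =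
        aeval (fun i => algebraMap _ (FractionRing (CoordRing k)) (coord k i)) p := by
      have : (IsScalarTower.toAlgHom k (CoordRing k) (FractionRing (CoordRing k))).comp
          (toCoordRing k) = aeval (fun i => algebraMap _ (FractionRing (CoordRing k)) (coord k i)) := by
        refine algHom_ext fun i => ?_
        rw [aeval_X]
        rfl
      exact congr($this p)
    rw [hc, ← aeval_of_isWeightedHomogeneous hp t _ _ hψ, ← comp_aeval_apply]
  rw [h0, map_zero, eq_comm, mul_eq_zero] at h1
  refine FaithfulSMul.algebraMap_injective (CoordRing k) (FractionRing (CoordRing k)) ?_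
  exact (h1.resolve_left (pow_ne_zero n ht)).trans (map_zero _).symm


theorem anticanonicalRingHom_coord (i : Fin 4) : anticanonicalRingHom k (coord k i) =
    algebraMap (MvPolynomial (Fin 2) k) (LinesComplementRing k) (anticanonicalCoords k i) :=
  congrArg (algebraMap (MvPolynomial (Fin 2) k) (LinesComplementRing k))
    (aeval_X (anticanonicalCoords k) i)

theorem anticanonicalRingHom_coord_eq : ∃ u v : LinesComplementRing k,
    u = algebraMap (MvPolynomial (Fin 2) k) _ (X 0) ∧ v = algebraMap (MvPolynomial (Fin 2) k) _ (X 1) ∧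
    (2 : LinesComplementRing k) = 0 ∧
    anticanonicalRingHom k (coord k 0) = v * (v + 1) ∧
    anticanonicalRingHom k (coord k 1) = u * (u + 1) ∧
    anticanonicalRingHom k (coord k 2) = u * v * (u + v) ∧
    anticanonicalRingHom k (coord k 3) = u * v * (u + v) * (v + 1) * (u + 1) := by
  refine ⟨_, _, rfl, rfl, ?_, ?_, ?_, ?_, ?_⟩
  · rw [← map_ofNat (algebraMap (MvPolynomial (Fin 2) k) (LinesComplementRing k)),
      two_eq_zero_poly, map_zero]
  all_goals rw [anticanonicalRingHom_coord]
  all_goals simp only [anticanonicalCoords, Matrix.cons_val, map_mul, map_add, map_one]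

/-- The product of the equations of the seven `𝔽₂`-lines. -/
def sevenLines : CoordRing k :=
  coord k 0 * coord k 1 * coord k 2 * (coord k 0 + coord k 1) * (coord k 0 + coord k 2) *
    (coord k 1 + coord k 2) * (coord k 0 + coord k 1 + coord k 2)

omit [CharP k 2] in
theorem sevenLines_mem_grading : sevenLines k ∈ grading k 7 := by
  have h (i : Fin 3) : coord k i.castSucc ∈ grading k 1 := by
    have := coord_mem_grading k i.castSucc
    fin_cases i <;> exact this
  have h0 : coord k 0 ∈ grading k 1 := h 0
  have h1 : coord k 1 ∈ grading k 1 := h 1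
  have h2 : coord k 2 ∈ grading k 1 := h 2
  exact SetLike.mul_mem_graded (SetLike.mul_mem_graded (SetLike.mul_mem_graded
    (SetLike.mul_mem_graded (SetLike.mul_mem_graded (SetLike.mul_mem_graded h0 h1) h2)
    (add_mem h0 h1)) (add_mem h0 h2)) (add_mem h1 h2)) (add_mem (add_mem h0 h1) h2)

-- On the plane these forms decompose into equations of 𝔽₂-lines, and each inverse formula becomes a
-- comparison of exponents.
omit [CharP k 2] in
theorem anticanonical_factorizations {R : Type*} [CommRing R] (h2 : (2 : R) = 0) {u v x y z q : R}
    (hx : x = v * (v + 1)) (hy : y = u * (u + 1)) (hz : z = u * v * (u + v))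
    (hq : q = u * v * (u + v) * (v + 1) * (u + 1)) :
    x + y = (u + v) * (u + v + 1) ∧ x + z = v * (u + 1) * (u + v + 1) ∧
      y + z = u * (v + 1) * (u + v + 1) ∧ x + y + z = (u + 1) * (v + 1) * (u + v) ∧
      q + y * z = u * v * (u + v) * (u + 1) * (u + v + 1) ∧
      q + x * y = u * v * (u + 1) * (v + 1) * (u + v + 1) ∧
      q + z * (x + y + z) = u * v * (u + 1) * (v + 1) * (u + v) * (u + v + 1) := by
  have e : x + y + z = (u + 1) * (v + 1) * (u + v) := by
    subst hx hy hz
    linear_combination - u * v * h2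
  rw [e]
  subst hx hy hz hq
  refine ⟨?_, ?_, ?_, rfl, ?_, ?_, ?_⟩
  · linear_combination - u * v * h2
  · linear_combination - u * v * h2
  · linear_combination - u * v * h2
  · ring
  · ring
  · ring

/-- Seven cubics, each a product of lines, in which every 𝔽₂-line occurs three times (the line at
infinity is 1 in the chart). -/
theorem anticanonicalRingHom_sevenLines : anticanonicalRingHom k (sevenLines k) =
    algebraMap (MvPolynomial (Fin 2) k) (LinesComplementRing k) (linesProduct k) ^ 3 := by
  obtain ⟨u, v, hu, hv, h2, h0, h1, h2', h3⟩ := anticanonicalRingHom_coord_eq k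
  obtain ⟨e1, e2, e3, e4, -⟩ := anticanonical_factorizations h2 h0 h1 h2' h3
  rw [sevenLines, map_mul, map_mul, map_mul, map_mul, map_mul, map_mul, map_add, map_add, map_add,
    map_add, map_add, e4, e1, e2, e3, h0, h1, h2']
  simp only [linesProduct, map_mul, map_add, map_one, ← hu, ← hv]
  ring

/-- The functions of this form are a subalgebra F, so it is enough that F contains u, v and the
inverse of the product of the lines. -/
theorem exists_fraction_anticanonicalRingHom (x : LinesComplementRing k) : ∃ n a,
    a ∈ grading k (n * 7) ∧ anticanonicalRingHom k (sevenLines k) ^ n * x =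
      anticanonicalRingHom k a := by
  let F : Subalgebra k (LinesComplementRing k) :=
    { carrier := {x | ∃ n a, a ∈ grading k (n * 7) ∧
        anticanonicalRingHom k (sevenLines k) ^ n * x = anticanonicalRingHom k a}
      mul_mem' := by
        rintro x y ⟨n, a, ha, hx⟩ ⟨m, b, hb, hy⟩
        refine ⟨n + m, a * b, ?_, ?_⟩
        · rw [add_mul]
          exact SetLike.mul_mem_graded ha hb
        · rw [map_mul, ← hx, ← hy]
          ring
      add_mem' := by
        rintro x y ⟨n, a, ha, hx⟩ ⟨m, b, hb, hy⟩
        refine ⟨n + m, sevenLines k ^ m * a + sevenLines k ^ n * b, add_mem ?_ ?_, ?_⟩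
        · rw [add_mul, add_comm]
          exact SetLike.mul_mem_graded (SetLike.pow_mem_graded m (sevenLines_mem_grading k)) ha
        · rw [add_mul]
          exact SetLike.mul_mem_graded (SetLike.pow_mem_graded n (sevenLines_mem_grading k)) hb
        · rw [map_add, map_mul, map_mul, ← hx, ← hy, map_pow, map_pow]
          ring
      algebraMap_mem' := fun c => by
        refine ⟨0, algebraMap k _ c, ?_, ?_⟩
        · rw [zero_mul]
          exact SetLike.algebraMap_mem_graded (grading k) c
        · rw [pow_zero, one_mul, AlgHom.commutes] }
  have hP : IsUnit (anticanonicalRingHom k (sevenLines k)) := by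
    rw [anticanonicalRingHom_sevenLines]
    exact (IsLocalization.Away.algebraMap_isUnit (S := LinesComplementRing k) (linesProduct k)).pow 3
  suffices x ∈ F from this
  have hmk (x : LinesComplementRing k) (a : CoordRing k) (ha : a ∈ grading k 7)
      (h : anticanonicalRingHom k (sevenLines k) * x = anticanonicalRingHom k a) : x ∈ F :=
    ⟨1, a, ha, by rwa [pow_one]⟩
  have c0 : coord k 0 ∈ grading k 1 := coord_mem_grading k 0
  have c1 : coord k 1 ∈ grading k 1 := coord_mem_grading k 1
  have c2 : coord k 2 ∈ grading k 1 := coord_mem_grading k 2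
  have c3 : coord k 3 ∈ grading k 2 := coord_mem_grading k 3
  have c12 : coord k 1 * coord k 2 ∈ grading k 2 := SetLike.mul_mem_graded c1 c2
  have c01 : coord k 0 * coord k 1 ∈ grading k 2 := SetLike.mul_mem_graded c0 c1
  have cs := add_mem (add_mem c0 c1) c2
  obtain ⟨u, v, hu, hv, h2, h0, h1, h2', h3⟩ := anticanonicalRingHom_coord_eq k
  obtain ⟨e1, e2, e3, e4, e5, e6, e7⟩ := anticanonical_factorizations h2 h0 h1 h2' h3
  have hs : anticanonicalRingHom k (sevenLines k) =
      (u * v * (u + 1) * (v + 1) * (u + v) * (u + v + 1)) ^ 3 := by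
    rw [anticanonicalRingHom_sevenLines]
    simp only [linesProduct, map_mul, map_add, map_one, ← hu, ← hv]
  -- The numerator is a form of degree seven whose factorization is u times the cube of the product
  -- of the lines.
  have hu' : u ∈ F := by
    refine hmk _ (coord k 2 * (coord k 3 + coord k 0 * coord k 1) * (coord k 3 + coord k 1 * coord k 2) *
      (coord k 0 + coord k 1 + coord k 2) * (coord k 1 + coord k 2))
      (SetLike.mul_mem_graded (SetLike.mul_mem_graded (SetLike.mul_mem_graded
        (SetLike.mul_mem_graded c2 (add_mem c3 c01)) (add_mem c3 c12)) cs) (add_mem c1 c2)) ?_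
    rw [hs, map_mul, map_mul, map_mul, map_mul, map_add, map_add, map_add, map_add, map_add, map_mul,
      map_mul, e6, e5, e4, e3, h2']
    ring
  have hv' : v ∈ F := by
    refine hmk _ (coord k 2 * (coord k 0 + coord k 2) * (coord k 3 + coord k 1 * coord k 2) * coord k 0 *
      (coord k 0 + coord k 1 + coord k 2) * (coord k 1 + coord k 2))
      (SetLike.mul_mem_graded (SetLike.mul_mem_graded (SetLike.mul_mem_graded
        (SetLike.mul_mem_graded (SetLike.mul_mem_graded c2 (add_mem c0 c2)) (add_mem c3 c12)) c0) cs)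
        (add_mem c1 c2)) ?_
    rw [hs, map_mul, map_mul, map_mul, map_mul, map_mul, map_add, map_add, map_add, map_add, map_add,
      map_mul, e5, e4, e3, e2, h2', h0]
    ring
  have hp (p : MvPolynomial (Fin 2) k) :
      algebraMap (MvPolynomial (Fin 2) k) (LinesComplementRing k) p ∈ F := by
    have h : (aeval ![u, v] : MvPolynomial (Fin 2) k →ₐ[k] LinesComplementRing k) =
        IsScalarTower.toAlgHom k (MvPolynomial (Fin 2) k) (LinesComplementRing k) := by
      refine algHom_ext fun i => ?_
      rw [aeval_X]
      fin_cases i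
      exacts [hu, hv]
    refine congr($h p) ▸ ?_
    induction p using MvPolynomial.induction_on with
    | C c => rw [aeval_C]; exact F.algebraMap_mem c
    | add p q hp hq => rw [map_add]; exact add_mem hp hq
    | mul_X p i hp =>
      rw [map_mul, aeval_X]
      refine mul_mem hp ?_
      fin_cases i
      exacts [hu', hv']
  -- An inverse in F of the image of x₀, again from a numerator of degree seven.
  obtain ⟨ι, hι⟩ : ∃ ι ∈ F, v * (v + 1) * ι = 1 := by
    obtain ⟨r, hr⟩ := hP
    have hr' : anticanonicalRingHom k (sevenLines k) * (↑r⁻¹ : LinesComplementRing k) = 1 := by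
      rw [← hr, Units.mul_inv]
    refine ⟨(↑r⁻¹ : LinesComplementRing k) * (v * (v + 1) * ((u * (u + 1)) ^ 2 *
      ((u + v) * (u + v + 1)) ^ 2 * (u * v * (u + 1) * (v + 1) * (u + v) * (u + v + 1)))), ?_, ?_⟩
    · refine hmk _ (coord k 0 * (coord k 1 * coord k 1 * ((coord k 0 + coord k 1) * (coord k 0 + coord k 1)) *
        (coord k 3 + coord k 2 * (coord k 0 + coord k 1 + coord k 2))))
        (SetLike.mul_mem_graded c0 (SetLike.mul_mem_graded (SetLike.mul_mem_graded
          (SetLike.mul_mem_graded c1 c1) (SetLike.mul_mem_graded (add_mem c0 c1) (add_mem c0 c1)))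
          (add_mem c3 (SetLike.mul_mem_graded c2 cs)))) ?_
      rw [← mul_assoc, hr', one_mul, map_mul, map_mul, map_mul, map_mul, map_mul, map_add, map_add,
        map_mul, map_add, map_add, e7, e1, h0, h1]
      ring
    · rw [hs] at hr'
      linear_combination hr'
  -- With s the image of `sevenLines`, x₀⁷/s lies in F since x₀⁷ has degree seven; multiplying by
  -- the seventh power of the inverse of x₀ leaves 1/s.
  have hinv : ∀ y, anticanonicalRingHom k (sevenLines k) * y = 1 → y ∈ F := by
    intro y hy
    have h7 : v * (v + 1) * (v * (v + 1)) ^ 6 * y ∈ F := by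
      refine hmk _ (coord k 0 ^ 7) (by simpa using SetLike.pow_mem_graded 7 c0) ?_
      rw [map_pow, h0]
      linear_combination (v * (v + 1)) ^ 7 * hy
    have : y = v * (v + 1) * (v * (v + 1)) ^ 6 * y * ι ^ 7 := by
      have : (v * (v + 1) * ι) ^ 7 = 1 := by rw [hι.2, one_pow]
      linear_combination - y * this
    rw [this]
    exact mul_mem h7 (pow_mem hι.1 7)
  obtain ⟨⟨p, ⟨_, n, rfl⟩⟩, hx⟩ := IsLocalization.surj (Submonoid.powers (linesProduct k)) x
  dsimp only at hx
  obtain ⟨r, hr⟩ := hP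
  have hr' : anticanonicalRingHom k (sevenLines k) * (↑r⁻¹ : LinesComplementRing k) = 1 := by
    rw [← hr, Units.mul_inv]
  -- The inverse of the product L of the lines is L² times the inverse of L³.
  have : x = algebraMap _ _ p * (algebraMap _ _ (linesProduct k) ^ 2 * (↑r⁻¹ : LinesComplementRing k)) ^ n := by
    rw [← hx, map_pow, mul_assoc, ← mul_pow]
    rw [anticanonicalRingHom_sevenLines] at hr'
    rw [← mul_assoc, ← pow_succ', hr', one_pow, mul_one]
  rw [this]
  exact mul_mem (hp p) (pow_mem (mul_mem (pow_mem (hp _) 2) (hinv _ hr')) n)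

theorem isOpenImmersion_anticanonicalMap : IsOpenImmersion (anticanonicalMap k) := by
  let e := (Scheme.ΓSpecIso (.of (LinesComplementRing k))).symm.commRingCatIsoToRingEquiv
  refine isOpenImmersion_fromOfGlobalSections _ _ (sevenLines_mem_grading k) (by norm_num) ?_ ?_ ?_
  · refine RingHom.isUnit_map e.toRingHom ?_
    refine (congrArg IsUnit (anticanonicalRingHom_sevenLines k)).mpr ?_
    exact (IsLocalization.Away.algebraMap_isUnit (S := LinesComplementRing k) (linesProduct k)).pow 3
  · intro n a ha h
    exact eq_zero_of_anticanonicalRingHom_eq_zero k ha (e.injective (h.trans (map_zero _).symm))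
  · intro x
    obtain ⟨x, rfl⟩ := e.surjective x
    obtain ⟨n, a, ha, h⟩ := exists_fraction_anticanonicalRingHom k x
    refine ⟨n, a, ha, ?_⟩
    refine Eq.trans ?_ (congrArg e h)
    rw [map_mul, map_pow]
    rfl

end Anticanonical

/-! ### Linear forms on pulled back sheaves, and maps to affine open sets -/

section Unit
variable {X Y : Scheme.{u}}

/-- The structure sheaf as a sheaf of modules. -/
def unitModule (X : Scheme.{u}) : X.Modules := SheafOfModules.unit X.ringCatSheaf

/-- The map `𝒪_X → q_* 𝒪_Y`. -/
def unitHom (q : Y ⟶ X) : unitModule X ⟶ (Scheme.Modules.pushforward q).obj (unitModule Y) :=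
  SheafOfModules.unitToPushforwardObjUnit q.toRingCatSheafHom

/-- The generators give an epimorphism from a free sheaf, and maps out of a free sheaf are
determined by global sections. -/
theorem hom_ext_of_generatingSections {M N : X.Modules} (σ : SheafOfModules.GeneratingSections M)
    {ψ ψ' : M ⟶ N} (h : ∀ i, ψ.app ⊤ ((σ.s i).1 (op ⊤)) = ψ'.app ⊤ ((σ.s i).1 (op ⊤))) : ψ = ψ' := by
  have hepi := σ.epi
  have h0 (i) : SheafOfModules.sectionsMap ψ (σ.s i) = SheafOfModules.sectionsMap ψ' (σ.s i) := by
    refine Subtype.ext (funext fun U => ?_)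
    have e1 := (SheafOfModules.sectionsMap ψ (σ.s i)).2 (homOfLE le_top : U.unop ⟶ ⊤).op
    have e2 := (SheafOfModules.sectionsMap ψ' (σ.s i)).2 (homOfLE le_top : U.unop ⟶ ⊤).op
    exact e1.symm.trans ((congrArg (N.presheaf.map (homOfLE le_top : U.unop ⟶ ⊤).op) (h i)).trans e2)
  refine (cancel_epi (C := SheafOfModules X.ringCatSheaf) ((SheafOfModules.freeHomEquiv M).symm σ.s)).mp ?_
  refine (SheafOfModules.freeHomEquiv_symm_comp σ.s ψ).trans
    (Eq.trans ?_ (SheafOfModules.freeHomEquiv_symm_comp σ.s ψ').symm)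
  exact congrArg _ (funext h0)

/-- The linear form on the pullback induced by a linear form. -/
def pullbackForm (q : Y ⟶ X) {M : X.Modules} (φ : M ⟶ unitModule X) :
    (Scheme.Modules.pullback q).obj M ⟶ unitModule Y :=
  ((Scheme.Modules.pullbackPushforwardAdjunction q).homEquiv M _).symm (φ ≫ unitHom q)

theorem comp_unitHom_eq_zero_of_pullbackForm_eq_zero {q : Y ⟶ X} {M : X.Modules}
    {φ : M ⟶ unitModule X} (h : pullbackForm q φ = 0) : φ ≫ unitHom q = 0 := by
  have h1 := congrArg ((Scheme.Modules.pullbackPushforwardAdjunction q).homEquiv M _) h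
  rw [pullbackForm, Equiv.apply_symm_apply] at h1
  rw [h1, Adjunction.homEquiv_unit, Functor.map_zero, Limits.comp_zero]

/-- If all values of φ on the presheaf vanish at q(y), then the pulled back form vanishes in the
fibre at y. This is seen by composing with the point Spec κ(y) and passing to the adjoint map, which
can be tested on the presheaf. -/
theorem notMem_basicOpen_pullbackForm {q : Y ⟶ X} {P : X.PresheafOfModules}
    {φ : sheafify P ⟶ unitModule X} {ι : Type u} {B : ι → X.Opens}
    (hB : Opens.IsBasis (Set.range B)) (y : Y)
    (h : ∀ i (p : P.obj (op (B i))), q y ∉ X.basicOpen (show Γ(X, B i) from φ.app (B i) (sheafifySection p)))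
    (m : Γ((Scheme.Modules.pullback q).obj (sheafify P), ⊤)) :
    y ∉ Y.basicOpen (show Γ(Y, ⊤) from (pullbackForm q φ).app ⊤ m) := by
  let r := Y.fromSpecResidueField y
  have key : pullbackForm q φ ≫ unitHom r = 0 := by
    refine ((Scheme.Modules.pullbackPushforwardAdjunction q).homEquiv _ _).injective ?_
    rw [Adjunction.homEquiv_naturality_right, pullbackForm, Equiv.apply_symm_apply,
      Adjunction.homEquiv_unit, Functor.map_zero, Limits.comp_zero]
    refine sheafify_hom_ext_of_basis hB fun i p => ?_
    change r.app (q ⁻¹ᵁ B i) (q.app (B i) (show Γ(X, B i) from φ.app (B i) (sheafifySection p))) =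
      (0 : Γ(Spec (Y.residueField y), r ⁻¹ᵁ q ⁻¹ᵁ B i))
    -- The spectrum of the residue field is reduced, so a function on it is zero once it is nowhere
    -- invertible.
    rw [← AlgebraicGeometry.basicOpen_eq_bot_iff, ← Scheme.preimage_basicOpen, ← Scheme.preimage_basicOpen]
    refine eq_bot_iff.mpr fun t ht => h i p ?_
    have ht' : q (r t) ∈ X.basicOpen (show Γ(X, B i) from φ.app (B i) (sheafifySection p)) := ht
    rwa [Scheme.fromSpecResidueField_apply] at ht'
  intro hy
  let c : Γ(Y, ⊤) := (pullbackForm q φ).app ⊤ m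
  have h0 : r.app ⊤ c = 0 := congr(($key).app ⊤ m)
  have h1 : r ⁻¹ᵁ Y.basicOpen c = ⊥ := by
    rw [Scheme.preimage_basicOpen, h0]
    exact Scheme.basicOpen_zero _ _
  obtain ⟨t⟩ : Nonempty (Spec (Y.residueField y)) := inferInstance
  have ht : r t ∈ Y.basicOpen c := by
    rw [Scheme.fromSpecResidueField_apply]
    exact hy
  exact h1.le ht

/-- A map to an affine scheme factors through Spec Γ(Y, ⊤), here a single point. -/
theorem subsingleton_range_of_isField (hY : IsField Γ(Y, ⊤)) (q : Y ⟶ X) {U : X.Opens}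
    (hU : IsAffineOpen U) (hq : ∀ y, q y ∈ U) : (Set.range q).Subsingleton := by
  have hUa : IsAffine U.toScheme := hU
  have hr : Set.range q ⊆ Set.range U.ι := by
    rintro _ ⟨y, rfl⟩
    rw [Scheme.Opens.range_ι]
    exact hq y
  let l : Y ⟶ U.toScheme := IsOpenImmersion.lift U.ι q hr
  have hl : l ≫ U.ι = q := IsOpenImmersion.lift_fac _ _ _
  have hl' : l = Y.toSpecΓ ≫ Spec.map l.appTop ≫ inv U.toScheme.toSpecΓ := by
    rw [← Scheme.toSpecΓ_naturality_assoc, IsIso.hom_inv_id, Category.comp_id]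
  have hsub : Subsingleton (Spec Γ(Y, ⊤)) := by
    let := hY.toField
    exact inferInstanceAs (Subsingleton (PrimeSpectrum Γ(Y, ⊤)))
  rintro _ ⟨y, rfl⟩ _ ⟨y', rfl⟩
  rw [← hl, hl']
  simp only [Scheme.Hom.comp_apply]
  rw [Subsingleton.elim (Y.toSpecΓ y) (Y.toSpecΓ y')]

end Unit

/-! ### Contraction of differential forms with vector fields -/

section Contraction

variable {k : Type u} [Field k] {X : Scheme.{u}} (s : X ⟶ Spec (.of k))

open CommRingCat.KaehlerDifferential (d)

/-- The contraction of differential forms with a vector field. -/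
def contract {U : X.Opens} (D : vectorFields s U) :
    CommRingCat.KaehlerDifferential (scalars s (op U)) →ₗ[Γ(X, U)] Γ(X, U) :=
  (ModuleCat.Derivation.mk (M := ModuleCat.of Γ(X, U) Γ(X, U)) (f := scalars s (op U))
    (fun r => D.1 ⟨U, le_rfl⟩ r) (D.2.map_add ⟨U, le_rfl⟩) (D.2.leibniz ⟨U, le_rfl⟩)
    (D.2.map_scalar ⟨U, le_rfl⟩)).desc.hom

variable {s}

theorem contract_d {U : X.Opens} (D : vectorFields s U) (r : Γ(X, U)) :
    contract s D (d r) = D.1 ⟨U, le_rfl⟩ r := ModuleCat.Derivation.desc_d (ModuleCat.Derivation.mk (M := ModuleCat.of Γ(X, U) Γ(X, U))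
    (f := scalars s (op U)) (fun r => D.1 ⟨U, le_rfl⟩ r) (D.2.map_add ⟨U, le_rfl⟩)
    (D.2.leibniz ⟨U, le_rfl⟩) (D.2.map_scalar ⟨U, le_rfl⟩)) r

theorem kaehler_linearMap_ext {A B : CommRingCat.{u}} {M : Type u} [AddCommGroup M] [Module B M]
    {σ : A ⟶ B} {l l' : CommRingCat.KaehlerDifferential σ →ₗ[B] M}
    (h : ∀ r, l (d r) = l' (d r)) (ω) : l ω = l' ω := by
  have := LinearMap.ext_on_range (kaehler_span_range_d σ) h
  rw [this]

theorem contract_add {U : X.Opens} (D D' : vectorFields s U) (ω) :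
    contract s (D + D') ω = contract s D ω + contract s D' ω :=
  kaehler_linearMap_ext (l' := contract s D + contract s D') (fun r => by
    rw [LinearMap.add_apply, contract_d, contract_d, contract_d]
    rfl) ω

theorem contract_smul {U : X.Opens} (a : Γ(X, U)) (D : vectorFields s U) (ω) :
    contract s (a • D) ω = a * contract s D ω :=
  kaehler_linearMap_ext (l' := a • contract s D) (fun r => by
    rw [LinearMap.smul_apply, contract_d, contract_d, smul_eq_mul]
    change X.presheaf.map (𝟙 _) a * _ = _
    rw [X.presheaf.map_id]
    rfl) ω

/-- Both sides are semilinear in the form, so exact forms suffice; for these it is the compatibility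
of D with restriction. -/
theorem contract_res {U V : X.Opens} (h : V ≤ U) (D : vectorFields s U) (E : vectorFields s V)
    (hE : ∀ r, E.1 ⟨V, le_rfl⟩ (X.presheaf.map (homOfLE h).op r) =
      X.presheaf.map (homOfLE h).op (D.1 ⟨U, le_rfl⟩ r)) (ω) :
    contract s E (differentialsRes s (homOfLE h).op ω) = X.presheaf.map (homOfLE h).op (contract s D ω) := by
  have hω : ω ∈ Submodule.span Γ(X, U) (Set.range (d (f := scalars s (op U)))) := by
    rw [kaehler_span_range_d]; trivial
  induction hω using Submodule.span_induction with
  | mem ω hω =>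
    obtain ⟨r, rfl⟩ := hω
    have h1 : differentialsRes s (homOfLE h).op (d r) = d (X.presheaf.map (homOfLE h).op r) :=
      CommRingCat.KaehlerDifferential.map_d ((scalarsHom s).naturality (homOfLE h).op) r
    rw [h1, contract_d, contract_d]
    exact hE r
  | zero => simp only [map_zero]
  | add x y _ _ hx hy => simp only [map_add, hx, hy]
  | smul r x _ hx =>
    rw [map_smulₛₗ, map_smul, map_smul, hx, smul_eq_mul, smul_eq_mul, map_mul]

variable (s) in
/-- The presheaf of modules `U ↦ Der_k(𝒪_U, 𝒪_U)`. -/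
def vectorFieldsModules : X.PresheafOfModules :=
  PresheafOfModules.ofPresheaf (R := X.ringCatSheaf.obj) (vectorFieldsPresheaf s)
    fun _ _ i r D => vectorFieldsPresheaf_map_smul s i r D

/-- A compatible family of differential forms on a basis defines a linear form on the tangent
sheaf. -/
theorem exists_tangentSheaf_form {ι : Type u} {B : ι → X.Opens} (hB : Opens.IsBasis (Set.range B))
    (ω : ∀ i, CommRingCat.KaehlerDifferential (scalars s (op (B i))))
    (hω : ∀ i j (h : B j ≤ B i), differentialsRes s (homOfLE h).op (ω i) = ω j) :
    ∃ φ : sheafify (vectorFieldsModules s) ⟶ unitModule X, ∀ i (D : vectorFields s (B i)),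
      φ.app (B i) (sheafifySection (P := vectorFieldsModules s) D) =
        (show Γ(unitModule X, B i) from contract s D (ω i)) := by
  obtain ⟨v, hv⟩ := exists_presheaf_hom_of_basis (vectorFieldsModules s) (unitModule X) hB
    (fun i => AddMonoidHom.mk' (fun D : vectorFields s (B i) => contract s D (ω i))
      (fun D D' => contract_add D D' (ω i)))
    (fun i r D => contract_smul r _ _) (fun i j h D => by
      refine Eq.trans ?_ (contract_res h D ((vectorFieldsPresheaf s).map (homOfLE h).op D)
        (fun r => D.2.map_res ⟨B i, le_rfl⟩ ⟨B j, h⟩ h r) (ω i))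
      exact congrArg (contract s (U := B j) ((vectorFieldsPresheaf s).map (homOfLE h).op D))
        (hω i j h).symm)
  obtain ⟨φ, hφ⟩ := exists_sheafify_desc v
  exact ⟨φ, fun i D => (hφ (B i) D).trans (hv i D)⟩

end Contraction

/-! ### The forms on the smooth locus that correspond to the sections xⱼ of 𝒪(1) -/

section SmoothForms

open MvPolynomial

open CommRingCat.KaehlerDifferential (d)

variable {k : Type u} [Field k] [CharP k 2]

/-- The section `xⱼ` of `J(1)~` on an open subset of the smooth locus. -/
def coordSection (j : Fin 3) {U : (S k).Opens} (hU : U ≤ smoothLocus (sToSpec k)) :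
    Γ(twist (grading k) (singularIdeal k) 1, U) :=
  (⟨fun x => algebraMap _ (LocAt (grading k) x.1) (incl k (X j)), fun x => by
    obtain ⟨m, hm⟩ := mem_smoothLocus_iff.mp (hU x.2)
    -- Where Fₘ is invertible, xⱼ = xⱼFₘ/Fₘ is a fraction whose numerator lies in the ideal of the
    -- points.
    refine ⟨Proj.basicOpen (grading k) (incl k (partials k m)) ⊓ U, ⟨hm, x.2⟩, homOfLE inf_le_right,
      1 + 3, 3, incl k (X j) * incl k (partials k m), incl k (partials k m), by norm_num,
      SetLike.mul_mem_graded (incl_X_mem j) (incl_mem_grading k (partials_isHomogeneous k m)),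
      incl_mem_grading k (partials_isHomogeneous k m),
      Ideal.mul_mem_left _ _ (Ideal.mem_map_of_mem _ (partials_mem_pointsIdeal m)), fun y => ⟨y.2.1, ?_⟩⟩
    rw [map_mul]
    exact mul_comm _ _⟩ : twistSections (grading k) (singularIdeal k) 1 (op U))

theorem twistVal_coordSection (j : Fin 3) {U : (S k).Opens} (hU : U ≤ smoothLocus (sToSpec k))
    (x : ProjectiveSpectrum (grading k)) (hx : x ∈ U) :
    twistVal (coordSection j hU) x hx = algebraMap _ _ (incl k (X j)) := rfl

-- On the chart, 1/xᵢ is a section of 𝒪(−1), and multiplication by it turns a section of the twist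
-- into a function.
omit [CharP k 2] in
theorem exists_mul_eq_twistVal {J : Ideal (CoordRing k)} {i : Fin 3} {U : (S k).Opens} (hU : U ≤ chartOpen k i)
    (m : Γ(twist (grading k) J 1, U)) : ∃ t : Γ(S k, U), ∀ x hx,
      algebraMap _ (LocAt (grading k) x) (incl k (X i)) * valHom U x hx t = twistVal m x hx := by
  let c := fracSection (𝒜 := grading k) ⊤ (-1) (op U) (i := 0) (j := 1) (a := 1) (b := incl k (X i)) (by norm_num)
    SetLike.GradedOne.one_mem (incl_X_mem i) trivial (fun x => hU x.2)
  obtain ⟨t, ht⟩ := exists_regVal_eq (𝒜 := grading k)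
    (⟨_, mul_mem_twistSections (𝒜 := grading k) (J := ⊤) (J' := J) (n := -1) (n' := 1) (m := 0)
      (by norm_num) c m⟩ : twistSections (grading k) ⊤ 0 (op U))
  refine ⟨t, fun x hx => ?_⟩
  have h1 : algebraMap _ (LocAt (grading k) x) (incl k (X i)) * c.1 ⟨x, hx⟩ = algebraMap (CoordRing k) _ 1 :=
    algebraMap_mul_fracSection (𝒜 := grading k) (J := ⊤) (n := -1) _ _ _ _ _ ⟨x, hx⟩
  refine (congrArg (algebraMap _ (LocAt (grading k) x) (incl k (X i)) * ·) (ht ⟨x, hx⟩)).trans ?_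
  change algebraMap _ (LocAt (grading k) x) (incl k (X i)) * (c.1 ⟨x, hx⟩ * m.1 ⟨x, hx⟩) = m.1 ⟨x, hx⟩
  rw [← mul_assoc, h1, map_one, one_mul]

omit [CharP k 2] in
theorem eq_of_mul_valHom_eq {i : Fin 3} {U : (S k).Opens} (hU : U ≤ chartOpen k i) {r r' : Γ(S k, U)}
    (h : ∀ x hx, algebraMap _ (LocAt (grading k) x) (incl k (X i)) * valHom U x hx r =
      algebraMap _ (LocAt (grading k) x) (incl k (X i)) * valHom U x hx r') : r = r' :=
  valHom_ext fun x hx => eq_of_algebraMap_mul_eq (hU hx) (h x hx)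

variable {V : (smoothLocus (sToSpec k)).toScheme.Opens}

/-- The vector field `xᵢ⁻¹ ∑ xⱼ² ∂ⱼ` on the chart `xᵢ ≠ 0` of the smooth locus. -/
theorem exists_vectorField {i : Fin 3} (hV : (smoothLocus (sToSpec k)).ι ''ᵁ V ≤ chartOpen k i) :
    ∃ D : vectorFields (smoothLocusToSpec (sToSpec k)) V, ∀ (r : Γ(S k, (smoothLocus (sToSpec k)).ι ''ᵁ V)) x hx,
      algebraMap _ (LocAt (grading k) x) (incl k (X i)) * valHom _ x hx (D.1 ⟨V, le_rfl⟩ r) =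
        twistVal (vectorV k _ r) x hx := by
  have hW (W : {W : (smoothLocus (sToSpec k)).toScheme.Opens // W ≤ V}) :
      (smoothLocus (sToSpec k)).ι ''ᵁ W.1 ≤ chartOpen k i :=
    ((smoothLocus (sToSpec k)).ι.image_mono W.2).trans hV
  choose D hD using fun (W : {W : (smoothLocus (sToSpec k)).toScheme.Opens // W ≤ V})
    (r : Γ(S k, (smoothLocus (sToSpec k)).ι ''ᵁ W.1)) =>
      exists_mul_eq_twistVal (hW W) (vectorV k _ r)
  refine ⟨⟨D, ?_, ?_, ?_, ?_⟩, fun r x hx => hD ⟨V, le_rfl⟩ r x hx⟩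
  · intro W a b
    refine eq_of_mul_valHom_eq (hW W) fun x hx => (hD W _ x hx).trans ?_
    refine (congrArg (fun m => twistVal m x hx) (twistDer_add (isTwistDerivation_derV k) a b)).trans ?_
    refine (congrArg₂ (· + ·) (hD W a x hx) (hD W b x hx)).symm.trans ?_
    refine (mul_add _ _ _).symm.trans (congrArg _ (map_add (valHom _ x hx) _ _).symm)
  · intro W a b
    refine eq_of_mul_valHom_eq (hW W) fun x hx => (hD W _ x hx).trans ?_
    refine (congrArg (fun m => twistVal m x hx) (twistDer_mul (isTwistDerivation_derV k) a b)).trans ?_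
    let a' : Γ(S k, (smoothLocus (sToSpec k)).ι ''ᵁ W.1) := a
    let b' : Γ(S k, (smoothLocus (sToSpec k)).ι ''ᵁ W.1) := b
    have e : valHom _ x hx (a' * D W b + b' * D W a) =
      valHom _ x hx a' * valHom _ x hx (D W b) + valHom _ x hx b' * valHom _ x hx (D W a) := by
      rw [map_add, map_mul, map_mul]
    refine Eq.trans ?_ (congrArg _ e.symm)
    refine (congrArg₂ (fun p q => valHom _ x hx a' * p + valHom _ x hx b' * q) (hD W b x hx)
      (hD W a x hx)).symm.trans ?_
    exact (congrArg₂ (· + ·) (mul_left_comm _ _ _) (mul_left_comm _ _ _)).trans (mul_add _ _ _).symm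
  · intro W c
    refine eq_of_mul_valHom_eq (hW W) fun x hx => (hD W _ x hx).trans ?_
    have e : scalars (smoothLocusToSpec (sToSpec k)) (op W.1) =
        scalars (sToSpec k) (op ((smoothLocus (sToSpec k)).ι ''ᵁ W.1)) := scalars_ι _ _ _
    refine (congrArg (fun σ => twistVal (vectorV k _ (CommRingCat.Hom.hom σ c)) x hx) e).trans ?_
    refine (congrArg (fun m => twistVal m x hx) (twistDer_scalars (isTwistDerivation_derV k) _ c)).trans ?_
    exact (congrArg _ (map_zero (valHom _ x hx))).trans (mul_zero _) |>.symm
  · intro W W' h a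
    refine eq_of_mul_valHom_eq (hW W') fun x hx => (hD W' _ x hx).trans ?_
    exact (hD W a x ((smoothLocus (sToSpec k)).ι.image_mono h hx)).symm

variable (V) in
/-- The map from `k` to the regular functions on an open subset of the smooth locus. -/
abbrev smoothScalars : CommRingCat.of k ⟶ (S k).presheaf.obj (op ((smoothLocus (sToSpec k)).ι ''ᵁ V)) :=
  scalars (smoothLocusToSpec (sToSpec k)) (op V)

/-- `smoothV` on sections. -/
def smoothFormV (V : (smoothLocus (sToSpec k)).toScheme.Opens) :
    CommRingCat.KaehlerDifferential (smoothScalars V) →ₗ[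
      Γ(S k, (smoothLocus (sToSpec k)).ι ''ᵁ V)]
      Γ(twist (grading k) (singularIdeal k) 1, (smoothLocus (sToSpec k)).ι ''ᵁ V) where
  toFun ω := (show Γ(twist (grading k) (singularIdeal k) 1, (smoothLocus (sToSpec k)).ι ''ᵁ V) from
    (smoothV k).app (op V) ω)
  map_add' ω ω' := map_add ((smoothV k).app (op V)).hom ω ω'
  map_smul' r ω := by
    let a' : CommRingCat.KaehlerDifferential (scalars (smoothLocusToSpec (sToSpec k)) (op V)) →ₗ[
        Γ((smoothLocus (sToSpec k)).toScheme, V)]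
        Γ((twist (grading k) (singularIdeal k) 1).restrict (smoothLocus (sToSpec k)).ι, V) :=
      ((smoothV k).app (op V)).hom
    exact (a'.map_smul r ω).trans
      (smul_restrict (twist (grading k) (singularIdeal k) 1) _ V r (a' ω))

/-- `smoothW` on sections. -/
def smoothFormW (V : (smoothLocus (sToSpec k)).toScheme.Opens) :
    CommRingCat.KaehlerDifferential (smoothScalars V) →ₗ[
      Γ(S k, (smoothLocus (sToSpec k)).ι ''ᵁ V)]
      Γ(twist (grading k) ⊤ (-2), (smoothLocus (sToSpec k)).ι ''ᵁ V) where
  toFun ω := (show Γ(twist (grading k) ⊤ (-2), (smoothLocus (sToSpec k)).ι ''ᵁ V) from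
    (smoothW k).app (op V) ω)
  map_add' ω ω' := map_add ((smoothW k).app (op V)).hom ω ω'
  map_smul' r ω := by
    let a' : CommRingCat.KaehlerDifferential (scalars (smoothLocusToSpec (sToSpec k)) (op V)) →ₗ[
        Γ((smoothLocus (sToSpec k)).toScheme, V)]
        Γ((twist (grading k) ⊤ (-2)).restrict (smoothLocus (sToSpec k)).ι, V) :=
      ((smoothW k).app (op V)).hom
    exact (a'.map_smul r ω).trans
      (smul_restrict (twist (grading k) ⊤ (-2)) _ V r (a' ω))

theorem smoothFormV_d (r : Γ(S k, (smoothLocus (sToSpec k)).ι ''ᵁ V)) :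
    smoothFormV V (d (f := smoothScalars V) r) = vectorV k _ r :=
  differentialsOnTo_d (isTwistDerivation_derV k) _ V r

theorem smoothFormW_d (r : Γ(S k, (smoothLocus (sToSpec k)).ι ''ᵁ V)) :
    smoothFormW V (d (f := smoothScalars V) r) = vectorW k _ r :=
  differentialsOnTo_d (isTwistDerivation_derW k) _ V r

theorem smoothFormV_res {V' : (smoothLocus (sToSpec k)).toScheme.Opens} (h : V' ≤ V)
    (ω : CommRingCat.KaehlerDifferential (smoothScalars V)) :
    smoothFormV V' (differentialsRes (smoothLocusToSpec (sToSpec k)) (homOfLE h).op ω) =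
      (twist (grading k) (singularIdeal k) 1).presheaf.map
        (homOfLE ((smoothLocus (sToSpec k)).ι.image_mono h)).op (smoothFormV V ω) :=
  PresheafOfModules.naturality_apply (smoothV k) (homOfLE h).op ω

theorem smoothFormW_res {V' : (smoothLocus (sToSpec k)).toScheme.Opens} (h : V' ≤ V)
    (ω : CommRingCat.KaehlerDifferential (smoothScalars V)) :
    smoothFormW V' (differentialsRes (smoothLocusToSpec (sToSpec k)) (homOfLE h).op ω) =
      (twist (grading k) ⊤ (-2)).presheaf.map
        (homOfLE ((smoothLocus (sToSpec k)).ι.image_mono h)).op (smoothFormW V ω) :=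
  PresheafOfModules.naturality_apply (smoothW k) (homOfLE h).op ω

/-- `contract` for the smooth locus, with values in the functions on `S`. -/
def smoothContract (D : vectorFields (smoothLocusToSpec (sToSpec k)) V) :
    CommRingCat.KaehlerDifferential (smoothScalars V) →ₗ[Γ(S k, (smoothLocus (sToSpec k)).ι ''ᵁ V)]
      Γ(S k, (smoothLocus (sToSpec k)).ι ''ᵁ V) :=
  contract (smoothLocusToSpec (sToSpec k)) D

omit [CharP k 2] in
theorem smoothContract_d (D : vectorFields (smoothLocusToSpec (sToSpec k)) V)
    (r : Γ(S k, (smoothLocus (sToSpec k)).ι ''ᵁ V)) :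
    smoothContract D (d (f := smoothScalars V) r) = D.1 ⟨V, le_rfl⟩ r := contract_d D r

theorem smoothForm_bijective (h : SmoothIndex k) :
    Function.Bijective fun ω => (smoothFormV (smoothOpen h) ω, smoothFormW (smoothOpen h) ω) :=
  bijective_prod_of_d (image_smoothOpen h) (scalars_ι _ _ _) _ _ smoothFormV_d smoothFormW_d

omit [CharP k 2] in
theorem image_ι_le (V : (smoothLocus (sToSpec k)).toScheme.Opens) :
    (smoothLocus (sToSpec k)).ι ''ᵁ V ≤ smoothLocus (sToSpec k) := by
  rintro _ ⟨x, -, rfl⟩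
  exact x.2

theorem exists_coordForm (j : Fin 3) (h : SmoothIndex k) :
    ∃ ω, smoothFormV (smoothOpen h) ω = coordSection j (image_ι_le _) ∧
      smoothFormW (smoothOpen h) ω = 0 := by
  obtain ⟨ω, hω⟩ := (smoothForm_bijective h).2 (coordSection j (image_ι_le _), 0)
  exact ⟨ω, congrArg Prod.fst hω, congrArg Prod.snd hω⟩

/-- The differential form `ω` on a basic open subset with `V(ω) = xⱼ` and `W(ω) = 0`. -/
def coordForm (j : Fin 3) (h : SmoothIndex k) :
    CommRingCat.KaehlerDifferential (smoothScalars (smoothOpen h)) :=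
  (exists_coordForm j h).choose

theorem smoothFormV_coordForm (j : Fin 3) (h : SmoothIndex k) :
    smoothFormV (smoothOpen h) (coordForm j h) = coordSection j (image_ι_le _) :=
  (exists_coordForm j h).choose_spec.1

theorem smoothFormW_coordForm (j : Fin 3) (h : SmoothIndex k) :
    smoothFormW (smoothOpen h) (coordForm j h) = 0 :=
  (exists_coordForm j h).choose_spec.2

/-- A form is determined by its images under V and W; this makes the chosen forms compatible with
restriction. -/
theorem eq_coordForm {j : Fin 3} {h : SmoothIndex k} {ω : CommRingCat.KaehlerDifferential (smoothScalars (smoothOpen h))}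
    (hV : smoothFormV (smoothOpen h) ω = coordSection j (image_ι_le _))
    (hW : smoothFormW (smoothOpen h) ω = 0) : ω = coordForm j h :=
  (smoothForm_bijective h).1 (Prod.ext (hV.trans (smoothFormV_coordForm j h).symm)
    (hW.trans (smoothFormW_coordForm j h).symm))

theorem coordSection_res (j : Fin 3) {U U' : (S k).Opens} (hU : U ≤ smoothLocus (sToSpec k))
    (hU' : U' ≤ smoothLocus (sToSpec k)) (h : U' ≤ U) :
    (twist (grading k) (singularIdeal k) 1).presheaf.map (homOfLE h).op (coordSection j hU) =
      coordSection j hU' := twistVal_ext fun _ _ => rfl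

theorem smoothFormV_res_eq (j : Fin 3) {V' : (smoothLocus (sToSpec k)).toScheme.Opens} (hle : V' ≤ V)
    {ω : CommRingCat.KaehlerDifferential (smoothScalars V)}
    (hV : smoothFormV V ω = coordSection j (image_ι_le _)) :
    smoothFormV V' (differentialsRes (smoothLocusToSpec (sToSpec k)) (homOfLE hle).op ω) =
      coordSection j (image_ι_le _) :=
  (smoothFormV_res hle ω).trans ((congrArg ((twist (grading k) (singularIdeal k) 1).presheaf.map
    (homOfLE ((smoothLocus (sToSpec k)).ι.image_mono hle)).op) hV).trans
    (coordSection_res j (image_ι_le _) (image_ι_le _) ((smoothLocus (sToSpec k)).ι.image_mono hle)))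

theorem smoothFormW_res_eq_zero {V' : (smoothLocus (sToSpec k)).toScheme.Opens} (hle : V' ≤ V)
    {ω : CommRingCat.KaehlerDifferential (smoothScalars V)} (hW : smoothFormW V ω = 0) :
    smoothFormW V' (differentialsRes (smoothLocusToSpec (sToSpec k)) (homOfLE hle).op ω) = 0 :=
  (smoothFormW_res hle ω).trans ((congrArg ((twist (grading k) ⊤ (-2)).presheaf.map
    (homOfLE ((smoothLocus (sToSpec k)).ι.image_mono hle)).op) hW).trans (map_zero _))

theorem coordForm_res (j : Fin 3) {h h' : SmoothIndex k} (hle : smoothOpen h' ≤ smoothOpen h) :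
    differentialsRes (smoothLocusToSpec (sToSpec k)) (homOfLE hle).op (coordForm j h) =
      coordForm j h' :=
  eq_coordForm (smoothFormV_res_eq j hle (smoothFormV_coordForm j h))
    (smoothFormW_res_eq_zero hle (smoothFormW_coordForm j h))

/-- The vector field is D = V/xᵢ. Contraction with D, multiplied by xᵢ, is V on forms, and V takes
the value xᵢ on this form. -/
theorem exists_contract_coordForm_eq_one {i : Fin 3} {h : SmoothIndex k} (hi : X i ∣ h.1.1) :
    ∃ D : vectorFields (smoothLocusToSpec (sToSpec k)) (smoothOpen h),
      smoothContract D (coordForm i h) = 1 := by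
  have hU : (smoothLocus (sToSpec k)).ι ''ᵁ smoothOpen h ≤ chartOpen k i :=
    (image_smoothOpen h).trans_le (sOpen_le_chartOpen hi)
  obtain ⟨D, hD⟩ := exists_vectorField hU
  refine ⟨D, ?_⟩
  have key : smoothContract D (coordForm i h) • coordSection i (image_ι_le (smoothOpen h)) =
      smoothFormV (smoothOpen h) (coordForm i h) :=
    kaehler_linearMap_ext
      (l := (smoothContract D).smulRight (coordSection i (image_ι_le (smoothOpen h)))) (fun r => by
        rw [smoothFormV_d, LinearMap.smulRight_apply, smoothContract_d]
        refine twistVal_ext fun x hx => ?_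
        exact (mul_comm _ _).trans (hD r x hx)) (coordForm i h)
  rw [smoothFormV_coordForm] at key
  refine eq_of_mul_valHom_eq hU fun x hx => ?_
  have := congrArg (fun m => twistVal m x hx) key
  simp only [twistVal_smul, twistVal_coordSection] at this
  rw [map_one, mul_one, mul_comm]
  exact this

/-- With xᵢ invertible, the j-th form is xⱼ/xᵢ times the i-th one, so all its contractions vanish
where xⱼ does. -/
theorem notMem_basicOpen_contract (j : Fin 3) (h : SmoothIndex k)
    (D : vectorFields (smoothLocusToSpec (sToSpec k)) (smoothOpen h))
    (x : (smoothLocus (sToSpec k)).toScheme) (hx : x.1 ∉ chartOpen k j) :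
    x ∉ (smoothLocus (sToSpec k)).toScheme.basicOpen
      (show Γ((smoothLocus (sToSpec k)).toScheme, smoothOpen h) from smoothContract D (coordForm j h)) := by
  intro hx'
  obtain ⟨i, hi⟩ := h.2
  have hi' := (X_dvd_partials i).trans hi
  have hU : (smoothLocus (sToSpec k)).ι ''ᵁ smoothOpen h ≤ chartOpen k i :=
    (image_smoothOpen h).trans_le (sOpen_le_chartOpen hi')
  obtain ⟨t, ht⟩ := exists_valHom (incl_X_mem (k := k) j) (incl_X_mem (k := k) i) fun x hx => hU hx
  let t' : Γ((smoothLocus (sToSpec k)).toScheme, smoothOpen h) := t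
  have h1 : t • coordForm i h = coordForm j h := by
    refine eq_coordForm ?_ ?_
    · refine ((smoothFormV (smoothOpen h)).map_smul t _).trans ?_
      rw [smoothFormV_coordForm]
      refine twistVal_ext fun x hx => ?_
      rw [twistVal_smul, twistVal_coordSection, twistVal_coordSection, ← ht x hx, mul_comm]
    · refine ((smoothFormW (smoothOpen h)).map_smul t _).trans ?_
      rw [smoothFormW_coordForm, smul_zero]
  have h2 : smoothContract D (coordForm j h) = t * smoothContract D (coordForm i h) := by
    rw [← h1, map_smul, smul_eq_mul]
  rw [h2] at hx'
  have hxt : x ∈ (smoothLocus (sToSpec k)).toScheme.basicOpen t' :=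
    ((Scheme.basicOpen_mul _ t' _).le hx').1
  have hxU : x.1 ∈ (smoothLocus (sToSpec k)).ι ''ᵁ smoothOpen h :=
    ⟨x, (smoothLocus (sToSpec k)).toScheme.basicOpen_le t' hxt, rfl⟩
  have hxt' : x.1 ∈ (S k).basicOpen t := by
    have : (smoothLocus (sToSpec k)).ι ''ᵁ (smoothLocus (sToSpec k)).toScheme.basicOpen t' =
        (S k).basicOpen t := by
      rw [Scheme.image_basicOpen, Scheme.Opens.ι_appIso]
      rfl
    rw [← this]
    exact ⟨x, hxt, rfl⟩
  exact hx ((mem_basicOpen_iff (𝒜 := grading k) hxU (hU hxU) (ht x.1 hxU)).mp hxt')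

end SmoothForms

/-! ### No free rational curves in the smooth locus -/

section FreeCurves

open MvPolynomial

variable (k : Type u) [Field k]

theorem algebraMap_homogeneousSubmodule_zero_surjective (n : ℕ) :
    Function.Surjective (algebraMap k (homogeneousSubmodule (Fin n) k 0)) := by
  rintro ⟨a, ha⟩
  refine ⟨coeff 0 a, Subtype.ext ?_⟩
  exact (totalDegree_eq_zero_iff_eq_C.mp (by
    simpa using ((mem_homogeneousSubmodule 0 a).mp ha).totalDegree_le)).symm

/-- Projective space is integral and proper over k, so its global functions form a field. -/
theorem isField_pSpace (n : ℕ) [Nonempty (PSpace k n)] : IsField Γ(PSpace k n, ⊤) := by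
  have hi : IsIntegral (PSpace k n) :=
    { component_integral := fun U hU => by
        obtain ⟨x⟩ := hU
        exact (valHom_injective (𝒜 := homogeneousSubmodule (Fin (n + 1)) k) x.1 x.2).isDomain _ }
  have hp : IsProper (pSpaceToSpec k n) :=
    structureMap_of_surjective k _ (algebraMap_homogeneousSubmodule_zero_surjective k (n + 1))
  exact isField_of_universallyClosed k (pSpaceToSpec k n)

variable [CharP k 2]

theorem not_isFreeCurve_smoothLocus (f : PSpace k 1 ⟶ (smoothLocus (sToSpec k)).toScheme) :
    ¬ IsFreeCurve (smoothLocusToSpec (sToSpec k)) f := by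
  intro hf
  obtain ⟨σ⟩ := hf.semiample
  obtain ⟨_, ⟨y, -⟩, _⟩ := hf.nonconstant
  have hne : Nonempty (PSpace k 1) := ⟨y⟩
  have hfield := isField_pSpace k 1
  choose φ hφ using fun j => exists_tangentSheaf_form (s := smoothLocusToSpec (sToSpec k))
    isBasis_smoothOpen (coordForm j) (fun h h' hle => coordForm_res j hle)
  -- The values of the pulled back forms on the global generators are elements of the field of
  -- functions on ℙ¹. If all are zero, the forms vanish on f^*T; but near f(y) one of them takes the
  -- value 1 on a vector field, so 1 = 0 on a neighbourhood of y.
  by_cases hc : ∀ i l, (pullbackForm f (φ i)).app ⊤ ((σ.s l).1 (op ⊤)) = 0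
  · obtain ⟨h, hyh, -⟩ := exists_smoothOpen_le (k := k) (U := ⊤) (x := f y) trivial
    obtain ⟨i, hi⟩ := h.2
    obtain ⟨D, hD⟩ := exists_contract_coordForm_eq_one ((X_dvd_partials i).trans hi)
    have h1 : pullbackForm f (φ i) = 0 := hom_ext_of_generatingSections σ fun l => (hc i l).trans rfl
    have h2 := comp_unitHom_eq_zero_of_pullbackForm_eq_zero h1
    have h3 : f.app (smoothOpen h) 1 = 0 := by
      have h4 : f.app (smoothOpen h) (show Γ((smoothLocus (sToSpec k)).toScheme, smoothOpen h) from
          smoothContract D (coordForm i h)) = 0 :=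
        (congrArg (f.app (smoothOpen h)) (hφ i h D)).symm.trans
          congr(($h2).app (smoothOpen h) (sheafifySection D))
      rwa [hD] at h4
    rw [map_one] at h3
    have : y ∈ (PSpace k 1).basicOpen (1 : Γ(PSpace k 1, f ⁻¹ᵁ smoothOpen h)) := by
      rw [Scheme.basicOpen_of_isUnit _ isUnit_one]
      exact hyh
    rw [h3, Scheme.basicOpen_zero] at this
    exact this
  · push Not at hc
    obtain ⟨i, l, hil⟩ := hc
    let c : Γ(PSpace k 1, ⊤) := (pullbackForm f (φ i)).app ⊤ ((σ.s l).1 (op ⊤))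
    have hcu : IsUnit c := by
      let := hfield.toField
      exact (Ne.isUnit hil : IsUnit c)
    -- A nonzero value c is a unit, whereas the i-th form vanishes wherever xᵢ does. So the curve
    -- stays in the affine chart xᵢ ≠ 0 and is constant.
    have hmem (y) : (f ≫ (smoothLocus (sToSpec k)).ι) y ∈ chartOpen k i := by
      by_contra hy
      refine notMem_basicOpen_pullbackForm (φ := φ i) isBasis_smoothOpen y (fun h D => ?_)
        ((σ.s l).1 (op ⊤)) ?_
      · have := notMem_basicOpen_contract i h D (f y) hy
        rwa [hφ i h D]
      · have : y ∈ (PSpace k 1).basicOpen c := by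
          rw [Scheme.basicOpen_of_isUnit _ hcu]
          trivial
        exact this
    have hsub := subsingleton_range_of_isField hfield _ (isAffineOpen_chartOpen i) hmem
    obtain ⟨_, ⟨y, rfl⟩, _, ⟨z, rfl⟩, hyz⟩ := hf.nonconstant
    exact hyz (Subtype.ext (hsub ⟨y, rfl⟩ ⟨z, rfl⟩))

end FreeCurves

end

end KollarSurface

theorem mainTheorem8 {k : Type u} [Field k] [CharP k 2] :
    -- `S` is the anticanonical model of the blow-up of `ℙ²` in the seven `𝔽₂`-points: it contains
    -- the complement of the seven `𝔽₂`-lines, embedded by the sections of `-K` and `-2K`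
    IsOpenImmersion (KollarSurface.anticanonicalMap k) ∧
    -- `S` is a Gorenstein del Pezzo surface of degree two with seven `A₁`-points, `-K_S = g^* 𝒪(1)`
    KollarSurface.IsA1DelPezzo (KollarSurface.sToSpec k) (KollarSurface.g k) ∧
    (Flat (KollarSurface.g k) ∧ ∀ y, (KollarSurface.g k).finrank y = 2) ∧
    (KollarSurface.singularPoints k).ncard = 7 ∧
    -- the exact sequence `0 → g^* I(1) → Ω¹_S → g^* 𝒪(-2) → 0`
    (∃ (α : (Scheme.Modules.pullback (KollarSurface.g k)).obj (KollarSurface.idealSheafOne k) ⟶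
          KollarSurface.differentials (KollarSurface.sToSpec k))
        (β : KollarSurface.differentials (KollarSurface.sToSpec k) ⟶
          (Scheme.Modules.pullback (KollarSurface.g k)).obj (KollarSurface.pSpaceO k 2 (-2)))
        (w : α ≫ β = 0), (ShortComplex.mk α β w).ShortExact) ∧
    -- the smooth locus of `S` contains no free rational curve
    (¬ ∃ f : KollarSurface.PSpace k 1 ⟶
        (KollarSurface.smoothLocus (KollarSurface.sToSpec k)).toScheme,
      KollarSurface.IsFreeCurve
        (KollarSurface.smoothLocusToSpec (KollarSurface.sToSpec k)) f) ∧
    -- so the theorem of Keel and McKernan fails over `k`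
    (¬ ∀ (X : Scheme.{u}) (s : X ⟶ Spec (.of k)) (N : ℕ) (h : X ⟶ KollarSurface.PSpace k N),
      KollarSurface.IsA1DelPezzo s h →
        ∃ f : KollarSurface.PSpace k 1 ⟶ (KollarSurface.smoothLocus s).toScheme,
          KollarSurface.IsFreeCurve (KollarSurface.smoothLocusToSpec s) f) := by
  have hfree : ¬ ∃ f, KollarSurface.IsFreeCurve
      (KollarSurface.smoothLocusToSpec (KollarSurface.sToSpec k)) f :=
    fun ⟨f, hf⟩ => KollarSurface.not_isFreeCurve_smoothLocus k f hf
  exact ⟨KollarSurface.isOpenImmersion_anticanonicalMap k, KollarSurface.isA1DelPezzo k,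
    (KollarSurface.finite_flat_g k).2, KollarSurface.ncard_singularPoints k,
    KollarSurface.exists_shortExact_differentials k, hfree,
    -- The surface with its double cover of ℙ², so N = 2, is the counterexample.
    fun H => hfree (H _ _ 2 _ (KollarSurface.isA1DelPezzo k))⟩
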